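/- **Setting.** $\mathbb H^1$ is $\mathbb R^3$ with the left-invariant fields $X=\partial_x+y\,\partial_t$, $Y=\partial_y-x\,\partial_t$, $T=\partial_t$, with the Riemannian metric making them orthonormal (its volume is Lebesgue measure), and $J(X)=Y$, $J(Y)=-X$. Let $K\subset\mathbb R^2$ be a compact convex set with $0\in\operatorname{int}K$, of class $C^2_+$ (its boundary is $C^2$ with positive geodesic curvature), and let $\|aX+bY\|_K$ be the Minkowski functional of $K$ at $(a,b)$. For measurable $E\subset\mathbb H^1$ and $V$ open, $$|\partial E|_K(V)=\sup\Big\{\int_E \operatorname{div}U\,d\mathbb H^1 : U \text{ a horizontal } C^1 \text{ vector field with compact support in } V,\ \|U\|_{K}\le 1\Big\}.$$ A measurable set $E\subset\Omega$ of locally finite $K$-perimeter in the open set $\Omega$ has *prescribed $K$-mean curvature $f\in C^0(\Omega)$* if for every open $B$ relatively compact in $\Omega$ it is a critical point of $|\partial E|_K(B)-\int_{E\cap B}f\,d\mathbb H^1$: for the flow $\varphi_s$ of any smooth vector field with compact support in $B$, the values $|\partial\varphi_s(E)|_K(B)$ are finite for small $s$, and the functional at $\varphi_s(E)$ has derivative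 $0$ at $s=0$. The boundary of $E$ is *Euclidean Lipschitz* in $\Omega$ if near each point of $\partial E\cap\Omega$, in suitable linear coordinates of $\mathbb R^3$, $E$ is, up to points of the graph, the epigraph of a Lipschitz function of two variables. A set $S$ is *$\mathbb H$-regular* if near each of its points it is the zero set of a continuous function $g$ whose distributional horizontal gradient $\nabla_{\mathbb H}g=(Xg,Yg)$ is continuous and nowhere zero. For $S=\partial E\cap\Omega$, choosing $g\le 0$ on $E$, the outer horizontal unit normal is $\nu_h=\nabla_{\mathbb H}g/|\nabla_{\mathbb H}g|$, and the *characteristic curves* of $S$ are the integral curves in $S$, on open intervals, of $Z=J(\nu_h)$. **Theorem 3.1.** (a) Let $K$ be as above, let $\Omega\subset\mathbb H^1$ be open, and let $E\subset\Omega$ be a set of prescribed $K$-mean curvature $f\in C^0(\Omega)$ in $\Omega$ whose boundary in $\Omega$, $S=\partial E\cap\Omega$, is Euclidean Lipschitz and $\mathbb H$-regular. Then every characteristic curve of $S$ is of class $C^2$. (b) This regularity is optimal, as Pansu–Wulff shapes show. For a clockwise arc-length $P$-periodic parametrization $\gamma$ of $\partial K$ and $v\in\mathbb R$, put $(x,y)(s)=\gamma(s+v)-\gamma(v)$,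 $\Gamma_v(s)=\big(x(s),y(s),\int_0^s (y x'-x y')\,d\tau\big)$ and $\mathbb S_K=\bigcup_{0\le v<P}\Gamma_v([0,P])$. There is a set $K$ as above for which $\mathbb S_K$ is the boundary of a bounded open set $E$ such that, with $\Omega$ the complement of the two poles $\Gamma_0(0)$, $\Gamma_0(P)$, the hypotheses of (a) hold with $f\equiv 1$, and for every $v$ the curve $s\mapsto\Gamma_v(-s)$, $s\in(-P,0)$, is a characteristic curve of $\mathbb S_K\cap\Omega$ that is not of class $C^3$. -/

import Mathlib

open Set MeasureTheory Topology
open scoped ContDiff NNReal ENNReal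

noncomputable section

namespace SubFinsler

/-- The space underlying the first Heisenberg group, with coordinates `(x, y, t)`. Its left-invariant
fields are `X = ∂x + y ∂t`, `Y = ∂y - x ∂t`, `T = ∂t`. The left-invariant Riemannian metric that makes
`X, Y, T` orthonormal has Lebesgue measure as its Riemannian measure. The norm that Mathlib puts on
this product is equivalent to the Euclidean one, so the notions of open set, Lipschitz function,
derivative and class `C^n` used below are the Euclidean ones. -/
abbrev Heis : Type := ℝ × ℝ × ℝ

/-- The horizontal vector `a X_p + b Y_p`, where `v = (a, b)`. -/
def horiz (p : Heis) (v : ℝ × ℝ) : Heis := (v.1, v.2, v.1 * p.2.1 - v.2 * p.1)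

/-- The left-invariant field `X = ∂x + y ∂t`. -/
def X (p : Heis) : Heis := horiz p (1, 0)

/-- The left-invariant field `Y = ∂y - x ∂t`. -/
def Y (p : Heis) : Heis := horiz p (0, 1)

/-- The rotation `J` of the horizontal plane: `J X = Y` and `J Y = -X`. -/
def J (v : ℝ × ℝ) : ℝ × ℝ := (-v.2, v.1)

/-- Euclidean length of the vector `a X + b Y`, where `v = (a, b)`. -/
def horizLength (v : ℝ × ℝ) : ℝ := Real.sqrt (v.1 ^ 2 + v.2 ^ 2)

/-- A convex body `K` of class `C²₊` in the plane with the origin in its interior: near each boundary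
point `p` the set `K` is a sublevel set `{φ ≤ 0}` of a `C²` function with `∇φ p ≠ 0`, and the
boundary has positive geodesic curvature at `p`, that is, the second derivative of `φ` at `p` is
positive on nonzero vectors tangent to the boundary (the curvature with respect to the inner normal
is `D²φ(τ, τ) / |∇φ|` for a unit tangent vector `τ`). -/
structure IsC2PlusBody (K : Set (ℝ × ℝ)) : Prop where
  convex : Convex ℝ K
  compact : IsCompact K
  zero_mem : (0 : ℝ × ℝ) ∈ interior K
  boundary : ∀ p ∈ frontier K, ∃ (U : Set (ℝ × ℝ)) (φ : ℝ × ℝ → ℝ), IsOpen U ∧ p ∈ U ∧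
    ContDiffOn ℝ 2 φ U ∧ K ∩ U = {q | q ∈ U ∧ φ q ≤ 0} ∧ fderiv ℝ φ p ≠ 0 ∧
    ∀ v : ℝ × ℝ, v ≠ 0 → fderiv ℝ φ p v = 0 → 0 < fderiv ℝ (fderiv ℝ φ) p v v

/-- The divergence `X a + Y b` of the horizontal vector field `a X + b Y`, where `U p = (a p, b p)`. -/
def hdiv (U : Heis → ℝ × ℝ) (p : Heis) : ℝ :=
  (fderiv ℝ U p (X p)).1 + (fderiv ℝ U p (Y p)).2

/-- `U` is a horizontal vector field of class `C¹` with compact support in `V` and `‖U‖_{K,∞} ≤ 1`.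
The asymmetric norm with unit ball `K` is the gauge (Minkowski functional) of `K`. -/
structure IsTestField (K : Set (ℝ × ℝ)) (V : Set Heis) (U : Heis → ℝ × ℝ) : Prop where
  contDiff : ContDiff ℝ 1 U
  compactSupport : HasCompactSupport U
  support_subset : tsupport U ⊆ V
  norm_le : ∀ p, gauge K (U p) ≤ 1

/-- The sub-Finsler perimeter `|∂E|_K(V)` of `E` in the open set `V`: the supremum of the integrals
over `E` of the divergences of the test fields. (The zero field is a test field, so that cutting
negative integrals off at `0` does not change the supremum.) -/
def perimeter (K : Set (ℝ × ℝ)) (E V : Set Heis) : ℝ≥0∞ :=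
  ⨆ (U : Heis → ℝ × ℝ) (_ : IsTestField K V U), ENNReal.ofReal (∫ p in E, hdiv U p)

/-- `B` is open and relatively compact in `Ω`. -/
def IsRelCompactOpen (B Ω : Set Heis) : Prop :=
  IsOpen B ∧ IsCompact (closure B) ∧ closure B ⊆ Ω

/-- `φ` is the flow of the vector field `W`. -/
structure IsFlow (W : Heis → Heis) (φ : ℝ → Heis → Heis) : Prop where
  smooth : ContDiff ℝ ∞ (fun q : ℝ × Heis => φ q.1 q.2)
  zero : ∀ p, φ 0 p = p
  deriv : ∀ s p, HasDerivAt (fun r => φ r p) (W (φ s p)) s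

/-- `E` has locally finite `K`-perimeter in `Ω` and prescribed `K`-mean curvature `f` in `Ω`: it is a
critical point of `E ↦ |∂E|_K(B) - ∫_{E ∩ B} f` with respect to the flows of all smooth vector
fields with compact support in `B`. -/
structure HasPrescribedCurvature (K : Set (ℝ × ℝ)) (Ω E : Set Heis) (f : Heis → ℝ) : Prop where
  locallyFinite : ∀ B, IsRelCompactOpen B Ω → perimeter K E B ≠ ⊤
  critical : ∀ B, IsRelCompactOpen B Ω → ∀ W : Heis → Heis, ContDiff ℝ ∞ W →
    HasCompactSupport W → tsupport W ⊆ B → ∀ φ, IsFlow W φ →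
      (∀ᶠ s in 𝓝 (0 : ℝ), perimeter K (φ s '' E) B ≠ ⊤) ∧
      HasDerivAt (fun s => (perimeter K (φ s '' E) B).toReal - ∫ p in (φ s '' E) ∩ B, f p) 0 0

/-- `E` has Euclidean Lipschitz boundary in `Ω`: near each point of `∂E ∩ Ω`, in suitable linear
coordinates of `ℝ³`, the set `E` is the epigraph of a Lipschitz function of two variables (with or
without points of the graph itself). -/
def HasLipschitzBoundary (Ω E : Set Heis) : Prop :=
  ∀ p ∈ frontier E ∩ Ω, ∃ (U : Set Heis) (A : Heis ≃L[ℝ] (ℝ × ℝ) × ℝ) (C : ℝ≥0) (ψ : ℝ × ℝ → ℝ),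
    IsOpen U ∧ p ∈ U ∧ LipschitzWith C ψ ∧
    ∀ q ∈ U, (ψ (A q).1 < (A q).2 → q ∈ E) ∧ (q ∈ E → ψ (A q).1 ≤ (A q).2)

/-- `g` is of class `C¹_ℍ` on the open set `U` and `G = (X g, Y g)` is its horizontal gradient: `g` and
`G` are continuous on `U`, and `G` represents the distributional derivatives of `g` along `X` and
`Y` (fields without divergence). -/
structure HasHorizontalGradient (U : Set Heis) (g : Heis → ℝ) (G : Heis → ℝ × ℝ) : Prop where
  continuousOn : ContinuousOn g U
  continuousOn_gradient : ContinuousOn G U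
  weak_X : ∀ η : Heis → ℝ, ContDiff ℝ ∞ η → HasCompactSupport η → tsupport η ⊆ U →
    ∫ p, g p * fderiv ℝ η p (X p) = -∫ p, (G p).1 * η p
  weak_Y : ∀ η : Heis → ℝ, ContDiff ℝ ∞ η → HasCompactSupport η → tsupport η ⊆ U →
    ∫ p, g p * fderiv ℝ η p (Y p) = -∫ p, (G p).2 * η p

/-- On the open set `U` the set `S` is the zero set of the `C¹_ℍ` function `g` with nowhere vanishing
horizontal gradient `G`. -/
def IsHDefiningFunction (S U : Set Heis) (g : Heis → ℝ) (G : Heis → ℝ × ℝ) : Prop :=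
  IsOpen U ∧ HasHorizontalGradient U g G ∧ (∀ q ∈ U, G q ≠ 0) ∧ S ∩ U = {q | q ∈ U ∧ g q = 0}

/-- `S` is an `ℍ`-regular surface. -/
def IsHRegular (S : Set Heis) : Prop :=
  ∀ p ∈ S, ∃ (U : Set Heis) (g : Heis → ℝ) (G : Heis → ℝ × ℝ), p ∈ U ∧ IsHDefiningFunction S U g G

/-- `ν = (a, b)` gives the outer horizontal unit normal `ν_h = a X + b Y` of `E` at `p`: it is
`∇_ℍ g / |∇_ℍ g|` for a local defining function `g` of `∂E` with `g ≤ 0` on `E`. -/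
def IsOuterNormal (E : Set Heis) (p : Heis) (ν : ℝ × ℝ) : Prop :=
  ∃ (U : Set Heis) (g : Heis → ℝ) (G : Heis → ℝ × ℝ), p ∈ U ∧
    IsHDefiningFunction (frontier E) U g G ∧ (∀ q ∈ U, q ∈ E → g q ≤ 0) ∧
    ν = (horizLength (G p))⁻¹ • G p

/-- `Γ`, restricted to `I`, is a characteristic curve of `∂E ∩ Ω`: an integral curve in `∂E ∩ Ω` of the
characteristic field `Z = J(ν_h)`. -/
def IsCharacteristicCurve (Ω E : Set Heis) (I : Set ℝ) (Γ : ℝ → Heis) : Prop :=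
  ∀ s ∈ I, Γ s ∈ frontier E ∩ Ω ∧
    ∃ ν, IsOuterNormal E (Γ s) ν ∧ HasDerivAt Γ (horiz (Γ s) (J ν)) s

/-- `E ⊆ Ω` is a set of prescribed `K`-mean curvature `f ∈ C⁰(Ω)` with Euclidean Lipschitz and
`ℍ`-regular boundary in the open set `Ω`. -/
structure IsRegularPrescribed (K : Set (ℝ × ℝ)) (Ω E : Set Heis) (f : Heis → ℝ) : Prop where
  isOpen : IsOpen Ω
  measurable : MeasurableSet E
  subset : E ⊆ Ω
  continuousOn : ContinuousOn f Ω
  lipschitz : HasLipschitzBoundary Ω E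
  hregular : IsHRegular (frontier E ∩ Ω)
  prescribed : HasPrescribedCurvature K Ω E f

/-- `γ` is a clockwise `P`-periodic `C²` parametrization by arc length of the boundary of `K`, where
`0` is interior to `K`. -/
structure IsClockwiseParam (K : Set (ℝ × ℝ)) (P : ℝ) (γ : ℝ → ℝ × ℝ) : Prop where
  pos : 0 < P
  contDiff : ContDiff ℝ 2 γ
  periodic : Function.Periodic γ P
  injOn : InjOn γ (Ico 0 P)
  range_eq : range γ = frontier K
  unitSpeed : ∀ s, (deriv γ s).1 ^ 2 + (deriv γ s).2 ^ 2 = 1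
  clockwise : ∀ s, (γ s).1 * (deriv γ s).2 - (γ s).2 * (deriv γ s).1 < 0

/-- The horizontal lift `Γ_v`, starting at the origin, of the translated boundary curve
`s ↦ γ (s + v) - γ v = (x s, y s)`; its third coordinate is `∫₀ˢ (y x' - x y')`. -/
def pansuWulffCurve (γ : ℝ → ℝ × ℝ) (v s : ℝ) : Heis :=
  ((γ (s + v) - γ v).1, (γ (s + v) - γ v).2,
    ∫ r in (0 : ℝ)..s, (γ (r + v) - γ v).2 * (deriv γ (r + v)).1
      - (γ (r + v) - γ v).1 * (deriv γ (r + v)).2)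

/-- The Pansu–Wulff shape, the union of the curves `Γ_v ([0, P])` with `0 ≤ v < P`. -/
def pansuWulffShape (γ : ℝ → ℝ × ℝ) (P : ℝ) : Set Heis :=
  ⋃ v ∈ Ico (0 : ℝ) P, pansuWulffCurve γ v '' Icc 0 P

/-- The two poles of the Pansu–Wulff shape, the common endpoints of the curves `Γ_v`. -/
def poles (γ : ℝ → ℝ × ℝ) (P : ℝ) : Set Heis :=
  {pansuWulffCurve γ 0 0, pansuWulffCurve γ 0 P}

end SubFinsler

end

open SubFinsler

noncomputable section

namespace SubFinsler

/-! Regularity. For `n ≠ 0` let `π n` be the point of `K` at which `dot n` is maximal. Positive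
curvature of `∂K` makes it unique and continuous in `n`. The heart of the matter is the equation `(π
∘ ν)' = f J(ν)` for the normal `ν` along a characteristic curve
(`IsRegularPrescribed.hasDerivAt_support`). It makes `π ∘ ν` of class `C¹`. Since `∂K` is `C²`, the
normal is a `C¹` function of the support point, and since the velocity of the curve is `J(ν)`, the
curve is `C²`.

To obtain the equation from so little regularity, the boundary is written as a graph `w = ψ z` over
the orbits of a right-invariant field. Its flow consists of left translations, so the horizontal
frame does not depend on `w` and the horizontal normal of the graph is affine in the derivative of
`ψ` (`graphNormal_add`). Testing the graph of `ψ + s η` with the dual field `Q = π(ν)` of the graph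
of `ψ` bounds its perimeter from below by the perimeter at `s = 0` plus `s` times a constant. At a
critical point this constant is therefore the derivative of the volume term. This is the weak
equation `∂₁ a + ∂₂ b = f` with `a = Q₂ - e Q₁` and `b = 2 z₁ Q₁` (`IsGraphChart.weak_equation`).

The step from the planar equation to a single curve is `hasDerivAt_comp_of_weak`. The integral of
`a` over the vertical segment of signed length `ε` at a point of the projected curve changes along
the curve by a source term and by a flux difference between the ends of the segment. The flux
difference equals `-2 z₁` times the deficit of the other end in the maximum that defines the support
point, so it has a constant sign for `ε` of both signs. Dividing by positive and by negative `ε`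
turns this one inequality into upper and lower bounds, hence into a derivative. Two charts with
different slopes `e` give both components of `π ∘ ν`.

Optimality. The boundary curve of the body has turning angle `turn`, with continuous positive
derivative `turnRate` that is not differentiable at the multiples of `π`. The body is thus `C²₊`,
but its boundary is not `C³`, and every lifted curve `Γ_v` passes over a bad point. The Pansu–Wulff
shape consists of the chords from `bdry a` to `bdry b`, placed at the height given by the area they
cut off. Dilating the chord by `λ` gives coordinates `(λ, a, b)` off the axis (`wulffMap`), unique
up to a common period in `a` and `b`. The factor `λ`, as a `C²` function `radius` of the point, is a
global defining function with horizontal gradient along `J (tang b)`.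

That the shape has curvature one is shown by calibration. The field `supportPoint (hgrad radius x)`
is optimal for the normal and has divergence one on the surface (`hdiv_supportPoint_hgrad_radius`).
Moving it with the flow of a test field and comparing the moved set with the original one in both
directions shows that the functional changes by at most `κ` times the swept volume, with `κ`
arbitrarily small, while the swept volume is linear in time (`perimeter_le_of_calibration`,
`IsFlow.exists_volume_symmDiff_le`). -/

/-! ### Support points of a `C²₊` convex body -/

/-- The Euclidean inner product of the plane. -/
def dot (a b : ℝ × ℝ) : ℝ := a.1 * b.1 + a.2 * b.2

lemma continuous_dot : Continuous fun x : (ℝ × ℝ) × ℝ × ℝ => dot x.1 x.2 := by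
  unfold dot; fun_prop

lemma dot_self_pos {n : ℝ × ℝ} (h : n ≠ 0) : 0 < dot n n := by
  have : n.1 ≠ 0 ∨ n.2 ≠ 0 := by
    by_contra hc; push Not at hc; exact h (Prod.ext hc.1 hc.2)
  unfold dot
  rcases this with h | h
  · nlinarith [mul_self_pos.2 h, mul_self_nonneg n.2]
  · nlinarith [mul_self_pos.2 h, mul_self_nonneg n.1]

/-- A vector which is nonpositive on the half-plane where `n` is negative is a nonnegative multiple
of `n`. -/
lemma exists_eq_smul_of_halfplane {n G : ℝ × ℝ} (hn : n ≠ 0)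
    (h : ∀ v, dot n v < 0 → dot G v ≤ 0) : ∃ μ : ℝ, 0 ≤ μ ∧ G = μ • n := by
  have hp := dot_self_pos hn
  set N := dot n n with hN
  -- All vectors `-n` plus a multiple of the rotated normal lie in the half-plane. A nonzero pairing
  -- of `G` with the rotated normal would make `dot G` unbounded on them.
  have key : ∀ t : ℝ, dot G (-n.1 + t * n.2, -n.2 - t * n.1) ≤ 0 := by
    intro t
    apply h
    have : dot n (-n.1 + t * n.2, -n.2 - t * n.1) = -N := by simp only [dot, hN]; ring
    linarith
  have hβ : G.1 * n.2 - G.2 * n.1 = 0 := by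
    by_contra hc
    set β := G.1 * n.2 - G.2 * n.1 with hβ
    -- This value of `t` makes the pairing equal to one.
    have h1 := key ((dot G n + 1) / β)
    have h2 : dot G (-n.1 + (dot G n + 1) / β * n.2, -n.2 - (dot G n + 1) / β * n.1)
        = -dot G n + (dot G n + 1) / β * β := by simp only [dot, hβ]; ring
    rw [h2, div_mul_cancel₀ _ hc] at h1
    linarith
  have h0 := key 0
  refine ⟨dot G n / N, div_nonneg ?_ hp.le, ?_⟩
  · simp only [dot, zero_mul, add_zero, sub_zero] at h0 ⊢; linarith
  · have hN' : n.1 * n.1 + n.2 * n.2 ≠ 0 := hp.ne'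
    ext
    · simp only [Prod.smul_fst, smul_eq_mul, hN, dot]
      rw [div_mul_eq_mul_div, eq_div_iff hN']
      linear_combination n.2 * hβ
    · simp only [Prod.smul_snd, smul_eq_mul, hN, dot]
      rw [div_mul_eq_mul_div, eq_div_iff hN']
      linear_combination -n.1 * hβ

/-- `q` is a point of `K` where the linear form `dot n` is maximal. -/
def IsSupportPoint (K : Set (ℝ × ℝ)) (n q : ℝ × ℝ) : Prop := q ∈ K ∧ ∀ k ∈ K, dot n k ≤ dot n q

lemma IsSupportPoint.notMem_interior {K : Set (ℝ × ℝ)} {n q : ℝ × ℝ} (h : IsSupportPoint K n q)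
    (hn : n ≠ 0) : q ∉ interior K := by
  intro hq
  have hc : Filter.Tendsto (fun t : ℝ => q + t • n) (𝓝[>] 0) (𝓝 q) := by
    have : Continuous fun t : ℝ => q + t • n := by fun_prop
    simpa using (this.tendsto 0).mono_left nhdsWithin_le_nhds
  obtain ⟨t, ht, ht0⟩ := ((hc.eventually (isOpen_interior.mem_nhds hq)).and
    self_mem_nhdsWithin).exists
  have h1 := h.2 _ (interior_subset ht)
  have h2 : dot n (q + t • n) = dot n q + t * dot n n := by simp [dot]; ring
  have := mul_pos (show (0 : ℝ) < t from ht0) (dot_self_pos hn)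
  linarith

lemma IsSupportPoint.mem_frontier {K : Set (ℝ × ℝ)} {n q : ℝ × ℝ} (h : IsSupportPoint K n q)
    (hn : n ≠ 0) : q ∈ frontier K :=
  ⟨subset_closure h.1, h.notMem_interior hn⟩

/-- One-sided information is enough because the derivative is assumed to exist. This is the
situation at the end point of a segment contained in the boundary of `K`. -/
lemma HasDerivAt.eq_zero_of_eq_zero_right {h : ℝ → ℝ} {d t t₂ : ℝ} (hd : HasDerivAt h d t)
    (ht : t < t₂) (h0 : ∀ r ∈ Ico t t₂, h r = 0) : d = 0 := by
  have h1 : HasDerivWithinAt h d (Ici t) t := hd.hasDerivWithinAt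
  have h2 : HasDerivWithinAt h 0 (Ici t) t := by
    refine (hasDerivWithinAt_const t (Ici t) (0 : ℝ)).congr_of_eventuallyEq ?_
      (h0 t ⟨le_rfl, ht⟩)
    filter_upwards [Ico_mem_nhdsGE ht] with r hr using h0 r hr
  exact (uniqueDiffWithinAt_Ici t).eq_deriv _ h1 h2

/-- Strict convexity. The segment between two maximum points consists of maximum points and so lies
in the boundary, where a defining function vanishes. Its first and second derivatives along the
segment are then zero, against positive curvature. -/
lemma IsSupportPoint.unique {K : Set (ℝ × ℝ)} (hK : IsC2PlusBody K) {n q₀ q₁ : ℝ × ℝ} (hn : n ≠ 0)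
    (h₀ : IsSupportPoint K n q₀) (h₁ : IsSupportPoint K n q₁) : q₁ = q₀ := by
  by_contra hne
  set v := q₁ - q₀ with hv
  have hv0 : v ≠ 0 := sub_ne_zero.2 hne
  have hseg : ∀ t ∈ Icc (0 : ℝ) 1, IsSupportPoint K n (q₀ + t • v) := by
    intro t ht
    refine ⟨hK.convex.add_smul_sub_mem h₀.1 h₁.1 ht, fun k hk => ?_⟩
    have e1 : dot n q₁ = dot n q₀ := le_antisymm (h₀.2 _ h₁.1) (h₁.2 _ h₀.1)
    have : dot n (q₀ + t • v) = dot n q₀ + t * (dot n q₁ - dot n q₀) := by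
      simp [dot, hv]; ring
    rw [this, e1, sub_self, mul_zero, add_zero]
    exact h₀.2 k hk
  obtain ⟨U, φ, hU, hqU, hφ, hKU, -, hpos⟩ := hK.boundary q₀ (h₀.mem_frontier hn)
  have hcont : Continuous fun t : ℝ => q₀ + t • v := by fun_prop
  have hev : ∀ᶠ t in 𝓝 (0 : ℝ), q₀ + t • v ∈ U :=
    (hcont.tendsto 0).eventually (by simpa using hU.mem_nhds hqU)
  obtain ⟨t₁, ht₁, hball⟩ := Metric.eventually_nhds_iff.1 hev
  set T := min t₁ 1 with hT
  have hTpos : 0 < T := lt_min ht₁ one_pos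
  have hmemU : ∀ t ∈ Ico (0 : ℝ) T, q₀ + t • v ∈ U := by
    intro t ht
    apply hball
    rw [Real.dist_eq, sub_zero, abs_of_nonneg ht.1]
    exact ht.2.trans_le (min_le_left _ _)
  have hzero : ∀ t ∈ Ico (0 : ℝ) T, φ (q₀ + t • v) = 0 := by
    intro t ht
    have hs := hseg t ⟨ht.1, ht.2.le.trans (min_le_right _ _)⟩
    have hle : φ (q₀ + t • v) ≤ 0 := by
      have : q₀ + t • v ∈ K ∩ U := ⟨hs.1, hmemU t ht⟩
      rw [hKU] at this; exact this.2
    -- A negative value of `φ` would put a whole neighbourhood into `K`, but a maximum point of a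
    -- nonzero linear form is not interior.
    refine le_antisymm hle (not_lt.1 fun hlt => hs.notMem_interior hn ?_)
    have hc : ContinuousAt φ (q₀ + t • v) :=
      hφ.continuousOn.continuousAt (hU.mem_nhds (hmemU t ht))
    rw [mem_interior_iff_mem_nhds]
    filter_upwards [hc.eventually (gt_mem_nhds hlt), hU.mem_nhds (hmemU t ht)] with x hx hxU
    have : x ∈ K ∩ U := by rw [hKU]; exact ⟨hxU, le_of_lt hx⟩
    exact this.1
  have hline : ∀ t : ℝ, HasDerivAt (fun t : ℝ => q₀ + t • v) v t := fun t => by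
    simpa using ((hasDerivAt_id t).smul_const v).const_add q₀
  have hd1 : ∀ t ∈ Ico (0 : ℝ) T, fderiv ℝ φ (q₀ + t • v) v = 0 := by
    intro t ht
    have hdiff : DifferentiableAt ℝ φ (q₀ + t • v) :=
      (hφ.contDiffAt (hU.mem_nhds (hmemU t ht))).differentiableAt (by norm_num)
    have := hdiff.hasFDerivAt.comp_hasDerivAt t (hline t)
    exact HasDerivAt.eq_zero_of_eq_zero_right this ht.2
      fun r hr => hzero r ⟨ht.1.trans hr.1, hr.2⟩
  have h00 : q₀ + (0 : ℝ) • v = q₀ := by simp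
  have hd2 : HasDerivAt (fun t : ℝ => fderiv ℝ φ (q₀ + t • v) v) (fderiv ℝ (fderiv ℝ φ) q₀ v v) 0 := by
    have hdiff : DifferentiableAt ℝ (fderiv ℝ φ) q₀ :=
      ((hφ.contDiffAt (hU.mem_nhds hqU)).fderiv_right (m := 1) (by norm_num)).differentiableAt
        (by norm_num)
    have h1 : HasFDerivAt (fun q => fderiv ℝ φ q v)
        ((ContinuousLinearMap.apply ℝ ℝ v).comp (fderiv ℝ (fderiv ℝ φ) q₀)) (q₀ + (0 : ℝ) • v) := by
      rw [h00]
      exact (ContinuousLinearMap.apply ℝ ℝ v).hasFDerivAt.comp q₀ hdiff.hasFDerivAt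
    exact h1.comp_hasDerivAt (0 : ℝ) (hline 0)
  have hd20 := HasDerivAt.eq_zero_of_eq_zero_right hd2 hTpos hd1
  have hd10 := hd1 0 ⟨le_rfl, hTpos⟩
  rw [h00] at hd10
  exact (hpos v hv0 hd10).ne' hd20

/-- The support map of a `C²₊` body: the point of `K` where `dot n` is maximal is unique and
depends continuously on `n ≠ 0`. -/
lemma IsC2PlusBody.exists_supportMap {K : Set (ℝ × ℝ)} (hK : IsC2PlusBody K) :
    ∃ π : ℝ × ℝ → ℝ × ℝ, (∀ n, IsSupportPoint K n (π n)) ∧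
      (∀ n q, n ≠ 0 → IsSupportPoint K n q → q = π n) ∧ ContinuousOn π {0}ᶜ := by
  have hne : K.Nonempty := ⟨0, interior_subset hK.zero_mem⟩
  have hex : ∀ n, ∃ q, IsSupportPoint K n q := by
    intro n
    have hc : ContinuousOn (dot n) K := by unfold dot; fun_prop
    obtain ⟨q, hq, hmax⟩ := hK.compact.exists_isMaxOn hne hc
    exact ⟨q, hq, fun k hk => hmax hk⟩
  choose π hπ using hex
  refine ⟨π, hπ, fun n q hn hq => (hπ n).unique hK hn hq, fun n hn => ContinuousAt.continuousWithinAt ?_⟩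
  -- Continuity by compactness: every cluster point of `π` at `n` is again a support point in the
  -- direction `n`, and there is only one.
  refine hK.compact.tendsto_nhds_of_unique_mapClusterPt (Filter.Eventually.of_forall fun m => (hπ m).1) ?_
  intro y hy hcl
  refine (hπ n).unique hK hn ⟨hy, fun k hk => ?_⟩
  obtain ⟨F, hF, hFt⟩ := mapClusterPt_iff_ultrafilter.1 hcl
  have hid : Filter.Tendsto (fun m : ℝ × ℝ => m) F (𝓝 n) := hF
  refine le_of_tendsto_of_tendsto' (b := (F : Filter (ℝ × ℝ))) ?_ ?_
    (f := fun m : ℝ × ℝ => dot m k) (g := fun m => dot m (π m)) fun m => (hπ m).2 k hk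
  · exact (continuous_dot.tendsto (n, k)).comp (hid.prodMk_nhds tendsto_const_nhds)
  · exact (continuous_dot.tendsto (n, y)).comp (hid.prodMk_nhds hFt)

/-- Coordinates of the differential of a function in the plane. -/
def grad (φ : ℝ × ℝ → ℝ) (q : ℝ × ℝ) : ℝ × ℝ := (fderiv ℝ φ q (1, 0), fderiv ℝ φ q (0, 1))

lemma dot_grad (φ : ℝ × ℝ → ℝ) (q v : ℝ × ℝ) : dot (grad φ q) v = fderiv ℝ φ q v := by
  have : v = v.1 • ((1, 0) : ℝ × ℝ) + v.2 • ((0, 1) : ℝ × ℝ) := by ext <;> simp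
  conv_rhs => rw [this, map_add, map_smul, map_smul]
  simp only [dot, grad, smul_eq_mul]; ring

/-- At a support point, the normal is the direction of the gradient of a local defining function. -/
lemma IsSupportPoint.grad_eq_smul {K : Set (ℝ × ℝ)} {n q : ℝ × ℝ} (h : IsSupportPoint K n q)
    (hn : n ≠ 0) {U : Set (ℝ × ℝ)} {φ : ℝ × ℝ → ℝ} (hU : IsOpen U) (hqU : q ∈ U)
    (hφ : ContDiffOn ℝ 2 φ U) (hKU : K ∩ U = {q | q ∈ U ∧ φ q ≤ 0}) (hd : fderiv ℝ φ q ≠ 0) :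
    ∃ μ : ℝ, 0 < μ ∧ grad φ q = μ • n := by
  have hg0 : grad φ q ≠ 0 := by
    intro h0
    apply hd
    refine ContinuousLinearMap.ext fun v => ?_
    rw [← dot_grad, h0]; simp [dot]
  have hq0 : φ q = 0 := by
    have hle : φ q ≤ 0 := by
      have : q ∈ K ∩ U := ⟨h.1, hqU⟩
      rw [hKU] at this; exact this.2
    refine le_antisymm hle (not_lt.1 fun hlt => h.notMem_interior hn ?_)
    have hc : ContinuousAt φ q := hφ.continuousOn.continuousAt (hU.mem_nhds hqU)
    rw [mem_interior_iff_mem_nhds]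
    filter_upwards [hc.eventually (gt_mem_nhds hlt), hU.mem_nhds hqU] with x hx hxU
    have : x ∈ K ∩ U := by rw [hKU]; exact ⟨hxU, le_of_lt hx⟩
    exact this.1
  -- Directions in which `φ` decreases lead into `K`, so `n` is nonpositive on them. This exhibits
  -- `n` as a multiple of the gradient, and the factor is inverted at the end.
  obtain ⟨μ, hμ, hμn⟩ := exists_eq_smul_of_halfplane (n := grad φ q) (G := n) hg0 (by
    intro v hv
    rw [dot_grad] at hv
    have hline : HasDerivAt (fun t : ℝ => q + t • v) v 0 := by
      simpa using ((hasDerivAt_id (0 : ℝ)).smul_const v).const_add q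
    have h00 : q + (0 : ℝ) • v = q := by simp
    have hdiff : DifferentiableAt ℝ φ (q + (0 : ℝ) • v) := by
      rw [h00]
      exact (hφ.contDiffAt (hU.mem_nhds hqU)).differentiableAt (by norm_num)
    have hder := hdiff.hasFDerivAt.comp_hasDerivAt (0 : ℝ) hline
    rw [h00] at hder
    have hneg : ∀ᶠ t in 𝓝[>] (0 : ℝ), φ (q + t • v) < 0 := by
      have := (hasDerivAt_iff_tendsto_slope.1 hder).eventually (gt_mem_nhds hv)
      have h2 : ∀ᶠ t in 𝓝[>] (0 : ℝ), slope (φ ∘ fun t : ℝ => q + t • v) 0 t < 0 :=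
        this.filter_mono (nhdsWithin_mono _ fun x hx => ne_of_gt hx)
      filter_upwards [h2, self_mem_nhdsWithin] with t ht ht0
      rw [slope_def_field] at ht
      simp only [Function.comp, h00, hq0, sub_zero] at ht
      have ht0' : (0 : ℝ) < t := ht0
      rcases div_neg_iff.1 ht with ⟨-, h⟩ | ⟨h, -⟩
      · linarith
      · exact h
    have hUev : ∀ᶠ t in 𝓝[>] (0 : ℝ), q + t • v ∈ U := by
      have hcont : Continuous fun t : ℝ => q + t • v := by fun_prop
      exact ((hcont.tendsto 0).eventually (by rw [h00]; exact hU.mem_nhds hqU)).filter_mono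
        nhdsWithin_le_nhds
    obtain ⟨t, ⟨ht1, ht2⟩, ht0⟩ := ((hneg.and hUev).and self_mem_nhdsWithin).exists
    have hmem : q + t • v ∈ K ∩ U := by rw [hKU]; exact ⟨ht2, ht1.le⟩
    have h1 := h.2 _ hmem.1
    have h2 : dot n (q + t • v) = dot n q + t * dot n v := by simp [dot]; ring
    have ht0' : (0 : ℝ) < t := ht0
    by_contra hc
    have := mul_pos ht0' (not_le.1 hc)
    linarith)
  have hμ0 : μ ≠ 0 := by rintro rfl; simp at hμn; exact hn hμn
  exact ⟨μ⁻¹, inv_pos.2 (lt_of_le_of_ne hμ (Ne.symm hμ0)), by rw [hμn, smul_smul, inv_mul_cancel₀ hμ0, one_smul]⟩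

lemma IsC2PlusBody.gauge_le_one_iff {K : Set (ℝ × ℝ)} (hK : IsC2PlusBody K) (q : ℝ × ℝ) :
    gauge K q ≤ 1 ↔ q ∈ K := by
  rw [gauge_le_one_iff_mem_closure hK.convex (mem_interior_iff_mem_nhds.1 hK.zero_mem),
    hK.compact.isClosed.closure_eq]

/-! ### Differentiability along horizontal lines from a distributional gradient -/

/-- Right translation by the exponential of the horizontal vector `ε v`. -/
def hflow (v : ℝ × ℝ) (ε : ℝ) (p : Heis) : Heis := p + ε • horiz p v

lemma continuous_horiz (v : ℝ × ℝ) : Continuous fun p : Heis => horiz p v := by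
  unfold horiz; fun_prop

lemma continuous_hflow (v : ℝ × ℝ) : Continuous fun x : ℝ × Heis => hflow v x.1 x.2 := by
  unfold hflow horiz; fun_prop

lemma hflow_neg_hflow (v : ℝ × ℝ) (ε : ℝ) (p : Heis) : hflow v (-ε) (hflow v ε p) = p := by
  unfold hflow horiz; ext <;> simp; ring

lemma hflow_hflow_neg (v : ℝ × ℝ) (ε : ℝ) (p : Heis) : hflow v ε (hflow v (-ε) p) = p := by
  unfold hflow horiz; ext <;> simp; ring

lemma hflow_zero (v : ℝ × ℝ) (p : Heis) : hflow v 0 p = p := by simp [hflow]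

/-- Each coordinate is translated by an amount depending only on the preceding ones, so the map is
an iterated skew product of translations. -/
lemma measurePreserving_hflow (v : ℝ × ℝ) (ε : ℝ) : MeasurePreserving (hflow v ε) := by
  have h1 : ∀ x : ℝ, MeasurePreserving
      (fun p : ℝ × ℝ => (p.1 + ε * v.2, p.2 + ε * (v.1 * p.1 - v.2 * x))) := fun x =>
    (measurePreserving_add_right volume (ε * v.2)).skew_product
      (g := fun y t : ℝ => t + ε * (v.1 * y - v.2 * x)) (by fun_prop)
      (.of_forall fun y => (measurePreserving_add_right volume _).map_eq)
  have h2 : MeasurePreserving (fun p : ℝ × ℝ × ℝ => (p.1 + ε * v.1,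
      (p.2.1 + ε * v.2, p.2.2 + ε * (v.1 * p.2.1 - v.2 * p.1)))) :=
    (measurePreserving_add_right volume (ε * v.1)).skew_product
      (g := fun x (p : ℝ × ℝ) => (p.1 + ε * v.2, p.2 + ε * (v.1 * p.1 - v.2 * x)))
      (by fun_prop) (.of_forall fun x => (h1 x).map_eq)
  exact h2

/-- Under a density of mass one the constant `c` can be moved inside the integral, and only points
with `η ≠ 0` count. This is the error bound for the averages of `g`, of its gradient, and for
mollified solutions. -/
lemma abs_integral_mul_sub_le {α : Type*} [MeasurableSpace α] {μ : Measure α} {η h : α → ℝ} {c δ : ℝ}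
    (hη0 : ∀ q, 0 ≤ η q) (hηi : Integrable η μ) (hη1 : ∫ q, η q ∂μ = 1)
    (hi : Integrable (fun q => h q * η q) μ) (hb : ∀ q, η q ≠ 0 → |h q - c| ≤ δ) :
    |∫ q, h q * η q ∂μ - c| ≤ δ := by
  have h1 : ∫ q, h q * η q ∂μ - c = ∫ q, (h q - c) * η q ∂μ := by
    simp_rw [sub_mul]
    rw [integral_sub hi (hηi.const_mul c), integral_const_mul, hη1, mul_one]
  have h2 : δ = ∫ q, δ * η q ∂μ := by rw [integral_const_mul, hη1, mul_one]
  rw [h1]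
  conv_rhs => rw [h2]
  rw [← Real.norm_eq_abs]
  refine norm_integral_le_of_norm_le (hηi.const_mul δ) (.of_forall fun q => ?_)
  rw [norm_mul, Real.norm_eq_abs, Real.norm_eq_abs, abs_of_nonneg (hη0 q)]
  by_cases hq : η q = 0
  · simp [hq]
  · exact mul_le_mul_of_nonneg_right (hb q hq) (hη0 q)

/-- Nothing is known about `g` outside `U`, not even measurability. The product is nevertheless
continuous everywhere, because it vanishes near each point off the support of `η`. -/
lemma integrable_mul_of_continuousOn {U : Set Heis} (hU : IsOpen U) {g η : Heis → ℝ} (hg : ContinuousOn g U)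
    (hη : Continuous η) (hc : HasCompactSupport η) (hs : tsupport η ⊆ U) :
    Integrable fun q => g q * η q := by
  have hcont : Continuous fun q => g q * η q := by
    rw [continuous_iff_continuousAt]
    intro q
    by_cases hq : q ∈ tsupport η
    · exact (hg.continuousAt (hU.mem_nhds (hs hq))).mul hη.continuousAt
    · have : (fun q => g q * η q) =ᶠ[𝓝 q] fun _ => 0 := by
        filter_upwards [notMem_tsupport_iff_eventuallyEq.1 hq] with x hx
        rw [hx]; simp
      exact continuousAt_const.congr this.symm
  exact hcont.integrable_of_hasCompactSupport hc.mul_left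

lemma HasHorizontalGradient.weak {U : Set Heis} {g : Heis → ℝ} {G : Heis → ℝ × ℝ}
    (h : HasHorizontalGradient U g G) (hU : IsOpen U) (v : ℝ × ℝ) {η : Heis → ℝ}
    (hη : ContDiff ℝ ∞ η) (hc : HasCompactSupport η) (hs : tsupport η ⊆ U) :
    ∫ p, g p * fderiv ℝ η p (horiz p v) = -∫ p, dot (G p) v * η p := by
  have hsd : ∀ w : Heis → Heis, Continuous w → Integrable fun p => g p * fderiv ℝ η p (w p) := by
    intro w hw
    refine integrable_mul_of_continuousOn hU h.continuousOn ?_ ?_ ?_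
    · exact (hη.continuous_fderiv (by simp)).clm_apply hw
    · refine (hc.fderiv (𝕜 := ℝ)).mono fun p hp => ?_
      rw [Function.mem_support] at hp ⊢
      intro h0; simp [h0] at hp
    · refine (closure_minimal (fun p hp => ?_) (isClosed_tsupport _)).trans hs
      rw [Function.mem_support] at hp
      refine tsupport_fderiv_subset ℝ (subset_tsupport _ ?_)
      rw [Function.mem_support]
      intro h0; simp [h0] at hp
  have hX : Continuous X := continuous_horiz _
  have hY : Continuous Y := continuous_horiz _
  have e1 : ∀ p, g p * fderiv ℝ η p (horiz p v)
      = v.1 * (g p * fderiv ℝ η p (X p)) + v.2 * (g p * fderiv ℝ η p (Y p)) := by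
    intro p
    have : horiz p v = v.1 • X p + v.2 • Y p := by
      ext <;> simp [horiz, X, Y]; ring
    rw [this, map_add, map_smul, map_smul, smul_eq_mul, smul_eq_mul]; ring
  have i1 : Integrable fun p => (G p).1 * η p :=
    integrable_mul_of_continuousOn hU h.continuousOn_gradient.fst hη.continuous hc hs
  have i2 : Integrable fun p => (G p).2 * η p :=
    integrable_mul_of_continuousOn hU h.continuousOn_gradient.snd hη.continuous hc hs
  have e2 : ∀ p, dot (G p) v * η p = v.1 * ((G p).1 * η p) + v.2 * ((G p).2 * η p) := by
    intro p; simp only [dot]; ring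
  simp_rw [e1, e2]
  rw [integral_add ((hsd X hX).const_mul _) ((hsd Y hY).const_mul _),
    integral_add (i1.const_mul _) (i2.const_mul _)]
  simp_rw [integral_const_mul]
  rw [h.weak_X η hη hc hs, h.weak_Y η hη hc hs]
  ring

/-- A function with continuous distributional horizontal gradient is differentiable along
horizontal lines. -/
lemma HasHorizontalGradient.hasDerivAt_hflow {U : Set Heis} {g : Heis → ℝ} {G : Heis → ℝ × ℝ}
    (h : HasHorizontalGradient U g G) (hU : IsOpen U) {p : Heis} (hp : p ∈ U) (v : ℝ × ℝ) :
    HasDerivAt (fun ε : ℝ => g (p + ε • horiz p v)) (dot (G p) v) 0 := by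
  change HasDerivAt (fun ε : ℝ => g (hflow v ε p)) (dot (G p) v) 0
  have hGc : ContinuousOn (fun q => dot (G q) v) U := by
    have := h.continuousOn_gradient
    unfold dot; exact (this.fst.mul continuousOn_const).add (this.snd.mul continuousOn_const)
  rw [hasDerivAt_iff_isLittleO, Asymptotics.isLittleO_iff]
  intro δ hδ
  -- a neighbourhood on which the gradient is almost constant
  have hnb : ∀ᶠ x : ℝ × Heis in 𝓝 ((0 : ℝ), p), hflow v x.1 x.2 ∈ U ∧
      |dot (G (hflow v x.1 x.2)) v - dot (G p) v| ≤ δ / 3 := by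
    have hc : Filter.Tendsto (fun x : ℝ × Heis => hflow v x.1 x.2) (𝓝 ((0 : ℝ), p)) (𝓝 p) := by
      simpa [hflow_zero] using (continuous_hflow v).tendsto ((0 : ℝ), p)
    have hG := (hGc.continuousAt (hU.mem_nhds hp)).tendsto
    filter_upwards [hc.eventually (hU.eventually_mem hp),
      hc.eventually (Metric.tendsto_nhds.1 hG (δ / 3) (by positivity))] with x hx1 hx2
    exact ⟨hx1, le_of_lt (by simpa [Real.dist_eq] using hx2)⟩
  obtain ⟨r₀, hr₀, hball⟩ := Metric.eventually_nhds_iff_ball.1 hnb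
  have hprod : ∀ ε q, |ε| < r₀ → dist q p < r₀ → hflow v ε q ∈ U ∧
      |dot (G (hflow v ε q)) v - dot (G p) v| ≤ δ / 3 := by
    intro ε q h1 h2
    refine hball (ε, q) ?_
    rw [Metric.mem_ball, Prod.dist_eq]
    exact max_lt (by simpa [Real.dist_eq] using h1) h2
  filter_upwards [Metric.ball_mem_nhds (0 : ℝ) (half_pos hr₀)] with ε hε
  rw [Metric.mem_ball, Real.dist_eq, sub_zero] at hε
  rcases eq_or_ne ε 0 with rfl | hε0
  · simp [hflow_zero]
  have hεa : 0 < |ε| := abs_pos.2 hε0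
  -- a small bump at `p`
  have hcl : ∀ τ : ℝ, |τ| < r₀ → ∀ᶠ q in 𝓝 p, |g (hflow v τ q) - g (hflow v τ p)| ≤ δ / 3 * |ε| := by
    intro τ hτ
    have hmem := (hprod τ p hτ (by simpa using hr₀)).1
    have hc : ContinuousAt (fun q => g (hflow v τ q)) p :=
      ContinuousAt.comp (f := hflow v τ) (h.continuousOn.continuousAt (hU.mem_nhds hmem))
        ((continuous_hflow v).comp (Continuous.prodMk_right τ)).continuousAt
    filter_upwards [Metric.tendsto_nhds.1 hc.tendsto (δ / 3 * |ε|) (by positivity)] with q hq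
    exact le_of_lt (by simpa [Real.dist_eq] using hq)
  obtain ⟨r₁, hr₁, hsm⟩ := Metric.eventually_nhds_iff_ball.1
    ((hcl ε (hε.trans (half_lt_self hr₀))).and (hcl 0 (by simpa using hr₀)))
  set r := min r₁ (r₀ / 2) with hr
  have hrpos : 0 < r := lt_min hr₁ (half_pos hr₀)
  let φ : ContDiffBump p := ⟨r / 2, r, half_pos hrpos, half_lt_self hrpos⟩
  set η := φ.normed volume with hη
  have hηs : ContDiff ℝ ∞ η := φ.contDiff_normed
  have hηsupp : Function.support η = Metric.ball p r := φ.support_normed_eq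
  set Kc : Set Heis := (fun x : ℝ × Heis => hflow v x.1 x.2) ''
    (Icc (-(r₀ / 2)) (r₀ / 2) ×ˢ Metric.closedBall p r) with hKc
  have hKcc : IsCompact Kc :=
    (isCompact_Icc.prod (isCompact_closedBall p r)).image (continuous_hflow v)
  have hKU : ∀ q ∈ Kc, q ∈ U ∧ |dot (G q) v - dot (G p) v| ≤ δ / 3 := by
    rintro _ ⟨⟨τ, q⟩, ⟨hτ, hq⟩, rfl⟩
    exact hprod τ q ((abs_le.2 hτ).trans_lt (half_lt_self hr₀))
      ((Metric.mem_closedBall.1 hq).trans_lt ((min_le_right _ _).trans_lt (half_lt_self hr₀)))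
  -- The bump is carried along by the right translations, which preserve volume. The derivative in
  -- `τ` of the average of `g` falls on the bump, and the weak identity turns it into the average of
  -- `dot (G q) v`.
  set ητ : ℝ → Heis → ℝ := fun τ q => η (hflow v (-τ) q) with hητ
  have hητs : ∀ τ, ContDiff ℝ ∞ (ητ τ) := fun τ =>
    hηs.comp (by unfold hflow horiz; fun_prop)
  have hητne : ∀ τ q, ητ τ q ≠ 0 → ∃ q' ∈ Metric.ball p r, q = hflow v τ q' := by
    intro τ q hq
    refine ⟨hflow v (-τ) q, ?_, (hflow_hflow_neg v τ q).symm⟩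
    rw [← hηsupp]; exact hq
  have hητsub : ∀ τ, |τ| ≤ r₀ / 2 → Function.support (ητ τ) ⊆ Kc := by
    intro τ hτ q hq
    obtain ⟨q', hq', rfl⟩ := hητne τ q hq
    exact ⟨(τ, q'), ⟨abs_le.1 hτ, Metric.ball_subset_closedBall hq'⟩, rfl⟩
  have hητts : ∀ τ, |τ| ≤ r₀ / 2 → tsupport (ητ τ) ⊆ Kc := fun τ hτ =>
    closure_minimal (hητsub τ hτ) hKcc.isClosed
  have hητc : ∀ τ, |τ| ≤ r₀ / 2 → HasCompactSupport (ητ τ) := fun τ hτ =>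
    HasCompactSupport.intro hKcc fun q hq => by
      by_contra hc; exact hq (hητsub τ hτ hc)
  have hητ0 : ∀ τ q, 0 ≤ ητ τ q := fun τ q => φ.nonneg_normed _
  have hητ1 : ∀ τ, ∫ q, ητ τ q = 1 := by
    intro τ
    have he : MeasurableEmbedding (hflow v (-τ)) := by
      have hcont : ∀ s, Continuous (hflow v s) := fun s =>
        (continuous_hflow v).comp (Continuous.prodMk_right s)
      exact (Homeomorph.mk ⟨hflow v (-τ), hflow v τ, hflow_hflow_neg v τ, hflow_neg_hflow v τ⟩
        (hcont _) (hcont _)).measurableEmbedding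
    rw [(measurePreserving_hflow v (-τ)).integral_comp he η, φ.integral_normed]
  -- the averaged function
  set I : ℝ → ℝ := fun τ => ∫ q, g q * ητ τ q with hI
  have hIest : ∀ τ, |τ| ≤ r₀ / 2 → (∀ q ∈ Metric.ball p r₁,
      |g (hflow v τ q) - g (hflow v τ p)| ≤ δ / 3 * |ε|) →
      |I τ - g (hflow v τ p)| ≤ δ / 3 * |ε| := by
    intro τ hτ hq
    refine abs_integral_mul_sub_le (hητ0 τ) ((hητs τ).continuous.integrable_of_hasCompactSupport
      (hητc τ hτ)) (hητ1 τ) (integrable_mul_of_continuousOn hU h.continuousOn (hητs τ).continuous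
      (hητc τ hτ) fun q hq => (hKU q (hητts τ hτ hq)).1) fun q hqne => ?_
    obtain ⟨q', hq', rfl⟩ := hητne τ q hqne
    exact hq q' (Metric.ball_subset_ball (min_le_left _ _) hq')
  -- Restricting `g` to the compact set swept by the bumps makes it integrable and does not change
  -- the averages in the relevant range of `τ`.
  set gi : Heis → ℝ := Kc.indicator g with hgi
  have hgint : Integrable gi := by
    rw [hgi, integrable_indicator_iff hKcc.measurableSet]
    exact (h.continuousOn.mono fun q hq => (hKU q hq).1).integrableOn_compact hKcc
  have hfη : Continuous (fderiv ℝ η) := hηs.continuous_fderiv (by simp)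
  obtain ⟨Cη, hCη⟩ : ∃ C, ∀ q, ‖fderiv ℝ η q‖ ≤ C :=
    (φ.hasCompactSupport_normed.fderiv (𝕜 := ℝ)).exists_bound_of_continuous hfη
  obtain ⟨Cb, hCb⟩ : ∃ C, ∀ q, ‖η q‖ ≤ C :=
    φ.hasCompactSupport_normed.exists_bound_of_continuous hηs.continuous
  obtain ⟨CH, hCH⟩ := hKcc.exists_bound_of_continuousOn (continuous_horiz v).continuousOn
  have hCη0 : 0 ≤ Cη := (norm_nonneg _).trans (hCη p)
  have hlin : ∀ τ q, HasDerivAt (fun τ : ℝ => hflow v (-τ) q) (-horiz q v) τ := by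
    intro τ q
    unfold hflow
    simpa using (((hasDerivAt_id τ).neg).smul_const (horiz q v)).const_add q
  have hIder : ∀ τ ∈ Metric.ball (0 : ℝ) (r₀ / 2),
      HasDerivAt I (∫ q, dot (G q) v * ητ τ q) τ := by
    intro τ hτ
    have hd := hasDerivAt_integral_of_dominated_loc_of_deriv_le (μ := volume)
      (F := fun τ q => gi q * ητ τ q)
      (F' := fun τ q => gi q * -(fderiv ℝ η (hflow v (-τ) q) (horiz q v)))
      (bound := fun q => ‖gi q‖ * (Cη * CH)) (x₀ := τ) (s := Metric.ball (0 : ℝ) (r₀ / 2))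
      (Metric.isOpen_ball.mem_nhds hτ)
      (.of_forall fun s => hgint.aestronglyMeasurable.mul (hητs s).continuous.aestronglyMeasurable)
      (hgint.mul_bdd (c := Cb) (hητs τ).continuous.aestronglyMeasurable (.of_forall fun q => hCb _))
      (hgint.aestronglyMeasurable.mul (Continuous.aestronglyMeasurable
        ((hfη.comp ((continuous_hflow v).comp (Continuous.prodMk_right _))).clm_apply
          (continuous_horiz v)).neg))
      (.of_forall fun q s hs => by
        rw [norm_mul]
        by_cases hq : q ∈ Kc
        · refine mul_le_mul_of_nonneg_left ?_ (norm_nonneg _)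
          rw [norm_neg]
          exact (ContinuousLinearMap.le_opNorm _ _).trans
            (mul_le_mul (hCη _) (hCH q hq) (norm_nonneg _) hCη0)
        · simp [hgi, hq])
      (hgint.norm.mul_const _)
      (.of_forall fun q s hs => by
        refine HasDerivAt.const_mul _ ?_
        have := ((hηs.differentiable (by simp)) (hflow v (-s) q)).hasFDerivAt.comp_hasDerivAt s (hlin s q)
        simpa [hητ, Function.comp_def] using this)
    have hτ' : |τ| < r₀ / 2 := by simpa [Real.dist_eq] using hτ
    have heq : I =ᶠ[𝓝 τ] fun s => ∫ q, gi q * ητ s q := by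
      filter_upwards [Metric.isOpen_ball.mem_nhds hτ] with s hs
      refine integral_congr_ae (.of_forall fun q => ?_)
      have hs' : |s| < r₀ / 2 := by simpa [Real.dist_eq] using hs
      by_cases hq : q ∈ Kc
      · simp [hgi, hq]
      · have : ητ s q = 0 := by by_contra hc; exact hq (hητsub s hs'.le hc)
        simp [this]
    have hval : ∫ q, gi q * -(fderiv ℝ η (hflow v (-τ) q) (horiz q v)) = ∫ q, dot (G q) v * ητ τ q := by
      have hw := h.weak hU v (hητs τ) (hητc τ hτ'.le) fun q hq => (hKU q (hητts τ hτ'.le hq)).1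
      rw [← neg_eq_iff_eq_neg] at hw
      rw [← hw, ← integral_neg]
      refine integral_congr_ae (.of_forall fun q => ?_)
      have hfl : HasFDerivAt (hflow v (-τ)) (fderiv ℝ (hflow v (-τ)) q) q :=
        (show Differentiable ℝ (hflow v (-τ)) by unfold hflow horiz; fun_prop).differentiableAt.hasFDerivAt
      -- The field is invariant under its own flow, so the derivative of the transported bump is the
      -- transported derivative.
      have hdir : fderiv ℝ (hflow v (-τ)) q (horiz q v) = horiz q v := by
        have hc : HasDerivAt (fun s : ℝ => hflow v (-τ) (hflow v s q))
            (fderiv ℝ (hflow v (-τ)) q (horiz q v)) 0 := by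
          refine HasFDerivAt.comp_hasDerivAt (f := fun s : ℝ => hflow v s q) (0 : ℝ)
            (by rw [hflow_zero]; exact hfl) ?_
          unfold hflow
          simpa using ((hasDerivAt_id (0 : ℝ)).smul_const (horiz q v)).const_add q
        have hc' : HasDerivAt (fun s : ℝ => hflow v (-τ) (hflow v s q)) (horiz q v) 0 := by
          have : (fun s : ℝ => hflow v (-τ) (hflow v s q)) = fun s : ℝ => hflow v (-τ) q + s • horiz q v := by
            funext s; unfold hflow horiz; ext <;> simp <;> ring
          rw [this]
          simpa using ((hasDerivAt_id (0 : ℝ)).smul_const (horiz q v)).const_add (hflow v (-τ) q)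
        exact hc.unique hc'
      have hch : fderiv ℝ (ητ τ) q (horiz q v) = fderiv ℝ η (hflow v (-τ) q) (horiz q v) := by
        have := (((hηs.differentiable (by simp)) (hflow v (-τ) q)).hasFDerivAt.comp q hfl).fderiv
        rw [hητ]
        simp only [Function.comp_def] at this
        rw [this, ContinuousLinearMap.comp_apply, hdir]
      change gi q * -(fderiv ℝ η (hflow v (-τ) q) (horiz q v)) = -(g q * fderiv ℝ (ητ τ) q (horiz q v))
      rw [hch]
      by_cases hq : q ∈ Kc
      · simp [hgi, hq]
      · have : fderiv ℝ (ητ τ) q = 0 := by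
          by_contra hc
          exact hq (hητts τ hτ'.le (tsupport_fderiv_subset ℝ (subset_tsupport _ hc)))
        rw [hch.symm, this]; simp
    exact (hval ▸ hd.2).congr_of_eventuallyEq heq
  -- mean value inequality
  have hmv : |I ε - I 0 - ε * dot (G p) v| ≤ δ / 3 * |ε| := by
    have hder : ∀ τ ∈ Metric.ball (0 : ℝ) (r₀ / 2), HasDerivWithinAt (fun τ => I τ - τ * dot (G p) v)
        ((∫ q, dot (G q) v * ητ τ q) - dot (G p) v) (Metric.ball (0 : ℝ) (r₀ / 2)) τ := fun τ hτ => by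
      have := ((hIder τ hτ).sub ((hasDerivAt_id τ).mul_const (dot (G p) v))).hasDerivWithinAt (s := Metric.ball (0 : ℝ) (r₀ / 2))
      rw [one_mul] at this; exact this
    have := (convex_ball (0 : ℝ) (r₀ / 2)).norm_image_sub_le_of_norm_hasDerivWithin_le hder
      (C := δ / 3) (fun τ hτ => by
        have hτ' : |τ| < r₀ / 2 := by simpa [Real.dist_eq] using hτ
        rw [Real.norm_eq_abs]
        refine abs_integral_mul_sub_le (hητ0 τ) ((hητs τ).continuous.integrable_of_hasCompactSupport
          (hητc τ hτ'.le)) (hητ1 τ) (integrable_mul_of_continuousOn hU hGc (hητs τ).continuous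
          (hητc τ hτ'.le) fun q hq => (hKU q (hητts τ hτ'.le hq)).1) fun q hqne => ?_
        exact (hKU q (hητsub τ hτ'.le hqne)).2)
      (Metric.mem_ball_self (half_pos hr₀)) (show ε ∈ Metric.ball (0 : ℝ) (r₀ / 2) by
        simpa [Real.dist_eq] using hε)
    simp only [zero_mul, sub_zero, Real.norm_eq_abs] at this
    convert this using 2; ring
  have e1 := hIest ε hε.le fun q hq => (hsm q hq).1
  have e2 := hIest 0 (by simpa using (half_pos hr₀).le) fun q hq => (hsm q hq).2
  rw [Real.norm_eq_abs, Real.norm_eq_abs, sub_zero, smul_eq_mul]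
  have key : g (hflow v ε p) - g (hflow v 0 p) - ε * dot (G p) v
      = -(I ε - g (hflow v ε p)) + (I 0 - g (hflow v 0 p)) + (I ε - I 0 - ε * dot (G p) v) := by ring
  rw [key]
  calc _ ≤ |I ε - g (hflow v ε p)| + |I 0 - g (hflow v 0 p)| + |I ε - I 0 - ε * dot (G p) v| := by
        refine (abs_add_le _ _).trans (add_le_add_left ((abs_add_le _ _).trans ?_) _)
        rw [abs_neg]
    _ ≤ δ * |ε| := by linarith

/-! ### The divergence theorem on Lipschitz epigraphs -/

section Epigraph

variable {ψ : ℝ × ℝ → ℝ} {C : ℝ≥0} {a : (ℝ × ℝ) × ℝ → ℝ}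

/-- The open epigraph of `ψ`. -/
def epi (ψ : ℝ × ℝ → ℝ) : Set ((ℝ × ℝ) × ℝ) := {q | ψ q.1 < q.2}

lemma isOpen_epi (hψ : Continuous ψ) : IsOpen (epi ψ) :=
  isOpen_lt (hψ.comp continuous_fst) continuous_snd

lemma measurePreserving_shear (hψ : Continuous ψ) :
    MeasurePreserving (fun q : (ℝ × ℝ) × ℝ => (q.1, q.2 + ψ q.1)) :=
  (MeasurePreserving.id volume).skew_product (g := fun z r : _ => r + ψ z)
    ((continuous_snd.add (hψ.comp continuous_fst)).measurable)
    (.of_forall fun z => (measurePreserving_add_right volume (ψ z)).map_eq)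

lemma measurableEmbedding_shear (hψ : Continuous ψ) :
    MeasurableEmbedding (fun q : (ℝ × ℝ) × ℝ => (q.1, q.2 + ψ q.1)) :=
  (Homeomorph.mk ⟨fun q : (ℝ × ℝ) × ℝ => (q.1, q.2 + ψ q.1), fun q => (q.1, q.2 - ψ q.1),
    fun q => by simp, fun q => by simp⟩ (by fun_prop) (by fun_prop)).measurableEmbedding

/-- The shear by `ψ` preserves volume and flattens the graph, so that Fubini applies on a product
domain. -/
lemma setIntegral_epi (hψ : Continuous ψ) (F : (ℝ × ℝ) × ℝ → ℝ) :
    ∫ q in epi ψ, F q = ∫ q in univ ×ˢ Ioi (0 : ℝ), F (q.1, q.2 + ψ q.1) := by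
  rw [← (measurePreserving_shear hψ).setIntegral_preimage_emb (measurableEmbedding_shear hψ)]
  congr 2
  ext q; simp [epi]

lemma integrable_shear (hψ : Continuous ψ) {F : (ℝ × ℝ) × ℝ → ℝ} (hF : Integrable F) :
    Integrable fun q : (ℝ × ℝ) × ℝ => F (q.1, q.2 + ψ q.1) :=
  ((measurePreserving_shear hψ).integrable_comp_emb (measurableEmbedding_shear hψ)).2 hF

lemma setIntegral_univ_prod_Ioi {F : (ℝ × ℝ) × ℝ → ℝ} (hF : Integrable F) :
    ∫ q in univ ×ˢ Ioi (0 : ℝ), F q = ∫ z, ∫ r in Ioi (0 : ℝ), F (z, r) := by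
  rw [Measure.volume_eq_prod, setIntegral_prod _ hF.integrableOn, setIntegral_univ]

lemma setIntegral_univ_prod_Ioi_swap {F : (ℝ × ℝ) × ℝ → ℝ} (hF : Integrable F) :
    ∫ q in univ ×ˢ Ioi (0 : ℝ), F q = ∫ r in Ioi (0 : ℝ), ∫ z, F (z, r) := by
  rw [setIntegral_univ_prod_Ioi hF]
  have := integral_integral_swap (f := fun z r => F (z, r)) (μ := volume)
    (ν := volume.restrict (Ioi (0 : ℝ))) (by
      have h := hF.integrableOn (s := univ ×ˢ Ioi (0 : ℝ))
      rw [IntegrableOn, Measure.volume_eq_prod, ← Measure.prod_restrict, Measure.restrict_univ] at h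
      exact h)
  exact this

lemma integrable_fderiv_apply (ha : ContDiff ℝ 1 a) (hc : HasCompactSupport a) (w : (ℝ × ℝ) × ℝ) :
    Integrable fun q => fderiv ℝ a q w := by
  refine Continuous.integrable_of_hasCompactSupport
    ((ha.continuous_fderiv (by simp)).clm_apply continuous_const) ?_
  refine (hc.fderiv (𝕜 := ℝ)).mono fun p hp => ?_
  rw [Function.mem_support] at hp ⊢
  intro h0; simp [h0] at hp

lemma integral_Ioi_fderiv_snd (ha : ContDiff ℝ 1 a) (hc : HasCompactSupport a) (z : ℝ × ℝ) (y : ℝ) :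
    ∫ r in Ioi (0 : ℝ), fderiv ℝ a (z, r + y) (0, 1) = -a (z, y) := by
  have hline : ∀ r : ℝ, HasDerivAt (fun r : ℝ => (z, r + y)) ((0 : ℝ × ℝ), (1 : ℝ)) r := fun r =>
    (hasDerivAt_const r z).prodMk ((hasDerivAt_id r).add_const y)
  have hd : ∀ r, HasDerivAt (fun r : ℝ => a (z, r + y)) (fderiv ℝ a (z, r + y) (0, 1)) r := fun r =>
    (ha.differentiable (by simp) _).hasFDerivAt.comp_hasDerivAt r (hline r)
  have hcs : HasCompactSupport fun r : ℝ => a (z, r + y) := by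
    refine HasCompactSupport.intro (K := (fun q : (ℝ × ℝ) × ℝ => q.2 - y) '' tsupport a)
      (hc.isCompact.image (by fun_prop)) fun r hr => ?_
    by_contra h0
    exact hr ⟨(z, r + y), subset_tsupport _ h0, by simp⟩
  have := hcs.integral_Ioi_deriv_eq (ha.comp (by fun_prop)) 0
  refine (integral_congr_ae (.of_forall fun r => (hd r).deriv.symm)).trans (this.trans ?_)
  simp

/-- Divergence theorem on a Lipschitz epigraph, vertical direction. -/
lemma setIntegral_epi_fderiv_snd (hψ : Continuous ψ) (ha : ContDiff ℝ 1 a) (hc : HasCompactSupport a) :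
    ∫ q in epi ψ, fderiv ℝ a q (0, 1) = -∫ z, a (z, ψ z) := by
  rw [setIntegral_epi hψ, setIntegral_univ_prod_Ioi
    (integrable_shear hψ (integrable_fderiv_apply ha hc _)), ← integral_neg]
  exact integral_congr_ae (.of_forall fun z => integral_Ioi_fderiv_snd ha hc z (ψ z))

/-- Integration by parts for Lipschitz functions, against the constant function one. -/
lemma integral_lineDeriv_eq_zero {g : ℝ × ℝ → ℝ} {D : ℝ≥0} (hg : LipschitzWith D g)
    (hc : HasCompactSupport g) (v : ℝ × ℝ) : ∫ z, lineDeriv ℝ g z v = 0 := by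
  have := (LipschitzWith.const (1 : ℝ) (α := ℝ × ℝ)).integral_lineDeriv_mul_eq (μ := volume) hg hc (-v)
  simpa [lineDeriv] using this.symm

/-- Divergence theorem on a Lipschitz epigraph, horizontal directions. -/
lemma setIntegral_epi_fderiv_fst (hψ : LipschitzWith C ψ) (ha : ContDiff ℝ 1 a)
    (hc : HasCompactSupport a) (v : ℝ × ℝ) :
    ∫ q in epi ψ, fderiv ℝ a q (v, 0) = ∫ z, a (z, ψ z) * lineDeriv ℝ ψ z v := by
  have i1 := integrable_shear hψ.continuous (integrable_fderiv_apply ha hc (v, 0))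
  have i2 := integrable_shear hψ.continuous (integrable_fderiv_apply ha hc (0, 1))
  have i3 : Integrable fun q : (ℝ × ℝ) × ℝ =>
      fderiv ℝ a (q.1, q.2 + ψ q.1) (0, 1) * lineDeriv ℝ ψ q.1 v := by
    refine i2.mul_bdd (c := C * ‖v‖) ?_ (.of_forall fun q => norm_lineDeriv_le_of_lipschitz ℝ hψ)
    exact ((measurable_lineDeriv hψ.continuous).comp measurable_fst).aestronglyMeasurable
  -- At fixed distance `r` above the graph the integrand is almost everywhere the derivative along
  -- `v` of the compactly supported Lipschitz function `z ↦ a (z, r + ψ z)`, by Rademacher's theorem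
  -- and the chain rule.
  have hslice : ∀ r : ℝ, ∫ z, (fderiv ℝ a (z, r + ψ z) (v, 0)
      + fderiv ℝ a (z, r + ψ z) (0, 1) * lineDeriv ℝ ψ z v) = 0 := by
    intro r
    obtain ⟨Ca, hCa⟩ := ContDiff.lipschitzWith_of_hasCompactSupport hc ha (by simp)
    have hlip : LipschitzWith (Ca * max 1 C) fun z => a (z, r + ψ z) := by
      refine hCa.comp (LipschitzWith.prodMk LipschitzWith.id ?_)
      have := (LipschitzWith.const r (α := ℝ × ℝ)).add hψ
      rwa [zero_add] at this
    have hcs : HasCompactSupport fun z => a (z, r + ψ z) := by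
      refine HasCompactSupport.intro (K := Prod.fst '' tsupport a)
        (hc.isCompact.image continuous_fst) fun z hz => ?_
      by_contra h0
      exact hz ⟨(z, r + ψ z), subset_tsupport _ h0, rfl⟩
    refine Eq.trans (integral_congr_ae ?_) (integral_lineDeriv_eq_zero hlip hcs v)
    filter_upwards [hψ.ae_differentiableAt] with z hz
    have h1 : HasFDerivAt (fun z => (z, r + ψ z))
        ((ContinuousLinearMap.id ℝ (ℝ × ℝ)).prod (fderiv ℝ ψ z)) z :=
      (hasFDerivAt_id z).prodMk (hz.hasFDerivAt.const_add r)
    have h2 := ((ha.differentiable (by simp) (z, r + ψ z)).hasFDerivAt.comp z h1)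
    have h3 := (h2.hasLineDerivAt v).lineDeriv
    simp only [Function.comp_def] at h3
    rw [h3, (hz.hasFDerivAt.hasLineDerivAt v).lineDeriv]
    have h4 : ((ContinuousLinearMap.id ℝ (ℝ × ℝ)).prod (fderiv ℝ ψ z)) v
        = (v, (0 : ℝ)) + fderiv ℝ ψ z v • ((0 : ℝ × ℝ), (1 : ℝ)) := by ext <;> simp
    rw [ContinuousLinearMap.comp_apply, h4, map_add, map_smul, smul_eq_mul, mul_comm (fderiv ℝ ψ z v)]
  -- Summed over `r`, the slices trade the horizontal derivative for the vertical one times the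
  -- slope of `ψ`. The vertical integral is then elementary.
  have hsum : ∫ q in univ ×ˢ Ioi (0 : ℝ), (fderiv ℝ a (q.1, q.2 + ψ q.1) (v, 0)
      + fderiv ℝ a (q.1, q.2 + ψ q.1) (0, 1) * lineDeriv ℝ ψ q.1 v) = 0 := by
    refine (setIntegral_univ_prod_Ioi_swap (i1.add i3)).trans ?_
    simp only [Pi.add_apply, hslice, integral_zero]
  rw [integral_add i1.integrableOn i3.integrableOn] at hsum
  rw [setIntegral_epi hψ.continuous, eq_neg_of_add_eq_zero_left hsum, setIntegral_univ_prod_Ioi i3,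
    ← integral_neg]
  refine integral_congr_ae (.of_forall fun z => ?_)
  change -∫ r in Ioi (0 : ℝ), fderiv ℝ a (z, r + ψ z) (0, 1) * lineDeriv ℝ ψ z v = _
  rw [integral_mul_const, integral_Ioi_fderiv_snd ha hc]
  ring

end Epigraph

/-! ### An explicit flow on the line with compact support -/

lemma exists_contDiffAt_rightInverse {E F : Type*} [NormedAddCommGroup E] [NormedSpace ℝ E]
    [CompleteSpace E] [NormedAddCommGroup F] [NormedSpace ℝ F] {n : WithTop ℕ∞} {f : E → F}
    {f' : E ≃L[ℝ] F} {a : E} (hf : ContDiffAt ℝ n f a) (hf' : HasFDerivAt f (f' : E →L[ℝ] F) a)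
    (hn : n ≠ 0) :
    ∃ g : F → E, ContDiffAt ℝ n g (f a) ∧ g (f a) = a ∧ ∀ᶠ y in 𝓝 (f a), f (g y) = y :=
  ⟨hf.localInverse hf' hn, hf.to_localInverse hf' hn, hf.localInverse_apply_image hf' hn,
    (hf.hasStrictFDerivAt' hf' hn).eventually_right_inverse⟩

/-- An odd diffeomorphism of `(-1, 1)` onto the line which is the identity near the origin. -/
def stretch (w : ℝ) : ℝ :=
  w + Real.smoothTransition (4 * w - 1) * (Real.exp (1 / (1 - w)) - w)
    - Real.smoothTransition (-4 * w - 1) * (Real.exp (1 / (1 + w)) + w)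

lemma stretch_neg (w : ℝ) : stretch (-w) = -stretch w := by
  unfold stretch
  rw [show 4 * -w - 1 = -4 * w - 1 by ring, show -4 * -w - 1 = 4 * w - 1 by ring,
    show 1 - -w = 1 + w by ring, show 1 + -w = 1 - w by ring]
  ring

lemma stretch_eq_self {w : ℝ} (h : |w| ≤ 1 / 4) : stretch w = w := by
  obtain ⟨h1, h2⟩ := abs_le.1 h
  unfold stretch
  rw [Real.smoothTransition.zero_of_nonpos (by linarith),
    Real.smoothTransition.zero_of_nonpos (by linarith)]
  ring

lemma stretch_eq_exp {w : ℝ} (h : 1 / 2 ≤ w) : stretch w = Real.exp (1 / (1 - w)) := by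
  unfold stretch
  rw [Real.smoothTransition.one_of_one_le (by linarith),
    Real.smoothTransition.zero_of_nonpos (by linarith)]
  ring

lemma contDiffAt_stretch {w : ℝ} (h : |w| < 1) : ContDiffAt ℝ ∞ stretch w := by
  obtain ⟨h1, h2⟩ := abs_lt.1 h
  have e1 : (1 : ℝ) - w ≠ 0 := by linarith
  have e2 : (1 : ℝ) + w ≠ 0 := by linarith
  have hS : ContDiff ℝ ∞ Real.smoothTransition := Real.smoothTransition.contDiff
  unfold stretch
  refine (contDiffAt_id.add (ContDiffAt.mul ?_ (ContDiffAt.sub ?_ contDiffAt_id))).sub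
    (ContDiffAt.mul ?_ (ContDiffAt.add ?_ contDiffAt_id))
  · exact (hS.comp (by fun_prop : ContDiff ℝ ∞ fun w : ℝ => 4 * w - 1)).contDiffAt
  · exact (contDiffAt_const.div (contDiffAt_const.sub contDiffAt_id) e1).exp
  · exact (hS.comp (by fun_prop : ContDiff ℝ ∞ fun w : ℝ => -4 * w - 1)).contDiffAt
  · exact (contDiffAt_const.div (contDiffAt_const.add contDiffAt_id) e2).exp

/-- For `w ≥ 0` the derivative is `1` plus `4 S' (e^{1/(1-w)} - w)` plus `S` times the excess over
`1` of the derivative of the exponential, where `S` is the increasing smooth transition. The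
exponential and its derivative both exceed one, so no term is negative. -/
lemma deriv_stretch_pos_aux {w : ℝ} (h0 : 0 ≤ w) (h : w < 1) : 0 < deriv stretch w := by
  have e1 : (1 : ℝ) - w ≠ 0 := by linarith
  have hev : stretch =ᶠ[𝓝 w] fun w => w + Real.smoothTransition (4 * w - 1) * (Real.exp (1 / (1 - w)) - w) := by
    filter_upwards [lt_mem_nhds (show (-1 / 4 : ℝ) < w by linarith)] with x hx
    unfold stretch
    rw [Real.smoothTransition.zero_of_nonpos (x := -4 * x - 1) (by linarith)]; ring
  have hS : HasDerivAt Real.smoothTransition (deriv Real.smoothTransition (4 * w - 1)) (4 * w - 1) :=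
    ((Real.smoothTransition.contDiff (n := 1)).differentiable (by simp) _).hasDerivAt
  have hS4 : HasDerivAt (fun w : ℝ => Real.smoothTransition (4 * w - 1))
      (deriv Real.smoothTransition (4 * w - 1) * 4) w := by
    have hlin : HasDerivAt (fun w : ℝ => 4 * w - 1) 4 w := by
      simpa using ((hasDerivAt_id w).const_mul (4 : ℝ)).sub_const 1
    exact HasDerivAt.comp (h := fun w : ℝ => 4 * w - 1) w hS hlin
  have hE : HasDerivAt (fun w : ℝ => Real.exp (1 / (1 - w)))
      (Real.exp (1 / (1 - w)) * (1 / (1 - w) ^ 2)) w := by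
    refine HasDerivAt.exp ?_
    have h1 : HasDerivAt (fun w : ℝ => 1 - w) (-1) w := by simpa using (hasDerivAt_id w).const_sub 1
    simpa [one_div] using h1.fun_inv e1
  have hd := (hasDerivAt_id w).add (hS4.mul (hE.sub (hasDerivAt_id w)))
  have hd' := hd.congr_of_eventuallyEq (f₁ := stretch) hev
  rw [hd'.deriv]
  have p1 := Real.smoothTransition.nonneg (4 * w - 1)
  have p2 := Real.smoothTransition.le_one (4 * w - 1)
  have p3 : 0 ≤ deriv Real.smoothTransition (4 * w - 1) := Real.smoothTransition.monotone.deriv_nonneg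
  have p4 : 1 < Real.exp (1 / (1 - w)) := Real.one_lt_exp_iff.2 (by apply one_div_pos.2; linarith)
  have p5 : 1 ≤ 1 / (1 - w) ^ 2 := by
    rw [le_div_iff₀ (by have : 0 < 1 - w := by linarith
                        positivity)]
    nlinarith
  have p6 : 1 < Real.exp (1 / (1 - w)) * (1 / (1 - w) ^ 2) := by nlinarith
  have p7 : 0 ≤ deriv Real.smoothTransition (4 * w - 1) * 4 * (Real.exp (1 / (1 - w)) - w) :=
    mul_nonneg (by positivity) (by linarith)
  have p8 : 0 ≤ Real.smoothTransition (4 * w - 1) * (Real.exp (1 / (1 - w)) * (1 / (1 - w) ^ 2) - 1) :=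
    mul_nonneg p1 (by linarith)
  rw [Pi.sub_apply, id_eq]
  linarith

lemma deriv_stretch_pos {w : ℝ} (h : |w| < 1) : 0 < deriv stretch w := by
  obtain ⟨h1, h2⟩ := abs_lt.1 h
  rcases le_total 0 w with h0 | h0
  · exact deriv_stretch_pos_aux h0 h2
  · have := deriv_stretch_pos_aux (w := -w) (by linarith) (by linarith)
    have e : stretch = fun w => -stretch (-w) := by funext w; rw [stretch_neg]; ring
    have hd : HasDerivAt (fun w => -stretch (-w)) (deriv stretch (-w)) w := by
      have hh := ((contDiffAt_stretch (w := -w) (by rwa [abs_neg])).differentiableAt (by simp)).hasDerivAt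
      simpa [Function.comp_def] using (hh.comp w (hasDerivAt_neg w)).fun_neg
    rw [← e] at hd
    rw [hd.deriv]; exact this

lemma stretch_strictMonoOn : StrictMonoOn stretch (Ioo (-1) 1) := by
  refine strictMonoOn_of_deriv_pos (convex_Ioo _ _) (fun w hw => ?_) fun w hw => ?_
  · exact (contDiffAt_stretch (abs_lt.2 hw)).continuousAt.continuousWithinAt
  · rw [interior_Ioo] at hw; exact deriv_stretch_pos (abs_lt.2 hw)

lemma exists_stretch_eq (x : ℝ) : ∃ w ∈ Ioo (-1 : ℝ) 1, stretch w = x := by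
  have key : ∀ x : ℝ, 0 ≤ x → ∃ w ∈ Ioo (-1 : ℝ) 1, stretch w = x := by
    intro x hx
    -- With this `b` the exponent `1 / (1 - b)` is at least `x + 1`, so the exponential branch is
    -- already above `x`.
    set b := max (1 / 2) (1 - 1 / (x + 1)) with hb
    have hx1 : 0 < 1 / (x + 1) := by positivity
    have hb1 : b < 1 := max_lt (by norm_num) (by linarith)
    have hb2 : 1 / 2 ≤ b := le_max_left _ _
    have hle : x ≤ stretch b := by
      rw [stretch_eq_exp hb2]
      have h1 : 1 - 1 / (x + 1) ≤ b := le_max_right _ _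
      have h2 : x + 1 ≤ 1 / (1 - b) := by
        rw [le_div_iff₀ (by linarith)]
        have h3 : (1 - b) ≤ 1 / (x + 1) := by linarith
        calc (x + 1) * (1 - b) ≤ (x + 1) * (1 / (x + 1)) := by gcongr
          _ = 1 := by field_simp
      have := Real.add_one_le_exp (1 / (1 - b))
      linarith
    have hc : ContinuousOn stretch (Icc 0 b) := fun w hw =>
      (contDiffAt_stretch (abs_lt.2 ⟨by linarith [hw.1], by linarith [hw.2]⟩)).continuousAt.continuousWithinAt
    have h0 : stretch 0 = 0 := stretch_eq_self (by simp)
    obtain ⟨w, hw, hwx⟩ := intermediate_value_Icc (by linarith : (0 : ℝ) ≤ b) hc ⟨by rw [h0]; exact hx, hle⟩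
    exact ⟨w, ⟨by linarith [hw.1], by linarith [hw.2]⟩, hwx⟩
  rcases le_total 0 x with h | h
  · exact key x h
  · obtain ⟨w, hw, hwx⟩ := key (-x) (by linarith)
    exact ⟨-w, ⟨by linarith [hw.2], by linarith [hw.1]⟩, by rw [stretch_neg, hwx, neg_neg]⟩

/-- The inverse of `stretch`. -/
def squash (x : ℝ) : ℝ := Classical.choose (exists_stretch_eq x)

lemma squash_mem (x : ℝ) : squash x ∈ Ioo (-1 : ℝ) 1 := (Classical.choose_spec (exists_stretch_eq x)).1

lemma stretch_squash (x : ℝ) : stretch (squash x) = x := (Classical.choose_spec (exists_stretch_eq x)).2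

lemma squash_eq {w x : ℝ} (hw : |w| < 1) (h : stretch w = x) : squash x = w :=
  stretch_strictMonoOn.injOn (squash_mem x) (abs_lt.1 hw) ((stretch_squash x).trans h.symm)

lemma squash_stretch {w : ℝ} (hw : |w| < 1) : squash (stretch w) = w := squash_eq hw rfl

lemma contDiff_squash : ContDiff ℝ ∞ squash := by
  rw [contDiff_iff_contDiffAt]
  intro x
  have hw := abs_lt.2 (squash_mem x)
  have hd := ((contDiffAt_stretch hw).differentiableAt (by simp)).hasDerivAt
  obtain ⟨g, hg, hgx, hgr⟩ := exists_contDiffAt_rightInverse (contDiffAt_stretch hw)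
    (hd.hasFDerivAt_equiv (deriv_stretch_pos hw).ne') (by simp)
  rw [stretch_squash] at hg hgx hgr
  refine hg.congr_of_eventuallyEq ?_
  have hcont := hg.continuousAt.tendsto
  rw [hgx] at hcont
  filter_upwards [hgr, hcont.eventually (isOpen_Ioo.mem_nhds (squash_mem x))] with y hy hym
  exact squash_eq (abs_lt.2 hym) hy

/-- A one-parameter group of diffeomorphisms of the line that fix everything outside `(-1, 1)` and
translate near the origin. -/
def slide (s w : ℝ) : ℝ := open Classical in if |w| < 1 then squash (stretch w + s) else w

lemma slide_of_lt {w : ℝ} (h : |w| < 1) (s : ℝ) : slide s w = squash (stretch w + s) := if_pos h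

lemma slide_of_le {w : ℝ} (h : 1 ≤ |w|) (s : ℝ) : slide s w = w := if_neg (not_lt.2 h)

lemma abs_slide_lt {w : ℝ} (h : |w| < 1) (s : ℝ) : |slide s w| < 1 := by
  rw [slide_of_lt h]; exact abs_lt.2 (squash_mem _)

lemma slide_zero (w : ℝ) : slide 0 w = w := by
  rcases lt_or_ge |w| 1 with h | h
  · rw [slide_of_lt h, add_zero, squash_stretch h]
  · exact slide_of_le h 0

/-- Inside the interval `slide` is the translation group of the line conjugated by `stretch`,
outside it is the identity. -/
lemma slide_add (s r w : ℝ) : slide (s + r) w = slide s (slide r w) := by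
  rcases lt_or_ge |w| 1 with h | h
  · rw [slide_of_lt (abs_slide_lt h r), slide_of_lt h, slide_of_lt h, stretch_squash]
    congr 1; ring
  · rw [slide_of_le h, slide_of_le h, slide_of_le h]

lemma slide_neg_neg (s w : ℝ) : slide (-s) (-w) = -slide s w := by
  rcases lt_or_ge |w| 1 with h | h
  · rw [slide_of_lt (by rwa [abs_neg]), slide_of_lt h]
    refine squash_eq (by rw [abs_neg]; exact abs_lt.2 (squash_mem _)) ?_
    rw [stretch_neg, stretch_squash, stretch_neg]; ring
  · rw [slide_of_le (by rwa [abs_neg]), slide_of_le h]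

/-- The two bounds `1 / 8` keep both `w` and `w + s` within distance `1 / 4` of the origin, where
`stretch` is the identity. -/
lemma slide_eq_add {s w : ℝ} (hs : |s| ≤ 1 / 8) (hw : |w| ≤ 1 / 8) : slide s w = w + s := by
  have h1 : |w + s| ≤ 1 / 4 := (abs_add_le _ _).trans (by linarith)
  rw [slide_of_lt (by linarith), stretch_eq_self (by linarith)]
  exact squash_eq (by linarith) (stretch_eq_self h1)

lemma slide_strictMono (s : ℝ) : StrictMono (slide s) := by
  have hin : ∀ w, |w| < 1 → -1 < slide s w ∧ slide s w < 1 := fun w h => abs_lt.1 (abs_slide_lt h s)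
  intro w w' hlt
  rcases lt_or_ge |w| 1 with h | h <;> rcases lt_or_ge |w'| 1 with h' | h'
  · have h1 := stretch_strictMonoOn (abs_lt.1 h) (abs_lt.1 h') hlt
    by_contra hc
    have h2 := stretch_strictMonoOn.monotoneOn (abs_lt.1 (abs_slide_lt h' s)) (abs_lt.1 (abs_slide_lt h s))
      (not_lt.1 hc)
    rw [slide_of_lt h, slide_of_lt h', stretch_squash, stretch_squash] at h2
    linarith
  · rw [slide_of_le h']
    rcases le_abs.1 h' with h2 | h2
    · linarith [(hin w h).2]
    · linarith [(abs_lt.1 h).1]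
  · rw [slide_of_le h]
    rcases le_abs.1 h with h2 | h2
    · linarith [(abs_lt.1 h').2]
    · linarith [(hin w' h').1]
  · rwa [slide_of_le h, slide_of_le h']

/-- The delicate point is `w = 1`. With `ρ = 1 - w` the conjugated translation becomes `ρ ↦ ρ / (1 +
ρ log (1 + s e^{-1/ρ}))`. Writing `e^{-1/ρ}` as `expNegInvGlue ρ` makes this smooth in `(s, ρ)` and
the identity for `ρ ≤ 0`. The exponential end of `stretch` serves this purpose. -/
lemma contDiffAt_slide_of_pos (s₀ : ℝ) {w₀ : ℝ} (h0 : 0 < w₀) :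
    ContDiffAt ℝ ∞ (fun x : ℝ × ℝ => slide x.1 x.2) (s₀, w₀) := by
  rcases lt_trichotomy w₀ 1 with h | rfl | h
  · have habs : |w₀| < 1 := by rwa [abs_of_pos h0]
    have hev : (fun x : ℝ × ℝ => slide x.1 x.2) =ᶠ[𝓝 (s₀, w₀)] fun x => squash (stretch x.2 + x.1) := by
      have : ∀ᶠ x : ℝ × ℝ in 𝓝 (s₀, w₀), |x.2| < 1 :=
        (continuous_snd.abs.continuousAt (x := (s₀, w₀))).eventually (gt_mem_nhds habs)
      filter_upwards [this] with x hx using slide_of_lt hx _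
    refine ContDiffAt.congr_of_eventuallyEq ?_ hev
    refine contDiff_squash.contDiffAt.comp _ (ContDiffAt.add ?_ contDiffAt_fst)
    exact (contDiffAt_stretch habs).comp (s₀, w₀) contDiffAt_snd
  · have hE : ContDiff ℝ ∞ expNegInvGlue := expNegInvGlue.contDiff
    have cE : ContDiff ℝ ∞ (fun x : ℝ × ℝ => expNegInvGlue (1 - x.2)) := hE.comp (by fun_prop)
    have c1 : ContDiff ℝ ∞ (fun x : ℝ × ℝ => 1 + x.1 * expNegInvGlue (1 - x.2)) :=
      contDiff_const.add (contDiff_fst.mul cE)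
    have v1 : 1 + s₀ * expNegInvGlue (1 - 1) = 1 := by simp
    have c2 : ContDiffAt ℝ ∞ (fun x : ℝ × ℝ => 1 + (1 - x.2) * Real.log (1 + x.1 * expNegInvGlue (1 - x.2)))
        (s₀, 1) := by
      refine contDiffAt_const.add ((contDiffAt_const.sub contDiffAt_snd).mul
        (c1.contDiffAt.log ?_))
      simp
    have c3 : ContDiffAt ℝ ∞ (fun x : ℝ × ℝ => (1 - x.2) /
        (1 + (1 - x.2) * Real.log (1 + x.1 * expNegInvGlue (1 - x.2)))) (s₀, 1) := by
      refine (contDiffAt_const.sub contDiffAt_snd).div c2 ?_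
      simp
    -- The closed formula agrees with `slide` on both sides of `w = 1`: outside by vanishing of the
    -- glue function, inside by solving for the new distance to the end point.
    refine ContDiffAt.congr_of_eventuallyEq (contDiffAt_const (c := (1 : ℝ)) |>.sub c3) ?_
    have t1 : ∀ᶠ x : ℝ × ℝ in 𝓝 (s₀, 1), 0 < 1 + x.1 * expNegInvGlue (1 - x.2) :=
      c1.continuous.continuousAt.eventually (lt_mem_nhds (by simp))
    have t2 := c2.continuousAt.eventually (lt_mem_nhds (show (0 : ℝ) < _ by simp))
    have t3 := c3.continuousAt.eventually (gt_mem_nhds (show _ < (1 / 2 : ℝ) by simp))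
    have t4 : ∀ᶠ x : ℝ × ℝ in 𝓝 (s₀, 1), 1 / 2 < x.2 :=
      continuous_snd.continuousAt.eventually (lt_mem_nhds (by norm_num))
    filter_upwards [t1, t2, t3, t4] with x h1 h2 h3 h4
    rcases le_or_gt 1 x.2 with h | h
    · rw [slide_of_le (by rw [abs_of_pos (by linarith)]; exact h),
        expNegInvGlue.zero_of_nonpos (by linarith)]
      simp
    · have hρ : 0 < 1 - x.2 := by linarith
      have habs : |x.2| < 1 := by rw [abs_of_pos (by linarith)]; exact h
      rw [slide_of_lt habs]
      set R := (1 - x.2) / (1 + (1 - x.2) * Real.log (1 + x.1 * expNegInvGlue (1 - x.2))) with hR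
      have hRpos : 0 < R := div_pos hρ h2
      refine squash_eq (by rw [abs_of_pos (by linarith)]; linarith) ?_
      rw [stretch_eq_exp (by linarith), stretch_eq_exp h4.le]
      have e1 : 1 / (1 - (1 - R)) = 1 / (1 - x.2) + Real.log (1 + x.1 * expNegInvGlue (1 - x.2)) := by
        rw [sub_sub_cancel, hR, one_div_div]
        field_simp
      have e2 : expNegInvGlue (1 - x.2) = Real.exp (-(1 / (1 - x.2))) := by
        simp [expNegInvGlue, not_le.2 h]
      rw [e1, Real.exp_add, Real.exp_log h1, e2, mul_add, mul_one, mul_left_comm, ← Real.exp_add]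
      simp
  · have hev : (fun x : ℝ × ℝ => slide x.1 x.2) =ᶠ[𝓝 (s₀, w₀)] fun x => x.2 := by
      have : ∀ᶠ x : ℝ × ℝ in 𝓝 (s₀, w₀), 1 < x.2 :=
        continuous_snd.continuousAt.eventually (lt_mem_nhds h)
      filter_upwards [this] with x hx
      exact slide_of_le (hx.le.trans (le_abs_self _)) _
    exact contDiffAt_snd.congr_of_eventuallyEq hev

lemma contDiff_slide : ContDiff ℝ ∞ (fun x : ℝ × ℝ => slide x.1 x.2) := by
  rw [contDiff_iff_contDiffAt]
  rintro ⟨s₀, w₀⟩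
  rcases lt_trichotomy w₀ 0 with h | rfl | h
  · have e : (fun x : ℝ × ℝ => slide x.1 x.2) = fun x => -slide (-x.1) (-x.2) := by
      funext x; rw [slide_neg_neg, neg_neg]
    rw [e]
    exact ((contDiffAt_slide_of_pos (-s₀) (neg_pos.2 h)).comp (s₀, w₀)
      (contDiffAt_fst.neg.prodMk contDiffAt_snd.neg)).neg
  · have hev : (fun x : ℝ × ℝ => slide x.1 x.2) =ᶠ[𝓝 (s₀, 0)] fun x => squash (x.2 + x.1) := by
      have : ∀ᶠ x : ℝ × ℝ in 𝓝 (s₀, (0 : ℝ)), |x.2| < 1 / 4 :=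
        (continuous_snd.abs.continuousAt (x := (s₀, (0 : ℝ)))).eventually (gt_mem_nhds (by simp))
      filter_upwards [this] with x hx
      rw [slide_of_lt (by linarith), stretch_eq_self hx.le]
    exact (contDiff_squash.contDiffAt.comp _ (contDiffAt_snd.add contDiffAt_fst)).congr_of_eventuallyEq hev
  · exact contDiffAt_slide_of_pos s₀ h

/-! ### Coordinates that straighten a right-invariant field -/

/-- Coordinates `((z₁, z₂), w)` of the Heisenberg group that straighten the right-invariant field whose
horizontal part at the origin is `σ (X + e Y)`. -/
def zw (σ e k : ℝ) (p : Heis) : (ℝ × ℝ) × ℝ :=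
  ((p.2.1 - e * p.1 - k, p.2.2 + p.1 * p.2.1 - e * p.1 ^ 2 - 2 * k * p.1), σ * p.1)

/-- The inverse of `zw`. -/
def zwInv (σ e k : ℝ) (q : (ℝ × ℝ) × ℝ) : Heis :=
  (σ * q.2, q.1.1 + e * (σ * q.2) + k, q.1.2 + σ * q.2 * (k - q.1.1))

/-- The horizontal vector `v` in the coordinates `zw`. -/
def zwHoriz (σ e : ℝ) (z v : ℝ × ℝ) : (ℝ × ℝ) × ℝ := ((v.2 - e * v.1, 2 * z.1 * v.1), σ * v.1)

/-- The straightened right-invariant field along the fibre over `z`. -/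
def zwDir (σ e k : ℝ) (z : ℝ × ℝ) : Heis := (σ, e * σ, σ * (k - z.1))

section Coordinates

variable {σ e k : ℝ}

lemma contDiff_zw {n : WithTop ℕ∞} : ContDiff ℝ n (zw σ e k) := by unfold zw; fun_prop

lemma contDiff_zwInv {n : WithTop ℕ∞} : ContDiff ℝ n (zwInv σ e k) := by unfold zwInv; fun_prop

lemma zwInv_zw (hσ : σ * σ = 1) (p : Heis) : zwInv σ e k (zw σ e k p) = p := by
  have h : σ * (σ * p.1) = p.1 := by rw [← mul_assoc, hσ, one_mul]
  unfold zwInv zw; ext <;> simp only [h] <;> ring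

lemma zw_zwInv (hσ : σ * σ = 1) (q : (ℝ × ℝ) × ℝ) : zw σ e k (zwInv σ e k q) = q := by
  have h : σ * (σ * q.2) = q.2 := by rw [← mul_assoc, hσ, one_mul]
  unfold zwInv zw; ext <;> simp only [h] <;> ring

/-- The coordinates `zw` as a homeomorphism. -/
def zwHomeo (e k : ℝ) (hσ : σ * σ = 1) : Heis ≃ₜ (ℝ × ℝ) × ℝ :=
  ⟨⟨zw σ e k, zwInv σ e k, zwInv_zw hσ, zw_zwInv hσ⟩, (contDiff_zw (n := 0)).continuous,
    (contDiff_zwInv (n := 0)).continuous⟩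

/-- Up to the order of the factors this is a reflection or the identity in `x`, followed by
translations of `y` and `t` by quantities depending on the earlier coordinates. -/
lemma measurePreserving_zw (hσ : σ * σ = 1) : MeasurePreserving (zw σ e k) := by
  have h0 : MeasurePreserving (fun x : ℝ => σ * x) := by
    rcases mul_self_eq_one_iff.1 hσ with rfl | rfl
    · simp only [one_mul]; exact MeasurePreserving.id volume
    · simpa using Measure.measurePreserving_neg (volume : Measure ℝ)
  have h1 : ∀ x : ℝ, MeasurePreserving
      (fun p : ℝ × ℝ => (p.1 + (-e * x - k), p.2 + (x * p.1 - e * x ^ 2 - 2 * k * x))) := fun x =>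
    (measurePreserving_add_right volume (-e * x - k)).skew_product
      (g := fun y t : ℝ => t + (x * y - e * x ^ 2 - 2 * k * x)) (by fun_prop)
      (.of_forall fun y => (measurePreserving_add_right volume _).map_eq)
  have h2 : MeasurePreserving (fun p : ℝ × ℝ × ℝ => (σ * p.1,
      (p.2.1 + (-e * p.1 - k), p.2.2 + (p.1 * p.2.1 - e * p.1 ^ 2 - 2 * k * p.1)))) :=
    h0.skew_product
      (g := fun x (p : ℝ × ℝ) => (p.1 + (-e * x - k), p.2 + (x * p.1 - e * x ^ 2 - 2 * k * x)))
      (by fun_prop) (.of_forall fun x => (h1 x).map_eq)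
  have h3 := (Measure.measurePreserving_swap (μ := (volume : Measure ℝ))
    (ν := (volume : Measure (ℝ × ℝ)))).comp h2
  have h4 : zw σ e k = Prod.swap ∘ fun p : ℝ × ℝ × ℝ => (σ * p.1,
      (p.2.1 + (-e * p.1 - k), p.2.2 + (p.1 * p.2.1 - e * p.1 ^ 2 - 2 * k * p.1))) := by
    funext p
    simp only [zw, Function.comp, Prod.swap]
    ext <;> simp <;> ring
  rw [h4]
  exact h3

lemma measurableEmbedding_zw (hσ : σ * σ = 1) : MeasurableEmbedding (zw σ e k) :=
  (zwHomeo e k hσ).measurableEmbedding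

/-- Translations in `w` are left translations and preserve the horizontal frame, so the components
of a horizontal vector depend on `z` alone. Because of this the first variation of a graph involves
the derivative of `ψ` and not `ψ` itself. -/
lemma hasDerivAt_zw_comp {Γ : ℝ → Heis} {s : ℝ} {v : ℝ × ℝ} (h : HasDerivAt Γ (horiz (Γ s) v) s) :
    HasDerivAt (fun s => zw σ e k (Γ s)) (zwHoriz σ e (zw σ e k (Γ s)).1 v) s := by
  have h1 : HasDerivAt (fun s => (Γ s).1) v.1 s := h.fst
  have h2 : HasDerivAt (fun s => (Γ s).2.1) v.2 s := h.snd.fst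
  have h3 : HasDerivAt (fun s => (Γ s).2.2) (v.1 * (Γ s).2.1 - v.2 * (Γ s).1) s := h.snd.snd
  have d := (((h2.sub (h1.const_mul e)).sub_const k).prodMk
    (((h3.add (h1.mul h2)).sub ((h1.pow 2).const_mul e)).sub (h1.const_mul (2 * k)))).prodMk
    (h1.const_mul σ)
  convert d using 1
  · funext s
    simp only [zw]
    ext <;> simp
  · simp only [zwHoriz, zw]
    ext <;> simp <;> ring

lemma fderiv_zw_horiz (p : Heis) (v : ℝ × ℝ) :
    fderiv ℝ (zw σ e k) p (horiz p v) = zwHoriz σ e (zw σ e k p).1 v := by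
  have hl : HasDerivAt (fun s : ℝ => p + s • horiz p v) (horiz (p + (0 : ℝ) • horiz p v) v) 0 := by
    simpa using ((hasDerivAt_id (0 : ℝ)).smul_const (horiz p v)).const_add p
  have h1 := hasDerivAt_zw_comp (σ := σ) (e := e) (k := k) hl
  have h2 : HasDerivAt (fun s : ℝ => zw σ e k (p + s • horiz p v)) (fderiv ℝ (zw σ e k) p (horiz p v)) 0 := by
    have hd : HasFDerivAt (zw σ e k) (fderiv ℝ (zw σ e k) p) (p + (0 : ℝ) • horiz p v) := by
      rw [zero_smul, add_zero]
      exact ((contDiff_zw (n := 1)).differentiable (by simp) p).hasFDerivAt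
    have := hd.comp_hasDerivAt (0 : ℝ) hl
    rw [zero_smul, add_zero] at this
    exact this
  have := h2.unique h1
  simpa using this

lemma hdiv_comp_zw {a : (ℝ × ℝ) × ℝ → ℝ × ℝ} (ha : Differentiable ℝ a) (p : Heis) :
    hdiv (fun p => a (zw σ e k p)) p =
      (fderiv ℝ a (zw σ e k p) (zwHoriz σ e (zw σ e k p).1 (1, 0))).1
        + (fderiv ℝ a (zw σ e k p) (zwHoriz σ e (zw σ e k p).1 (0, 1))).2 := by
  have h : fderiv ℝ (fun p => a (zw σ e k p)) p
      = (fderiv ℝ a (zw σ e k p)).comp (fderiv ℝ (zw σ e k) p) :=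
    ((ha _).hasFDerivAt.comp p
      ((contDiff_zw (n := 1)).differentiable (by simp) p).hasFDerivAt).fderiv
  simp only [hdiv, h, X, Y, ContinuousLinearMap.comp_apply, fderiv_zw_horiz]

/-- The horizontal normal of the graph `w = ψ z`, up to a positive factor. -/
def graphNormal (σ e : ℝ) (ψ : ℝ × ℝ → ℝ) (z : ℝ × ℝ) : ℝ × ℝ :=
  (-e * lineDeriv ℝ ψ z (1, 0) + 2 * z.1 * lineDeriv ℝ ψ z (0, 1) - σ, lineDeriv ℝ ψ z (1, 0))

lemma integrable_mul_lineDeriv {ψ : ℝ × ℝ → ℝ} {C : ℝ≥0} (hψ : LipschitzWith C ψ) {f : ℝ × ℝ → ℝ}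
    (hf : Integrable f) (v : ℝ × ℝ) : Integrable fun z => f z * lineDeriv ℝ ψ z v :=
  hf.mul_bdd (c := C * ‖v‖) (measurable_lineDeriv hψ.continuous).aestronglyMeasurable
    (.of_forall fun _ => norm_lineDeriv_le_of_lipschitz ℝ hψ)

lemma integrable_comp_graph {ψ : ℝ × ℝ → ℝ} (hψ : Continuous ψ) {f : (ℝ × ℝ) × ℝ → ℝ}
    (hf : Continuous f) (hc : HasCompactSupport f) : Integrable fun z => f (z, ψ z) := by
  refine Continuous.integrable_of_hasCompactSupport (by fun_prop) ?_
  refine HasCompactSupport.intro (K := Prod.fst '' tsupport f)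
    (hc.isCompact.image continuous_fst) fun z hz => ?_
  by_contra h0
  exact hz ⟨(z, ψ z), subset_tsupport _ h0, rfl⟩

/-- Divergence theorem for horizontal fields on the epigraph of a Lipschitz function. -/
lemma setIntegral_hdiv_epi (hσ : σ * σ = 1) {ψ : ℝ × ℝ → ℝ} {C : ℝ≥0} (hψ : LipschitzWith C ψ)
    {a : (ℝ × ℝ) × ℝ → ℝ × ℝ} (ha : ContDiff ℝ 1 a) (hc : HasCompactSupport a) :
    ∫ p in zw σ e k ⁻¹' epi ψ, hdiv (fun p => a (zw σ e k p)) p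
      = ∫ z, dot (a (z, ψ z)) (graphNormal σ e ψ z) := by
  simp_rw [hdiv_comp_zw (σ := σ) (e := e) (k := k) (ha.differentiable (by simp))]
  rw [(measurePreserving_zw hσ).setIntegral_preimage_emb (measurableEmbedding_zw hσ)
    (fun q => (fderiv ℝ a q (zwHoriz σ e q.1 (1, 0))).1 + (fderiv ℝ a q (zwHoriz σ e q.1 (0, 1))).2)]
  have ha1 : ContDiff ℝ 1 fun q => (a q).1 := ha.fst
  have ha2 : ContDiff ℝ 1 fun q => (a q).2 := ha.snd
  have hc1 : HasCompactSupport fun q => (a q).1 := hc.comp_left (g := Prod.fst) rfl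
  have hc2 : HasCompactSupport fun q => (a q).2 := hc.comp_left (g := Prod.snd) rfl
  have ha3 : ContDiff ℝ 1 fun q : (ℝ × ℝ) × ℝ => 2 * q.1.1 * (a q).1 := by fun_prop
  have hc3 : HasCompactSupport fun q : (ℝ × ℝ) × ℝ => 2 * q.1.1 * (a q).1 := hc1.mul_left
  have f1 : ∀ q w, (fderiv ℝ a q w).1 = fderiv ℝ (fun q => (a q).1) q w := fun q w => by
    rw [(((ha.differentiable (by simp)) q).hasFDerivAt.fst).fderiv]; rfl
  have f2 : ∀ q w, (fderiv ℝ a q w).2 = fderiv ℝ (fun q => (a q).2) q w := fun q w => by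
    rw [(((ha.differentiable (by simp)) q).hasFDerivAt.snd).fderiv]; rfl
  have f3 : ∀ q : (ℝ × ℝ) × ℝ, fderiv ℝ (fun q : (ℝ × ℝ) × ℝ => 2 * q.1.1 * (a q).1) q ((0, 1), 0)
      = 2 * q.1.1 * fderiv ℝ (fun q => (a q).1) q ((0, 1), 0) := by
    intro q
    have h1 : HasFDerivAt (fun q : (ℝ × ℝ) × ℝ => 2 * q.1.1)
        ((2 : ℝ) • ((ContinuousLinearMap.fst ℝ ℝ ℝ).comp (ContinuousLinearMap.fst ℝ (ℝ × ℝ) ℝ))) q :=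
      ((hasFDerivAt_fst (𝕜 := ℝ) (p := q)).fst).const_mul 2
    rw [(h1.fun_mul ((ha1.differentiable (by simp)) q).hasFDerivAt).fderiv]
    simp
  -- The coefficient `2 z₁` of `∂₂` does not depend on `z₂` and can be absorbed into the
  -- differentiated function. All terms are then covered by the two one-directional divergence
  -- theorems.
  have hsplit : ∀ q : (ℝ × ℝ) × ℝ, (fderiv ℝ a q (zwHoriz σ e q.1 (1, 0))).1
      + (fderiv ℝ a q (zwHoriz σ e q.1 (0, 1))).2 =
      (-e) * fderiv ℝ (fun q => (a q).1) q ((1, 0), 0)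
        + fderiv ℝ (fun q : (ℝ × ℝ) × ℝ => 2 * q.1.1 * (a q).1) q ((0, 1), 0)
        + σ * fderiv ℝ (fun q => (a q).1) q (0, 1)
        + fderiv ℝ (fun q => (a q).2) q ((1, 0), 0) := by
    intro q
    rw [f1, f2, f3]
    have v1 : zwHoriz σ e q.1 (1, 0) = (-e) • (((1 : ℝ), (0 : ℝ)), (0 : ℝ))
        + (2 * q.1.1) • (((0 : ℝ), (1 : ℝ)), (0 : ℝ)) + σ • ((0 : ℝ × ℝ), (1 : ℝ)) := by
      ext <;> simp [zwHoriz]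
    have v2 : zwHoriz σ e q.1 (0, 1) = (((1 : ℝ), (0 : ℝ)), (0 : ℝ)) := by ext <;> simp [zwHoriz]
    rw [v1, v2]
    simp only [map_add, map_smul, smul_eq_mul]
  simp_rw [hsplit]
  have i1 := (integrable_fderiv_apply ha1 hc1 ((1, 0), 0)).const_mul (-e)
  have i2 := integrable_fderiv_apply ha3 hc3 ((0, 1), 0)
  have i3 := (integrable_fderiv_apply ha1 hc1 (0, 1)).const_mul σ
  have i4 := integrable_fderiv_apply ha2 hc2 ((1, 0), 0)
  rw [integral_add ((i1.fun_add i2).fun_add i3).integrableOn i4.integrableOn,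
    integral_add (i1.fun_add i2).integrableOn i3.integrableOn,
    integral_add i1.integrableOn i2.integrableOn, integral_const_mul, integral_const_mul,
    setIntegral_epi_fderiv_fst hψ ha1 hc1, setIntegral_epi_fderiv_fst hψ ha3 hc3,
    setIntegral_epi_fderiv_snd hψ.continuous ha1 hc1, setIntegral_epi_fderiv_fst hψ ha2 hc2]
  have g1 := integrable_comp_graph hψ.continuous ha1.continuous hc1
  have g2 := integrable_comp_graph hψ.continuous ha2.continuous hc2
  have g3 := integrable_comp_graph hψ.continuous ha3.continuous hc3
  have j1 := (integrable_mul_lineDeriv hψ g1 (1, 0)).const_mul (-e)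
  have j2 := integrable_mul_lineDeriv hψ g3 (0, 1)
  have j3 := g1.fun_neg.const_mul σ
  have j4 := integrable_mul_lineDeriv hψ g2 (1, 0)
  rw [← integral_neg, ← integral_const_mul, ← integral_const_mul, ← integral_add j1 j2,
    ← integral_add (j1.fun_add j2) j3, ← integral_add ((j1.fun_add j2).fun_add j3) j4]
  refine integral_congr_ae (.of_forall fun z => ?_)
  simp only [dot, graphNormal]
  ring

/-- The fibres are straight lines of the ambient space, so transversality to a Lipschitz graph is a
cone condition on their direction. -/
lemma zwInv_add (z : ℝ × ℝ) (w r : ℝ) :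
    zwInv σ e k (z, w + r) = zwInv σ e k (z, w) + r • zwDir σ e k z := by
  unfold zwInv zwDir; ext <;> simp <;> ring

lemma norm_zwInv_sub_le (hσ : σ * σ = 1) (z z' : ℝ × ℝ) (w : ℝ) :
    ‖zwInv σ e k (z, w) - zwInv σ e k (z', w)‖ ≤ (1 + |w|) * ‖z - z'‖ := by
  have h1 : |z.1 - z'.1| ≤ ‖z - z'‖ := norm_fst_le (z - z')
  have h2 : |z.2 - z'.2| ≤ ‖z - z'‖ := norm_snd_le (z - z')
  have hσ1 : |σ| = 1 := by
    rcases mul_self_eq_one_iff.1 hσ with rfl | rfl <;> simp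
  have e0 : zwInv σ e k (z, w) - zwInv σ e k (z', w)
      = (0, z.1 - z'.1, (z.2 - z'.2) - σ * w * (z.1 - z'.1)) := by
    unfold zwInv; ext <;> simp; ring
  have h0 := norm_nonneg (z - z')
  have hw := abs_nonneg w
  rw [e0, Prod.norm_def, Prod.norm_def]
  refine max_le ?_ (max_le ?_ ?_)
  · simp only [norm_zero]; positivity
  · simp only [Real.norm_eq_abs]; nlinarith
  · simp only [Real.norm_eq_abs]
    refine (abs_sub _ _).trans ?_
    rw [abs_mul, abs_mul, hσ1, one_mul]
    nlinarith

end Coordinates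

/-! ### Graph charts of the boundary -/

/-- A strictly monotone equation `h z w = 0` has a Lipschitz solution `w = ψ z`. -/
lemma exists_lipschitz_zero {h : ℝ × ℝ → ℝ → ℝ} {z₀ : ℝ × ℝ} {w₀ r₀ b₀ c L δ : ℝ} (hr₀ : 0 < r₀)
    (hc : 0 < c) (hL : 0 ≤ L) (hδ : 0 < δ) (hδb : δ ≤ b₀)
    (hmono : ∀ z ∈ Metric.closedBall z₀ r₀, ∀ w ∈ Icc (w₀ - b₀) (w₀ + b₀),
      ∀ w' ∈ Icc (w₀ - b₀) (w₀ + b₀), w ≤ w' → c * (w' - w) ≤ h z w' - h z w)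
    (hlip : ∀ z ∈ Metric.closedBall z₀ r₀, ∀ z' ∈ Metric.closedBall z₀ r₀,
      ∀ w ∈ Icc (w₀ - b₀) (w₀ + b₀), |h z w - h z' w| ≤ L * ‖z - z'‖)
    (hcont : ∀ z ∈ Metric.closedBall z₀ r₀, ContinuousOn (h z) (Icc (w₀ - b₀) (w₀ + b₀)))
    (h0 : h z₀ w₀ = 0) :
    ∃ r > 0, r ≤ r₀ ∧ ∃ (C : ℝ≥0) (ψ : ℝ × ℝ → ℝ), LipschitzWith C ψ ∧ ψ z₀ = w₀ ∧
      ∀ z ∈ Metric.closedBall z₀ r, |ψ z - w₀| < δ ∧ h z (ψ z) = 0 := by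
  have hz₀ : z₀ ∈ Metric.closedBall z₀ r₀ := Metric.mem_closedBall_self hr₀.le
  have hw₀ : w₀ ∈ Icc (w₀ - b₀) (w₀ + b₀) := ⟨by linarith, by linarith⟩
  -- Within this radius the dependence on `z` changes `h z w₀` by less than `c δ / 2`, which is what
  -- monotonicity gains between `w₀` and `w₀ ± δ / 2`. A zero is trapped in between.
  set r := min r₀ (c * δ / (4 * (L + 1))) with hr
  have hrr : r ≤ r₀ := min_le_left _ _
  have hrpos : 0 < r := lt_min hr₀ (by positivity)
  have hLr : L * r < c * δ / 2 := by
    have h1 : r * (4 * (L + 1)) ≤ c * δ := by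
      rw [← le_div_iff₀ (by positivity)]; exact min_le_right _ _
    nlinarith [mul_pos hc hδ]
  have hsub : Metric.closedBall z₀ r ⊆ Metric.closedBall z₀ r₀ := Metric.closedBall_subset_closedBall hrr
  have hex : ∀ z ∈ Metric.closedBall z₀ r, ∃ w ∈ Icc (w₀ - δ / 2) (w₀ + δ / 2), h z w = 0 := by
    intro z hz
    have hz' := hsub hz
    have h1 : |h z w₀| ≤ L * r := by
      have := hlip z hz' z₀ hz₀ w₀ hw₀
      rw [h0, sub_zero] at this
      exact this.trans (mul_le_mul_of_nonneg_left (by simpa [dist_eq_norm] using hz) hL)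
    have hp : w₀ + δ / 2 ∈ Icc (w₀ - b₀) (w₀ + b₀) := ⟨by linarith, by linarith⟩
    have hm : w₀ - δ / 2 ∈ Icc (w₀ - b₀) (w₀ + b₀) := ⟨by linarith, by linarith⟩
    have h2 := hmono z hz' w₀ hw₀ _ hp (by linarith)
    have h3 := hmono z hz' _ hm w₀ hw₀ (by linarith)
    have h4 := abs_le.1 h1
    have hsubI : Icc (w₀ - δ / 2) (w₀ + δ / 2) ⊆ Icc (w₀ - b₀) (w₀ + b₀) :=
      Icc_subset_Icc hm.1 hp.2
    exact intermediate_value_Icc (by linarith) ((hcont z hz').mono hsubI)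
      ⟨by nlinarith, by nlinarith⟩
  choose! ψ₀ hψ₀ hzero using hex
  have hI : ∀ z ∈ Metric.closedBall z₀ r, ψ₀ z ∈ Icc (w₀ - b₀) (w₀ + b₀) := fun z hz =>
    Icc_subset_Icc (by linarith) (by linarith) (hψ₀ z hz)
  have habs : ∀ z ∈ Metric.closedBall z₀ r₀, ∀ w ∈ Icc (w₀ - b₀) (w₀ + b₀),
      ∀ w' ∈ Icc (w₀ - b₀) (w₀ + b₀), c * |w - w'| ≤ |h z w - h z w'| := by
    intro z hz w hw w' hw'
    rcases le_total w w' with hle | hle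
    · rw [abs_sub_comm, abs_of_nonneg (sub_nonneg.2 hle), abs_sub_comm]
      exact (hmono z hz w hw w' hw' hle).trans (le_abs_self _)
    · rw [abs_of_nonneg (sub_nonneg.2 hle)]
      exact (hmono z hz w' hw' w hw hle).trans (le_abs_self _)
  have hlipψ : LipschitzOnWith (L / c).toNNReal ψ₀ (Metric.closedBall z₀ r) := by
    refine LipschitzOnWith.of_dist_le_mul fun z hz z' hz' => ?_
    rw [Real.coe_toNNReal _ (by positivity), Real.dist_eq, dist_eq_norm, div_mul_eq_mul_div,
      le_div_iff₀ hc, mul_comm]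
    refine (habs z' (hsub hz') _ (hI z hz) _ (hI z' hz')).trans ?_
    rw [hzero z' hz', ← hzero z hz, abs_sub_comm]
    exact hlip z (hsub hz) z' (hsub hz') _ (hI z hz)
  -- The solution is extended from the ball to a Lipschitz function on the plane, since the integral
  -- formulas are stated for globally Lipschitz graphs.
  obtain ⟨ψ, hψ, heq⟩ := hlipψ.extend_real
  refine ⟨r, hrpos, hrr, _, ψ, hψ, ?_, fun z hz => ?_⟩
  · have hz := Metric.mem_closedBall_self (x := z₀) hrpos.le
    rw [← heq hz]
    have := habs z₀ hz₀ _ (hI z₀ hz) w₀ hw₀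
    rw [hzero z₀ hz, h0, sub_self, abs_zero] at this
    have h5 : |ψ₀ z₀ - w₀| = 0 := le_antisymm (by nlinarith) (abs_nonneg _)
    linarith [abs_eq_zero.1 h5]
  · rw [← heq hz]
    refine ⟨?_, hzero z hz⟩
    have := hψ₀ z hz
    rw [abs_lt]; constructor <;> linarith [this.1, this.2]

/-- A frontier point of a Lipschitz epigraph lies on the graph. -/
lemma frontier_epigraph_eq {E U : Set Heis} {A : Heis ≃L[ℝ] (ℝ × ℝ) × ℝ} {ψ : ℝ × ℝ → ℝ}
    (hU : IsOpen U) (hψ : Continuous ψ)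
    (hepi : ∀ q ∈ U, (ψ (A q).1 < (A q).2 → q ∈ E) ∧ (q ∈ E → ψ (A q).1 ≤ (A q).2))
    {p : Heis} (hp : p ∈ U) (hpE : p ∈ frontier E) : ψ (A p).1 = (A p).2 := by
  have c1 : Continuous fun q => ψ (A q).1 := hψ.comp (continuous_fst.comp A.continuous)
  have c2 : Continuous fun q => (A q).2 := continuous_snd.comp A.continuous
  rcases lt_trichotomy (ψ (A p).1) (A p).2 with h | h | h
  · refine absurd ?_ hpE.2
    rw [mem_interior_iff_mem_nhds]
    filter_upwards [hU.mem_nhds hp, (isOpen_lt c1 c2).mem_nhds h] with q hq hq'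
    exact (hepi q hq).1 hq'
  · exact h
  · refine absurd hpE.1 ?_
    rw [mem_closure_iff_nhds]
    push Not
    refine ⟨U ∩ {q | (A q).2 < ψ (A q).1}, Filter.inter_mem (hU.mem_nhds hp)
      ((isOpen_lt c2 c1).mem_nhds h), ?_⟩
    rw [← not_nonempty_iff_eq_empty]
    rintro ⟨q, ⟨hq, hq'⟩, hqE⟩
    exact absurd ((hepi q hq).2 hqE) (not_le.2 hq')

/-- In the coordinates `zw σ e k`, the set `E` is the epigraph of the Lipschitz function `ψ` on a box of
radius `r` and half-height `b` around the point `q`, whose preimage is contained in `N`. -/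
structure IsGraphChart (σ e k : ℝ) (E N : Set Heis) (q : (ℝ × ℝ) × ℝ) (r b : ℝ) (C : ℝ≥0)
    (ψ : ℝ × ℝ → ℝ) : Prop where
  sq : σ * σ = 1
  r_pos : 0 < r
  b_pos : 0 < b
  lipschitz : LipschitzWith C ψ
  center : ψ q.1 = q.2
  near : ∀ z ∈ Metric.closedBall q.1 r, |ψ z - q.2| < b / 16
  subset : ∀ z ∈ Metric.closedBall q.1 r, ∀ w ∈ Icc (q.2 - b) (q.2 + b), zwInv σ e k (z, w) ∈ N
  above : ∀ z ∈ Metric.closedBall q.1 r, ∀ w ∈ Icc (q.2 - b) (q.2 + b), ψ z < w →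
    zwInv σ e k (z, w) ∈ E
  below : ∀ z ∈ Metric.closedBall q.1 r, ∀ w ∈ Icc (q.2 - b) (q.2 + b), zwInv σ e k (z, w) ∈ E →
    ψ z ≤ w

/-- By the cone condition the function `(A p).2 - ψ (A p).1` grows along the fibres at a rate
bounded below, also on nearby fibres. Its zero on each fibre is then unique in the box and depends
on `z` in a Lipschitz way. -/
lemma exists_isGraphChart {σ e k : ℝ} (hσ : σ * σ = 1) {E U N : Set Heis}
    {A : Heis ≃L[ℝ] (ℝ × ℝ) × ℝ} {C : ℝ≥0} {ψ : ℝ × ℝ → ℝ} (hU : IsOpen U)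
    (hψ : LipschitzWith C ψ)
    (hepi : ∀ q ∈ U, (ψ (A q).1 < (A q).2 → q ∈ E) ∧ (q ∈ E → ψ (A q).1 ≤ (A q).2))
    {p : Heis} (hp : p ∈ U) (hpE : p ∈ frontier E) (hN : N ∈ 𝓝 p)
    (hd : C * ‖(A (zwDir σ e k (zw σ e k p).1)).1‖ < (A (zwDir σ e k (zw σ e k p).1)).2) :
    ∃ (r b : ℝ) (C' : ℝ≥0) (ψ' : ℝ × ℝ → ℝ), IsGraphChart σ e k E N (zw σ e k p) r b C' ψ' := by
  set z₀ := (zw σ e k p).1 with hz₀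
  set w₀ := (zw σ e k p).2 with hw₀
  have hinv : zwInv σ e k (z₀, w₀) = p := zwInv_zw hσ p
  have hcdir : Continuous fun z => zwDir σ e k z := by unfold zwDir; fun_prop
  set c := ((A (zwDir σ e k z₀)).2 - C * ‖(A (zwDir σ e k z₀)).1‖) / 2 with hc
  have hcpos : 0 < c := by rw [hc]; linarith
  have hev1 : ∀ᶠ z in 𝓝 z₀, c < (A (zwDir σ e k z)).2 - C * ‖(A (zwDir σ e k z)).1‖ := by
    have hcont : Continuous fun z => (A (zwDir σ e k z)).2 - C * ‖(A (zwDir σ e k z)).1‖ := by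
      fun_prop
    refine hcont.continuousAt.eventually_const_lt ?_
    rw [hc]; linarith
  obtain ⟨r₁, hr₁, hball⟩ := Metric.nhds_basis_closedBall.eventually_iff.1 hev1
  have hev2 : ∀ᶠ q in 𝓝 (z₀, w₀), zwInv σ e k q ∈ U ∩ N := by
    have hcont : Continuous (zwInv σ e k) := (contDiff_zwInv (n := 0)).continuous
    refine hcont.continuousAt.eventually_mem ?_
    rw [hinv]
    exact Filter.inter_mem (hU.mem_nhds hp) hN
  obtain ⟨b, hb, hbox⟩ := Metric.nhds_basis_closedBall.eventually_iff.1 hev2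
  have hbox' : ∀ z ∈ Metric.closedBall z₀ b, ∀ w ∈ Icc (w₀ - b) (w₀ + b),
      zwInv σ e k (z, w) ∈ U ∩ N := by
    intro z hz w hw
    refine hbox ?_
    rw [← closedBall_prod_same]
    exact ⟨hz, by rw [Real.closedBall_eq_Icc]; exact hw⟩
  set h : ℝ × ℝ → ℝ → ℝ := fun z w =>
    (A (zwInv σ e k (z, w))).2 - ψ (A (zwInv σ e k (z, w))).1 with hh
  have hcinv : Continuous (zwInv σ e k) := (contDiff_zwInv (n := 0)).continuous
  have hψc := hψ.continuous
  have hmono : ∀ z ∈ Metric.closedBall z₀ (min r₁ b), ∀ w ∈ Icc (w₀ - b) (w₀ + b),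
      ∀ w' ∈ Icc (w₀ - b) (w₀ + b), w ≤ w' → c * (w' - w) ≤ h z w' - h z w := by
    intro z hz w _ w' _ hle
    have h1 := hball (Metric.closedBall_subset_closedBall (min_le_left _ _) hz)
    have h2 : zwInv σ e k (z, w') = zwInv σ e k (z, w) + (w' - w) • zwDir σ e k z := by
      rw [← zwInv_add]; congr; ring
    have h3 := hψ.dist_le_mul (A (zwInv σ e k (z, w'))).1 (A (zwInv σ e k (z, w))).1
    rw [Real.dist_eq, dist_eq_norm] at h3
    have h4 : (A (zwInv σ e k (z, w'))).1 - (A (zwInv σ e k (z, w))).1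
        = (w' - w) • (A (zwDir σ e k z)).1 := by
      rw [h2, map_add, map_smul]; simp
    have h5 : (A (zwInv σ e k (z, w'))).2 - (A (zwInv σ e k (z, w))).2
        = (w' - w) * (A (zwDir σ e k z)).2 := by
      rw [h2, map_add, map_smul]; simp
    rw [h4, norm_smul, Real.norm_eq_abs, abs_of_nonneg (sub_nonneg.2 hle)] at h3
    have h6 := (abs_le.1 h3).2
    have h7 : h z w' - h z w = (w' - w) * (A (zwDir σ e k z)).2
        - (ψ (A (zwInv σ e k (z, w'))).1 - ψ (A (zwInv σ e k (z, w))).1) := by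
      simp only [hh]; linarith
    rw [h7]
    nlinarith [sub_nonneg.2 hle]
  set M := ‖(A : Heis →L[ℝ] (ℝ × ℝ) × ℝ)‖ with hM
  have hM0 : 0 ≤ M := norm_nonneg _
  have hlip : ∀ z ∈ Metric.closedBall z₀ (min r₁ b), ∀ z' ∈ Metric.closedBall z₀ (min r₁ b),
      ∀ w ∈ Icc (w₀ - b) (w₀ + b),
        |h z w - h z' w| ≤ ((1 + C) * (M * (1 + (|w₀| + b)))) * ‖z - z'‖ := by
    intro z _ z' _ w hw
    have hw1 : |w| ≤ |w₀| + b := by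
      have : |w - w₀| ≤ b := abs_le.2 ⟨by linarith [hw.1], by linarith [hw.2]⟩
      have := abs_sub_abs_le_abs_sub w w₀
      linarith
    have h1 := norm_zwInv_sub_le (e := e) (k := k) hσ z z' w
    have h2 : ‖A (zwInv σ e k (z, w)) - A (zwInv σ e k (z', w))‖
        ≤ M * ((1 + (|w₀| + b)) * ‖z - z'‖) := by
      rw [← map_sub]
      refine ((A : Heis →L[ℝ] (ℝ × ℝ) × ℝ).le_opNorm _).trans (mul_le_mul_of_nonneg_left ?_ hM0)
      exact h1.trans (mul_le_mul_of_nonneg_right (by linarith) (norm_nonneg _))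
    have h3 := (norm_snd_le (A (zwInv σ e k (z, w)) - A (zwInv σ e k (z', w)))).trans h2
    have h4 := (norm_fst_le (A (zwInv σ e k (z, w)) - A (zwInv σ e k (z', w)))).trans h2
    have h5 := hψ.dist_le_mul (A (zwInv σ e k (z, w))).1 (A (zwInv σ e k (z', w))).1
    rw [Real.dist_eq, dist_eq_norm] at h5
    have h6 := h5.trans (mul_le_mul_of_nonneg_left h4 C.2)
    rw [Prod.snd_sub, Real.norm_eq_abs] at h3
    have h7 : h z w - h z' w = ((A (zwInv σ e k (z, w))).2 - (A (zwInv σ e k (z', w))).2)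
      - (ψ (A (zwInv σ e k (z, w))).1 - ψ (A (zwInv σ e k (z', w))).1) := by simp only [hh]; ring
    rw [h7]
    refine (abs_sub _ _).trans ((add_le_add h3 h6).trans (le_of_eq ?_))
    ring_nf
  have hcont : ∀ z, Continuous (h z) := by
    intro z; simp only [hh]; fun_prop
  have h0 : h z₀ w₀ = 0 := by
    simp only [hh, hinv]
    rw [frontier_epigraph_eq hU hψc hepi hp hpE, sub_self]
  -- The margin `b / 16` matches the vertical flow used later: with half-height `β = b / 2` it is a
  -- pure translation for heights and displacements up to `β / 8`.
  obtain ⟨r, hr, hrr, C', ψ', hψ', hctr, hz⟩ := exists_lipschitz_zero (δ := b / 16)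
    (lt_min hr₁ hb) hcpos (by positivity) (by positivity) (by linarith) hmono hlip
    (fun z _ => (hcont z).continuousOn) h0
  have hrb : Metric.closedBall z₀ r ⊆ Metric.closedBall z₀ b :=
    Metric.closedBall_subset_closedBall (hrr.trans (min_le_right _ _))
  have hψI : ∀ z ∈ Metric.closedBall z₀ r, ψ' z ∈ Icc (w₀ - b) (w₀ + b) := by
    intro z hz'
    have := abs_lt.1 (hz z hz').1
    constructor <;> linarith [this.1, this.2]
  refine ⟨r, b, C', ψ', hσ, hr, hb, hψ', hctr, fun z hz' => (hz z hz').1, fun z hz' w hw =>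
    (hbox' z (hrb hz') w hw).2, fun z hz' w hw hlt => ?_, fun z hz' w hw hE => ?_⟩
  · refine (hepi _ (hbox' z (hrb hz') w hw).1).1 ?_
    have := hmono z (Metric.closedBall_subset_closedBall hrr hz') _ (hψI z hz') w hw hlt.le
    rw [(hz z hz').2, sub_zero] at this
    have h2 : 0 < h z w := by nlinarith
    simp only [hh] at h2
    linarith
  · by_contra! hlt
    have := hmono z (Metric.closedBall_subset_closedBall hrr hz') w hw _ (hψI z hz') hlt.le
    rw [(hz z hz').2] at this
    have h2 : h z w < 0 := by nlinarith
    have h3 := (hepi _ (hbox' z (hrb hz') w hw).1).2 hE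
    simp only [hh] at h2
    linarith

/-- An affine function with nonzero slope has a single zero, so all but one of the small
perturbations are admissible. This puts a transversal direction into general position. -/
lemma exists_perturb {O : Set Heis} (hO : IsOpen O) {d : Heis} (hd : d ∈ O) (v : Heis) {l c : ℝ}
    (hc : c ≠ 0) : ∃ ε : ℝ, ε ≠ 0 ∧ d + ε • v ∈ O ∧ l + ε * c ≠ 0 := by
  have h1 : ∀ᶠ ε : ℝ in 𝓝[≠] 0, d + ε • v ∈ O := by
    have : ContinuousAt (fun ε : ℝ => d + ε • v) 0 := by fun_prop
    exact (this.eventually_mem (hO.mem_nhds (by simpa using hd))).filter_mono nhdsWithin_le_nhds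
  have h2 : ∀ᶠ ε : ℝ in 𝓝[≠] 0, ε ≠ -l / c := by
    by_cases h : -l / c = 0
    · rw [h]; exact eventually_mem_nhdsWithin
    · exact (eventually_ne_nhds (Ne.symm h)).filter_mono nhdsWithin_le_nhds
  obtain ⟨ε, ⟨h3, h4⟩, h5⟩ := ((h1.and h2).and eventually_mem_nhdsWithin).exists
  refine ⟨ε, h5, h3, fun h => h4 ?_⟩
  field_simp
  linarith

/-- Coordinates of type `zw` in which the fibres are transversal to a Lipschitz graph; there are two such
coordinate systems with linearly independent horizontal directions. -/
lemma exists_zw_directions (A : Heis ≃L[ℝ] (ℝ × ℝ) × ℝ) (C : ℝ≥0) (p : Heis) :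
    ∃ σ e k σ' e' k' : ℝ, e ≠ e' ∧
      (σ * σ = 1 ∧ (zw σ e k p).1.1 ≠ 0 ∧
        C * ‖(A (zwDir σ e k (zw σ e k p).1)).1‖ < (A (zwDir σ e k (zw σ e k p).1)).2) ∧
      (σ' * σ' = 1 ∧ (zw σ' e' k' p).1.1 ≠ 0 ∧
        C * ‖(A (zwDir σ' e' k' (zw σ' e' k' p).1)).1‖
          < (A (zwDir σ' e' k' (zw σ' e' k' p).1)).2) := by
  set O : Set Heis := {d | C * ‖(A d).1‖ < (A d).2} with hO
  have hOo : IsOpen O := isOpen_lt (by fun_prop) (by fun_prop)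
  -- The second nonvanishing quantity is the contact form at `p`: the direction `d` is not
  -- horizontal there. In the chart with fibre direction `d` this means that the first base
  -- coordinate of `p` is nonzero. The constant `k` solves the equation for the last component of
  -- the fibre direction.
  have key : ∀ d ∈ O, d.1 ≠ 0 → d.2.2 - p.2.1 * d.1 + p.1 * d.2.1 ≠ 0 →
      ∃ σ k : ℝ, σ * σ = 1 ∧ (zw σ (d.2.1 / d.1) k p).1.1 ≠ 0 ∧
        C * ‖(A (zwDir σ (d.2.1 / d.1) k (zw σ (d.2.1 / d.1) k p).1)).1‖
          < (A (zwDir σ (d.2.1 / d.1) k (zw σ (d.2.1 / d.1) k p).1)).2 := by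
    intro d hd h1 h2
    have hs : SignType.sign d.1 * |d.1| = d.1 := sign_mul_abs d.1
    have habs : 0 < |d.1| := abs_pos.2 h1
    have hσ : ((SignType.sign d.1 : SignType) : ℝ) = d.1 / |d.1| := by
      rw [eq_div_iff habs.ne']; exact hs
    refine ⟨d.1 / |d.1|, (d.2.2 / d.1 + p.2.1 - d.2.1 / d.1 * p.1) / 2, ?_, ?_, ?_⟩
    · field_simp; exact (sq_abs _).symm
    · simp only [zw]
      intro h3
      apply h2
      field_simp at h3
      linarith
    · have hdir : zwDir (d.1 / |d.1|) (d.2.1 / d.1) ((d.2.2 / d.1 + p.2.1 - d.2.1 / d.1 * p.1) / 2)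
          (zw (d.1 / |d.1|) (d.2.1 / d.1) ((d.2.2 / d.1 + p.2.1 - d.2.1 / d.1 * p.1) / 2) p).1
          = |d.1|⁻¹ • d := by
        simp only [zwDir, zw]
        ext
        · simp; field_simp
        · simp; field_simp
        · simp; field_simp; ring
      rw [hdir, map_smul]
      simp only [Prod.smul_fst, Prod.smul_snd, norm_smul, smul_eq_mul, norm_inv, Real.norm_eq_abs,
        abs_abs]
      have h4 : C * ‖(A d).1‖ < (A d).2 := hd
      have := mul_lt_mul_of_pos_left h4 (inv_pos.2 habs)
      linarith
  -- The axis of the cone is perturbed three times: to make `d.1` nonzero, to leave the horizontal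
  -- plane, and to obtain a second direction with another slope `d.2.1 / d.1`.
  have hd0 : A.symm ((0 : ℝ × ℝ), (1 : ℝ)) ∈ O := by simp [hO]
  set d0 := A.symm ((0 : ℝ × ℝ), (1 : ℝ))
  obtain ⟨ε₁, -, h1, h1'⟩ := exists_perturb hOo hd0 (1, 0, 0) (l := d0.1) one_ne_zero
  set d1 := d0 + ε₁ • ((1 : ℝ), (0 : ℝ), (0 : ℝ)) with hd1
  obtain ⟨ε₂, -, h2, h2'⟩ := exists_perturb hOo h1 (0, 0, 1)
    (l := d1.2.2 - p.2.1 * d1.1 + p.1 * d1.2.1) one_ne_zero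
  set d2 := d1 + ε₂ • ((0 : ℝ), (0 : ℝ), (1 : ℝ)) with hd2
  have e1 : d1.1 ≠ 0 := by simpa [hd1] using h1'
  have e2 : d2.1 = d1.1 := by simp [hd2]
  have e3 : d2.2.1 = d1.2.1 := by simp [hd2]
  have e4 : d2.2.2 = d1.2.2 + ε₂ := by simp [hd2]
  have h2'' : d2.2.2 - p.2.1 * d2.1 + p.1 * d2.2.1 ≠ 0 := by
    rw [e2, e3, e4]; intro h; apply h2'; linarith
  have hO' : IsOpen (O ∩ {d | d.2.2 - p.2.1 * d.1 + p.1 * d.2.1 ≠ 0}) :=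
    hOo.inter (isOpen_ne_fun (by fun_prop) (by fun_prop))
  obtain ⟨ε₃, h30, h3, -⟩ := exists_perturb hO' ⟨h2, h2''⟩ (0, 1, 0) (l := 0) one_ne_zero
  set d3 := d2 + ε₃ • ((0 : ℝ), (1 : ℝ), (0 : ℝ)) with hd3
  have e5 : d3.1 = d1.1 := by simp [hd3, e2]
  have e6 : d3.2.1 = d1.2.1 + ε₃ := by simp [hd3, e3]
  obtain ⟨σ, k, hk⟩ := key d2 h2 (by rwa [e2]) h2''
  obtain ⟨σ', k', hk'⟩ := key d3 h3.1 (by rwa [e5]) h3.2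
  refine ⟨σ, _, k, σ', _, k', ?_, hk, hk'⟩
  rw [e2, e3, e5, e6]
  intro h
  rw [div_left_inj' e1] at h
  exact h30 (by linarith)

/-! ### Smooth approximation of fields with values in a convex body -/

/-- A normalized average of values in a closed convex set lies in the set. -/
lemma integral_smul_mem_of_convex {K : Set (ℝ × ℝ)} (hK : Convex ℝ K) (hc : IsClosed K) {φ : ℝ × ℝ → ℝ}
    {g : ℝ × ℝ → ℝ × ℝ} (h0 : ∀ t, 0 ≤ φ t) (hφ : Integrable φ) (h1 : ∫ t, φ t = 1)
    (hg : ∀ t, g t ∈ K) (hi : Integrable fun t => φ t • g t) : ∫ t, φ t • g t ∈ K := by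
  by_contra hx
  obtain ⟨f, u, hfu, hux⟩ := geometric_hahn_banach_closed_point hK hc hx
  have h2 : f (∫ t, φ t • g t) = ∫ t, φ t * f (g t) := by
    rw [← ContinuousLinearMap.integral_comp_comm f hi]
    simp
  have h3 : ∫ t, φ t * f (g t) ≤ ∫ t, φ t * u := by
    refine integral_mono ?_ (hφ.mul_const u) fun t =>
      mul_le_mul_of_nonneg_left (hfu _ (hg t)).le (h0 t)
    have := f.integrable_comp hi
    simpa using this
  rw [integral_mul_const, h1, one_mul, ← h2] at h3
  linarith

/-- A continuous field on a ball with values in a convex body is a pointwise limit of compactly supported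
smooth fields with values in the body. -/
lemma exists_smooth_approx {K : Set (ℝ × ℝ)} (hK : Convex ℝ K) (hc : IsClosed K) (h0 : (0 : ℝ × ℝ) ∈ K)
    {z₀ : ℝ × ℝ} {r : ℝ} (hr : 0 < r) {Q : ℝ × ℝ → ℝ × ℝ} (hQ : ContinuousOn Q (Metric.ball z₀ r))
    (hQK : ∀ z, Q z ∈ K) :
    ∃ u : ℕ → ℝ × ℝ → ℝ × ℝ, (∀ j, ContDiff ℝ ∞ (u j)) ∧ (∀ j, HasCompactSupport (u j)) ∧
      (∀ j, tsupport (u j) ⊆ Metric.ball z₀ r) ∧ (∀ j z, u j z ∈ K) ∧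
      ∀ z ∈ Metric.ball z₀ r, Filter.Tendsto (fun j => u j z) Filter.atTop (𝓝 (Q z)) := by
  set δ : ℕ → ℝ := fun j => r / 4 * (1 / ((j : ℝ) + 1)) with hδ
  have hδ0 : ∀ j, 0 < δ j := fun j => by positivity
  have hδlim : Filter.Tendsto δ Filter.atTop (𝓝 0) := by
    have := (tendsto_one_div_add_atTop_nhds_zero_nat (𝕜 := ℝ)).const_mul (r / 4)
    rwa [mul_zero] at this
  let φ : ℕ → ContDiffBump (0 : ℝ × ℝ) := fun j =>
    ⟨δ j / 2, δ j, half_pos (hδ0 j), half_lt_self (hδ0 j)⟩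
  -- Truncation at radius `r - 2 δ` before mollifying at scale `δ` leaves room inside the ball. As
  -- `0 ∈ K`, the truncated field still has values in `K`, hence so do its averages.
  let g : ℕ → ℝ × ℝ → ℝ × ℝ := fun j => (Metric.closedBall z₀ (r - 2 * δ j)).indicator Q
  have hsubj : ∀ j, Metric.closedBall z₀ (r - 2 * δ j) ⊆ Metric.ball z₀ r := fun j =>
    Metric.closedBall_subset_ball (by linarith [hδ0 j])
  have hgint : ∀ j, Integrable (g j) := fun j =>
    ((hQ.mono (hsubj j)).integrableOn_compact (isCompact_closedBall _ _)).integrable_indicator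
      Metric.isClosed_closedBall.measurableSet
  have hgK : ∀ j z, g j z ∈ K := by
    intro j z
    by_cases hz : z ∈ Metric.closedBall z₀ (r - 2 * δ j)
    · simp only [g, indicator_of_mem hz]; exact hQK z
    · simp only [g, indicator_of_notMem hz]; exact h0
  set u : ℕ → ℝ × ℝ → ℝ × ℝ := fun j =>
    convolution ((φ j).normed volume) (g j) (ContinuousLinearMap.lsmul ℝ ℝ) volume with hu
  have hsm : ∀ j, ContDiff ℝ ∞ (u j) := fun j =>
    (φ j).hasCompactSupport_normed.contDiff_convolution_left _ (φ j).contDiff_normed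
      (hgint j).locallyIntegrable
  have hsupp : ∀ j, Function.support (u j) ⊆ Metric.closedBall z₀ (r - δ j) := by
    intro j z hz
    obtain ⟨a, ha, c, hc', rfl⟩ := support_convolution_subset _ hz
    rw [(φ j).support_normed_eq, mem_ball_zero_iff] at ha
    have hc2 : c ∈ Metric.closedBall z₀ (r - 2 * δ j) := by
      by_contra h
      exact hc' (indicator_of_notMem h _)
    rw [mem_closedBall_iff_norm] at hc2 ⊢
    have e1 : a + c - z₀ = a + (c - z₀) := by abel
    change ‖a + c - z₀‖ ≤ _
    rw [e1]
    have ha' : ‖a‖ < δ j := ha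
    linarith [norm_add_le a (c - z₀)]
  have hts : ∀ j, tsupport (u j) ⊆ Metric.closedBall z₀ (r - δ j) := fun j =>
    closure_minimal (hsupp j) Metric.isClosed_closedBall
  refine ⟨u, hsm, fun j => ?_, fun j => (hts j).trans
    (Metric.closedBall_subset_ball (by linarith [hδ0 j])), fun j z => ?_, fun z hz => ?_⟩
  · exact HasCompactSupport.of_support_subset_isCompact (isCompact_closedBall _ _) (hsupp j)
  · have hci : ConvolutionExistsAt ((φ j).normed volume) (g j) z (ContinuousLinearMap.lsmul ℝ ℝ) volume :=
      (φ j).hasCompactSupport_normed.convolutionExists_left _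
        ((φ j).contDiff_normed (n := 0)).continuous (hgint j).locallyIntegrable z
    exact integral_smul_mem_of_convex hK hc (g := fun t => g j (z - t))
      (fun t => (φ j).nonneg_normed t) (φ j).integrable_normed (φ j).integral_normed
      (fun t => hgK j _) hci
  · refine ContDiffBump.convolution_tendsto_right (φ := φ) (g := g) (k := fun _ => z) (x₀ := z)
      hδlim (.of_forall fun j => (hgint j).aestronglyMeasurable) ?_ tendsto_const_nhds
    have hz' : dist z z₀ < r := hz
    set m := (r - dist z z₀) / 4 with hm
    have hm0 : 0 < m := by rw [hm]; linarith
    have h1 : ∀ᶠ x : ℕ × (ℝ × ℝ) in Filter.atTop ×ˢ 𝓝 z, Q x.2 = Function.uncurry g x := by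
      have ha : ∀ᶠ j in Filter.atTop, δ j < m := hδlim.eventually (gt_mem_nhds hm0)
      filter_upwards [ha.prod_mk (Metric.ball_mem_nhds z hm0)] with x hx
      simp only [Function.uncurry, g]
      rw [indicator_of_mem]
      rw [Metric.mem_closedBall]
      have h2 : dist x.2 z < m := hx.2
      linarith [dist_triangle x.2 z z₀, hx.1]
    refine Filter.Tendsto.congr' h1 ?_
    exact (hQ.continuousAt (Metric.isOpen_ball.mem_nhds hz)).tendsto.comp Filter.tendsto_snd

/-! ### Vertical flows in a chart -/

/-- The motion of the line given by `slide`, scaled to `[w₀ - β, w₀ + β]`. -/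
def boxSlide (w₀ β s w : ℝ) : ℝ := w₀ + β * slide (s / β) ((w - w₀) / β)

section BoxSlide

variable {w₀ β : ℝ}

lemma boxSlide_zero (hβ : 0 < β) (w : ℝ) : boxSlide w₀ β 0 w = w := by
  simp only [boxSlide, zero_div, slide_zero]; field_simp; ring

lemma boxSlide_add (hβ : 0 < β) (s r w : ℝ) :
    boxSlide w₀ β (s + r) w = boxSlide w₀ β s (boxSlide w₀ β r w) := by
  simp only [boxSlide]
  rw [add_div, slide_add]
  congr 4
  field_simp
  ring

lemma boxSlide_of_le (hβ : 0 < β) {w : ℝ} (h : β ≤ |w - w₀|) (s : ℝ) : boxSlide w₀ β s w = w := by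
  simp only [boxSlide]
  rw [slide_of_le]
  · field_simp; ring
  · rw [abs_div, abs_of_pos hβ, le_div_iff₀ hβ]; linarith

lemma abs_boxSlide_sub_lt (hβ : 0 < β) {w b : ℝ} (hb : β ≤ b) (h : |w - w₀| < b) (s : ℝ) :
    |boxSlide w₀ β s w - w₀| < b := by
  rcases lt_or_ge |w - w₀| β with h1 | h1
  · have h2 : |(w - w₀) / β| < 1 := by rwa [abs_div, abs_of_pos hβ, div_lt_one hβ]
    have h3 := abs_slide_lt h2 (s / β)
    simp only [boxSlide, add_sub_cancel_left]
    rw [abs_mul, abs_of_pos hβ]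
    nlinarith
  · rwa [boxSlide_of_le hβ h1]

lemma boxSlide_eq_add (hβ : 0 < β) {s w : ℝ} (hs : |s| ≤ β / 8) (hw : |w - w₀| ≤ β / 8) :
    boxSlide w₀ β s w = w + s := by
  simp only [boxSlide]
  rw [slide_eq_add]
  · field_simp; ring
  · rw [abs_div, abs_of_pos hβ, div_le_iff₀ hβ]; linarith
  · rw [abs_div, abs_of_pos hβ, div_le_iff₀ hβ]; linarith

lemma boxSlide_strictMono (hβ : 0 < β) (s : ℝ) : StrictMono (boxSlide w₀ β s) := by
  intro x y h
  simp only [boxSlide]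
  have h1 : (x - w₀) / β < (y - w₀) / β := by gcongr
  have := slide_strictMono (s / β) h1
  nlinarith

lemma contDiff_boxSlide : ContDiff ℝ ∞ fun x : ℝ × ℝ => boxSlide w₀ β x.1 x.2 := by
  have : ContDiff ℝ ∞ fun x : ℝ × ℝ => slide (x.1 / β) ((x.2 - w₀) / β) :=
    contDiff_slide.comp (f := fun x : ℝ × ℝ => (x.1 / β, (x.2 - w₀) / β)) (by fun_prop)
  unfold boxSlide
  fun_prop

end BoxSlide

/-- A smooth one-parameter group of transformations is the flow of a smooth field. -/
lemma exists_isFlow_of_group {φ : ℝ → Heis → Heis} (hs : ContDiff ℝ ∞ fun q : ℝ × Heis => φ q.1 q.2)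
    (h0 : ∀ p, φ 0 p = p) (hadd : ∀ s r p, φ (s + r) p = φ s (φ r p)) {F : Set Heis}
    (hF : IsCompact F) (hfix : ∀ s, ∀ p ∉ F, φ s p = p) :
    ∃ W : Heis → Heis, ContDiff ℝ ∞ W ∧ HasCompactSupport W ∧ tsupport W ⊆ F ∧ IsFlow W φ := by
  set W : Heis → Heis := fun p => fderiv ℝ (fun q : ℝ × Heis => φ q.1 q.2) (0, p) (1, 0) with hW
  have hd0 : ∀ p, HasDerivAt (fun r => φ r p) (W p) 0 := by
    intro p
    have h1 : HasDerivAt (fun r : ℝ => (r, p)) ((1 : ℝ), (0 : Heis)) 0 :=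
      (hasDerivAt_id 0).prodMk (hasDerivAt_const 0 p)
    exact ((hs.differentiable (by simp) (0, p)).hasFDerivAt).comp_hasDerivAt (0 : ℝ) h1
  have hsupp : Function.support W ⊆ F := by
    intro p hp
    by_contra hpF
    apply hp
    have h1 : (fun r => φ r p) = fun _ => p := funext fun s => hfix s p hpF
    -- Where the motion is stationary for all times its initial velocity is zero, which bounds the
    -- support of the generating field.
    have h2 := hd0 p
    rw [h1] at h2
    exact h2.unique (hasDerivAt_const _ _)
  refine ⟨W, ?_, HasCompactSupport.of_support_subset_isCompact hF hsupp,
    closure_minimal hsupp hF.isClosed, hs, h0, fun s p => ?_⟩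
  · have h1 : ContDiff ℝ ∞ (fderiv ℝ fun q : ℝ × Heis => φ q.1 q.2) := hs.fderiv_right (by simp)
    have h2 : ContDiff ℝ ∞ fun p : Heis => ((0 : ℝ), p) := by fun_prop
    exact (h1.comp h2).clm_apply contDiff_const
  · have h1 : (fun r => φ r p) = fun r => φ (r - s) (φ s p) := by
      funext r; rw [← hadd, sub_add_cancel]
    rw [h1]
    have h2 : HasDerivAt (fun r => φ r (φ s p)) (W (φ s p)) (s - s) := by
      rw [sub_self]; exact hd0 _
    exact h2.comp_sub_const s s

lemma mem_image_group_iff {φ : ℝ → Heis → Heis} (h0 : ∀ p, φ 0 p = p)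
    (hadd : ∀ s r p, φ (s + r) p = φ s (φ r p)) (s : ℝ) (E : Set Heis) (p : Heis) :
    p ∈ φ s '' E ↔ φ (-s) p ∈ E := by
  constructor
  · rintro ⟨q, hq, rfl⟩
    rwa [← hadd, neg_add_cancel, h0]
  · intro h
    exact ⟨_, h, by rw [← hadd, add_neg_cancel, h0]⟩

/-- The vertical flow in the coordinates `zw` with velocity `η z` near the height `w₀`. -/
def graphFlow (σ e k w₀ β : ℝ) (η : ℝ × ℝ → ℝ) (s : ℝ) (p : Heis) : Heis :=
  zwInv σ e k ((zw σ e k p).1, boxSlide w₀ β (s * η (zw σ e k p).1) (zw σ e k p).2)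

section GraphFlow

variable {σ e k w₀ β : ℝ} {η : ℝ × ℝ → ℝ}

lemma zw_graphFlow (hσ : σ * σ = 1) (s : ℝ) (p : Heis) : zw σ e k (graphFlow σ e k w₀ β η s p)
    = ((zw σ e k p).1, boxSlide w₀ β (s * η (zw σ e k p).1) (zw σ e k p).2) := zw_zwInv hσ _

lemma graphFlow_zero (hσ : σ * σ = 1) (hβ : 0 < β) (p : Heis) : graphFlow σ e k w₀ β η 0 p = p := by
  simp only [graphFlow, zero_mul, boxSlide_zero hβ, Prod.mk.eta, zwInv_zw hσ]

lemma graphFlow_add (hσ : σ * σ = 1) (hβ : 0 < β) (s r : ℝ) (p : Heis) :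
    graphFlow σ e k w₀ β η (s + r) p = graphFlow σ e k w₀ β η s (graphFlow σ e k w₀ β η r p) := by
  conv_rhs => rw [graphFlow, zw_graphFlow hσ]
  simp only [graphFlow, add_mul, boxSlide_add hβ]

lemma contDiff_graphFlow (hη : ContDiff ℝ ∞ η) :
    ContDiff ℝ ∞ fun q : ℝ × Heis => graphFlow σ e k w₀ β η q.1 q.2 := by
  have h1 : ContDiff ℝ ∞ fun q : ℝ × Heis => zw σ e k q.2 := contDiff_zw.comp contDiff_snd
  have h2 : ContDiff ℝ ∞ fun q : ℝ × Heis => (q.1 * η (zw σ e k q.2).1, (zw σ e k q.2).2) :=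
    (contDiff_fst.mul (hη.comp h1.fst)).prodMk h1.snd
  exact contDiff_zwInv.comp (h1.fst.prodMk (contDiff_boxSlide.comp h2))

lemma exists_isFlow_graphFlow (hσ : σ * σ = 1) (hβ : 0 < β) (hη : ContDiff ℝ ∞ η)
    (hc : HasCompactSupport η) :
    ∃ W : Heis → Heis, ContDiff ℝ ∞ W ∧ HasCompactSupport W ∧
      tsupport W ⊆ zw σ e k ⁻¹' (tsupport η ×ˢ Metric.closedBall w₀ β) ∧
      IsFlow W (graphFlow σ e k w₀ β η) := by
  refine exists_isFlow_of_group (contDiff_graphFlow hη) (graphFlow_zero hσ hβ) (graphFlow_add hσ hβ)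
    ?_ ?_
  · exact (zwHomeo e k hσ).isClosedEmbedding.isCompact_preimage
      (hc.isCompact.prod (isCompact_closedBall _ _))
  · intro s p hp
    rw [mem_preimage, mem_prod, not_and_or] at hp
    simp only [graphFlow]
    rcases hp with hp | hp
    · rw [image_eq_zero_of_notMem_tsupport hp, mul_zero, boxSlide_zero hβ, Prod.mk.eta, zwInv_zw hσ]
    · rw [Metric.mem_closedBall, Real.dist_eq, not_le] at hp
      rw [boxSlide_of_le hβ hp.le, Prod.mk.eta, zwInv_zw hσ]

end GraphFlow

/-! ### Perimeter and normals in a chart -/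

lemma perimeter_toReal_le {K : Set (ℝ × ℝ)} {E V : Set Heis} {c : ℝ} (hc : 0 ≤ c)
    (h : ∀ U, IsTestField K V U → ∫ p in E, hdiv U p ≤ c) : (perimeter K E V).toReal ≤ c := by
  refine ENNReal.toReal_le_of_le_ofReal hc (iSup₂_le fun U hU => ?_)
  exact ENNReal.ofReal_le_ofReal (h U hU)

lemma le_perimeter_toReal {K : Set (ℝ × ℝ)} {E V : Set Heis} (h : perimeter K E V ≠ ⊤)
    {U : Heis → ℝ × ℝ} (hU : IsTestField K V U) : ∫ p in E, hdiv U p ≤ (perimeter K E V).toReal := by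
  rw [← ENNReal.ofReal_le_iff_le_toReal h]
  exact le_iSup₂ (f := fun U (_ : IsTestField K V U) => ENNReal.ofReal (∫ p in E, hdiv U p)) U hU

lemma volume_graph_eq_zero {ψ : ℝ × ℝ → ℝ} (hψ : Continuous ψ) :
    volume {q : (ℝ × ℝ) × ℝ | q.2 = ψ q.1} = 0 := by
  rw [← (measurePreserving_shear hψ).measure_preimage_emb (measurableEmbedding_shear hψ)]
  have : (fun q : (ℝ × ℝ) × ℝ => (q.1, q.2 + ψ q.1)) ⁻¹' {q | q.2 = ψ q.1} = univ ×ˢ {0} := by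
    ext q; simp
  rw [this, Measure.volume_eq_prod, Measure.prod_prod]
  simp

/-- The open box of radius `r` and half-height `b` around `q` in the coordinates `zw`. -/
def chartBox (σ e k : ℝ) (q : (ℝ × ℝ) × ℝ) (r b : ℝ) : Set Heis :=
  zw σ e k ⁻¹' (Metric.ball q.1 r ×ˢ Ioo (q.2 - b) (q.2 + b))

lemma isOpen_chartBox (σ e k : ℝ) (q : (ℝ × ℝ) × ℝ) (r b : ℝ) : IsOpen (chartBox σ e k q r b) :=
  (Metric.isOpen_ball.prod isOpen_Ioo).preimage (contDiff_zw (n := 0)).continuous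

section Epigraph

variable {σ e k r b : ℝ} {q : (ℝ × ℝ) × ℝ} {ψ : ℝ × ℝ → ℝ} {E' : Set Heis}

/-- Whether points of the graph itself belong to the set is left open, but the graph has measure
zero. -/
lemma inter_ae_eq_of_epigraph (hσ : σ * σ = 1) (hψ : Continuous ψ)
    (h : ∀ p ∈ chartBox σ e k q r b, (ψ (zw σ e k p).1 < (zw σ e k p).2 → p ∈ E') ∧
      (p ∈ E' → ψ (zw σ e k p).1 ≤ (zw σ e k p).2)) :
    (E' ∩ chartBox σ e k q r b : Set Heis) =ᵐ[volume]
      (zw σ e k ⁻¹' epi ψ ∩ chartBox σ e k q r b : Set Heis) := by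
  have h0 : ∀ᵐ p : Heis, p ∉ zw σ e k ⁻¹' {q | q.2 = ψ q.1} := by
    rw [← measure_eq_zero_iff_ae_notMem,
      (measurePreserving_zw hσ).measure_preimage_emb (measurableEmbedding_zw hσ)]
    exact volume_graph_eq_zero hψ
  filter_upwards [h0] with p hp
  refine propext ⟨fun hx => ⟨?_, hx.2⟩, fun hx => ⟨(h p hx.2).1 hx.1, hx.2⟩⟩
  exact lt_of_le_of_ne ((h p hx.2).2 hx.1) (fun h1 => hp h1.symm)

/-- A field supported in the box sees the set only there, where it is an epigraph up to a null set.
The divergence theorem for epigraphs then applies. -/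
lemma setIntegral_hdiv_eq (hσ : σ * σ = 1) {C : ℝ≥0} (hψ : LipschitzWith C ψ)
    (hE : (E' ∩ chartBox σ e k q r b : Set Heis) =ᵐ[volume]
      (zw σ e k ⁻¹' epi ψ ∩ chartBox σ e k q r b : Set Heis))
    {U : Heis → ℝ × ℝ} (hU : ContDiff ℝ 1 U) (hc : HasCompactSupport U)
    (hs : tsupport U ⊆ chartBox σ e k q r b) :
    ∫ p in E', hdiv U p = ∫ z, dot (U (zwInv σ e k (z, ψ z))) (graphNormal σ e ψ z) := by
  have hB := (isOpen_chartBox σ e k q r b).measurableSet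
  have h0 : (chartBox σ e k q r b).indicator (hdiv U) = hdiv U := by
    rw [indicator_eq_self]
    intro p hp
    apply hs
    by_contra h
    apply hp
    have : fderiv ℝ U p = 0 := by
      by_contra h1
      exact h (tsupport_fderiv_subset ℝ (subset_tsupport _ h1))
    simp [hdiv, this]
  have h1 : ∫ p in E', hdiv U p = ∫ p in zw σ e k ⁻¹' epi ψ, hdiv U p := by
    rw [← h0, setIntegral_indicator hB, setIntegral_indicator hB, setIntegral_congr_set hE]
  have h2 : U = fun p => (U ∘ zwInv σ e k) (zw σ e k p) := by
    funext p; simp [zwInv_zw hσ]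
  rw [h1]
  conv_lhs => rw [h2]
  rw [setIntegral_hdiv_epi hσ hψ (hU.comp contDiff_zwInv)]
  · rfl
  · exact hc.comp_homeomorph (zwHomeo e k hσ).symm

end Epigraph

namespace IsGraphChart

variable {σ e k r b : ℝ} {E N : Set Heis} {q : (ℝ × ℝ) × ℝ} {C : ℝ≥0} {ψ : ℝ × ℝ → ℝ}
  (h : IsGraphChart σ e k E N q r b C ψ)

lemma closure_chartBox_subset : closure (chartBox σ e k q r b) ⊆
    zw σ e k ⁻¹' (Metric.closedBall q.1 r ×ˢ Icc (q.2 - b) (q.2 + b)) :=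
  closure_minimal (preimage_mono (prod_mono Metric.ball_subset_closedBall Ioo_subset_Icc_self))
    ((Metric.isClosed_closedBall.prod isClosed_Icc).preimage (contDiff_zw (n := 0)).continuous)

include h

lemma mem_of_mem_closedBox {p : Heis}
    (hp : p ∈ zw σ e k ⁻¹' (Metric.closedBall q.1 r ×ˢ Icc (q.2 - b) (q.2 + b))) : p ∈ N := by
  have := h.subset _ hp.1 _ hp.2
  rwa [Prod.mk.eta, zwInv_zw h.sq] at this

lemma isRelCompactOpen {Ω : Set Heis} (hN : N ⊆ Ω) : IsRelCompactOpen (chartBox σ e k q r b) Ω := by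
  refine ⟨isOpen_chartBox _ _ _ _ _ _, ?_, fun p hp =>
    hN (h.mem_of_mem_closedBox (closure_chartBox_subset hp))⟩
  refine IsCompact.of_isClosed_subset ?_ isClosed_closure closure_chartBox_subset
  exact (zwHomeo e k h.sq).isClosedEmbedding.isCompact_preimage
    ((isCompact_closedBall _ _).prod isCompact_Icc)

lemma graph_mem_Ioo {z : ℝ × ℝ} (hz : z ∈ Metric.closedBall q.1 r) :
    ψ z ∈ Ioo (q.2 - b) (q.2 + b) := by
  have h1 := abs_lt.1 (h.near z hz)
  have := h.b_pos
  constructor <;> linarith [h1.1, h1.2]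

lemma graph_mem_chartBox {z : ℝ × ℝ} (hz : z ∈ Metric.ball q.1 r) :
    zwInv σ e k (z, ψ z) ∈ chartBox σ e k q r b := by
  rw [chartBox, mem_preimage, zw_zwInv h.sq]
  exact ⟨hz, h.graph_mem_Ioo (Metric.ball_subset_closedBall hz)⟩

lemma graph_mem {z : ℝ × ℝ} (hz : z ∈ Metric.closedBall q.1 r) : zwInv σ e k (z, ψ z) ∈ N :=
  h.subset z hz _ (Ioo_subset_Icc_self (h.graph_mem_Ioo hz))

lemma epigraph {p : Heis} (hp : p ∈ chartBox σ e k q r b) :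
    (ψ (zw σ e k p).1 < (zw σ e k p).2 → p ∈ E) ∧ (p ∈ E → ψ (zw σ e k p).1 ≤ (zw σ e k p).2) := by
  have h1 := h.above _ (Metric.ball_subset_closedBall hp.1) _ (Ioo_subset_Icc_self hp.2)
  have h2 := h.below _ (Metric.ball_subset_closedBall hp.1) _ (Ioo_subset_Icc_self hp.2)
  rw [Prod.mk.eta, zwInv_zw h.sq] at h1 h2
  exact ⟨h1, h2⟩

lemma graph_mem_frontier {z : ℝ × ℝ} (hz : z ∈ Metric.closedBall q.1 r) :
    zwInv σ e k (z, ψ z) ∈ frontier E := by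
  have hI := h.graph_mem_Ioo hz
  have hcont : Continuous fun w : ℝ => zwInv σ e k (z, w) :=
    (contDiff_zwInv (n := 0)).continuous.comp (by fun_prop)
  constructor
  · refine mem_closure_of_tendsto (b := 𝓝[>] (ψ z)) (hcont.continuousAt.mono_left nhdsWithin_le_nhds) ?_
    filter_upwards [Ioo_mem_nhdsGT hI.2] with w hw
    exact h.above z hz w ⟨by linarith [hI.1, hw.1], hw.2.le⟩ hw.1
  · intro hint
    have h1 : ∀ᶠ w in 𝓝[<] (ψ z), zwInv σ e k (z, w) ∈ interior E :=
      (hcont.continuousAt.mono_left nhdsWithin_le_nhds).eventually_mem (isOpen_interior.mem_nhds hint)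
    obtain ⟨w, hw, hw'⟩ := (h1.and (Ioo_mem_nhdsLT hI.1)).exists
    have := h.below z hz w ⟨hw'.1.le, by linarith [hI.2, hw'.2]⟩ (interior_subset hw)
    linarith [hw'.2]

lemma mem_frontier_iff {p : Heis} (hp : p ∈ chartBox σ e k q r b) :
    p ∈ frontier E ↔ ψ (zw σ e k p).1 = (zw σ e k p).2 := by
  constructor
  · intro hpE
    have hcz := (contDiff_zw (σ := σ) (e := e) (k := k) (n := 0)).continuous
    have hψc := h.lipschitz.continuous
    have hBo := isOpen_chartBox σ e k q r b
    rcases lt_trichotomy (ψ (zw σ e k p).1) (zw σ e k p).2 with hlt | heq | hlt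
    · refine absurd ?_ hpE.2
      rw [mem_interior_iff_mem_nhds]
      filter_upwards [hBo.mem_nhds hp, (isOpen_lt (hψc.comp (continuous_fst.comp hcz))
        (continuous_snd.comp hcz)).mem_nhds hlt] with x hx hx'
      exact (h.epigraph hx).1 hx'
    · exact heq
    · refine absurd hpE.1 ?_
      rw [mem_closure_iff_nhds]
      push Not
      refine ⟨_, Filter.inter_mem (hBo.mem_nhds hp) ((isOpen_lt (continuous_snd.comp hcz)
        (hψc.comp (continuous_fst.comp hcz))).mem_nhds hlt), ?_⟩
      rw [← not_nonempty_iff_eq_empty]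
      rintro ⟨x, ⟨hx, hx'⟩, hxE⟩
      exact absurd ((h.epigraph hx).2 hxE) (not_le.2 hx')
  · intro heq
    have := h.graph_mem_frontier (Metric.ball_subset_closedBall hp.1)
    rwa [heq, Prod.mk.eta, zwInv_zw h.sq] at this

lemma inter_ae_eq : (E ∩ chartBox σ e k q r b : Set Heis) =ᵐ[volume]
    (zw σ e k ⁻¹' epi ψ ∩ chartBox σ e k q r b : Set Heis) :=
  inter_ae_eq_of_epigraph h.sq h.lipschitz.continuous fun _ hp => h.epigraph hp

/-- The flow is increasing on each fibre and translates by `s * η z` at the height of the graph, so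
it carries points above `ψ` to points above `ψ + s η`. The margins of a chart keep the graph in the
range where the motion is a translation. -/
lemma image_graphFlow_inter_ae_eq {η : ℝ × ℝ → ℝ} (hη : Continuous η) {s : ℝ}
    (hs : ∀ z, |s * η z| ≤ b / 16) :
    (graphFlow σ e k q.2 (b / 2) η s '' E ∩ chartBox σ e k q r b : Set Heis) =ᵐ[volume]
      (zw σ e k ⁻¹' epi (fun z => ψ z + s * η z) ∩ chartBox σ e k q r b : Set Heis) := by
  have hβ : 0 < b / 2 := half_pos h.b_pos
  have hbb : b / 2 ≤ b := by linarith
  refine inter_ae_eq_of_epigraph h.sq (by have := h.lipschitz.continuous; fun_prop) fun p hp => ?_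
  rw [mem_image_group_iff (graphFlow_zero h.sq hβ) (graphFlow_add h.sq hβ)]
  set z := (zw σ e k p).1 with hz
  set w := (zw σ e k p).2 with hw
  have hwb : |w - q.2| < b := by
    have : w ∈ Ioo (q.2 - b) (q.2 + b) := hp.2
    exact abs_lt.2 ⟨by linarith [this.1], by linarith [this.2]⟩
  have hzz : z ∈ Metric.closedBall q.1 r := Metric.ball_subset_closedBall hp.1
  set w' := boxSlide q.2 (b / 2) (-s * η z) w with hw'
  have hwb' : |w' - q.2| < b := abs_boxSlide_sub_lt hβ hbb hwb _
  have hI : w' ∈ Icc (q.2 - b) (q.2 + b) := by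
    have := abs_lt.1 hwb'
    exact ⟨by linarith, by linarith⟩
  have e1 : graphFlow σ e k q.2 (b / 2) η (-s) p = zwInv σ e k (z, w') := rfl
  have e2 : boxSlide q.2 (b / 2) (s * η z) w' = w := by
    rw [hw', ← boxSlide_add hβ]
    have : s * η z + -s * η z = 0 := by ring
    rw [this, boxSlide_zero hβ]
  have e3 : boxSlide q.2 (b / 2) (s * η z) (ψ z) = ψ z + s * η z :=
    boxSlide_eq_add hβ (by linarith [hs z]) (by linarith [h.near z hzz])
  have hm := boxSlide_strictMono hβ (s * η z) (w₀ := q.2)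
  rw [e1]
  constructor
  · intro hlt
    refine h.above z hzz w' hI (hm.lt_iff_lt.1 ?_)
    rwa [e2, e3]
  · intro hE
    have := hm.monotone (h.below z hzz w' hI hE)
    rwa [e2, e3] at this

/-- The horizontal normal of the graph is dual to the support point in the direction of the horizontal
gradient. -/
lemma ae_dot_graphNormal_le {K : Set (ℝ × ℝ)} {π : ℝ × ℝ → ℝ × ℝ} (hπ : ∀ n, IsSupportPoint K n (π n))
    {U : Set Heis} {g : Heis → ℝ} {G : Heis → ℝ × ℝ} (hg : IsHDefiningFunction (frontier E) U g G)
    (hgE : ∀ p ∈ U, p ∈ E → g p ≤ 0) (hNU : N ⊆ U) :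
    ∀ᵐ z : ℝ × ℝ, z ∈ Metric.ball q.1 r → ∀ x ∈ K, dot x (graphNormal σ e ψ z) ≤
      dot (π (G (zwInv σ e k (z, ψ z)))) (graphNormal σ e ψ z) := by
  filter_upwards [h.lipschitz.ae_differentiableAt (μ := volume)] with z hd hz x hx
  set n := graphNormal σ e ψ z with hn
  set p := zwInv σ e k (z, ψ z) with hp
  have hpU : p ∈ U := hNU (h.graph_mem (Metric.ball_subset_closedBall hz))
  -- The chart may be degenerate at a characteristic direction of the graph, where both sides
  -- vanish.
  by_cases hn0 : n = 0
  · rw [hn0]; simp [dot]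
  have hzp : zw σ e k p = (z, ψ z) := zw_zwInv h.sq _
  have hgp : g p = 0 := by
    have : p ∈ frontier E ∩ U := ⟨h.graph_mem_frontier (Metric.ball_subset_closedBall hz), hpU⟩
    rw [hg.2.2.2] at this
    exact this.2
  -- At a point of differentiability of `ψ`, a horizontal direction with `dot n v < 0` enters the
  -- epigraph to first order. There `g ≤ 0`, so the horizontal derivative of `g` is nonpositive.
  -- Hence `G p` is a nonnegative multiple of `n`, and nonzero by assumption on `g`.
  have key : ∀ v, dot n v < 0 → dot (G p) v ≤ 0 := by
    intro v hv
    have hl : HasDerivAt (fun s : ℝ => p + s • horiz p v) (horiz (p + (0 : ℝ) • horiz p v) v) 0 := by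
      simpa using ((hasDerivAt_id (0 : ℝ)).smul_const (horiz p v)).const_add p
    have h1 := hasDerivAt_zw_comp (σ := σ) (e := e) (k := k) hl
    rw [zero_smul, add_zero, hzp] at h1
    have h2 : HasDerivAt (fun s : ℝ => (zw σ e k (p + s • horiz p v)).1) (zwHoriz σ e z v).1 0 := h1.fst
    have h3 : HasDerivAt (fun s : ℝ => (zw σ e k (p + s • horiz p v)).2) (zwHoriz σ e z v).2 0 := h1.snd
    have hd' : HasFDerivAt ψ (fderiv ℝ ψ z) (zw σ e k (p + (0 : ℝ) • horiz p v)).1 := by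
      rw [zero_smul, add_zero, hzp]; exact hd.hasFDerivAt
    have h4 := h3.fun_sub (hd'.comp_hasDerivAt (0 : ℝ) h2)
    have h5 : (zwHoriz σ e z v).2 - fderiv ℝ ψ z (zwHoriz σ e z v).1 = -dot n v := by
      have e1 : (zwHoriz σ e z v).1 = (v.2 - e * v.1) • ((1 : ℝ), (0 : ℝ))
          + (2 * z.1 * v.1) • ((0 : ℝ), (1 : ℝ)) := by ext <;> simp [zwHoriz]
      rw [e1, map_add, map_smul, map_smul, hn]
      simp only [dot, graphNormal, hd.lineDeriv_eq_fderiv, zwHoriz, smul_eq_mul]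
      ring
    rw [h5] at h4
    have hpos : 0 < -dot n v := neg_pos.2 hv
    have hslope := (hasDerivAt_iff_tendsto_slope.1 h4).mono_left
      (nhdsWithin_mono (0 : ℝ) (fun x (hx : x ∈ Ioi (0 : ℝ)) => ne_of_gt hx))
    have hev := hslope.eventually (lt_mem_nhds hpos)
    have hbox : ∀ᶠ s : ℝ in 𝓝[>] 0, p + s • horiz p v ∈ chartBox σ e k q r b := by
      have hc : ContinuousAt (fun s : ℝ => p + s • horiz p v) 0 := hl.continuousAt
      refine (hc.eventually_mem ?_).filter_mono nhdsWithin_le_nhds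
      rw [zero_smul, add_zero]
      exact (isOpen_chartBox _ _ _ _ _ _).mem_nhds (h.graph_mem_chartBox hz)
    have hle : ∀ᶠ s : ℝ in 𝓝[>] 0, g (p + s • horiz p v) ≤ 0 := by
      filter_upwards [hev, hbox, self_mem_nhdsWithin] with s hs hs' hs0
      have hs0' : (0 : ℝ) < s := hs0
      rw [slope_def_field] at hs
      have h6 := (lt_div_iff₀ (by linarith)).1 hs
      simp only [Function.comp, zero_smul, add_zero, hzp, zero_mul, sub_self, sub_zero] at h6
      refine hgE _ (hNU (h.mem_of_mem_closedBox (closure_chartBox_subset (subset_closure hs'))))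
        ((h.epigraph hs').1 (by linarith))
    have hG := hg.2.1.hasDerivAt_hflow hg.1 hpU v
    have hslope2 := (hasDerivAt_iff_tendsto_slope.1 hG).mono_left
      (nhdsWithin_mono (0 : ℝ) (fun x (hx : x ∈ Ioi (0 : ℝ)) => ne_of_gt hx))
    refine le_of_tendsto hslope2 ?_
    filter_upwards [hle, self_mem_nhdsWithin] with s hs hs0
    have hs0' : (0 : ℝ) < s := hs0
    rw [slope_def_field, zero_smul, add_zero, hgp, sub_zero, sub_zero]
    exact div_nonpos_of_nonpos_of_nonneg hs hs0'.le
  obtain ⟨μ, hμ, hGn⟩ := exists_eq_smul_of_halfplane hn0 key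
  have hμ0 : 0 < μ := lt_of_le_of_ne hμ fun h0 => hg.2.2.1 p hpU (by rw [hGn, ← h0, zero_smul])
  have h7 := (hπ (G p)).2 x hx
  have h8 : ∀ y, dot (G p) y = μ * dot y n := by
    intro y; rw [hGn]; simp only [dot, Prod.smul_fst, Prod.smul_snd, smul_eq_mul]; ring
  rw [h8, h8] at h7
  exact le_of_mul_le_mul_left h7 hμ0

end IsGraphChart

/-! ### First variation and the weak equation -/

/-- Derivative of the integral over a moving epigraph inside a box. -/
lemma hasDerivAt_setIntegral_epi {z₀ : ℝ × ℝ} {w₀ r b c : ℝ} {ψ η : ℝ × ℝ → ℝ} (hψ : Continuous ψ)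
    (hη : Continuous η) (hc : 0 < c) (hηc : ∀ s : ℝ, |s| < c → ∀ z, |s * η z| ≤ b / 16)
    (hnear : ∀ z ∈ Metric.closedBall z₀ r, |ψ z - w₀| < b / 16) {g : (ℝ × ℝ) × ℝ → ℝ}
    (hg : ContinuousOn g (Metric.closedBall z₀ r ×ˢ Icc (w₀ - b) (w₀ + b))) :
    HasDerivAt (fun s => ∫ q in epi (fun z => ψ z + s * η z) ∩
        (Metric.ball z₀ r ×ˢ Ioo (w₀ - b) (w₀ + b)), g q)
      (-∫ z in Metric.ball z₀ r, g (z, ψ z) * η z) 0 := by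
  set box := Metric.closedBall z₀ r ×ˢ Icc (w₀ - b) (w₀ + b) with hbox
  have hboxc : IsCompact box := (isCompact_closedBall _ _).prod isCompact_Icc
  -- By Tietze's theorem `g` may be replaced by a function continuous everywhere, for which the
  -- integrals over fibres depend continuously on their end points.
  obtain ⟨G, hG⟩ := ContinuousMap.exists_restrict_eq hboxc.isClosed ⟨_, hg.domRestrict⟩
  have hGg : ∀ q ∈ box, G q = g q := fun q hq => DFunLike.congr_fun hG ⟨q, hq⟩
  have hsub : Metric.ball z₀ r ×ˢ Ioo (w₀ - b) (w₀ + b) ⊆ box :=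
    prod_mono Metric.ball_subset_closedBall Ioo_subset_Icc_self
  have hopen : IsOpen (Metric.ball z₀ r ×ˢ Ioo (w₀ - b) (w₀ + b)) :=
    Metric.isOpen_ball.prod isOpen_Ioo
  have hin : ∀ s : ℝ, |s| < c → ∀ z ∈ Metric.ball z₀ r, ψ z + s * η z ∈ Ioo (w₀ - b) (w₀ + b) := by
    intro s hs z hz
    have h1 := abs_lt.1 (hnear z (Metric.ball_subset_closedBall hz))
    have h2 := abs_le.1 (hηc s hs z)
    constructor <;> linarith [h1.1, h1.2, h2.1, h2.2]
  have hGi : IntegrableOn G (Metric.ball z₀ r ×ˢ Ioo (w₀ - b) (w₀ + b)) :=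
    (G.continuous.continuousOn.integrableOn_compact hboxc).mono_set hsub
  have hslice : ∀ s : ℝ, |s| < c → ∫ q in epi (fun z => ψ z + s * η z) ∩
      (Metric.ball z₀ r ×ˢ Ioo (w₀ - b) (w₀ + b)), g q
      = ∫ z in Metric.ball z₀ r, ∫ w in (ψ z + s * η z)..(w₀ + b), G (z, w) := by
    intro s hs
    have ho : IsOpen (epi fun z => ψ z + s * η z) := isOpen_epi (by fun_prop)
    rw [setIntegral_congr_fun (g := G) (ho.inter hopen).measurableSet
      (fun q hq => (hGg q (hsub hq.2)).symm), inter_comm, ← setIntegral_indicator ho.measurableSet,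
      Measure.volume_eq_prod, setIntegral_prod]
    · refine setIntegral_congr_fun Metric.isOpen_ball.measurableSet fun z hz => ?_
      have h1 := hin s hs z hz
      have h2 : (fun w => (epi fun z => ψ z + s * η z).indicator G (z, w))
          = (Ioi (ψ z + s * η z)).indicator fun w => G (z, w) := by
        funext w
        simp only [indicator, epi, mem_ofPred_eq, mem_Ioi]
        congr
      simp only [h2]
      have h3 : Ioo (w₀ - b) (w₀ + b) ∩ Ioi (ψ z + s * η z) = Ioo (ψ z + s * η z) (w₀ + b) := by
        ext w
        simp only [mem_inter_iff, mem_Ioo, mem_Ioi]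
        constructor
        · rintro ⟨⟨_, h⟩, h'⟩; exact ⟨h', h⟩
        · rintro ⟨h, h'⟩; exact ⟨⟨h1.1.trans h, h'⟩, h⟩
      rw [setIntegral_indicator measurableSet_Ioi, intervalIntegral.integral_of_le h1.2.le, h3,
        integral_Ioc_eq_integral_Ioo]
    · exact hGi.indicator ho.measurableSet
  obtain ⟨M, hM⟩ := hboxc.exists_bound_of_continuousOn G.continuous.continuousOn
  -- A bound for `η` itself is read off from the bound on `s * η` at `s = c / 2`.
  have hηb : ∃ M', ∀ z, |η z| ≤ M' := by
    refine ⟨b / 16 / (c / 2), fun z => ?_⟩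
    rw [le_div_iff₀ (by positivity)]
    have := hηc (c / 2) (by rw [abs_of_pos (by positivity)]; linarith) z
    rw [abs_mul, abs_of_pos (by positivity : 0 < c / 2)] at this
    linarith
  obtain ⟨M', hM'⟩ := hηb
  have hc2 : Continuous fun x : (ℝ × ℝ) × ℝ => G (x.1, x.2) := by fun_prop
  have hFc : ∀ s : ℝ, Continuous fun z => ∫ w in (ψ z + s * η z)..(w₀ + b), G (z, w) := by
    intro s
    have h1 := intervalIntegral.continuous_parametric_intervalIntegral_of_continuous (a₀ := w₀ + b)
      (μ := volume) (f := fun z w => G (z, w)) hc2 (s := fun z => ψ z + s * η z) (by fun_prop)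
    simp_rw [fun z => intervalIntegral.integral_symm (μ := volume) (f := fun w => G (z, w)) (w₀ + b) (ψ z + s * η z)]
    exact h1.neg
  have hfin : IsFiniteMeasure (volume.restrict (Metric.ball z₀ r)) :=
    ⟨by rw [Measure.restrict_apply_univ]; exact measure_ball_lt_top⟩
  have hiof : ∀ F : ℝ × ℝ → ℝ, Continuous F → IntegrableOn F (Metric.ball z₀ r) := fun F hF =>
    (hF.continuousOn.integrableOn_compact (isCompact_closedBall z₀ r)).mono_set
      Metric.ball_subset_closedBall
  have key := hasDerivAt_integral_of_dominated_loc_of_deriv_le (μ := volume.restrict (Metric.ball z₀ r))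
    (𝕜 := ℝ) (x₀ := 0) (s := Ioo (-c) c)
    (F := fun s z => ∫ w in (ψ z + s * η z)..(w₀ + b), G (z, w))
    (F' := fun s z => -G (z, ψ z + s * η z) * η z) (bound := fun _ => M * M')
    (Ioo_mem_nhds (by linarith) hc)
    (.of_forall fun s => (hFc s).aestronglyMeasurable) (hiof _ (hFc 0))
    (Continuous.aestronglyMeasurable (by fun_prop)) ?_ (integrable_const _) ?_
  · have h1 := key.2
    have h2 : (fun s => ∫ q in epi (fun z => ψ z + s * η z) ∩
        (Metric.ball z₀ r ×ˢ Ioo (w₀ - b) (w₀ + b)), g q) =ᶠ[𝓝 0]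
        fun s => ∫ z in Metric.ball z₀ r, ∫ w in (ψ z + s * η z)..(w₀ + b), G (z, w) := by
      filter_upwards [Ioo_mem_nhds (show -c < 0 by linarith) hc] with s hs
      exact hslice s (abs_lt.2 hs)
    refine (h1.congr_of_eventuallyEq h2).congr_deriv ?_
    rw [← integral_neg]
    refine setIntegral_congr_fun Metric.isOpen_ball.measurableSet fun z hz => ?_
    have h3 := hin 0 (by simpa using hc) z hz
    simp only [zero_mul, add_zero] at h3 ⊢
    rw [hGg (z, ψ z) ⟨Metric.ball_subset_closedBall hz, Ioo_subset_Icc_self h3⟩]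
    ring
  · filter_upwards [ae_restrict_mem Metric.isOpen_ball.measurableSet] with z hz s hs
    have h3 := hin s (abs_lt.2 hs) z hz
    have h4 := hM (z, ψ z + s * η z) ⟨Metric.ball_subset_closedBall hz, Ioo_subset_Icc_self h3⟩
    rw [norm_mul, norm_neg]
    exact mul_le_mul h4 (hM' z) (norm_nonneg _) ((norm_nonneg _).trans h4)
  · refine .of_forall fun z s _ => ?_
    have hcz : Continuous fun w => G (z, w) := by fun_prop
    have h5 := intervalIntegral.integral_hasDerivAt_left (a := ψ z + s * η z) (b := w₀ + b)
      (hcz.intervalIntegrable _ _) (hcz.stronglyMeasurableAtFilter _ _) hcz.continuousAt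
    have h6 : HasDerivAt (fun s : ℝ => ψ z + s * η z) (η z) s := by
      simpa using ((hasDerivAt_id s).mul_const (η z)).const_add (ψ z)
    exact h5.comp s h6

/-- The variation of the normal `graphNormal σ e ψ` in the direction `η`. -/
def normalVariation (e : ℝ) (η : ℝ × ℝ → ℝ) (z : ℝ × ℝ) : ℝ × ℝ :=
  (-e * fderiv ℝ η z (1, 0) + 2 * z.1 * fderiv ℝ η z (0, 1), fderiv ℝ η z (1, 0))

/-- Left invariance of the frame makes the normal affine in the variation. Paired with a fixed
field, the flux through the moved graph is exactly linear in `s`. -/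
lemma graphNormal_add {σ e : ℝ} {ψ η : ℝ × ℝ → ℝ} {z : ℝ × ℝ} (hψ : DifferentiableAt ℝ ψ z)
    (hη : DifferentiableAt ℝ η z) (s : ℝ) : graphNormal σ e (fun z => ψ z + s * η z) z
      = graphNormal σ e ψ z + s • normalVariation e η z := by
  have h1 := (hψ.hasFDerivAt.fun_add (hη.hasFDerivAt.const_mul s))
  simp only [graphNormal, normalVariation, hψ.lineDeriv_eq_fderiv,
    h1.differentiableAt.lineDeriv_eq_fderiv, h1.fderiv]
  ext <;> simp
  ring

lemma measurable_graphNormal {σ e : ℝ} {ψ : ℝ × ℝ → ℝ} (hψ : Continuous ψ) :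
    Measurable (graphNormal σ e ψ) := by
  have h1 := measurable_lineDeriv (𝕜 := ℝ) (v := ((1 : ℝ), (0 : ℝ))) hψ
  have h2 := measurable_lineDeriv (𝕜 := ℝ) (v := ((0 : ℝ), (1 : ℝ))) hψ
  unfold graphNormal
  fun_prop

lemma exists_norm_graphNormal_le {σ e : ℝ} {ψ : ℝ × ℝ → ℝ} {C : ℝ≥0} (hψ : LipschitzWith C ψ)
    (z₀ : ℝ × ℝ) (r : ℝ) : ∃ M, 0 ≤ M ∧ ∀ z ∈ Metric.ball z₀ r, ‖graphNormal σ e ψ z‖ ≤ M := by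
  refine ⟨|e| * C + 2 * (|z₀.1| + |r|) * C + |σ| + C, by positivity, fun z hz => ?_⟩
  have h1 : |lineDeriv ℝ ψ z (1, 0)| ≤ C := by
    have := norm_lineDeriv_le_of_lipschitz ℝ hψ (x₀ := z) (v := ((1 : ℝ), (0 : ℝ)))
    simpa using this
  have h2 : |lineDeriv ℝ ψ z (0, 1)| ≤ C := by
    have := norm_lineDeriv_le_of_lipschitz ℝ hψ (x₀ := z) (v := ((0 : ℝ), (1 : ℝ)))
    simpa using this
  have h3 : |z.1| ≤ |z₀.1| + |r| := by
    have h4 : |z.1 - z₀.1| ≤ ‖z - z₀‖ := norm_fst_le (z - z₀)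
    have h5 : ‖z - z₀‖ < r := by rwa [← dist_eq_norm]
    have h6 := abs_sub_abs_le_abs_sub z.1 z₀.1
    linarith [le_abs_self r]
  have hC : (0 : ℝ) ≤ C := C.2
  rw [graphNormal, Prod.norm_def]
  refine max_le ?_ ?_
  · simp only [Real.norm_eq_abs]
    have a1 : |(-e) * lineDeriv ℝ ψ z (1, 0)| ≤ |e| * C := by
      rw [abs_mul, abs_neg]; gcongr
    have a2 : |2 * z.1 * lineDeriv ℝ ψ z (0, 1)| ≤ 2 * (|z₀.1| + |r|) * C := by
      rw [abs_mul, abs_mul, abs_two]; gcongr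
    have a3 := abs_sub (-e * lineDeriv ℝ ψ z (1, 0) + 2 * z.1 * lineDeriv ℝ ψ z (0, 1)) σ
    have a4 := abs_add_le (-e * lineDeriv ℝ ψ z (1, 0)) (2 * z.1 * lineDeriv ℝ ψ z (0, 1))
    linarith
  · simp only [Real.norm_eq_abs]
    have : 0 ≤ |e| * C + 2 * (|z₀.1| + |r|) * C + |σ| := by positivity
    linarith

lemma abs_dot_le (a b : ℝ × ℝ) : |dot a b| ≤ 2 * (‖a‖ * ‖b‖) := by
  have h1 : |a.1| ≤ ‖a‖ := norm_fst_le a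
  have h2 : |a.2| ≤ ‖a‖ := norm_snd_le a
  have h3 : |b.1| ≤ ‖b‖ := norm_fst_le b
  have h4 : |b.2| ≤ ‖b‖ := norm_snd_le b
  refine (abs_add_le _ _).trans ?_
  rw [abs_mul, abs_mul]
  have := mul_le_mul h1 h3 (abs_nonneg _) (norm_nonneg _)
  have := mul_le_mul h2 h4 (abs_nonneg _) (norm_nonneg _)
  linarith

lemma integrableOn_dot {z₀ : ℝ × ℝ} {r R M : ℝ} {u n : ℝ × ℝ → ℝ × ℝ}
    (hu : AEStronglyMeasurable u (volume.restrict (Metric.ball z₀ r))) (hn : Measurable n)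
    (hR : ∀ z, ‖u z‖ ≤ R) (hM : ∀ z ∈ Metric.ball z₀ r, ‖n z‖ ≤ M) :
    IntegrableOn (fun z => dot (u z) (n z)) (Metric.ball z₀ r) := by
  have hfin : IsFiniteMeasure (volume.restrict (Metric.ball z₀ r)) :=
    ⟨by rw [Measure.restrict_apply_univ]; exact measure_ball_lt_top⟩
  refine Integrable.of_bound (C := 2 * (R * M)) ?_ ?_
  · exact continuous_dot.comp_aestronglyMeasurable (hu.prodMk hn.aestronglyMeasurable)
  · filter_upwards [ae_restrict_mem Metric.isOpen_ball.measurableSet] with z hz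
    refine (abs_dot_le _ _).trans ?_
    have := mul_le_mul (hR z) (hM z hz) (norm_nonneg _) ((norm_nonneg _).trans (hR z))
    linarith

lemma normalVariation_eq_zero {e : ℝ} {η : ℝ × ℝ → ℝ} {z : ℝ × ℝ} (h : z ∉ tsupport η) :
    normalVariation e η z = 0 := by
  have : fderiv ℝ η z = 0 := by
    by_contra h1
    exact h (tsupport_fderiv_subset ℝ (subset_tsupport _ h1))
  simp [normalVariation, this]

lemma continuous_normalVariation {e : ℝ} {η : ℝ × ℝ → ℝ} (hη : ContDiff ℝ 1 η) :
    Continuous (normalVariation e η) := by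
  have h1 : Continuous fun z => fderiv ℝ η z (1, 0) :=
    (hη.continuous_fderiv (by simp)).clm_apply continuous_const
  have h2 : Continuous fun z => fderiv ℝ η z (0, 1) :=
    (hη.continuous_fderiv (by simp)).clm_apply continuous_const
  unfold normalVariation
  fun_prop

/-- A horizontal test field that is constant along the fibres near the graph. -/
def fibreField (σ e k : ℝ) {w₀ : ℝ} (χ : ContDiffBump w₀) (u : ℝ × ℝ → ℝ × ℝ) (p : Heis) : ℝ × ℝ :=
  χ (zw σ e k p).2 • u (zw σ e k p).1

section WeakEquation

variable {K : Set (ℝ × ℝ)} {σ e k r b : ℝ} {E N : Set Heis} {q : (ℝ × ℝ) × ℝ} {C : ℝ≥0}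
  {ψ : ℝ × ℝ → ℝ}

lemma isTestField_fibreField (hK : IsC2PlusBody K) (hσ : σ * σ = 1) {u : ℝ × ℝ → ℝ × ℝ}
    (hu : ContDiff ℝ ∞ u) (huc : HasCompactSupport u) (hus : tsupport u ⊆ Metric.ball q.1 r)
    (huK : ∀ z, u z ∈ K) (χ : ContDiffBump q.2) (hχ : χ.rOut < b) :
    IsTestField K (chartBox σ e k q r b) (fibreField σ e k χ u) := by
  have hsupp : tsupport (fibreField σ e k χ u) ⊆
      zw σ e k ⁻¹' (tsupport u ×ˢ Metric.closedBall q.2 χ.rOut) := by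
    refine closure_minimal (fun p hp => ?_) ((isClosed_tsupport u |>.prod
      Metric.isClosed_closedBall).preimage (contDiff_zw (n := 0)).continuous)
    have h1 : χ (zw σ e k p).2 ≠ 0 := fun h => hp (by simp [fibreField, h])
    have h2 : u (zw σ e k p).1 ≠ 0 := fun h => hp (by simp [fibreField, h])
    refine ⟨subset_tsupport _ h2, ?_⟩
    rw [← χ.tsupport_eq]
    exact subset_tsupport _ h1
  constructor
  · have h1 : ContDiff ℝ 1 fun p : Heis => χ (zw σ e k p).2 := χ.contDiff.comp contDiff_zw.snd
    have h2 : ContDiff ℝ 1 fun p : Heis => u (zw σ e k p).1 :=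
      (hu.of_le (by simp)).comp contDiff_zw.fst
    exact h1.smul h2
  · refine IsCompact.of_isClosed_subset ?_ (isClosed_tsupport _) hsupp
    exact (zwHomeo e k hσ).isClosedEmbedding.isCompact_preimage
      (huc.isCompact.prod (isCompact_closedBall _ _))
  · refine hsupp.trans (preimage_mono (prod_mono hus ?_))
    rw [Real.closedBall_eq_Icc]
    exact Icc_subset_Ioo (by linarith) (by linarith)
  · intro p
    rw [hK.gauge_le_one_iff]
    exact hK.convex.smul_mem_of_zero_mem (interior_subset hK.zero_mem) (huK _) ⟨χ.nonneg, χ.le_one⟩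

lemma IsC2PlusBody.exists_norm_le (hK : IsC2PlusBody K) : ∃ R, ∀ x ∈ K, ‖x‖ ≤ R :=
  hK.compact.isBounded.exists_norm_le

/-- Upper bound for the perimeter of an epigraph in a box by the integral of the dual pairing. -/
lemma IsGraphChart.perimeter_toReal_le (h : IsGraphChart σ e k E N q r b C ψ) (hK : IsC2PlusBody K)
    {Q : ℝ × ℝ → ℝ × ℝ} (hQc : ContinuousOn Q (Metric.ball q.1 r)) (hQK : ∀ z, Q z ∈ K)
    (hdual : ∀ᵐ z : ℝ × ℝ, z ∈ Metric.ball q.1 r → ∀ x ∈ K,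
      dot x (graphNormal σ e ψ z) ≤ dot (Q z) (graphNormal σ e ψ z)) :
    (perimeter K E (chartBox σ e k q r b)).toReal
      ≤ ∫ z in Metric.ball q.1 r, dot (Q z) (graphNormal σ e ψ z) := by
  obtain ⟨R, hR⟩ := hK.exists_norm_le
  obtain ⟨M, hM0, hM⟩ := exists_norm_graphNormal_le (σ := σ) (e := e) h.lipschitz q.1 r
  have hn := measurable_graphNormal (σ := σ) (e := e) h.lipschitz.continuous
  have hball := Metric.isOpen_ball (x := q.1) (ε := r) |>.measurableSet
  have hdual' : ∀ᵐ z ∂(volume.restrict (Metric.ball q.1 r)), ∀ x ∈ K,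
      dot x (graphNormal σ e ψ z) ≤ dot (Q z) (graphNormal σ e ψ z) :=
    (ae_restrict_iff' hball).2 hdual
  have hiQ := integrableOn_dot (hQc.aestronglyMeasurable hball) hn (fun z => hR _ (hQK z)) hM
  refine SubFinsler.perimeter_toReal_le ?_ fun U hU => ?_
  -- The bound is nonnegative because `0` competes with the dual vector.
  · refine integral_nonneg_of_ae ?_
    filter_upwards [hdual'] with z hz
    have := hz 0 (interior_subset hK.zero_mem)
    simpa [dot] using this
  · rw [setIntegral_hdiv_eq h.sq h.lipschitz h.inter_ae_eq hU.contDiff hU.compactSupport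
      hU.support_subset]
    have hUK : ∀ p, U p ∈ K := fun p => (hK.gauge_le_one_iff _).1 (hU.norm_le p)
    have hc : Continuous fun z => U (zwInv σ e k (z, ψ z)) := by
      have h1 := (contDiff_zwInv (σ := σ) (e := e) (k := k) (n := 0)).continuous
      have h2 := h.lipschitz.continuous
      exact hU.contDiff.continuous.comp (h1.comp (by fun_prop))
    rw [← setIntegral_eq_integral_of_forall_compl_eq_zero (s := Metric.ball q.1 r)]
    · refine integral_mono_ae (integrableOn_dot hc.aestronglyMeasurable hn (fun z => hR _ (hUK _)) hM)
        hiQ ?_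
      filter_upwards [hdual'] with z hz
      exact hz _ (hUK _)
    · intro z hz
      have : U (zwInv σ e k (z, ψ z)) = 0 := by
        refine image_eq_zero_of_notMem_tsupport fun h1 => hz ?_
        have := hU.support_subset h1
        rw [chartBox, mem_preimage, zw_zwInv h.sq] at this
        exact this.1
      simp [this, dot]

/-- Lower bound for the perimeter of a varied epigraph. -/
lemma IsGraphChart.le_perimeter_toReal (h : IsGraphChart σ e k E N q r b C ψ) (hK : IsC2PlusBody K)
    {Q : ℝ × ℝ → ℝ × ℝ} (hQc : ContinuousOn Q (Metric.ball q.1 r)) (hQK : ∀ z, Q z ∈ K)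
    {η : ℝ × ℝ → ℝ} (hη : ContDiff ℝ ∞ η) (hηc : HasCompactSupport η) {s : ℝ}
    (hs : ∀ z, |s * η z| ≤ b / 16)
    (hfin : perimeter K (graphFlow σ e k q.2 (b / 2) η s '' E) (chartBox σ e k q r b) ≠ ⊤) :
    (∫ z in Metric.ball q.1 r, dot (Q z) (graphNormal σ e ψ z))
        + s * ∫ z in Metric.ball q.1 r, dot (Q z) (normalVariation e η z)
      ≤ (perimeter K (graphFlow σ e k q.2 (b / 2) η s '' E) (chartBox σ e k q r b)).toReal := by
  obtain ⟨R, hR⟩ := hK.exists_norm_le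
  have hball := Metric.isOpen_ball (x := q.1) (ε := r) |>.measurableSet
  have hfinm : IsFiniteMeasure (volume.restrict (Metric.ball q.1 r)) :=
    ⟨by rw [Measure.restrict_apply_univ]; exact measure_ball_lt_top⟩
  obtain ⟨u, hu, huc, hus, huK, hulim⟩ := exists_smooth_approx hK.convex hK.compact.isClosed
    (interior_subset hK.zero_mem) h.r_pos hQc hQK
  set ψs : ℝ × ℝ → ℝ := fun z => ψ z + s * η z with hψs
  obtain ⟨D, hD⟩ := ContDiff.lipschitzWith_of_hasCompactSupport (f := fun z => s * η z) (𝕂 := ℝ)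
    hηc.mul_left (contDiff_const.mul hη) (by simp)
  have hψsL : LipschitzWith (C + D) ψs := h.lipschitz.add hD
  obtain ⟨M, hM0, hM⟩ := exists_norm_graphNormal_le (σ := σ) (e := e) hψsL q.1 r
  have hn := measurable_graphNormal (σ := σ) (e := e) hψsL.continuous
  have hae := h.image_graphFlow_inter_ae_eq hη.continuous hs
  -- The cut-off is one up to height `b / 4`, which covers all graphs of `ψ + s η` considered (they
  -- stay within `b / 8`), and it is supported within `b / 2`, inside the box.
  let χ : ContDiffBump q.2 := ⟨b / 4, b / 2, by linarith [h.b_pos], by linarith [h.b_pos]⟩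
  have hχ : χ.rOut < b := by change b / 2 < b; linarith [h.b_pos]
  have hle : ∀ j, ∫ z in Metric.ball q.1 r, dot (u j z) (graphNormal σ e ψs z)
      ≤ (perimeter K (graphFlow σ e k q.2 (b / 2) η s '' E) (chartBox σ e k q r b)).toReal := by
    intro j
    have hT : IsTestField K (chartBox σ e k q r b) (fibreField σ e k χ (u j)) :=
      isTestField_fibreField hK h.sq (hu j) (huc j) (hus j) (huK j) χ hχ
    refine le_of_eq_of_le ?_ (SubFinsler.le_perimeter_toReal hfin hT)
    rw [setIntegral_hdiv_eq h.sq hψsL hae hT.contDiff hT.compactSupport hT.support_subset]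
    refine Eq.symm ((setIntegral_eq_integral_of_forall_compl_eq_zero (s := Metric.ball q.1 r)
      ?_).symm.trans (Eq.symm ?_))
    rotate_left
    · refine setIntegral_congr_fun hball fun z hz => ?_
      have h1 : χ (ψs z) = 1 := by
        refine χ.one_of_mem_closedBall ?_
        rw [Metric.mem_closedBall, Real.dist_eq]
        change |ψ z + s * η z - q.2| ≤ b / 4
        have h2 := abs_lt.1 (h.near z (Metric.ball_subset_closedBall hz))
        have h3 := abs_le.1 (hs z)
        have := h.b_pos
        exact abs_le.2 ⟨by linarith [h2.1, h3.1], by linarith [h2.2, h3.2]⟩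
      simp only [fibreField, zw_zwInv h.sq, h1, one_smul]
    · intro z hz
      have : u j z = 0 := image_eq_zero_of_notMem_tsupport fun h1 => hz (hus j h1)
      simp [fibreField, zw_zwInv h.sq, this, dot]
  -- The dual field is only continuous, so it is not a test field. It is reached as a bounded
  -- pointwise limit of test fields.
  have hlim : Filter.Tendsto (fun j => ∫ z in Metric.ball q.1 r, dot (u j z) (graphNormal σ e ψs z))
      Filter.atTop (𝓝 (∫ z in Metric.ball q.1 r, dot (Q z) (graphNormal σ e ψs z))) := by
    refine tendsto_integral_of_dominated_convergence (fun _ => 2 * (R * M)) (fun j => ?_)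
      (integrable_const _) (fun j => ?_) ?_
    · exact (integrableOn_dot (hu j).continuous.aestronglyMeasurable hn (fun z => hR _ (huK j z))
        hM).aestronglyMeasurable
    · filter_upwards [ae_restrict_mem hball] with z hz
      refine (abs_dot_le _ _).trans ?_
      have := mul_le_mul (hR _ (huK j z)) (hM z hz) (norm_nonneg _)
        ((norm_nonneg _).trans (hR _ (huK j z)))
      linarith
    · filter_upwards [ae_restrict_mem hball] with z hz
      exact (continuous_dot.tendsto _).comp ((hulim z hz).prodMk_nhds tendsto_const_nhds)
  have hfinal := le_of_tendsto' hlim hle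
  refine le_of_eq_of_le ?_ hfinal
  obtain ⟨M₁, -, hM₁⟩ := exists_norm_graphNormal_le (σ := σ) (e := e) h.lipschitz q.1 r
  have hcv := continuous_normalVariation (e := e) (hη.of_le (by simp))
  obtain ⟨M₂, hM₂⟩ := (isCompact_closedBall q.1 r).exists_bound_of_continuousOn hcv.continuousOn
  have i1 := integrableOn_dot (hQc.aestronglyMeasurable hball)
    (measurable_graphNormal (σ := σ) (e := e) h.lipschitz.continuous) (fun z => hR _ (hQK z)) hM₁
  have i2 := integrableOn_dot (hQc.aestronglyMeasurable hball) hcv.measurable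
    (fun z => hR _ (hQK z)) (fun z hz => hM₂ z (Metric.ball_subset_closedBall hz))
  rw [← integral_const_mul, ← integral_add i1 (i2.const_mul s)]
  refine integral_congr_ae ((h.lipschitz.ae_differentiableAt (μ := volume)).filter_mono
    (ae_mono Measure.restrict_le_self) |>.mono fun z hz => ?_)
  simp only [hψs]
  rw [graphNormal_add hz (hη.differentiable (by simp) z)]
  simp only [dot, Prod.fst_add, Prod.snd_add, Prod.smul_fst, Prod.smul_snd, smul_eq_mul]
  ring

/-- First variation: the dual field of the normal is a weak solution of the prescribed curvature
equation on the base of the graph. -/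
theorem IsGraphChart.weak_equation (h : IsGraphChart σ e k E N q r b C ψ) (hK : IsC2PlusBody K)
    {Ω : Set Heis} {f : Heis → ℝ} (hf : ContinuousOn f Ω) (hpc : HasPrescribedCurvature K Ω E f)
    (hNΩ : N ⊆ Ω) {π : ℝ × ℝ → ℝ × ℝ} (hπ : ∀ n, IsSupportPoint K n (π n))
    (hπc : ContinuousOn π {0}ᶜ) {U : Set Heis} {g : Heis → ℝ} {G : Heis → ℝ × ℝ}
    (hg : IsHDefiningFunction (frontier E) U g G) (hgE : ∀ p ∈ U, p ∈ E → g p ≤ 0) (hNU : N ⊆ U)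
    {η : ℝ × ℝ → ℝ} (hη : ContDiff ℝ ∞ η) (hηc : HasCompactSupport η)
    (hηs : tsupport η ⊆ Metric.ball q.1 r) :
    ∫ z, dot (π (G (zwInv σ e k (z, ψ z)))) (normalVariation e η z)
      = -∫ z, f (zwInv σ e k (z, ψ z)) * η z := by
  have hβ : 0 < b / 2 := half_pos h.b_pos
  have hcinv := (contDiff_zwInv (σ := σ) (e := e) (k := k) (n := 0)).continuous
  set Q : ℝ × ℝ → ℝ × ℝ := fun z => π (G (zwInv σ e k (z, ψ z))) with hQ
  have hQK : ∀ z, Q z ∈ K := fun z => (hπ _).1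
  have hmemU : ∀ z ∈ Metric.ball q.1 r, zwInv σ e k (z, ψ z) ∈ U := fun z hz =>
    hNU (h.graph_mem (Metric.ball_subset_closedBall hz))
  have hQc : ContinuousOn Q (Metric.ball q.1 r) := by
    have hc : Continuous fun z => zwInv σ e k (z, ψ z) := by
      have h2 := h.lipschitz.continuous
      exact hcinv.comp (by fun_prop)
    exact hπc.comp (hg.2.1.continuousOn_gradient.comp hc.continuousOn hmemU)
      fun z hz => hg.2.2.1 _ (hmemU z hz)
  have hup := h.perimeter_toReal_le hK hQc hQK (h.ae_dot_graphNormal_le hπ hg hgE hNU)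
  obtain ⟨W, hW, hWc, hWs, hflow⟩ := exists_isFlow_graphFlow (k := k) (e := e) (w₀ := q.2) h.sq hβ hη hηc
  have hWB : tsupport W ⊆ chartBox σ e k q r b := by
    refine hWs.trans (preimage_mono (prod_mono hηs ?_))
    rw [Real.closedBall_eq_Icc]
    exact Icc_subset_Ioo (by linarith) (by linarith)
  obtain ⟨hfin, hder⟩ := hpc.critical _ (h.isRelCompactOpen hNΩ) W hW hWc hWB _ hflow
  obtain ⟨M', hM'⟩ := hηc.exists_bound_of_continuous hη.continuous
  set c : ℝ := b / 16 / (|M'| + 1) with hc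
  have hc0 : 0 < c := by have := h.b_pos; positivity
  have hηb : ∀ s : ℝ, |s| < c → ∀ z, |s * η z| ≤ b / 16 := by
    intro s hs z
    have h1 : |η z| ≤ |M'| + 1 := (hM' z).trans (by linarith [le_abs_self M'])
    rw [abs_mul]
    calc |s| * |η z| ≤ c * (|M'| + 1) := mul_le_mul hs.le h1 (abs_nonneg _) hc0.le
      _ = b / 16 := by rw [hc]; field_simp
  set F : ℝ → ℝ := fun s => ∫ p in (graphFlow σ e k q.2 (b / 2) η s '' E) ∩ chartBox σ e k q r b, f p
    with hF
  set a := ∫ z in Metric.ball q.1 r, dot (Q z) (normalVariation e η z) with ha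
  have hFeq : ∀ s : ℝ, |s| < c → F s = ∫ x in epi (fun z => ψ z + s * η z) ∩
      (Metric.ball q.1 r ×ˢ Ioo (q.2 - b) (q.2 + b)), f (zwInv σ e k x) := by
    intro s hs
    simp only [hF]
    rw [setIntegral_congr_set (h.image_graphFlow_inter_ae_eq hη.continuous (hηb s hs)),
      ← (measurePreserving_zw (e := e) (k := k) h.sq).setIntegral_preimage_emb
        (measurableEmbedding_zw h.sq) (fun x => f (zwInv σ e k x))]
    simp_rw [zwInv_zw h.sq]
    rfl
  have hFd : HasDerivAt F (-∫ z in Metric.ball q.1 r, f (zwInv σ e k (z, ψ z)) * η z) 0 := by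
    have h1 := hasDerivAt_setIntegral_epi (g := fun x => f (zwInv σ e k x)) h.lipschitz.continuous
      hη.continuous hc0 hηb h.near
      (hf.comp hcinv.continuousOn fun x hx => hNΩ (h.subset x.1 hx.1 x.2 hx.2))
    refine h1.congr_of_eventuallyEq ?_
    filter_upwards [Ioo_mem_nhds (show -c < 0 by linarith) hc0] with s hs
    exact hFeq s (abs_lt.2 hs)
  set P : ℝ → ℝ := fun s => (perimeter K (graphFlow σ e k q.2 (b / 2) η s '' E)
    (chartBox σ e k q r b)).toReal with hP
  have hP0 : P 0 = (perimeter K E (chartBox σ e k q r b)).toReal := by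
    have : graphFlow σ e k q.2 (b / 2) η 0 '' E = E := by
      have : graphFlow σ e k q.2 (b / 2) η 0 = id := funext fun p => graphFlow_zero h.sq hβ p
      rw [this, image_id]
    simp only [hP, this]
  -- The perimeter is differentiable at `0` as the sum of the critical functional and of the volume
  -- term. No smoothness of `ψ` enters.
  have hPd : HasDerivAt (fun s => P s - s * a)
      (0 + (-∫ z in Metric.ball q.1 r, f (zwInv σ e k (z, ψ z)) * η z) - 1 * a) 0 := by
    have h1 := (hder.fun_add hFd).fun_sub ((hasDerivAt_id (0 : ℝ)).mul_const a)
    refine h1.congr_of_eventuallyEq (.of_forall fun s => ?_)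
    simp [hP, hF]
  -- For the moved sets the old dual field gives a lower bound of the perimeter, while at `s = 0`
  -- its flux bounds the perimeter from above. So the linear function of slope `a` touches the
  -- perimeter from below, and its slope is the derivative.
  have hmin : IsLocalMin (fun s => P s - s * a) 0 := by
    filter_upwards [hfin, Ioo_mem_nhds (show -c < 0 by linarith) hc0] with s hs hsc
    have h1 := h.le_perimeter_toReal hK hQc hQK hη hηc (hηb s (abs_lt.2 hsc)) hs
    simp only [zero_mul, sub_zero]
    rw [hP0]
    linarith
  have h0 := hmin.hasDerivAt_eq_zero hPd
  have e1 : ∫ z, dot (Q z) (normalVariation e η z) = a := by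
    rw [ha, setIntegral_eq_integral_of_forall_compl_eq_zero]
    intro z hz
    rw [normalVariation_eq_zero fun h1 => hz (hηs h1)]
    simp [dot]
  have e2 : ∫ z, f (zwInv σ e k (z, ψ z)) * η z
      = ∫ z in Metric.ball q.1 r, f (zwInv σ e k (z, ψ z)) * η z := by
    rw [setIntegral_eq_integral_of_forall_compl_eq_zero]
    intro z hz
    rw [image_eq_zero_of_notMem_tsupport fun h1 => hz (hηs h1), mul_zero]
  rw [e1, e2]
  linarith

end WeakEquation

/-! ### Weak divergence equations along curves -/

lemma fderiv_mollify_apply {f φ : ℝ × ℝ → ℝ} (hf : Integrable f) (hφ : ContDiff ℝ ∞ φ)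
    (hφc : HasCompactSupport φ) (x v : ℝ × ℝ) :
    fderiv ℝ (fun x => ∫ t, f t * φ (x - t)) x v = ∫ t, f t * fderiv ℝ φ (x - t) v := by
  have h1 := hφc.hasFDerivAt_convolution_right (ContinuousLinearMap.mul ℝ ℝ) hf.locallyIntegrable
    (hφ.of_le (by simp)) x
  have h2 : fderiv ℝ (fun x => ∫ t, f t * φ (x - t)) x
      = convolution f (fderiv ℝ φ) ((ContinuousLinearMap.mul ℝ ℝ).precompR (ℝ × ℝ)) volume x :=
    h1.fderiv
  rw [h2, convolution_precompR_apply _ hf.locallyIntegrable (hφc.fderiv (𝕜 := ℝ))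
    (hφ.continuous_fderiv (by simp))]
  rfl

lemma contDiff_mollify {f φ : ℝ × ℝ → ℝ} (hf : Integrable f) (hφ : ContDiff ℝ ∞ φ)
    (hφc : HasCompactSupport φ) : ContDiff ℝ ∞ fun x => ∫ t, f t * φ (x - t) :=
  hφc.contDiff_convolution_right (ContinuousLinearMap.mul ℝ ℝ) hf.locallyIntegrable hφ

/-- Solutions of `∂₁ a + ∂₂ b = F` in the sense of distributions are locally uniform limits of classical
solutions. -/
lemma exists_smooth_solution {z₀ : ℝ × ℝ} {r : ℝ} (hr : 0 < r) {a b F : ℝ × ℝ → ℝ}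
    (ha : ContinuousOn a (Metric.ball z₀ r)) (hb : ContinuousOn b (Metric.ball z₀ r))
    (hF : ContinuousOn F (Metric.ball z₀ r))
    (hweak : ∀ η : ℝ × ℝ → ℝ, ContDiff ℝ ∞ η → HasCompactSupport η → tsupport η ⊆ Metric.ball z₀ r →
      ∫ z, (a z * fderiv ℝ η z (1, 0) + b z * fderiv ℝ η z (0, 1)) = -∫ z, F z * η z)
    {θ : ℝ} (hθ : 0 < θ) :
    ∃ a' b' : ℝ × ℝ → ℝ, ContDiff ℝ ∞ a' ∧ ContDiff ℝ ∞ b' ∧ ∀ z ∈ Metric.closedBall z₀ (r / 2),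
      |a' z - a z| ≤ θ ∧ |b' z - b z| ≤ θ ∧
        |fderiv ℝ a' z (1, 0) + fderiv ℝ b' z (0, 1) - F z| ≤ θ := by
  set D := Metric.closedBall z₀ (3 * r / 4) with hD
  have hDc : IsCompact D := isCompact_closedBall _ _
  have hDb : D ⊆ Metric.ball z₀ r := Metric.closedBall_subset_ball (by linarith)
  have huc : ∀ f : ℝ × ℝ → ℝ, ContinuousOn f (Metric.ball z₀ r) → ∃ δ > 0, ∀ x ∈ D, ∀ y ∈ D,
      dist x y < δ → |f x - f y| ≤ θ := by
    intro f hf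
    obtain ⟨δ, hδ, h⟩ := Metric.uniformContinuousOn_iff.1
      (hDc.uniformContinuousOn_of_continuous (hf.mono hDb)) θ hθ
    exact ⟨δ, hδ, fun x hx y hy hxy => (h x hx y hy hxy).le⟩
  obtain ⟨δ₁, hδ₁, h₁⟩ := huc a ha
  obtain ⟨δ₂, hδ₂, h₂⟩ := huc b hb
  obtain ⟨δ₃, hδ₃, h₃⟩ := huc F hF
  -- Averages at scale `δ ≤ r / 4` around points of the half ball only use values in the compact
  -- ball of radius `3 r / 4`, where all three functions are uniformly continuous.
  set δ := min (r / 4) (min δ₁ (min δ₂ δ₃)) with hδ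
  have hδ0 : 0 < δ := by positivity
  let χ : ContDiffBump (0 : ℝ × ℝ) := ⟨δ / 2, δ, half_pos hδ0, half_lt_self hδ0⟩
  set φ := χ.normed volume with hφ
  have hφs : ContDiff ℝ ∞ φ := χ.contDiff_normed
  have hφc : HasCompactSupport φ := χ.hasCompactSupport_normed
  have hφ0 : ∀ t, 0 ≤ φ t := fun t => χ.nonneg_normed t
  have hφsupp : ∀ t, φ t ≠ 0 → ‖t‖ < δ := by
    intro t ht
    have : t ∈ Function.support φ := ht
    rw [hφ, χ.support_normed_eq] at this
    exact mem_ball_zero_iff.1 this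
  have hφts : tsupport φ = Metric.closedBall 0 δ := χ.tsupport_normed_eq
  set m : (ℝ × ℝ → ℝ) → ℝ × ℝ → ℝ := fun f x => ∫ t, D.indicator f t * φ (x - t) with hm
  have hint : ∀ f : ℝ × ℝ → ℝ, ContinuousOn f (Metric.ball z₀ r) → Integrable (D.indicator f) :=
    fun f hf => ((hf.mono hDb).integrableOn_compact hDc).integrable_indicator hDc.measurableSet
  have hnear : ∀ x ∈ Metric.closedBall z₀ (r / 2), ∀ t, ‖x - t‖ ≤ δ → t ∈ D := by
    intro x hx t ht
    rw [hD, Metric.mem_closedBall]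
    have h4 : dist t x ≤ δ := by rw [dist_comm, dist_eq_norm]; exact ht
    have h5 : δ ≤ r / 4 := min_le_left _ _
    have h6 : dist x z₀ ≤ r / 2 := hx
    linarith [dist_triangle t x z₀]
  have hpass : ∀ (f : ℝ × ℝ → ℝ), ContinuousOn f (Metric.ball z₀ r) → ∀ δ' : ℝ, δ ≤ δ' →
      (∀ x ∈ D, ∀ y ∈ D, dist x y < δ' → |f x - f y| ≤ θ) →
      ∀ x ∈ Metric.closedBall z₀ (r / 2), |m f x - f x| ≤ θ := by
    intro f hf δ' hδ' hfθ x hx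
    have hbdd : Integrable fun t => D.indicator f t * φ (x - t) := by
      obtain ⟨Cφ, hCφ⟩ := hφc.exists_bound_of_continuous hφs.continuous
      exact (hint f hf).mul_bdd (c := Cφ)
        (hφs.continuous.comp (by fun_prop)).aestronglyMeasurable (.of_forall fun t => hCφ _)
    have hi : Integrable fun t => φ (x - t) := χ.integrable_normed.comp_sub_left x
    refine abs_integral_mul_sub_le (fun t => hφ0 _) hi ?_ hbdd fun t ht => ?_
    · rw [integral_sub_left_eq_self φ volume x]; exact χ.integral_normed
    · have h4 := hφsupp _ ht
      have h5 := hnear x hx t h4.le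
      have h6 := hnear x hx x (by rw [sub_self, norm_zero]; exact hδ0.le)
      rw [indicator_of_mem h5, abs_sub_comm]
      exact hfθ x h6 t h5 (by rw [dist_eq_norm]; linarith)
  refine ⟨m a, m b, contDiff_mollify (hint a ha) hφs hφc, contDiff_mollify (hint b hb) hφs hφc,
    fun x hx => ⟨hpass a ha δ₁ ((min_le_right _ _).trans (min_le_left _ _)) h₁ x hx,
      hpass b hb δ₂ ((min_le_right _ _).trans ((min_le_right _ _).trans (min_le_left _ _))) h₂ x hx, ?_⟩⟩
  -- The reflected kernel `t ↦ φ (x - t)` is an admissible test function, so the mollified pair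
  -- solves the mollified equation exactly.
  have hFx : fderiv ℝ (m a) x (1, 0) + fderiv ℝ (m b) x (0, 1) = m F x := by
    set η : ℝ × ℝ → ℝ := fun t => φ (x - t) with hη
    have hηs : ContDiff ℝ ∞ η := hφs.comp (by fun_prop)
    have hηt : tsupport η ⊆ D := by
      refine closure_minimal (fun t ht => hnear x hx t (hφsupp _ ht).le) hDc.isClosed
    have hηc : HasCompactSupport η := hDc.of_isClosed_subset (isClosed_tsupport _) hηt
    have hηd : ∀ t v, fderiv ℝ η t v = -fderiv ℝ φ (x - t) v := by
      intro t v
      have e1 : HasFDerivAt (fun t : ℝ × ℝ => x - t) (-ContinuousLinearMap.id ℝ (ℝ × ℝ)) t :=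
        (hasFDerivAt_id t).const_sub x
      have e2 := ((hφs.differentiable (by simp) (x - t)).hasFDerivAt).comp t e1
      have e3 : fderiv ℝ η t = (fderiv ℝ φ (x - t)).comp (-ContinuousLinearMap.id ℝ (ℝ × ℝ)) := e2.fderiv
      rw [e3]; simp
    have hw := hweak η hηs hηc (hηt.trans hDb)
    have hind : ∀ (f h : ℝ × ℝ → ℝ), (∀ t, h t ≠ 0 → t ∈ D) → ∀ t, D.indicator f t * h t = f t * h t := by
      intro f h hh t
      by_cases ht : t ∈ D
      · rw [indicator_of_mem ht]
      · rw [show h t = 0 by by_contra h0; exact ht (hh t h0), mul_zero, mul_zero]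
    have hdD : ∀ v t, fderiv ℝ φ (x - t) v ≠ 0 → t ∈ D := by
      intro v t ht
      refine hηt (tsupport_fderiv_subset ℝ (subset_tsupport _ fun h0 => ht ?_))
      have := hηd t v
      rw [h0] at this
      simpa using this.symm
    have hdi : ∀ (f : ℝ × ℝ → ℝ), ContinuousOn f (Metric.ball z₀ r) → ∀ v,
        Integrable fun t => f t * fderiv ℝ φ (x - t) v := by
      intro f hf v
      have hcf : Continuous fun t => fderiv ℝ φ (x - t) v :=
        ((hφs.continuous_fderiv (by simp)).comp (by fun_prop)).clm_apply continuous_const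
      obtain ⟨Cφ, hCφ⟩ := (hφc.fderiv (𝕜 := ℝ)).exists_bound_of_continuous
        (hφs.continuous_fderiv (by simp))
      have := (hint f hf).mul_bdd (c := Cφ * ‖v‖) hcf.aestronglyMeasurable (.of_forall fun t =>
        ((fderiv ℝ φ (x - t)).le_opNorm v).trans (mul_le_mul_of_nonneg_right (hCφ _) (norm_nonneg v)))
      refine this.congr (.of_forall fun t => hind f _ (hdD v) t)
    simp only [hm]
    rw [fderiv_mollify_apply (hint a ha) hφs hφc, fderiv_mollify_apply (hint b hb) hφs hφc]
    simp_rw [hind a _ (hdD (1, 0)), hind b _ (hdD (0, 1))]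
    rw [← integral_add (hdi a ha _) (hdi b hb _)]
    have hlast : ∫ t, D.indicator F t * φ (x - t) = ∫ t, F t * η t :=
      integral_congr_ae (.of_forall fun t => hind F η
        (fun t ht => hnear x hx t (hφsupp _ ht).le) t)
    rw [hlast, ← neg_eq_iff_eq_neg.2 hw, ← integral_neg]
    refine integral_congr_ae (.of_forall fun t => ?_)
    simp only [hηd]
    ring
  rw [hFx]
  exact hpass F hF δ₃ ((min_le_right _ _).trans ((min_le_right _ _).trans (min_le_right _ _))) h₃ x hx

/-- Derivative along a curve of the integral of `a` over vertical segments. -/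
lemma hasDerivAt_integral_vertical {a b : ℝ × ℝ → ℝ} (ha : ContDiff ℝ ∞ a) (hb : ContDiff ℝ ∞ b)
    (ε : ℝ) {z : ℝ → ℝ × ℝ} {v : ℝ × ℝ} {s : ℝ} (hz : HasDerivAt z v s) :
    HasDerivAt (fun s => ∫ ρ in (0 : ℝ)..ε, a (z s + (0, ρ)))
      (v.1 * (∫ ρ in (0 : ℝ)..ε, (fderiv ℝ a (z s + (0, ρ)) (1, 0) + fderiv ℝ b (z s + (0, ρ)) (0, 1)))
        - (v.1 * (b (z s + (0, ε)) - b (z s)) - v.2 * (a (z s + (0, ε)) - a (z s)))) s := by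
  have hda : Continuous (fderiv ℝ a) := ha.continuous_fderiv (by simp)
  have hdb : Continuous (fderiv ℝ b) := hb.continuous_fderiv (by simp)
  have hac := ha.continuous
  have hcompact : IsCompact (Metric.closedBall (z s) (1 + |ε|)) := isCompact_closedBall _ _
  obtain ⟨M, hM⟩ := hcompact.exists_bound_of_continuousOn hda.continuousOn
  have hF := intervalIntegral.hasFDerivAt_integral_of_dominated_of_fderiv_le (𝕜 := ℝ) (μ := volume)
    (a := 0) (b := ε) (x₀ := z s) (s := Metric.ball (z s) 1)
    (F := fun x ρ => a (x + (0, ρ))) (F' := fun x ρ => fderiv ℝ a (x + (0, ρ))) (bound := fun _ => M)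
    (Metric.ball_mem_nhds _ one_pos)
    (.of_forall fun x => Continuous.aestronglyMeasurable (by fun_prop))
    (Continuous.intervalIntegrable (by fun_prop) _ _)
    (Continuous.aestronglyMeasurable (by fun_prop))
    (.of_forall fun ρ hρ x hx => hM _ ?_) intervalIntegrable_const
    (.of_forall fun ρ _ x _ => ?_)
  rotate_left
  · rw [Metric.mem_closedBall, dist_eq_norm]
    have h1 : ‖((0 : ℝ), ρ)‖ ≤ |ε| := by
      rw [Prod.norm_def]
      simp only [norm_zero, Real.norm_eq_abs, abs_nonneg, sup_of_le_right]
      have := uIoc_subset_uIcc hρ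
      rw [mem_uIcc] at this
      rcases this with h | h
      · rw [abs_of_nonneg h.1]; exact h.2.trans (le_abs_self _)
      · rw [abs_of_nonpos h.2]; exact (neg_le_neg h.1).trans (neg_le_abs _)
    have h2 : ‖x - z s‖ < 1 := by rwa [← dist_eq_norm]
    have h3 : x + (0, ρ) - z s = (x - z s) + (0, ρ) := by abel
    rw [h3]
    linarith [norm_add_le (x - z s) ((0 : ℝ), ρ)]
  · have h1 : HasFDerivAt (fun x : ℝ × ℝ => x + ((0 : ℝ), ρ)) (ContinuousLinearMap.id ℝ _) x :=
      (hasFDerivAt_id x).add_const _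
    have h2 := ((ha.differentiable (by simp) (x + (0, ρ))).hasFDerivAt).comp x h1
    exact h2
  have h1 := hF.comp_hasDerivAt s hz
  refine h1.congr_deriv ?_
  rw [ContinuousLinearMap.intervalIntegral_apply]
  rotate_left
  · exact Continuous.intervalIntegrable (by fun_prop) _ _
  have hv : v = v.1 • ((1 : ℝ), (0 : ℝ)) + v.2 • ((0 : ℝ), (1 : ℝ)) := by ext <;> simp
  -- Vertical derivatives integrate to differences of end values. For `b` this brings in the
  -- divergence in place of `∂₁ a`, for `a` it evaluates the vertical part of the velocity.
  have hftc : ∀ f : ℝ × ℝ → ℝ, ContDiff ℝ ∞ f →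
      ∫ ρ in (0 : ℝ)..ε, fderiv ℝ f (z s + (0, ρ)) (0, 1) = f (z s + (0, ε)) - f (z s) := by
    intro f hf
    have hd : ∀ ρ ∈ uIcc 0 ε, HasDerivAt (fun ρ : ℝ => f (z s + (0, ρ)))
        (fderiv ℝ f (z s + (0, ρ)) (0, 1)) ρ := by
      intro ρ _
      have h1 : HasDerivAt (fun ρ : ℝ => z s + ((0 : ℝ), ρ)) ((0 : ℝ), (1 : ℝ)) ρ :=
        ((hasDerivAt_const ρ (0 : ℝ)).prodMk (hasDerivAt_id ρ)).const_add _
      exact ((hf.differentiable (by simp) _).hasFDerivAt).comp_hasDerivAt ρ h1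
    have hfc : Continuous (fderiv ℝ f) := hf.continuous_fderiv (by simp)
    rw [intervalIntegral.integral_eq_sub_of_hasDerivAt hd
      (Continuous.intervalIntegrable (by fun_prop) _ _)]
    have : z s + ((0 : ℝ), (0 : ℝ)) = z s := by ext <;> simp
    rw [this]
  have e1 : ∫ ρ in (0 : ℝ)..ε, fderiv ℝ a (z s + (0, ρ)) v
      = v.1 * (∫ ρ in (0 : ℝ)..ε, fderiv ℝ a (z s + (0, ρ)) (1, 0))
        + v.2 * ∫ ρ in (0 : ℝ)..ε, fderiv ℝ a (z s + (0, ρ)) (0, 1) := by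
    rw [← intervalIntegral.integral_const_mul, ← intervalIntegral.integral_const_mul,
      ← intervalIntegral.integral_add (Continuous.intervalIntegrable (by fun_prop) _ _)
        (Continuous.intervalIntegrable (by fun_prop) _ _)]
    congr 1
    funext ρ
    conv_lhs => rw [hv]
    rw [map_add, map_smul, map_smul, smul_eq_mul, smul_eq_mul]
  rw [e1, intervalIntegral.integral_add (Continuous.intervalIntegrable (by fun_prop) _ _)
    (Continuous.intervalIntegrable (by fun_prop) _ _), hftc a ha, hftc b hb]
  ring

/-- Division by a negative `ε` reverses the inequality, so a single lower bound for `ε` of both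
signs bounds the derivative on both sides. -/
lemma HasDerivAt.le_of_eventually_le {B : ℝ → ℝ} {β m κ : ℝ} (hB : HasDerivAt B β 0) (h0 : B 0 = 0)
    (h : ∀ᶠ ε in 𝓝 (0 : ℝ), ε * m - |ε| * κ ≤ B ε) : m - κ ≤ β ∧ β ≤ m + κ := by
  have hs := hasDerivAt_iff_tendsto_slope.1 hB
  constructor
  · refine ge_of_tendsto (hs.mono_left (nhdsWithin_mono (0 : ℝ)
      (fun x (hx : x ∈ Ioi (0 : ℝ)) => ne_of_gt hx))) ?_
    filter_upwards [h.filter_mono nhdsWithin_le_nhds, self_mem_nhdsWithin] with ε hε hε0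
    have hε0' : (0 : ℝ) < ε := hε0
    rw [slope_def_field, h0, sub_zero, sub_zero, le_div_iff₀ hε0']
    rw [abs_of_pos hε0'] at hε
    linarith
  · refine le_of_tendsto (hs.mono_left (nhdsWithin_mono (0 : ℝ)
      (fun x (hx : x ∈ Iio (0 : ℝ)) => ne_of_lt hx))) ?_
    filter_upwards [h.filter_mono nhdsWithin_le_nhds, self_mem_nhdsWithin] with ε hε hε0
    have hε0' : ε < (0 : ℝ) := hε0
    rw [slope_def_field, h0, sub_zero, sub_zero, div_le_iff_of_neg hε0']
    rw [abs_of_neg hε0'] at hε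
    linarith

/-- A weak solution of `∂₁ a + ∂₂ b = F` is differentiable along a curve on whose vertical translates the
flux has a maximum. -/
lemma hasDerivAt_comp_of_weak {z₀ : ℝ × ℝ} {r : ℝ} (hr : 0 < r) {a b F : ℝ × ℝ → ℝ}
    (ha : ContinuousOn a (Metric.ball z₀ r)) (hb : ContinuousOn b (Metric.ball z₀ r))
    (hF : ContinuousOn F (Metric.ball z₀ r))
    (hweak : ∀ η : ℝ × ℝ → ℝ, ContDiff ℝ ∞ η → HasCompactSupport η → tsupport η ⊆ Metric.ball z₀ r →
      ∫ z, (a z * fderiv ℝ η z (1, 0) + b z * fderiv ℝ η z (0, 1)) = -∫ z, F z * η z)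
    {z v : ℝ → ℝ × ℝ} {s₀ : ℝ} (hz₀ : z s₀ = z₀) (hz : ∀ᶠ s in 𝓝 s₀, HasDerivAt z (v s) s)
    (hv : ContinuousAt v s₀)
    (hsign : ∀ᶠ x : ℝ × ℝ in 𝓝 (s₀, 0), (v x.1).1 * (b (z x.1 + (0, x.2)) - b (z x.1))
      - (v x.1).2 * (a (z x.1 + (0, x.2)) - a (z x.1)) ≤ 0) :
    HasDerivAt (fun s => a (z s)) ((v s₀).1 * F z₀) s₀ := by
  set c := (v s₀).1 * F z₀ with hc
  set M := ‖v s₀‖ + 1 with hM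
  have hM0 : 0 < M := by positivity
  have hzc : ContinuousAt z s₀ := hz.self_of_nhds.continuousAt
  have hfst : Filter.Tendsto (fun x : ℝ × ℝ => x.1) (𝓝 (s₀, (0 : ℝ))) (𝓝 s₀) :=
    continuous_fst.tendsto (s₀, (0 : ℝ))
  have htr : Filter.Tendsto (fun x : ℝ × ℝ => z x.1 + ((0 : ℝ), x.2)) (𝓝 (s₀, (0 : ℝ))) (𝓝 z₀) := by
    have h1 : Filter.Tendsto (fun x : ℝ × ℝ => ((0 : ℝ), x.2)) (𝓝 (s₀, (0 : ℝ))) (𝓝 ((0 : ℝ), (0 : ℝ))) :=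
      (by fun_prop : Continuous fun x : ℝ × ℝ => ((0 : ℝ), x.2)).tendsto (s₀, (0 : ℝ))
    have h2 := (hzc.tendsto.comp hfst).add h1
    have h3 : z s₀ + ((0 : ℝ), (0 : ℝ)) = z₀ := by rw [hz₀]; ext <;> simp
    rw [h3] at h2
    exact h2
  have hF₀ : ContinuousAt F z₀ := hF.continuousAt (Metric.ball_mem_nhds _ hr)
  rw [hasDerivAt_iff_isLittleO, Asymptotics.isLittleO_iff]
  intro κ hκ
  have hev : ∀ᶠ x : ℝ × ℝ in 𝓝 (s₀, (0 : ℝ)), HasDerivAt z (v x.1) x.1 ∧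
      z x.1 + (0, x.2) ∈ Metric.closedBall z₀ (r / 2) ∧
      |(v x.1).1 * F (z x.1 + (0, x.2)) - c| ≤ κ ∧ ‖v x.1‖ ≤ M ∧
      (v x.1).1 * (b (z x.1 + (0, x.2)) - b (z x.1))
      - (v x.1).2 * (a (z x.1 + (0, x.2)) - a (z x.1)) ≤ 0 := by
    have h3 : Filter.Tendsto (fun x : ℝ × ℝ => (v x.1).1 * F (z x.1 + (0, x.2))) (𝓝 (s₀, (0 : ℝ)))
        (𝓝 c) := (hv.tendsto.comp hfst).fst_nhds.mul (hF₀.tendsto.comp htr)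
    have h4 : Filter.Tendsto (fun x : ℝ × ℝ => ‖v x.1‖) (𝓝 (s₀, (0 : ℝ))) (𝓝 ‖v s₀‖) :=
      (hv.tendsto.comp hfst).norm
    filter_upwards [hfst.eventually hz, htr.eventually (Metric.closedBall_mem_nhds z₀ (half_pos hr)),
      h3.eventually (Metric.closedBall_mem_nhds c hκ), h4.eventually (gt_mem_nhds (lt_add_one _)),
      hsign] with x x1 x2 x3 x4 x5
    exact ⟨x1, x2, x3, x4.le, x5⟩
  obtain ⟨ℓ, hℓ, hball⟩ := Metric.nhds_basis_closedBall.eventually_iff.1 hev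
  have H : ∀ s ∈ Icc (s₀ - ℓ) (s₀ + ℓ), ∀ ρ : ℝ, |ρ| ≤ ℓ → HasDerivAt z (v s) s ∧
      z s + (0, ρ) ∈ Metric.closedBall z₀ (r / 2) ∧
      |(v s).1 * F (z s + (0, ρ)) - c| ≤ κ ∧ ‖v s‖ ≤ M ∧
      (v s).1 * (b (z s + (0, ρ)) - b (z s)) - (v s).2 * (a (z s + (0, ρ)) - a (z s)) ≤ 0 := by
    intro s hs ρ hρ
    refine @hball (s, ρ) ?_
    rw [← closedBall_prod_same]
    exact ⟨by rw [Real.closedBall_eq_Icc]; exact hs, by simpa [Real.dist_eq] using hρ⟩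
  have hcb : Metric.closedBall z₀ (r / 2) ⊆ Metric.ball z₀ r :=
    Metric.closedBall_subset_ball (by linarith)
  have huI : ∀ {ε ρ : ℝ}, ρ ∈ uIcc 0 ε → |ρ| ≤ |ε| := by
    intro ε ρ hρ
    rw [mem_uIcc] at hρ
    rcases hρ with h | h
    · rw [abs_of_nonneg h.1]; exact h.2.trans (le_abs_self _)
    · rw [abs_of_nonpos h.2]; exact (neg_le_neg h.1).trans (neg_le_abs _)
  set A : ℝ → ℝ → ℝ := fun ε s => ∫ ρ in (0 : ℝ)..ε, a (z s + (0, ρ)) with hA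
  have hai : ∀ ε : ℝ, |ε| ≤ ℓ → ∀ s ∈ Icc (s₀ - ℓ) (s₀ + ℓ),
      IntervalIntegrable (fun ρ : ℝ => a (z s + (0, ρ))) volume 0 ε := by
    intro ε hε s hs
    refine ContinuousOn.intervalIntegrable ?_
    exact ha.comp (by fun_prop) fun ρ hρ => hcb (H s hs ρ ((huI hρ).trans hε)).2.1
  -- Along the curve the integral over the vertical segment changes at the rate of the source term
  -- minus the flux difference. The flux difference is nonpositive by `hsign`, whatever the sign of
  -- `ε`. The estimate is made for classical solutions close to the weak one, with an error
  -- proportional to `θ`.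
  have step1 : ∀ ε : ℝ, |ε| ≤ ℓ → ∀ s₁ ∈ Icc (s₀ - ℓ) (s₀ + ℓ), ∀ s₂ ∈ Icc (s₀ - ℓ) (s₀ + ℓ),
      s₁ ≤ s₂ → (ε * c - |ε| * κ) * (s₂ - s₁) ≤ A ε s₂ - A ε s₁ := by
    intro ε hε s₁ hs₁ s₂ hs₂ h12
    set T := M * (|ε| + 4) * (s₂ - s₁) + 2 * |ε| with hT
    have hT0 : 0 ≤ T := by
      have := sub_nonneg.2 h12
      positivity
    have main : ∀ θ > 0, (ε * c - |ε| * κ) * (s₂ - s₁) ≤ A ε s₂ - A ε s₁ + θ * T := by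
      intro θ hθ
      obtain ⟨a', b', ha', hb', hab⟩ := exists_smooth_solution hr ha hb hF hweak hθ
      have hd : ∀ s ∈ Icc (s₀ - ℓ) (s₀ + ℓ), HasDerivAt (fun s => ∫ ρ in (0 : ℝ)..ε, a' (z s + (0, ρ)))
          _ s := fun s hs => hasDerivAt_integral_vertical ha' hb' ε (H s hs ε hε).1
      have hlow : ∀ s ∈ Icc (s₀ - ℓ) (s₀ + ℓ), ε * c - |ε| * κ - θ * (M * (|ε| + 4)) ≤
          deriv (fun s => ∫ ρ in (0 : ℝ)..ε, a' (z s + (0, ρ))) s := by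
        intro s hs
        rw [(hd s hs).deriv]
        obtain ⟨-, hε1, -, hvM, hsgn⟩ := H s hs ε hε
        have h00 := (H s hs 0 (by simpa using hℓ.le)).2.1
        have hz0 : z s + ((0 : ℝ), (0 : ℝ)) = z s := by ext <;> simp
        rw [hz0] at h00
        have hv1 : |(v s).1| ≤ M := (norm_fst_le (v s)).trans hvM
        have hv2 : |(v s).2| ≤ M := (norm_snd_le (v s)).trans hvM
        have hint : |(v s).1 * (∫ ρ in (0 : ℝ)..ε, (fderiv ℝ a' (z s + (0, ρ)) (1, 0)
            + fderiv ℝ b' (z s + (0, ρ)) (0, 1))) - ε * c| ≤ (M * θ + κ) * |ε| := by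
          have hca : Continuous (fderiv ℝ a') := ha'.continuous_fderiv (by simp)
          have hcb' : Continuous (fderiv ℝ b') := hb'.continuous_fderiv (by simp)
          have e1 : (v s).1 * (∫ ρ in (0 : ℝ)..ε, (fderiv ℝ a' (z s + (0, ρ)) (1, 0)
            + fderiv ℝ b' (z s + (0, ρ)) (0, 1))) - ε * c
            = ∫ ρ in (0 : ℝ)..ε, ((v s).1 * (fderiv ℝ a' (z s + (0, ρ)) (1, 0)
            + fderiv ℝ b' (z s + (0, ρ)) (0, 1)) - c) := by
            rw [intervalIntegral.integral_sub (Continuous.intervalIntegrable (by fun_prop) _ _)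
              (by simp), intervalIntegral.integral_const_mul]
            simp
          rw [e1, ← Real.norm_eq_abs]
          have := intervalIntegral.norm_integral_le_of_norm_le_const (a := 0) (b := ε) (C := M * θ + κ)
            (f := fun ρ => (v s).1 * (fderiv ℝ a' (z s + (0, ρ)) (1, 0)
              + fderiv ℝ b' (z s + (0, ρ)) (0, 1)) - c) (fun ρ hρ => ?_)
          · simpa using this
          · obtain ⟨-, hm, hk, -, -⟩ := H s hs ρ ((huI (uIoc_subset_uIcc hρ)).trans hε)
            have h5 := (hab _ hm).2.2
            have e2 : (v s).1 * (fderiv ℝ a' (z s + (0, ρ)) (1, 0)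
              + fderiv ℝ b' (z s + (0, ρ)) (0, 1)) - c
              = (v s).1 * (fderiv ℝ a' (z s + (0, ρ)) (1, 0)
              + fderiv ℝ b' (z s + (0, ρ)) (0, 1) - F (z s + (0, ρ)))
              + ((v s).1 * F (z s + (0, ρ)) - c) := by ring
            rw [e2, Real.norm_eq_abs]
            refine (abs_add_le _ _).trans (add_le_add ?_ hk)
            rw [abs_mul]
            exact mul_le_mul hv1 h5 (abs_nonneg _) hM0.le
        have hb1 : |(b' (z s + (0, ε)) - b' (z s)) - (b (z s + (0, ε)) - b (z s))| ≤ 2 * θ := by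
          have h5 := abs_le.1 (hab _ hε1).2.1
          have h6 := abs_le.1 (hab _ h00).2.1
          exact abs_le.2 ⟨by linarith [h5.1, h6.2], by linarith [h5.2, h6.1]⟩
        have ha1 : |(a' (z s + (0, ε)) - a' (z s)) - (a (z s + (0, ε)) - a (z s))| ≤ 2 * θ := by
          have h5 := abs_le.1 (hab _ hε1).1
          have h6 := abs_le.1 (hab _ h00).1
          exact abs_le.2 ⟨by linarith [h5.1, h6.2], by linarith [h5.2, h6.1]⟩
        have p1 := mul_le_mul hv1 hb1 (abs_nonneg _) hM0.le
        have p2 := mul_le_mul hv2 ha1 (abs_nonneg _) hM0.le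
        rw [← abs_mul] at p1 p2
        have q1 := (abs_le.1 p1).2
        have q2 := (abs_le.1 p2).1
        have q3 := (abs_le.1 hint).1
        linarith
      have hcI : Convex ℝ (Icc (s₀ - ℓ) (s₀ + ℓ)) := convex_Icc _ _
      have hmvt := hcI.mul_sub_le_image_sub_of_le_deriv
        (fun s hs => (hd s hs).continuousAt.continuousWithinAt)
        (fun s hs => (hd s (interior_subset hs)).differentiableAt.differentiableWithinAt)
        (fun s hs => hlow s (interior_subset hs)) s₁ hs₁ s₂ hs₂ h12
      have happ : ∀ s ∈ Icc (s₀ - ℓ) (s₀ + ℓ),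
          |(∫ ρ in (0 : ℝ)..ε, a' (z s + (0, ρ))) - A ε s| ≤ θ * |ε| := by
        intro s hs
        have hac := ha'.continuous
        simp only [hA]
        rw [← intervalIntegral.integral_sub (Continuous.intervalIntegrable (by fun_prop) _ _)
          (hai ε hε s hs), ← Real.norm_eq_abs]
        have := intervalIntegral.norm_integral_le_of_norm_le_const (a := 0) (b := ε) (C := θ)
            (f := fun ρ => a' (z s + (0, ρ)) - a (z s + (0, ρ))) (fun ρ hρ =>
              (hab _ (H s hs ρ ((huI (uIoc_subset_uIcc hρ)).trans hε)).2.1).1)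
        simpa using this
      have r1 := abs_le.1 (happ s₁ hs₁)
      have r2 := abs_le.1 (happ s₂ hs₂)
      rw [hT]
      nlinarith [r1.1, r2.2]
    by_contra! hcon
    -- The constant `T` does not depend on `θ`, so a violated inequality is contradicted by a small
    -- `θ`.
    have h7 := main ((((ε * c - |ε| * κ) * (s₂ - s₁)) - (A ε s₂ - A ε s₁)) / (2 * (T + 1)))
      (div_pos (by linarith) (by positivity))
    have h8 : (((ε * c - |ε| * κ) * (s₂ - s₁)) - (A ε s₂ - A ε s₁)) / (2 * (T + 1)) * T
        ≤ (((ε * c - |ε| * κ) * (s₂ - s₁)) - (A ε s₂ - A ε s₁)) / 2 := by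
      rw [div_mul_eq_mul_div, div_le_div_iff₀ (by positivity) (by positivity)]
      nlinarith
    linarith
  have step2 : ∀ s ∈ Icc (s₀ - ℓ) (s₀ + ℓ), HasDerivAt (fun ε => A ε s) (a (z s)) 0 := by
    intro s hs
    have ho : IsOpen {ρ : ℝ | z s + ((0 : ℝ), ρ) ∈ Metric.ball z₀ r} :=
      Metric.isOpen_ball.preimage (by fun_prop)
    have hcon : ContinuousOn (fun ρ : ℝ => a (z s + (0, ρ))) {ρ : ℝ | z s + ((0 : ℝ), ρ) ∈ Metric.ball z₀ r} :=
      ha.comp (by fun_prop) fun ρ hρ => hρ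
    have h0 : (0 : ℝ) ∈ {ρ : ℝ | z s + ((0 : ℝ), ρ) ∈ Metric.ball z₀ r} :=
      hcb (H s hs 0 (by simpa using hℓ.le)).2.1
    have := intervalIntegral.integral_hasDerivAt_right (a := 0) (b := 0) (hai 0 (by simpa using hℓ.le) s hs)
      (hcon.stronglyMeasurableAtFilter ho 0 h0) (hcon.continuousAt (ho.mem_nhds h0))
    have hz0 : z s + ((0 : ℝ), (0 : ℝ)) = z s := by ext <;> simp
    rw [hz0] at this
    exact this
  -- The derivative at `ε = 0` of the integral over the segment is the value of `a` on the curve.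
  -- The lower bounds for the increments of the integral become two-sided bounds for the increments
  -- of `a`.
  have step3 : ∀ s₁ ∈ Icc (s₀ - ℓ) (s₀ + ℓ), ∀ s₂ ∈ Icc (s₀ - ℓ) (s₀ + ℓ), s₁ ≤ s₂ →
      |a (z s₂) - a (z s₁) - (s₂ - s₁) * c| ≤ κ * (s₂ - s₁) := by
    intro s₁ hs₁ s₂ hs₂ h12
    have hB := (step2 s₂ hs₂).fun_sub (step2 s₁ hs₁)
    have := HasDerivAt.le_of_eventually_le (m := c * (s₂ - s₁)) (κ := κ * (s₂ - s₁)) hB (by simp [hA]) (by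
      filter_upwards [Metric.closedBall_mem_nhds (0 : ℝ) hℓ] with ε hε
      have := step1 ε (by simpa [Real.dist_eq] using hε) s₁ hs₁ s₂ hs₂ h12
      linarith)
    exact abs_le.2 ⟨by linarith [this.1], by linarith [this.2]⟩
  have hs₀ : s₀ ∈ Icc (s₀ - ℓ) (s₀ + ℓ) := ⟨by linarith, by linarith⟩
  filter_upwards [Icc_mem_nhds (show s₀ - ℓ < s₀ by linarith) (show s₀ < s₀ + ℓ by linarith)] with s hs
  rw [smul_eq_mul, Real.norm_eq_abs, Real.norm_eq_abs]
  rcases le_total s₀ s with h | h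
  · rw [abs_of_nonneg (sub_nonneg.2 h)]
    exact step3 s₀ hs₀ s hs h
  · rw [abs_of_nonpos (sub_nonpos.2 h)]
    have := step3 s hs s₀ hs₀ h
    rw [← abs_neg]
    have e : -(a (z s) - a (z s₀) - (s - s₀) * c) = a (z s₀) - a (z s) - (s₀ - s) * c := by ring
    rw [e]
    linarith

/-! ### Independence of the outer normal from the defining function -/

/-- The Euclidean unit vector in the direction of `n`. -/
def unitVec (n : ℝ × ℝ) : ℝ × ℝ := (horizLength n)⁻¹ • n

lemma horizLength_pos {n : ℝ × ℝ} (h : n ≠ 0) : 0 < horizLength n := by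
  have := dot_self_pos h
  exact Real.sqrt_pos.2 (by simpa [dot, sq] using this)

lemma horizLength_smul {μ : ℝ} (hμ : 0 ≤ μ) (n : ℝ × ℝ) : horizLength (μ • n) = μ * horizLength n := by
  simp only [horizLength, Prod.smul_fst, Prod.smul_snd, smul_eq_mul]
  have : (μ * n.1) ^ 2 + (μ * n.2) ^ 2 = μ ^ 2 * (n.1 ^ 2 + n.2 ^ 2) := by ring
  rw [this, Real.sqrt_mul (sq_nonneg _), Real.sqrt_sq hμ]

lemma unitVec_smul {μ : ℝ} (hμ : 0 < μ) (n : ℝ × ℝ) : unitVec (μ • n) = unitVec n := by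
  rw [unitVec, unitVec, horizLength_smul hμ.le, smul_smul, mul_inv, mul_comm μ⁻¹, mul_assoc,
    inv_mul_cancel₀ hμ.ne', mul_one]

lemma unitVec_unitVec {n : ℝ × ℝ} (h : n ≠ 0) : unitVec (unitVec n) = unitVec n :=
  unitVec_smul (inv_pos.2 (horizLength_pos h)) n

lemma unitVec_ne_zero {n : ℝ × ℝ} (h : n ≠ 0) : unitVec n ≠ 0 :=
  smul_ne_zero (inv_pos.2 (horizLength_pos h)).ne' h

lemma contDiffAt_unitVec {n : ℝ × ℝ} (h : n ≠ 0) {m : WithTop ℕ∞} : ContDiffAt ℝ m unitVec n := by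
  have h1 : n.1 ^ 2 + n.2 ^ 2 ≠ 0 := (Real.sqrt_pos.1 (horizLength_pos h)).ne'
  have h2 : ContDiffAt ℝ m (fun n : ℝ × ℝ => n.1 ^ 2 + n.2 ^ 2) n := by fun_prop
  exact ((h2.sqrt h1).inv (horizLength_pos h).ne').smul contDiffAt_id

lemma IsOuterNormal.eq_unitVec {E : Set Heis} {p : Heis} {ν : ℝ × ℝ} (h : IsOuterNormal E p ν) :
    ∃ (U : Set Heis) (g : Heis → ℝ) (G : Heis → ℝ × ℝ), p ∈ U ∧
      IsHDefiningFunction (frontier E) U g G ∧ (∀ q ∈ U, q ∈ E → g q ≤ 0) ∧ ν = unitVec (G p) := h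

lemma eventually_pos_hflow {U : Set Heis} {g : Heis → ℝ} {G : Heis → ℝ × ℝ}
    (hg : HasHorizontalGradient U g G) (hU : IsOpen U) {p : Heis} (hp : p ∈ U) (h0 : g p = 0)
    {v : ℝ × ℝ} (hv : dot (G p) v < 0) : ∀ᶠ s in 𝓝[>] (0 : ℝ), g (p + s • horiz p v) < 0 := by
  have h1 := (hasDerivAt_iff_tendsto_slope.1 (hg.hasDerivAt_hflow hU hp v)).mono_left
    (nhdsWithin_mono (0 : ℝ) (fun x (hx : x ∈ Ioi (0 : ℝ)) => ne_of_gt hx))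
  filter_upwards [h1.eventually (gt_mem_nhds hv), self_mem_nhdsWithin] with s hs hs0
  have hs0' : (0 : ℝ) < s := hs0
  rw [slope_def_field, zero_smul, add_zero, h0, sub_zero, sub_zero] at hs
  exact (div_neg_iff.1 hs).resolve_left (fun h => absurd h.2 (not_lt.2 hs0'.le)) |>.1

lemma tendsto_hflow (p : Heis) (v : ℝ × ℝ) :
    Filter.Tendsto (fun s : ℝ => p + s • horiz p v) (𝓝[>] 0) (𝓝 p) := by
  have h : Continuous fun s : ℝ => p + s • horiz p v := by fun_prop
  simpa using (h.tendsto 0).mono_left nhdsWithin_le_nhds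

namespace IsGraphChart

variable {σ e k r b : ℝ} {E N : Set Heis} {q : (ℝ × ℝ) × ℝ} {C : ℝ≥0} {ψ : ℝ × ℝ → ℝ}

lemma defining_eq_zero_iff (h : IsGraphChart σ e k E N q r b C ψ) {U : Set Heis} {g : Heis → ℝ}
    {G : Heis → ℝ × ℝ} (hg : IsHDefiningFunction (frontier E) U g G) (hNU : N ⊆ U) {p : Heis}
    (hp : p ∈ chartBox σ e k q r b) : g p = 0 ↔ ψ (zw σ e k p).1 = (zw σ e k p).2 := by
  have hpU : p ∈ U := hNU (h.mem_of_mem_closedBox (closure_chartBox_subset (subset_closure hp)))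
  rw [← h.mem_frontier_iff hp]
  constructor
  · intro h0
    have : p ∈ frontier E ∩ U := by rw [hg.2.2.2]; exact ⟨hpU, h0⟩
    exact this.1
  · intro hF
    have : p ∈ frontier E ∩ U := ⟨hF, hpU⟩
    rw [hg.2.2.2] at this
    exact this.2

/-- A defining function that is nonpositive on `E` is positive below the graph. -/
lemma defining_pos (h : IsGraphChart σ e k E N q r b C ψ) {U : Set Heis} {g : Heis → ℝ}
    {G : Heis → ℝ × ℝ} (hg : IsHDefiningFunction (frontier E) U g G)
    (hgE : ∀ p ∈ U, p ∈ E → g p ≤ 0) (hNU : N ⊆ U) {p : Heis} (hp : p ∈ chartBox σ e k q r b)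
    (hlt : (zw σ e k p).2 < ψ (zw σ e k p).1) : 0 < g p := by
  have hboxU : ∀ x ∈ chartBox σ e k q r b, x ∈ U := fun x hx =>
    hNU (h.mem_of_mem_closedBox (closure_chartBox_subset (subset_closure hx)))
  set L : Set Heis := {x ∈ chartBox σ e k q r b | (zw σ e k x).2 < ψ (zw σ e k x).1} with hL
  -- The region of the box below the graph is a continuous image of a convex set. The function `g`
  -- has no zero in it, so its sign is decided at one point.
  have hLconn : IsPreconnected L := by
    set Φ : (ℝ × ℝ) × ℝ → Heis := fun x =>
      zwInv σ e k (x.1, q.2 - b + x.2 * (ψ x.1 - (q.2 - b))) with hΦ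
    have hΦc : Continuous Φ := by
      have := h.lipschitz.continuous
      exact (contDiff_zwInv (n := 0)).continuous.comp (by fun_prop)
    have : L = Φ '' (Metric.ball q.1 r ×ˢ Ioo (0 : ℝ) 1) := by
      ext x
      constructor
      · rintro ⟨hx, hxl⟩
        have hx2 : q.2 - b < (zw σ e k x).2 := hx.2.1
        have hd : 0 < ψ (zw σ e k x).1 - (q.2 - b) := by linarith
        refine ⟨((zw σ e k x).1, ((zw σ e k x).2 - (q.2 - b)) / (ψ (zw σ e k x).1 - (q.2 - b))),
          ⟨hx.1, div_pos (by linarith) hd, (div_lt_one hd).2 (by linarith)⟩, ?_⟩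
        simp only [hΦ]
        rw [div_mul_cancel₀ _ hd.ne', add_sub_cancel, Prod.mk.eta, zwInv_zw h.sq]
      · rintro ⟨⟨z, t⟩, ⟨hz, ht⟩, rfl⟩
        have hI := h.graph_mem_Ioo (Metric.ball_subset_closedBall hz)
        have hI1 : q.2 - b < ψ z := hI.1
        have hI2 : ψ z < q.2 + b := hI.2
        have h1 : 0 < ψ z - (q.2 - b) := by linarith
        have h2 : 0 < t * (ψ z - (q.2 - b)) := mul_pos ht.1 h1
        have h3 : t * (ψ z - (q.2 - b)) < ψ z - (q.2 - b) := by
          have := mul_lt_mul_of_pos_right ht.2 h1; linarith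
        have e1 : zw σ e k (Φ (z, t)) = (z, q.2 - b + t * (ψ z - (q.2 - b))) := zw_zwInv h.sq _
        have e2 : Φ (z, t) ∈ chartBox σ e k q r b := by
          rw [chartBox, mem_preimage, e1]
          exact ⟨hz, show q.2 - b < q.2 - b + t * (ψ z - (q.2 - b)) by linarith,
            show q.2 - b + t * (ψ z - (q.2 - b)) < q.2 + b by linarith⟩
        refine ⟨e2, ?_⟩
        rw [e1]
        change q.2 - b + t * (ψ z - (q.2 - b)) < ψ z
        linarith
    rw [this]
    exact ((convex_ball _ _).prod (convex_Ioo _ _)).isPreconnected.image _ hΦc.continuousOn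
  have hgc : ContinuousOn g L := hg.2.1.continuousOn.mono fun x hx => hboxU x hx.1
  have hne : ∀ x ∈ L, g x ≠ 0 := fun x hx h0 =>
    absurd ((h.defining_eq_zero_iff hg hNU hx.1).1 h0) hx.2.ne'
  -- Moving from the centre of the chart along the horizontal gradient makes `g` positive. Such a
  -- point is not on the graph, where `g` vanishes, nor above it, where `g ≤ 0`.
  obtain ⟨x, hxL, hx⟩ : ∃ x ∈ L, 0 < g x := by
    have hz := Metric.mem_ball_self (x := q.1) h.r_pos
    set c := zwInv σ e k (q.1, ψ q.1) with hc
    have hcb : c ∈ chartBox σ e k q r b := h.graph_mem_chartBox hz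
    have hcU := hboxU c hcb
    have hc0 : g c = 0 := (h.defining_eq_zero_iff hg hNU hcb).2 (by rw [hc, zw_zwInv h.sq])
    have hneg : dot ((-G c)) (-(-G c)) < 0 := by
      have := dot_self_pos (hg.2.2.1 c hcU)
      simp only [dot, Prod.fst_neg, Prod.snd_neg, neg_neg] at this ⊢
      linarith
    have hpos : ∀ᶠ s in 𝓝[>] (0 : ℝ), 0 < g (c + s • horiz c (G c)) := by
      have h1 := (hasDerivAt_iff_tendsto_slope.1 (hg.2.1.hasDerivAt_hflow hg.1 hcU (G c))).mono_left
        (nhdsWithin_mono (0 : ℝ) (fun x (hx : x ∈ Ioi (0 : ℝ)) => ne_of_gt hx))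
      filter_upwards [h1.eventually (lt_mem_nhds (dot_self_pos (hg.2.2.1 c hcU))),
        self_mem_nhdsWithin] with s hs hs0
      have hs0' : (0 : ℝ) < s := hs0
      rw [slope_def_field, zero_smul, add_zero, hc0, sub_zero, sub_zero] at hs
      exact (div_pos_iff_of_pos_right hs0').1 hs
    obtain ⟨s, hs, hs'⟩ := (hpos.and ((tendsto_hflow c (G c)).eventually_mem
      ((isOpen_chartBox σ e k q r b).mem_nhds hcb))).exists
    refine ⟨_, ⟨hs', ?_⟩, hs⟩
    by_contra! hle
    rcases hle.eq_or_lt with heq | hlt'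
    · exact hs.ne' ((h.defining_eq_zero_iff hg hNU hs').2 heq)
    · exact absurd (hgE _ (hboxU _ hs') ((h.epigraph hs').1 hlt')) (not_le.2 hs)
  by_contra! hle
  obtain ⟨y, hy, hy0⟩ := hLconn.intermediate_value (show p ∈ L from ⟨hp, hlt⟩) hxL hgc ⟨hle, hx.le⟩
  exact hne y hy hy0

/-- The outer normal does not depend on the defining function. -/
lemma outerNormal_eq (h : IsGraphChart σ e k E N q r b C ψ) {U : Set Heis} {g : Heis → ℝ}
    {G : Heis → ℝ × ℝ} (hg : IsHDefiningFunction (frontier E) U g G)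
    (hgE : ∀ p ∈ U, p ∈ E → g p ≤ 0) (hNU : N ⊆ U) {p : Heis} (hp : p ∈ chartBox σ e k q r b)
    (hpE : p ∈ frontier E) {ν : ℝ × ℝ} (hν : IsOuterNormal E p ν) : ν = unitVec (G p) := by
  obtain ⟨U', g', G', hpU', hg', hgE', rfl⟩ := hν.eq_unitVec
  have hpU : p ∈ U := hNU (h.mem_of_mem_closedBox (closure_chartBox_subset (subset_closure hp)))
  have h0 : g p = 0 := by
    have : p ∈ frontier E ∩ U := ⟨hpE, hpU⟩
    rw [hg.2.2.2] at this
    exact this.2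
  have h0' : g' p = 0 := by
    have : p ∈ frontier E ∩ U' := ⟨hpE, hpU'⟩
    rw [hg'.2.2.2] at this
    exact this.2
  -- In directions where `g` decreases the points satisfy `g < 0`, so they lie above the graph and
  -- belong to `E`, where `g' ≤ 0`. One gradient is therefore a positive multiple of the other.
  obtain ⟨μ, hμ, hG⟩ := exists_eq_smul_of_halfplane (n := G p) (G := G' p) (hg.2.2.1 p hpU) (by
    intro v hv
    have hslope := (hasDerivAt_iff_tendsto_slope.1 (hg'.2.1.hasDerivAt_hflow hg'.1 hpU' v)).mono_left
      (nhdsWithin_mono (0 : ℝ) (fun x (hx : x ∈ Ioi (0 : ℝ)) => ne_of_gt hx))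
    refine le_of_tendsto hslope ?_
    filter_upwards [eventually_pos_hflow hg.2.1 hg.1 hpU h0 hv, self_mem_nhdsWithin,
      (tendsto_hflow p v).eventually_mem ((isOpen_chartBox σ e k q r b).mem_nhds hp),
      (tendsto_hflow p v).eventually_mem (hg'.1.mem_nhds hpU')] with s hs hs0 hsb hsU'
    have hs0' : (0 : ℝ) < s := hs0
    rw [slope_def_field, zero_smul, add_zero, h0', sub_zero, sub_zero]
    refine div_nonpos_of_nonpos_of_nonneg (hgE' _ hsU' ((h.epigraph hsb).1 ?_)) hs0'.le
    by_contra! hle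
    rcases hle.eq_or_lt with heq | hlt
    · exact hs.ne ((h.defining_eq_zero_iff hg hNU hsb).2 heq.symm)
    · exact absurd (h.defining_pos hg hgE hNU hsb hlt) (not_lt.2 hs.le))
  have hμ0 : 0 < μ := lt_of_le_of_ne hμ fun h0 => hg'.2.2.1 p hpU' (by rw [hG, ← h0, zero_smul])
  rw [hG, unitVec_smul hμ0]

end IsGraphChart

/-! ### Regularity of characteristic curves -/

lemma supportMap_smul {K : Set (ℝ × ℝ)} {π : ℝ × ℝ → ℝ × ℝ} (hπ : ∀ n, IsSupportPoint K n (π n))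
    (huniq : ∀ n x, n ≠ 0 → IsSupportPoint K n x → x = π n) {μ : ℝ} (hμ : 0 < μ) {n : ℝ × ℝ}
    (hn : n ≠ 0) : π (μ • n) = π n := by
  refine huniq n _ hn ⟨(hπ _).1, fun x hx => ?_⟩
  have h1 := (hπ (μ • n)).2 x hx
  have h2 : ∀ y, dot (μ • n) y = μ * dot n y := fun y => by
    simp only [dot, Prod.smul_fst, Prod.smul_snd, smul_eq_mul]; ring
  rw [h2, h2] at h1
  exact le_of_mul_le_mul_left h1 hμ

/-- Along a characteristic curve the component of the dual field of the normal that is transversal to the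
fibres of a graph chart is differentiable. -/
lemma IsGraphChart.hasDerivAt_dual {K : Set (ℝ × ℝ)} (hK : IsC2PlusBody K) {σ e k r b : ℝ}
    {E N Ω : Set Heis} {C : ℝ≥0} {ψ : ℝ × ℝ → ℝ} {Γ : ℝ → Heis} {s₀ : ℝ}
    (h : IsGraphChart σ e k E N (zw σ e k (Γ s₀)) r b C ψ) (hz1 : (zw σ e k (Γ s₀)).1.1 ≠ 0)
    {f : Heis → ℝ} (hf : ContinuousOn f Ω) (hpc : HasPrescribedCurvature K Ω E f) (hNΩ : N ⊆ Ω)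
    {π : ℝ × ℝ → ℝ × ℝ} (hπ : ∀ n, IsSupportPoint K n (π n)) (hπc : ContinuousOn π {0}ᶜ)
    {U : Set Heis} {g : Heis → ℝ} {G : Heis → ℝ × ℝ}
    (hg : IsHDefiningFunction (frontier E) U g G) (hgE : ∀ p ∈ U, p ∈ E → g p ≤ 0) (hNU : N ⊆ U)
    (hΓE : ∀ᶠ s in 𝓝 s₀, Γ s ∈ frontier E)
    (hΓ : ∀ᶠ s in 𝓝 s₀, HasDerivAt Γ (horiz (Γ s) (J (unitVec (G (Γ s))))) s) :
    HasDerivAt (fun s => (π (G (Γ s))).2 - e * (π (G (Γ s))).1)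
      (((unitVec (G (Γ s₀))).1 + e * (unitVec (G (Γ s₀))).2) * f (Γ s₀)) s₀ := by
  set q := zw σ e k (Γ s₀) with hq
  have hcinv := (contDiff_zwInv (σ := σ) (e := e) (k := k) (n := 0)).continuous
  have hψc := h.lipschitz.continuous
  set P : ℝ × ℝ → Heis := fun z => zwInv σ e k (z, ψ z) with hP
  have hPc : Continuous P := hcinv.comp (by fun_prop)
  have hPU : ∀ z ∈ Metric.ball q.1 r, P z ∈ U := fun z hz =>
    hNU (h.graph_mem (Metric.ball_subset_closedBall hz))
  have hPΩ : ∀ z ∈ Metric.ball q.1 r, P z ∈ Ω := fun z hz =>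
    hNΩ (h.graph_mem (Metric.ball_subset_closedBall hz))
  set Q : ℝ × ℝ → ℝ × ℝ := fun z => π (G (P z)) with hQ
  have hQc : ContinuousOn Q (Metric.ball q.1 r) :=
    hπc.comp (hg.2.1.continuousOn_gradient.comp hPc.continuousOn hPU) fun z hz => hg.2.2.1 _ (hPU z hz)
  have hFc : ContinuousOn (fun z => f (P z)) (Metric.ball q.1 r) := hf.comp hPc.continuousOn hPΩ
  have hac : ContinuousOn (fun z => (Q z).2 - e * (Q z).1) (Metric.ball q.1 r) :=
    hQc.snd.sub (continuousOn_const.mul hQc.fst)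
  have hbc : ContinuousOn (fun z : ℝ × ℝ => 2 * z.1 * (Q z).1) (Metric.ball q.1 r) :=
    (by fun_prop : Continuous fun z : ℝ × ℝ => 2 * z.1).continuousOn.mul hQc.fst
  have hweak : ∀ η : ℝ × ℝ → ℝ, ContDiff ℝ ∞ η → HasCompactSupport η →
      tsupport η ⊆ Metric.ball q.1 r → ∫ z, (((Q z).2 - e * (Q z).1) * fderiv ℝ η z (1, 0)
        + 2 * z.1 * (Q z).1 * fderiv ℝ η z (0, 1)) = -∫ z, f (P z) * η z := by
    intro η hη hηc hηs
    rw [← h.weak_equation hK hf hpc hNΩ hπ hπc hg hgE hNU hη hηc hηs]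
    refine integral_congr_ae (.of_forall fun z => ?_)
    simp only [dot, normalVariation, hQ, hP]
    ring
  set ν : ℝ → ℝ × ℝ := fun s => unitVec (G (Γ s)) with hν
  set z : ℝ → ℝ × ℝ := fun s => (zw σ e k (Γ s)).1 with hz
  set v : ℝ → ℝ × ℝ := fun s => (zwHoriz σ e (z s) (J (ν s))).1 with hv
  have hΓc : ContinuousAt Γ s₀ := hΓ.self_of_nhds.continuousAt
  have hqmem : Γ s₀ ∈ chartBox σ e k q r b := by
    refine ⟨Metric.mem_ball_self h.r_pos, ?_⟩
    have := h.b_pos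
    constructor <;> linarith
  have hbox : ∀ᶠ s in 𝓝 s₀, Γ s ∈ chartBox σ e k q r b :=
    hΓc.eventually_mem ((isOpen_chartBox _ _ _ _ _ _).mem_nhds hqmem)
  have hboxU : ∀ x ∈ chartBox σ e k q r b, x ∈ U := fun x hx =>
    hNU (h.mem_of_mem_closedBox (closure_chartBox_subset (subset_closure hx)))
  have hΓP : ∀ᶠ s in 𝓝 s₀, P (z s) = Γ s := by
    filter_upwards [hbox, hΓE] with s hs hsE
    simp only [hP, hz]
    rw [(h.mem_frontier_iff hs).1 hsE, Prod.mk.eta, zwInv_zw h.sq]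
  have hzd : ∀ᶠ s in 𝓝 s₀, HasDerivAt z (v s) s := by
    filter_upwards [hΓ] with s hs
    exact (hasDerivAt_zw_comp (σ := σ) (e := e) (k := k) hs).fst
  have hνc : ContinuousAt ν s₀ := by
    have h1 : ContinuousAt G (Γ s₀) :=
      hg.2.1.continuousOn_gradient.continuousAt (hg.1.mem_nhds (hboxU _ hqmem))
    have h2 : ContinuousAt unitVec (G (Γ s₀)) :=
      (contDiffAt_unitVec (m := 0) (hg.2.2.1 _ (hboxU _ hqmem))).continuousAt
    exact ContinuousAt.comp (f := fun s => G (Γ s)) (g := unitVec) h2 (ContinuousAt.comp h1 hΓc)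
  have hzc : ContinuousAt z s₀ := hzd.self_of_nhds.continuousAt
  have hvc : ContinuousAt v s₀ := by
    simp only [hv, zwHoriz, J]
    exact ((hνc.fst).sub ((hνc.snd.neg).const_mul e)).prodMk
      (((hzc.fst).const_mul 2).mul hνc.snd.neg)
  -- A vertical shift does not change `z₁`, and the flux difference collapses to `2 z₁` times the
  -- change of `dot ν Q`. As `Q (z s)` is the support point in the direction `ν` and the shifted
  -- value of `Q` lies in `K`, this change is nonpositive.
  have hflux : ∀ᶠ x : ℝ × ℝ in 𝓝 (s₀, 0), ∃ m : ℝ, 0 ≤ m ∧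
      (v x.1).1 * (2 * (z x.1 + (0, x.2)).1 * (Q (z x.1 + (0, x.2))).1 - 2 * (z x.1).1 * (Q (z x.1)).1)
      - (v x.1).2 * ((Q (z x.1 + (0, x.2))).2 - e * (Q (z x.1 + (0, x.2))).1
        - ((Q (z x.1)).2 - e * (Q (z x.1)).1)) = -(z x.1).1 * m := by
    have hfst : Filter.Tendsto (fun x : ℝ × ℝ => x.1) (𝓝 (s₀, (0 : ℝ))) (𝓝 s₀) :=
      continuous_fst.tendsto (s₀, (0 : ℝ))
    filter_upwards [hfst.eventually hΓP, hfst.eventually hbox] with x hx hxb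
    have hGne := hg.2.2.1 _ (hboxU _ hxb)
    refine ⟨2 * (dot (ν x.1) (Q (z x.1)) - dot (ν x.1) (Q (z x.1 + (0, x.2)))), ?_, ?_⟩
    · have h1 := (hπ (G (Γ x.1))).2 (Q (z x.1 + (0, x.2))) (hπ _).1
      have h2 : ∀ y, dot (ν x.1) y = (horizLength (G (Γ x.1)))⁻¹ * dot (G (Γ x.1)) y := fun y => by
        simp only [hν, unitVec, dot, Prod.smul_fst, Prod.smul_snd, smul_eq_mul]; ring
      have h3 : Q (z x.1) = π (G (Γ x.1)) := by simp only [hQ, hx]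
      rw [h2, h2, h3]
      have h4 := mul_le_mul_of_nonneg_left h1 (inv_pos.2 (horizLength_pos hGne)).le
      linarith
    · simp only [hv, zwHoriz, J, dot, Prod.fst_add, add_zero]
      ring
  have hfinal : HasDerivAt (fun s => (Q (z s)).2 - e * (Q (z s)).1) ((v s₀).1 * f (P q.1)) s₀ := by
    have hz1c : Filter.Tendsto (fun x : ℝ × ℝ => (z x.1).1) (𝓝 (s₀, (0 : ℝ))) (𝓝 q.1.1) :=
      (hzc.tendsto.fst_nhds).comp (continuous_fst.tendsto (s₀, (0 : ℝ)))
    -- The sign of the flux difference is governed by `z₁`. When `z₁ < 0` the equation is multiplied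
    -- by `-1`.
    rcases lt_or_gt_of_ne hz1 with hneg | hpos
    · have hd := hasDerivAt_comp_of_weak (a := fun z => -((Q z).2 - e * (Q z).1))
        (b := fun z => -(2 * z.1 * (Q z).1)) (F := fun z => -f (P z)) h.r_pos hac.neg hbc.neg hFc.neg (fun η hη hηc hηs => by
        have := hweak η hη hηc hηs
        simp only [neg_mul]
        rw [integral_neg, ← this, ← integral_neg]
        refine integral_congr_ae (.of_forall fun x => ?_)
        ring) (z := z) (v := v) rfl hzd hvc (by
          filter_upwards [hflux, hz1c.eventually (gt_mem_nhds hneg)] with x hx hx1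
          obtain ⟨m, hm, hxm⟩ := hx
          have := mul_nonneg (neg_pos.2 hx1).le hm
          linarith)
      have hd' := hd.fun_neg
      refine hd'.congr_deriv (by ring) |>.congr_of_eventuallyEq (.of_forall fun s => ?_)
      ring
    · exact hasDerivAt_comp_of_weak h.r_pos hac hbc hFc hweak (z := z) (v := v) rfl hzd hvc (by
          filter_upwards [hflux, hz1c.eventually (lt_mem_nhds hpos)] with x hx hx1
          obtain ⟨m, hm, hxm⟩ := hx
          have := mul_nonneg hx1.le hm
          linarith)
  have hPq : P q.1 = Γ s₀ := hΓP.self_of_nhds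
  rw [hPq] at hfinal
  refine (hfinal.congr_of_eventuallyEq ?_).congr_deriv ?_
  · filter_upwards [hΓP] with s hs
    simp only [hQ, hs]
  · simp only [hv, zwHoriz, J, hν]
    ring

/-- The normal is a `C¹` function of the support point. -/
lemma contDiffAt_normal_of_support {K : Set (ℝ × ℝ)} (hK : IsC2PlusBody K) {ν x : ℝ → ℝ × ℝ} {s₀ : ℝ}
    (hν : ∀ᶠ s in 𝓝 s₀, ν s ≠ 0 ∧ unitVec (ν s) = ν s ∧ IsSupportPoint K (ν s) (x s))
    (hx : ContDiffAt ℝ 1 x s₀) : ContDiffAt ℝ 1 ν s₀ := by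
  obtain ⟨h0, -, hs0⟩ := hν.self_of_nhds
  obtain ⟨U, φ, hU, hxU, hφ, hKU, hd, -⟩ := hK.boundary _ (hs0.mem_frontier h0)
  have hgradc : ContDiffAt ℝ 1 (fderiv ℝ φ) (x s₀) :=
    (hφ.contDiffAt (hU.mem_nhds hxU)).fderiv_right (by norm_num)
  have hgrad : ContDiffAt ℝ 1 (grad φ) (x s₀) :=
    (hgradc.clm_apply contDiffAt_const).prodMk (hgradc.clm_apply contDiffAt_const)
  have hgx : ContDiffAt ℝ 1 (fun s => grad φ (x s)) s₀ := hgrad.comp s₀ hx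
  have hg0 : grad φ (x s₀) ≠ 0 := by
    obtain ⟨μ, hμ, hg⟩ := hs0.grad_eq_smul h0 hU hxU hφ hKU hd
    rw [hg]
    exact smul_ne_zero hμ.ne' h0
  -- The unit normal at a boundary point is the normalized gradient of a `C²` defining function,
  -- hence `C¹` in the point.
  have hcomp : ContDiffAt ℝ 1 (fun s => unitVec (grad φ (x s))) s₀ :=
    ContDiffAt.comp (g := unitVec) (f := fun s => grad φ (x s)) s₀ (contDiffAt_unitVec hg0) hgx
  refine hcomp.congr_of_eventuallyEq ?_
  have hdne : ∀ᶠ s in 𝓝 s₀, fderiv ℝ φ (x s) ≠ 0 :=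
    (hgradc.continuousAt.comp hx.continuousAt).eventually_ne hd
  filter_upwards [hν, hx.continuousAt.eventually_mem (hU.mem_nhds hxU), hdne] with s hs hsU hsd
  obtain ⟨μ, hμ, hg⟩ := hs.2.2.grad_eq_smul hs.1 hU hsU hφ hKU hsd
  rw [hg, unitVec_smul hμ, hs.2.1]

/-- Near each of its points the normal along a characteristic curve is continuous, and its dual vector is
differentiable with derivative `f J(ν)`. -/
lemma IsRegularPrescribed.hasDerivAt_support {K : Set (ℝ × ℝ)} {Ω E : Set Heis} {f : Heis → ℝ}
    (hK : IsC2PlusBody K) (hE : IsRegularPrescribed K Ω E f) {π : ℝ × ℝ → ℝ × ℝ}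
    (hπ : ∀ n, IsSupportPoint K n (π n)) (huniq : ∀ n x, n ≠ 0 → IsSupportPoint K n x → x = π n)
    (hπc : ContinuousOn π {0}ᶜ) {I : Set ℝ} (hI : IsOpen I) {Γ : ℝ → Heis} {ν : ℝ → ℝ × ℝ}
    (hΓ : ∀ s ∈ I, Γ s ∈ frontier E ∩ Ω) (hν : ∀ s ∈ I, IsOuterNormal E (Γ s) (ν s))
    (hd : ∀ s ∈ I, HasDerivAt Γ (horiz (Γ s) (J (ν s))) s) {s₀ : ℝ} (hs₀ : s₀ ∈ I) :
    ContinuousAt ν s₀ ∧ HasDerivAt (fun s => π (ν s)) (f (Γ s₀) • J (ν s₀)) s₀ := by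
  obtain ⟨hp, hpΩ⟩ := hΓ s₀ hs₀
  obtain ⟨U, g, G, hpU, hg, hgE, -⟩ := (hν s₀ hs₀).eq_unitVec
  obtain ⟨U₂, A, C, ψ₀, hU₂, hpU₂, hψ₀, hepi⟩ := hE.lipschitz _ (hΓ s₀ hs₀)
  have hN : U ∩ Ω ∈ 𝓝 (Γ s₀) := (hg.1.inter hE.isOpen).mem_nhds ⟨hpU, hpΩ⟩
  obtain ⟨σ, e, k, σ', e', k', hee, ⟨hσ, hz, hcone⟩, hσ', hz', hcone'⟩ :=
    exists_zw_directions A C (Γ s₀)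
  obtain ⟨r, b, C₁, ψ, h⟩ := exists_isGraphChart hσ hU₂ hψ₀ hepi hpU₂ hp hN hcone
  obtain ⟨r', b', C₁', ψ', h'⟩ := exists_isGraphChart hσ' hU₂ hψ₀ hepi hpU₂ hp hN hcone'
  have hΓc : ContinuousAt Γ s₀ := (hd s₀ hs₀).continuousAt
  have hmem : Γ s₀ ∈ chartBox σ e k (zw σ e k (Γ s₀)) r b := by
    refine ⟨Metric.mem_ball_self h.r_pos, ?_⟩
    have := h.b_pos
    constructor <;> linarith
  have hνG : ∀ᶠ s in 𝓝 s₀, ν s = unitVec (G (Γ s)) := by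
    filter_upwards [hI.mem_nhds hs₀, hΓc.eventually_mem ((isOpen_chartBox _ _ _ _ _ _).mem_nhds hmem)]
      with s hs hsb
    exact h.outerNormal_eq hg hgE inter_subset_left hsb (hΓ s hs).1 (hν s hs)
  have hGne : ∀ᶠ s in 𝓝 s₀, G (Γ s) ≠ 0 := by
    filter_upwards [hΓc.eventually_mem (hg.1.mem_nhds hpU)] with s hs
    exact hg.2.2.1 _ hs
  have hΓE : ∀ᶠ s in 𝓝 s₀, Γ s ∈ frontier E := by
    filter_upwards [hI.mem_nhds hs₀] with s hs using (hΓ s hs).1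
  have hΓd : ∀ᶠ s in 𝓝 s₀, HasDerivAt Γ (horiz (Γ s) (J (unitVec (G (Γ s))))) s := by
    filter_upwards [hI.mem_nhds hs₀, hνG] with s hs hsν
    rw [← hsν]
    exact hd s hs
  have d₁ := h.hasDerivAt_dual hK hz hE.continuousOn hE.prescribed inter_subset_right hπ hπc hg hgE
    inter_subset_left hΓE hΓd
  have d₂ := h'.hasDerivAt_dual hK hz' hE.continuousOn hE.prescribed inter_subset_right hπ hπc hg hgE
    inter_subset_left hΓE hΓd
  have hπν : ∀ᶠ s in 𝓝 s₀, π (ν s) = π (G (Γ s)) := by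
    filter_upwards [hνG, hGne] with s hs hs'
    rw [hs, unitVec, supportMap_smul hπ huniq (inv_pos.2 (horizLength_pos hs')) hs']
  have hν₀ := hνG.self_of_nhds
  refine ⟨?_, ?_⟩
  · have h1 : ContinuousAt G (Γ s₀) := hg.2.1.continuousOn_gradient.continuousAt (hg.1.mem_nhds hpU)
    have h2 : ContinuousAt unitVec (G (Γ s₀)) :=
      (contDiffAt_unitVec (m := 0) (hg.2.2.1 _ hpU)).continuousAt
    exact (ContinuousAt.comp (f := fun s => G (Γ s)) (g := unitVec) h2
      (ContinuousAt.comp h1 hΓc)).congr_of_eventuallyEq hνG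
  · have hne : e' - e ≠ 0 := sub_ne_zero.2 hee.symm
    -- The two charts differentiate `Q₂ - e Q₁` and `Q₂ - e' Q₁`. As `e ≠ e'`, their difference
    -- isolates `Q₁`, and then `Q₂` follows.
    have c₁ : HasDerivAt (fun s => (π (G (Γ s))).1) (-(unitVec (G (Γ s₀))).2 * f (Γ s₀)) s₀ := by
      have := (d₁.fun_sub d₂).div_const (e' - e)
      refine (this.congr_of_eventuallyEq (.of_forall fun s => ?_)).congr_deriv ?_
      · simp only; field_simp; ring
      · field_simp; ring
    have c₂ : HasDerivAt (fun s => (π (G (Γ s))).2) ((unitVec (G (Γ s₀))).1 * f (Γ s₀)) s₀ := by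
      have := d₁.fun_add (c₁.const_mul e)
      refine (this.congr_of_eventuallyEq (.of_forall fun s => ?_)).congr_deriv ?_
      · simp only; ring
      · ring
    refine ((c₁.prodMk c₂).congr_of_eventuallyEq hπν).congr_deriv ?_
    rw [hν₀]
    ext <;> simp [J, mul_comm]

/-- Characteristic curves of sets of prescribed continuous sub-Finsler mean curvature are of class `C²`. -/
theorem IsRegularPrescribed.contDiffOn_characteristic {K : Set (ℝ × ℝ)} {Ω E : Set Heis} {f : Heis → ℝ}
    (hK : IsC2PlusBody K) (hE : IsRegularPrescribed K Ω E f) {I : Set ℝ} (hI : IsOpen I) {Γ : ℝ → Heis}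
    (hΓ : IsCharacteristicCurve Ω E I Γ) : ContDiffOn ℝ 2 Γ I := by
  obtain ⟨π, hπ, huniq, hπc⟩ := hK.exists_supportMap
  have hΓ₁ : ∀ s ∈ I, Γ s ∈ frontier E ∩ Ω := fun s hs => (hΓ s hs).1
  choose! ν hν hd using fun s hs => (hΓ s hs).2
  have hΓc : ContinuousOn Γ I := fun s hs => (hd s hs).continuousAt.continuousWithinAt
  have key := fun s (hs : s ∈ I) => hE.hasDerivAt_support hK hπ huniq hπc hI hΓ₁ hν hd hs
  have hνc : ContinuousOn ν I := fun s hs => (key s hs).1.continuousWithinAt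
  -- The bootstrap: the derivative `f J(ν)` of the support point is continuous because `ν` is, so
  -- the support point is `C¹`. Then `ν` is `C¹`, and the velocity of the curve, a polynomial in the
  -- curve and `ν`, is `C¹` as well.
  have hπν : ContDiffOn ℝ 1 (fun s => π (ν s)) I := by
    rw [show (1 : WithTop ℕ∞) = 0 + 1 by norm_num, contDiffOn_succ_iff_deriv_of_isOpen hI]
    refine ⟨fun s hs => (key s hs).2.differentiableAt.differentiableWithinAt, by simp, ?_⟩
    rw [contDiffOn_zero]
    have h1 : ContinuousOn (fun s => f (Γ s) • J (ν s)) I := by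
      refine (hE.continuousOn.comp hΓc fun s hs => (hΓ₁ s hs).2).smul ?_
      simp only [J]
      exact hνc.snd.neg.prodMk hνc.fst
    exact h1.congr fun s hs => (key s hs).2.deriv
  have hνu : ∀ s ∈ I, ν s ≠ 0 ∧ unitVec (ν s) = ν s := by
    intro s hs
    obtain ⟨U, g, G, hpU, hg, -, h1⟩ := (hν s hs).eq_unitVec
    have := hg.2.2.1 _ hpU
    rw [h1]
    exact ⟨unitVec_ne_zero this, unitVec_unitVec this⟩
  have hν1 : ContDiffOn ℝ 1 ν I := by
    intro s hs
    refine (contDiffAt_normal_of_support hK (x := fun s => π (ν s)) ?_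
      (hπν.contDiffAt (hI.mem_nhds hs))).contDiffWithinAt
    filter_upwards [hI.mem_nhds hs] with t ht
    exact ⟨(hνu t ht).1, (hνu t ht).2, hπ _⟩
  have hJν : ContDiffOn ℝ 1 (fun s => J (ν s)) I := by
    simp only [J]
    exact hν1.snd.neg.prodMk hν1.fst
  have hderiv : ∀ s ∈ I, deriv Γ s = horiz (Γ s) (J (ν s)) := fun s hs => (hd s hs).deriv
  have hdiff : DifferentiableOn ℝ Γ I := fun s hs => (hd s hs).differentiableAt.differentiableWithinAt
  have hΓ1 : ContDiffOn ℝ 1 Γ I := by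
    rw [show (1 : WithTop ℕ∞) = 0 + 1 by norm_num, contDiffOn_succ_iff_deriv_of_isOpen hI]
    refine ⟨hdiff, by simp, ?_⟩
    rw [contDiffOn_zero]
    refine ContinuousOn.congr ?_ hderiv
    have h1 := hJν.continuousOn
    simp only [horiz]
    exact h1.fst.prodMk (h1.snd.prodMk ((h1.fst.mul hΓc.snd.fst).sub (h1.snd.mul hΓc.fst)))
  rw [show (2 : WithTop ℕ∞) = 1 + 1 by norm_num, contDiffOn_succ_iff_deriv_of_isOpen hI]
  refine ⟨hdiff, by simp, ContDiffOn.congr ?_ hderiv⟩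
  simp only [horiz]
  exact hJν.fst.prodMk (hJν.snd.prodMk ((hJν.fst.mul hΓ1.snd.fst).sub (hJν.snd.mul hΓ1.fst)))

/-! ### The boundary curve of the example -/

lemma hasDerivAt_mul_abs (x : ℝ) : HasDerivAt (fun x : ℝ => x * |x|) (2 * |x|) x := by
  rcases lt_trichotomy x 0 with h | rfl | h
  · have h1 := ((hasDerivAt_id x).fun_mul (hasDerivAt_abs_neg h))
    refine h1.congr_deriv ?_
    simp only [id, abs_of_neg h]; ring
  · rw [hasDerivAt_iff_isLittleO, Asymptotics.isLittleO_iff]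
    intro c hc
    filter_upwards [Metric.ball_mem_nhds (0 : ℝ) hc] with x hx
    have : |x| < c := by simpa [Real.dist_eq] using hx
    simp only [abs_zero, mul_zero, sub_zero, smul_eq_mul, norm_mul, Real.norm_eq_abs, abs_abs]
    exact mul_le_mul_of_nonneg_right this.le (abs_nonneg _)
  · have h1 := ((hasDerivAt_id x).fun_mul (hasDerivAt_abs_pos h))
    refine h1.congr_deriv ?_
    simp only [id, abs_of_pos h]; ring

/-- The turning angle of the boundary curve, of class `C¹` but not twice differentiable at the multiples
of `π`. -/
def turn (s : ℝ) : ℝ := s + Real.sin s * |Real.sin s| * Real.cos s / 4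

/-- The derivative of `turn`. -/
def turnRate (s : ℝ) : ℝ := 1 + |Real.sin s| * (2 * Real.cos s ^ 2 - Real.sin s ^ 2) / 4

lemma hasDerivAt_turn (s : ℝ) : HasDerivAt turn (turnRate s) s := by
  have h1 := (hasDerivAt_mul_abs (Real.sin s)).comp s (Real.hasDerivAt_sin s)
  have h2 := (hasDerivAt_id s).fun_add ((h1.fun_mul (Real.hasDerivAt_cos s)).div_const 4)
  refine h2.congr_deriv ?_
  simp only [turnRate, Function.comp]
  ring

/-- The factor `2 cos² - sin²` is at least `-1`, so the rate is at least `3 / 4`. This is the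
positive curvature of the boundary curve. -/
lemma turnRate_pos (s : ℝ) : 0 < turnRate s := by
  have h1 := Real.sin_sq_add_cos_sq s
  have h2 : |Real.sin s| ≤ 1 := Real.abs_sin_le_one s
  have h3 := abs_nonneg (Real.sin s)
  have h4 : -1 ≤ 2 * Real.cos s ^ 2 - Real.sin s ^ 2 := by nlinarith [sq_nonneg (Real.cos s)]
  unfold turnRate
  nlinarith

lemma continuous_turnRate : Continuous turnRate := by unfold turnRate; fun_prop

lemma turn_strictMono : StrictMono turn :=
  strictMono_of_deriv_pos fun s => by rw [(hasDerivAt_turn s).deriv]; exact turnRate_pos s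

lemma continuous_turn : Continuous turn := by unfold turn; fun_prop

/-- This symmetry gives opposite tangents at parameters differing by `π`, so the curve closes up
after `2 π` and is centrally symmetric. -/
lemma turn_add_pi (s : ℝ) : turn (s + Real.pi) = turn s + Real.pi := by
  simp only [turn, Real.sin_add_pi, Real.cos_add_pi, abs_neg]; ring

lemma turn_sub_pi (s : ℝ) : turn (s - Real.pi) = turn s - Real.pi := by
  have := turn_add_pi (s - Real.pi)
  rw [sub_add_cancel] at this; linarith

/-- At a zero of the sine the factor `2 cos² - sin²` equals `2`, so `|sin|` could be recovered
differentiably from the rate. Composition with the arcsine would make the absolute value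
differentiable at the origin. -/
lemma not_differentiableAt_turnRate {s : ℝ} (h : Real.sin s = 0) : ¬DifferentiableAt ℝ turnRate s := by
  intro hd
  have hc : Real.cos s ^ 2 = 1 := by have := Real.sin_sq_add_cos_sq s; rw [h] at this; linarith
  have hq : DifferentiableAt ℝ (fun s => 2 * Real.cos s ^ 2 - Real.sin s ^ 2) s := by fun_prop
  have hq0 : 2 * Real.cos s ^ 2 - Real.sin s ^ 2 ≠ 0 := by rw [h, hc]; norm_num
  have habs : DifferentiableAt ℝ (fun s => |Real.sin s|) s := by
    have h1 : DifferentiableAt ℝ (fun s => 4 * (turnRate s - 1) / (2 * Real.cos s ^ 2 - Real.sin s ^ 2)) s :=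
      ((hd.sub_const 1).const_mul 4).div hq hq0
    refine h1.congr_of_eventuallyEq ?_
    filter_upwards [hq.continuousAt.eventually_ne hq0] with r hr
    simp only [turnRate]
    field_simp
    ring
  have hcs : ContDiffAt ℝ 1 Real.arcsin 0 :=
    Real.contDiffAt_arcsin (by norm_num) (by norm_num)
  have h2 : HasDerivAt (fun r : ℝ => s + Real.arcsin r) 1 0 := by
    have := (Real.hasDerivAt_arcsin (x := 0) (by norm_num) (by norm_num)).const_add s
    simpa using this
  have h3 : DifferentiableAt ℝ (fun r : ℝ => |Real.sin (s + Real.arcsin r)|) 0 := by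
    have h4 : DifferentiableAt ℝ (fun s => |Real.sin s|) (s + Real.arcsin 0) := by simpa using habs
    exact h4.comp (0 : ℝ) h2.differentiableAt
  have h5 : (fun r : ℝ => |Real.sin (s + Real.arcsin r)|) =ᶠ[𝓝 0] fun r => |r| := by
    filter_upwards [Icc_mem_nhds (show (-1 : ℝ) < 0 by norm_num) (show (0 : ℝ) < 1 by norm_num)] with r hr
    rw [Real.sin_add, h, zero_mul, zero_add, Real.sin_arcsin hr.1 hr.2, abs_mul]
    have : |Real.cos s| = 1 := by
      have := sq_abs (Real.cos s)
      rw [hc] at this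
      nlinarith [abs_nonneg (Real.cos s)]
    rw [this, one_mul]
  exact not_differentiableAt_abs_zero (h3.congr_of_eventuallyEq h5.symm)

/-- The area form of the plane. -/
def om (p q : ℝ × ℝ) : ℝ := p.1 * q.2 - p.2 * q.1

/-- The unit tangent of the boundary curve. -/
def tang (s : ℝ) : ℝ × ℝ := (Real.cos (turn s), -Real.sin (turn s))

lemma om_tang (a b : ℝ) : om (tang a) (tang b) = Real.sin (turn a - turn b) := by
  simp only [om, tang, Real.sin_sub]; ring

lemma hasDerivAt_tang (s : ℝ) : HasDerivAt tang (-turnRate s • J (tang s)) s := by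
  have h := (hasDerivAt_turn s).cos.prodMk (hasDerivAt_turn s).sin.fun_neg
  refine h.congr_deriv ?_
  ext <;> simp [J, tang, mul_comm]

lemma continuous_tang : Continuous tang :=
  continuous_iff_continuousAt.2 fun s => (hasDerivAt_tang s).continuousAt

lemma contDiff_tang : ContDiff ℝ 1 tang := by
  have h : deriv tang = fun s => -turnRate s • J (tang s) := funext fun s => (hasDerivAt_tang s).deriv
  rw [contDiff_one_iff_deriv]
  refine ⟨fun s => (hasDerivAt_tang s).differentiableAt, ?_⟩
  rw [h]
  exact continuous_turnRate.neg.smul (continuous_tang.snd.neg.prodMk continuous_tang.fst)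

lemma tang_add_pi (s : ℝ) : tang (s + Real.pi) = -tang s := by
  simp only [tang, turn_add_pi, Real.cos_add_pi, Real.sin_add_pi]; ext <;> simp

/-- The boundary curve, clockwise and symmetric about the origin. -/
def bdry (s : ℝ) : ℝ × ℝ := (∫ r in (0 : ℝ)..s, tang r) - (1 / 2 : ℝ) • ∫ r in (0 : ℝ)..Real.pi, tang r

lemma hasDerivAt_bdry (s : ℝ) : HasDerivAt bdry (tang s) s :=
  (intervalIntegral.integral_hasDerivAt_right (continuous_tang.intervalIntegrable _ _)
    (continuous_tang.stronglyMeasurableAtFilter _ _) continuous_tang.continuousAt).sub_const _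

lemma deriv_bdry : deriv bdry = tang := funext fun s => (hasDerivAt_bdry s).deriv

lemma continuous_bdry : Continuous bdry :=
  continuous_iff_continuousAt.2 fun s => (hasDerivAt_bdry s).continuousAt

lemma contDiff_bdry : ContDiff ℝ 2 bdry := by
  rw [show (2 : WithTop ℕ∞) = 1 + 1 by norm_num, contDiff_succ_iff_deriv, deriv_bdry]
  exact ⟨fun s => (hasDerivAt_bdry s).differentiableAt, by simp, contDiff_tang⟩

lemma bdry_add_pi (s : ℝ) : bdry (s + Real.pi) = -bdry s := by
  have hd : ∀ r, HasDerivAt (fun r => bdry (r + Real.pi) + bdry r) 0 r := by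
    intro r
    have h1 := ((hasDerivAt_bdry (r + Real.pi)).comp_add_const r Real.pi).fun_add (hasDerivAt_bdry r)
    rw [tang_add_pi, neg_add_cancel] at h1
    exact h1
  have h2 := is_const_of_deriv_eq_zero (fun r => (hd r).differentiableAt) (fun r => (hd r).deriv) s 0
  have h3 : bdry (0 + Real.pi) + bdry 0 = 0 := by
    simp only [bdry, zero_add, intervalIntegral.integral_same]
    module
  rw [h3] at h2
  exact eq_neg_of_add_eq_zero_left h2

lemma bdry_add_two_pi (s : ℝ) : bdry (s + 2 * Real.pi) = bdry s := by
  rw [two_mul, ← add_assoc, bdry_add_pi, bdry_add_pi, neg_neg]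

lemma tang_add_two_pi (s : ℝ) : tang (s + 2 * Real.pi) = tang s := by
  rw [two_mul, ← add_assoc, tang_add_pi, tang_add_pi, neg_neg]

/-- Over an interval of length `π` the turning angle grows by exactly `π`, so over a shorter one it
grows by an amount strictly between `0` and `π`. -/
lemma sin_turn_sub_pos {a b : ℝ} (h0 : 0 < b - a) (h1 : b - a < Real.pi) :
    0 < Real.sin (turn b - turn a) := by
  refine Real.sin_pos_of_pos_of_lt_pi (sub_pos.2 (turn_strictMono (by linarith))) ?_
  have := turn_strictMono (show b < a + Real.pi by linarith)
  rw [turn_add_pi] at this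
  linarith

lemma sin_turn_sub_neg {a b : ℝ} (h0 : Real.pi < b - a) (h1 : b - a < 2 * Real.pi) :
    Real.sin (turn b - turn a) < 0 := by
  have := sin_turn_sub_pos (a := a + Real.pi) (b := b) (by linarith) (by linarith)
  rw [turn_add_pi, show turn b - (turn a + Real.pi) = turn b - turn a - Real.pi by ring,
    Real.sin_sub_pi] at this
  linarith

/-- Convexity of the curve is used in this form: along the curve, a linear form vanishing on `tang
c` is monotone on the intervals where the sine of the relative turning angle has one sign. -/
lemma hasDerivAt_om_bdry (c s : ℝ) :
    HasDerivAt (fun s => om (bdry s) (tang c)) (Real.sin (turn s - turn c)) s := by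
  rw [← om_tang]
  have h1 : HasDerivAt (fun s => (bdry s).1) (tang s).1 s := (hasDerivAt_bdry s).fst
  have h2 : HasDerivAt (fun s => (bdry s).2) (tang s).2 s := (hasDerivAt_bdry s).snd
  exact (h1.mul_const _).fun_sub (h2.mul_const _)

lemma om_bdry_lt {a b c : ℝ} (hab : a < b) (h : ∀ s ∈ Ioo a b, 0 < Real.sin (turn s - turn c)) :
    om (bdry a) (tang c) < om (bdry b) (tang c) := by
  refine strictMonoOn_of_deriv_pos (convex_Icc a b)
    (fun s _ => (hasDerivAt_om_bdry c s).continuousAt.continuousWithinAt) (fun s hs => ?_)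
    (left_mem_Icc.2 hab.le) (right_mem_Icc.2 hab.le) hab
  rw [interior_Icc] at hs
  rw [(hasDerivAt_om_bdry c s).deriv]
  exact h s hs

lemma om_bdry_gt {a b c : ℝ} (hab : a < b) (h : ∀ s ∈ Ioo a b, Real.sin (turn s - turn c) < 0) :
    om (bdry b) (tang c) < om (bdry a) (tang c) := by
  refine strictAntiOn_of_deriv_neg (convex_Icc a b)
    (fun s _ => (hasDerivAt_om_bdry c s).continuousAt.continuousWithinAt) (fun s hs => ?_)
    (left_mem_Icc.2 hab.le) (right_mem_Icc.2 hab.le) hab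
  rw [interior_Icc] at hs
  rw [(hasDerivAt_om_bdry c s).deriv]
  exact h s hs

/-- A chord and the tangent at its end point. -/
lemma om_chord_end {a b : ℝ} (h0 : 0 < b - a) (h1 : b - a < 2 * Real.pi) :
    om (bdry b - bdry a) (tang b) < 0 := by
  have key : om (bdry b) (tang b) < om (bdry a) (tang b) := by
    -- When the arc is longer than `π`, the complementary arc from `b` to `a + 2 π` is short and
    -- joins the same points.
    rcases le_or_gt (b - a) Real.pi with h | h
    · refine om_bdry_gt (by linarith) fun s hs => ?_
      have := sin_turn_sub_pos (a := s) (b := b) (by linarith [hs.2]) (by linarith [hs.1])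
      rw [← neg_sub, Real.sin_neg] at this
      linarith
    · have := om_bdry_lt (a := b) (b := a + 2 * Real.pi) (c := b) (by linarith) fun s hs =>
        sin_turn_sub_pos (by linarith [hs.1]) (by linarith [hs.2])
      rwa [bdry_add_two_pi] at this
  simp only [om, Prod.fst_sub, Prod.snd_sub] at key ⊢
  linarith

/-- A chord and the tangent at its initial point. -/
lemma om_chord_start {a b : ℝ} (h0 : 0 < b - a) (h1 : b - a < 2 * Real.pi) :
    0 < om (bdry b - bdry a) (tang a) := by
  have key : om (bdry a) (tang a) < om (bdry b) (tang a) := by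
    rcases le_or_gt (b - a) Real.pi with h | h
    · exact om_bdry_lt (by linarith) fun s hs => sin_turn_sub_pos (by linarith [hs.1]) (by linarith [hs.2])
    · have := om_bdry_gt (a := b) (b := a + 2 * Real.pi) (c := a) (by linarith) fun s hs =>
        sin_turn_sub_neg (by linarith [hs.1]) (by linarith [hs.2])
      rwa [bdry_add_two_pi] at this
  simp only [om, Prod.fst_sub, Prod.snd_sub] at key ⊢
  linarith

/-- The antipode of `bdry s` is `-bdry s`, so this is the chord inequality for the diameter through
the origin. -/
lemma om_bdry_tang_neg (s : ℝ) : om (bdry s) (tang s) < 0 := by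
  have h := om_chord_start (a := s) (b := s + Real.pi) (by linarith [Real.pi_pos])
    (by linarith [Real.pi_pos])
  rw [bdry_add_pi] at h
  simp only [om, Prod.fst_sub, Prod.snd_sub, Prod.fst_neg, Prod.snd_neg] at h ⊢
  linarith

/-! ### The convex body bounded by the curve -/

/-- The inverse function theorem in a finite-dimensional space. -/
lemma exists_local_inverse {E : Type*} [NormedAddCommGroup E] [NormedSpace ℝ E] [FiniteDimensional ℝ E]
    {n : WithTop ℕ∞} {f : E → E} {f' : E →L[ℝ] E} {a : E} (hf : ContDiffAt ℝ n f a)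
    (hf' : HasFDerivAt f f' a) (hn : n ≠ 0) (hinj : ∀ v, f' v = 0 → v = 0) :
    ∃ g : E → E, ContDiffAt ℝ n g (f a) ∧ g (f a) = a ∧ (∀ᶠ y in 𝓝 (f a), f (g y) = y) ∧
      (∀ᶠ x in 𝓝 a, g (f x) = x) ∧ ∀ v, f' (fderiv ℝ g (f a) v) = v := by
  have : CompleteSpace E := FiniteDimensional.complete ℝ E
  have hi : Function.Injective (f' : E →ₗ[ℝ] E) :=
    (injective_iff_map_eq_zero (f' : E →ₗ[ℝ] E)).2 hinj
  set e : E ≃L[ℝ] E := (LinearEquiv.ofInjectiveEndo (f' : E →ₗ[ℝ] E) hi).toContinuousLinearEquiv with he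
  have hee : (e : E →L[ℝ] E) = f' := by ext v; simp [he]
  have hf'' : HasFDerivAt f (e : E →L[ℝ] E) a := by rwa [hee]
  have hg := hf.to_localInverse hf'' hn
  have h0 := hf.localInverse_apply_image hf'' hn
  have hr := (hf.hasStrictFDerivAt' hf'' hn).eventually_right_inverse
  refine ⟨hf.localInverse hf'' hn, hg, h0, hr,
    (hf.hasStrictFDerivAt' hf'' hn).eventually_left_inverse, fun v => ?_⟩
  have h1 := (hg.differentiableAt hn).hasFDerivAt
  have h2 : HasFDerivAt (fun y => f (hf.localInverse hf'' hn y))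
      (f'.comp (fderiv ℝ (hf.localInverse hf'' hn) (f a))) (f a) :=
    HasFDerivAt.comp (g := f) (f a) (by rw [h0]; exact hf') h1
  have h3 := (h2.congr_of_eventuallyEq (f₁ := id) (hr.mono fun y hy => hy.symm)).unique (hasFDerivAt_id (f a))
  exact congrArg (fun L : E →L[ℝ] E => L v) h3

lemma om_J (a b : ℝ × ℝ) : om a b = dot (J a) b := by simp only [om, dot, J]; ring

lemma om_add_right (a b c : ℝ × ℝ) : om a (b + c) = om a b + om a c := by
  simp only [om, Prod.fst_add, Prod.snd_add]; ring

lemma om_sub_right (a b c : ℝ × ℝ) : om a (b - c) = om a b - om a c := by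
  simp only [om, Prod.fst_sub, Prod.snd_sub]; ring

lemma om_smul_right (r : ℝ) (a b : ℝ × ℝ) : om a (r • b) = r * om a b := by
  simp only [om, Prod.smul_fst, Prod.smul_snd, smul_eq_mul]; ring

lemma om_add_left (a b c : ℝ × ℝ) : om (a + b) c = om a c + om b c := by
  simp only [om, Prod.fst_add, Prod.snd_add]; ring

lemma om_sub_left (a b c : ℝ × ℝ) : om (a - b) c = om a c - om b c := by
  simp only [om, Prod.fst_sub, Prod.snd_sub]; ring

lemma om_smul_left (r : ℝ) (a b : ℝ × ℝ) : om (r • a) b = r * om a b := by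
  simp only [om, Prod.smul_fst, Prod.smul_snd, smul_eq_mul]; ring

lemma om_self (a : ℝ × ℝ) : om a a = 0 := by simp only [om]; ring

lemma om_comm (a b : ℝ × ℝ) : om a b = -om b a := by simp only [om]; ring

lemma tang_sq (s : ℝ) : (tang s).1 ^ 2 + (tang s).2 ^ 2 = 1 := by simp [tang]

lemma om_tang_J (s : ℝ) : om (tang s) (J (tang s)) = 1 := by
  rw [← tang_sq s]; simp only [om, J]; ring

lemma tang_ne_zero (s : ℝ) : tang s ≠ 0 := by
  intro h; have := tang_sq s; rw [h] at this; norm_num at this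

lemma J_tang_ne_zero (s : ℝ) : J (tang s) ≠ 0 := by
  intro h; have := om_tang_J s; rw [h] at this; norm_num [om] at this

/-- Coordinates with respect to the orthonormal frame `τ, Jτ`. -/
lemma tang_frame (s : ℝ) (v : ℝ × ℝ) : v = om v (J (tang s)) • tang s + om (tang s) v • J (tang s) := by
  have h := tang_sq s
  ext
  · simp only [om, J, Prod.fst_add, Prod.smul_fst, smul_eq_mul]
    linear_combination -v.1 * h
  · simp only [om, J, Prod.snd_add, Prod.smul_snd, smul_eq_mul]
    linear_combination -v.2 * h

lemma abs_om_tang_le (s : ℝ) (v : ℝ × ℝ) : |om (tang s) v| ≤ 2 * ‖v‖ := by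
  have h1 : |(tang s).1| ≤ 1 := Real.abs_cos_le_one _
  have h2 : |(tang s).2| ≤ 1 := by simpa [tang] using Real.abs_sin_le_one (turn s)
  have h3 : |v.1| ≤ ‖v‖ := norm_fst_le v
  have h4 : |v.2| ≤ ‖v‖ := norm_snd_le v
  unfold om
  refine (abs_sub _ _).trans ?_
  rw [abs_mul, abs_mul]
  nlinarith [abs_nonneg v.1, abs_nonneg v.2, abs_nonneg (tang s).1, abs_nonneg (tang s).2]

lemma bdry_periodic : Function.Periodic bdry (2 * Real.pi) := bdry_add_two_pi

lemma om_tang_bdry_pos (s : ℝ) : 0 < om (tang s) (bdry s) := by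
  rw [om_comm]; linarith [om_bdry_tang_neg s]

lemma om_tang_sub_bdry_nonpos (r s : ℝ) : om (tang s) (bdry r - bdry s) ≤ 0 := by
  obtain ⟨b, hb, hbr⟩ := bdry_periodic.exists_mem_Ico Real.two_pi_pos r s
  rw [hbr, om_comm]
  rcases hb.1.eq_or_lt with h | h
  · simp [h, om]
  · linarith [om_chord_start (a := s) (b := b) (by linarith) (by linarith [hb.2])]

/-- The convex body bounded by the curve `bdry`. -/
def wulffBody : Set (ℝ × ℝ) := {q | ∀ s, om (tang s) (q - bdry s) ≤ 0}

lemma bdry_mem_wulffBody (s : ℝ) : bdry s ∈ wulffBody := fun r => om_tang_sub_bdry_nonpos s r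

lemma isSupportPoint_bdry (s : ℝ) : IsSupportPoint wulffBody (J (tang s)) (bdry s) := by
  refine ⟨bdry_mem_wulffBody s, fun k hk => ?_⟩
  have := hk s
  rw [om_sub_right] at this
  rw [← om_J, ← om_J]
  linarith

lemma continuous_om : Continuous fun x : (ℝ × ℝ) × ℝ × ℝ => om x.1 x.2 := by
  unfold om; fun_prop

lemma convex_wulffBody : Convex ℝ wulffBody := by
  intro p hp q hq a b ha hb hab s
  have h1 := hp s
  have h2 := hq s
  have : om (tang s) (a • p + b • q - bdry s)
      = a * om (tang s) (p - bdry s) + b * om (tang s) (q - bdry s) := by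
    simp only [om_sub_right, om_add_right, om_smul_right]
    linear_combination om (tang s) (bdry s) * hab
  rw [this]
  nlinarith

lemma isClosed_wulffBody : IsClosed wulffBody := by
  have : wulffBody = ⋂ s, {q | om (tang s) (q - bdry s) ≤ 0} := by ext q; simp [wulffBody]
  rw [this]
  refine isClosed_iInter fun s => isClosed_le ?_ continuous_const
  exact continuous_om.comp (f := fun q => (tang s, q - bdry s)) (by fun_prop)

/-- The constraints are periodic in `s`, so the worst one is attained and strict inequalities hold
with a uniform margin. -/
lemma mem_nhds_wulffBody {q : ℝ × ℝ} (h : ∀ s, om (tang s) (q - bdry s) < 0) : wulffBody ∈ 𝓝 q := by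
  have hc : Continuous fun s => om (tang s) (q - bdry s) :=
    continuous_om.comp (f := fun s => (tang s, q - bdry s))
      (continuous_tang.prodMk (continuous_const.sub continuous_bdry))
  obtain ⟨m, -, hm⟩ := (isCompact_Icc (a := (0 : ℝ)) (b := 2 * Real.pi)).exists_isMaxOn
    (nonempty_Icc.2 Real.two_pi_pos.le) hc.continuousOn
  have hper : Function.Periodic (fun s => om (tang s) (q - bdry s)) (2 * Real.pi) := fun s => by
    simp only [tang_add_two_pi, bdry_add_two_pi]
  have hmax : ∀ s, om (tang s) (q - bdry s) ≤ om (tang m) (q - bdry m) := fun s => by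
    obtain ⟨r, hr, hrs⟩ := hper.exists_mem_Ico Real.two_pi_pos s 0
    have h1 : om (tang s) (q - bdry s) = om (tang r) (q - bdry r) := hrs
    rw [h1]
    exact hm ⟨hr.1, by linarith [hr.2]⟩
  have hδ := h m
  set δ := -om (tang m) (q - bdry m) with hδd
  filter_upwards [Metric.ball_mem_nhds q (show 0 < δ / 2 by linarith)] with p hp s
  rw [Metric.mem_ball, dist_eq_norm] at hp
  have h1 := abs_le.1 (abs_om_tang_le s (p - q))
  have h2 := hmax s
  rw [om_sub_right] at h1 h2 ⊢
  linarith [h1.2]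

lemma zero_mem_interior_wulffBody : (0 : ℝ × ℝ) ∈ interior wulffBody := by
  rw [mem_interior_iff_mem_nhds]
  refine mem_nhds_wulffBody fun s => ?_
  have := om_tang_bdry_pos s
  rw [om_sub_right]
  simp [om] at this ⊢
  linarith

lemma isCompact_wulffBody : IsCompact wulffBody := by
  refine Metric.isCompact_of_isClosed_isBounded isClosed_wulffBody ?_
  -- At the parameters `0`, `π / 2` and their antipodes the tangents are parallel to the axes. The
  -- four half-planes cut out a rectangle.
  have h0 : turn 0 = 0 := by simp [turn]
  have h1 : turn (Real.pi / 2) = Real.pi / 2 := by simp [turn]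
  have e0 : tang 0 = (1, 0) := by simp [tang, h0]
  have e1 : tang (Real.pi / 2) = (0, -1) := by simp [tang, h1]
  have e2 : tang (0 + Real.pi) = (-1, 0) := by rw [tang_add_pi, e0]; simp
  have e3 : tang (Real.pi / 2 + Real.pi) = (0, 1) := by rw [tang_add_pi, e1]; simp
  refine (Metric.isBounded_Icc ((bdry (Real.pi / 2 + Real.pi)).1, (bdry (0 + Real.pi)).2)
    ((bdry (Real.pi / 2)).1, (bdry 0).2)).subset fun q hq => ?_
  have q0 := hq 0
  have q1 := hq (Real.pi / 2)
  have q2 := hq (0 + Real.pi)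
  have q3 := hq (Real.pi / 2 + Real.pi)
  rw [e0] at q0; rw [e1] at q1; rw [e2] at q2; rw [e3] at q3
  simp only [om, Prod.fst_sub, Prod.snd_sub] at q0 q1 q2 q3
  refine ⟨⟨?_, ?_⟩, ?_, ?_⟩ <;> dsimp only <;> linarith

/-- At a boundary point some constraint is active, and its parameter `s` maximizes the constraint
function. Criticality and `turnRate ≠ 0` remove the tangential component of `q - bdry s`, the active
constraint removes the normal one. -/
lemma frontier_wulffBody : frontier wulffBody = range bdry := by
  refine subset_antisymm (fun q hq => ?_) ?_
  · have hqK : q ∈ wulffBody := isClosed_wulffBody.frontier_subset hq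
    have hs : ∃ s, om (tang s) (q - bdry s) = 0 := by
      by_contra hne
      push Not at hne
      exact hq.2 (mem_interior_iff_mem_nhds.2 (mem_nhds_wulffBody fun s => lt_of_le_of_ne (hqK s) (hne s)))
    obtain ⟨s, hs⟩ := hs
    have hd : HasDerivAt (fun r => om (tang r) (q - bdry r)) (-turnRate s * om (J (tang s)) (q - bdry s)) s := by
      have h1 : HasDerivAt (fun s => (bdry s).1) (tang s).1 s := (hasDerivAt_bdry s).fst
      have h2 : HasDerivAt (fun s => (bdry s).2) (tang s).2 s := (hasDerivAt_bdry s).snd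
      have h3 : HasDerivAt (fun s => (tang s).1) (-turnRate s • J (tang s)).1 s := (hasDerivAt_tang s).fst
      have h4 : HasDerivAt (fun s => (tang s).2) (-turnRate s • J (tang s)).2 s := (hasDerivAt_tang s).snd
      refine ((h3.fun_mul (h2.const_sub q.2)).fun_sub (h4.fun_mul (h1.const_sub q.1))).congr_deriv ?_
      simp only [om, Prod.smul_fst, Prod.smul_snd, smul_eq_mul, Prod.fst_sub, Prod.snd_sub]
      ring
    have hm : IsLocalMax (fun r => om (tang r) (q - bdry r)) s :=
      Filter.Eventually.of_forall fun r => by simp only [hs]; exact hqK r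
    have h0 := hm.hasDerivAt_eq_zero hd
    have h1 : om (J (tang s)) (q - bdry s) = 0 :=
      (mul_eq_zero.1 h0).resolve_left (neg_ne_zero.2 (turnRate_pos s).ne')
    refine ⟨s, ?_⟩
    have h2 := tang_frame s (q - bdry s)
    rw [hs, om_comm, h1] at h2
    simp only [neg_zero, zero_smul, add_zero] at h2
    exact (sub_eq_zero.1 h2).symm
  · rintro _ ⟨s, rfl⟩
    exact (isSupportPoint_bdry s).mem_frontier (J_tang_ne_zero s)

lemma smul_bdry_mem_wulffBody {μ s : ℝ} (hμ : 0 < μ) : μ • bdry s ∈ wulffBody ↔ μ ≤ 1 := by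
  constructor
  · intro h
    have h1 := h s
    have h2 := om_tang_bdry_pos s
    rw [om_sub_right, om_smul_right] at h1
    by_contra hc
    nlinarith
  · intro h
    exact convex_wulffBody.smul_mem_of_zero_mem (interior_subset zero_mem_interior_wulffBody)
      (bdry_mem_wulffBody s) ⟨hμ.le, h⟩

/-- Polar coordinates adapted to `wulffBody`. -/
lemma exists_polar_inverse (s₀ : ℝ) : ∃ g : ℝ × ℝ → ℝ × ℝ, ContDiffAt ℝ 2 g (bdry s₀) ∧
    g (bdry s₀) = (1, s₀) ∧ (∀ᶠ q in 𝓝 (bdry s₀), (g q).1 • bdry (g q).2 = q) ∧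
    (∀ᶠ x in 𝓝 ((1 : ℝ), s₀), g (x.1 • bdry x.2) = x) := by
  have hb := contDiff_bdry
  have hF : ContDiff ℝ 2 fun x : ℝ × ℝ => x.1 • bdry x.2 := by fun_prop
  have hd : HasFDerivAt (fun x : ℝ × ℝ => x.1 • bdry x.2) _ ((1 : ℝ), s₀) :=
    (hasFDerivAt_fst (𝕜 := ℝ) (p := ((1 : ℝ), s₀))).smul
      (HasFDerivAt.comp (g := bdry) (f := Prod.snd) ((1 : ℝ), s₀) (hasDerivAt_bdry s₀).hasFDerivAt
        hasFDerivAt_snd)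
  obtain ⟨g, hg, hg0, hr, hl, -⟩ := exists_local_inverse hF.contDiffAt hd (by simp) fun v hv => by
    simp at hv
    have h1 : om (tang s₀) (v.2 • tang s₀ + v.1 • bdry s₀) = 0 := by rw [hv]; simp [om]
    rw [om_add_right, om_smul_right, om_smul_right, om_self, mul_zero, zero_add] at h1
    have hv1 : v.1 = 0 := (mul_eq_zero.1 h1).resolve_right (om_tang_bdry_pos s₀).ne'
    rw [hv1, zero_smul, add_zero] at hv
    exact Prod.ext hv1 ((smul_eq_zero.1 hv).resolve_right (tang_ne_zero s₀))
  simp only [one_smul] at hg hg0 hr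
  exact ⟨g, hg, hg0, hr, hl⟩

/-- The defining function is `λ - 1` in the polar coordinates `q = λ • bdry s`, which are `C²`.
Differentiating along the curve the relation that its differential kills the tangent gives `D²φ(τ,
τ) = turnRate * Dφ(Jτ)`. -/
lemma isC2PlusBody_wulffBody : IsC2PlusBody wulffBody where
  convex := convex_wulffBody
  compact := isCompact_wulffBody
  zero_mem := zero_mem_interior_wulffBody
  boundary := by
    intro p hp
    rw [frontier_wulffBody] at hp
    obtain ⟨s₀, rfl⟩ := hp
    obtain ⟨g, hg, hg0, hr, hl⟩ := exists_polar_inverse s₀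
    have hpos : ∀ᶠ q in 𝓝 (bdry s₀), 0 < (g q).1 := by
      refine hg.continuousAt.fst.eventually (isOpen_Ioi.mem_nhds ?_)
      simp [hg0]
    obtain ⟨U, hU, hUo, hpU⟩ := eventually_nhds_iff.1
      ((hg.eventually (by simp)).and (hr.and hpos))
    have hφ : ContDiffAt ℝ 2 (fun q => (g q).1 - 1) (bdry s₀) := hg.fst.sub contDiffAt_const
    set φ : ℝ × ℝ → ℝ := fun q => (g q).1 - 1 with hφd
    have hlin : ∀ᶠ s in 𝓝 s₀, φ (bdry s) = 0 := by
      have : Filter.Tendsto (fun s : ℝ => ((1 : ℝ), s)) (𝓝 s₀) (𝓝 (1, s₀)) :=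
        (by fun_prop : Continuous fun s : ℝ => ((1 : ℝ), s)).tendsto _
      filter_upwards [this.eventually hl] with s hs
      simp only [one_smul] at hs
      simp [hφd, hs]
    have hD : ∀ᶠ s in 𝓝 s₀, fderiv ℝ φ (bdry s) (tang s) = 0 := by
      have h1 : ∀ᶠ s in 𝓝 s₀, ContDiffAt ℝ 2 φ (bdry s) :=
        continuous_bdry.continuousAt.eventually (hφ.eventually (by simp))
      filter_upwards [hlin.eventually_nhds, h1] with s hs h1
      have h2 := (h1.differentiableAt (by simp)).hasFDerivAt.comp_hasDerivAt s (hasDerivAt_bdry s)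
      have h3 : HasDerivAt (φ ∘ bdry) 0 s :=
        (hasDerivAt_const s (0 : ℝ)).congr_of_eventuallyEq hs
      exact h2.unique h3
    have hD0 := hD.self_of_nhds
    have hDγ : fderiv ℝ φ (bdry s₀) (bdry s₀) = 1 := by
      have h1 : HasDerivAt (fun μ : ℝ => μ • bdry s₀) (bdry s₀) 1 := by
        simpa using (hasDerivAt_id (1 : ℝ)).smul_const (bdry s₀)
      have h2 : HasFDerivAt φ (fderiv ℝ φ (bdry s₀)) ((1 : ℝ) • bdry s₀) := by
        rw [one_smul]; exact (hφ.differentiableAt (by simp)).hasFDerivAt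
      have h3 := h2.comp_hasDerivAt (1 : ℝ) h1
      have h4 : HasDerivAt (φ ∘ fun μ : ℝ => μ • bdry s₀) 1 1 := by
        have : Filter.Tendsto (fun μ : ℝ => (μ, s₀)) (𝓝 1) (𝓝 (1, s₀)) :=
          (by fun_prop : Continuous fun μ : ℝ => (μ, s₀)).tendsto _
        refine ((hasDerivAt_id (1 : ℝ)).sub_const 1).congr_of_eventuallyEq ?_
        filter_upwards [this.eventually hl] with μ hμ
        simp [hφd, hμ]
      exact h3.unique h4
    -- The position vector has derivative one by homogeneity and a positive component along `J τ`,
    -- while its component along `τ` does not contribute.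
    have hDJ : 0 < fderiv ℝ φ (bdry s₀) (J (tang s₀)) := by
      have h1 := om_tang_bdry_pos s₀
      have h2 : fderiv ℝ φ (bdry s₀) (om (bdry s₀) (J (tang s₀)) • tang s₀
          + om (tang s₀) (bdry s₀) • J (tang s₀)) = 1 := by rw [← tang_frame, hDγ]
      rw [map_add, map_smul, map_smul, hD0, smul_zero, zero_add, smul_eq_mul] at h2
      exact pos_of_mul_pos_right (h2.symm ▸ one_pos) h1.le
    have hD2 : fderiv ℝ (fderiv ℝ φ) (bdry s₀) (tang s₀) (tang s₀)
        = turnRate s₀ * fderiv ℝ φ (bdry s₀) (J (tang s₀)) := by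
      have h1 : ContDiffAt ℝ 1 (fderiv ℝ φ) (bdry s₀) := hφ.fderiv_right (by norm_num)
      have h2 := ((h1.differentiableAt (by simp)).hasFDerivAt.comp_hasDerivAt s₀
        (hasDerivAt_bdry s₀)).clm_apply (hasDerivAt_tang s₀)
      have h3 : HasDerivAt (fun s => (fderiv ℝ φ ∘ bdry) s (tang s)) 0 s₀ :=
        (hasDerivAt_const s₀ (0 : ℝ)).congr_of_eventuallyEq hD
      have h4 := h2.unique h3
      simp only [Function.comp, map_smul, neg_smul, map_neg, smul_eq_mul] at h4
      linarith
    refine ⟨U, φ, hUo, hpU, fun q hq => ?_, ?_, ?_, fun v hv hv0 => ?_⟩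
    · exact ((hU q hq).1.fst.sub contDiffAt_const).contDiffWithinAt
    · ext q
      simp only [mem_inter_iff, mem_ofPred_eq]
      refine ⟨fun h => ⟨h.2, ?_⟩, fun h => ⟨?_, h.1⟩⟩
      · obtain ⟨-, h1, h2⟩ := hU q h.2
        have := h.1
        rw [← h1, smul_bdry_mem_wulffBody h2] at this
        simp only [hφd]; linarith
      · obtain ⟨-, h1, h2⟩ := hU q h.1
        rw [← h1, smul_bdry_mem_wulffBody h2]
        have := h.2
        simp only [hφd] at this; linarith
    · intro h
      rw [h] at hDγ
      norm_num at hDγ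
    · have h1 := tang_frame s₀ v
      rw [h1, map_add, map_smul, map_smul, hD0, smul_zero, zero_add, smul_eq_mul] at hv0
      have h2 := (mul_eq_zero.1 hv0).resolve_right hDJ.ne'
      rw [h2, zero_smul, add_zero] at h1
      have h3 : om v (J (tang s₀)) ≠ 0 := fun h => hv (by rw [h1, h, zero_smul])
      rw [h1, map_smul, map_smul, smul_apply, hD2, smul_eq_mul, smul_eq_mul, ← mul_assoc]
      exact mul_pos (mul_self_pos.2 h3) (mul_pos (turnRate_pos s₀) hDJ)

lemma bdry_injOn {a b : ℝ} (h0 : 0 < b - a) (h1 : b - a < 2 * Real.pi) : bdry b ≠ bdry a := by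
  intro h
  have := om_chord_end h0 h1
  rw [h, sub_self] at this
  simp [om] at this

lemma isClockwiseParam_bdry : IsClockwiseParam wulffBody (2 * Real.pi) bdry where
  pos := Real.two_pi_pos
  contDiff := contDiff_bdry
  periodic := bdry_periodic
  injOn := by
    intro a ha b hb hab
    rcases lt_trichotomy a b with h | h | h
    · exact absurd hab.symm (bdry_injOn (by linarith) (by linarith [ha.1, hb.2]))
    · exact h
    · exact absurd hab (bdry_injOn (by linarith) (by linarith [hb.1, ha.2]))
  range_eq := frontier_wulffBody.symm
  unitSpeed s := by rw [deriv_bdry]; exact tang_sq s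
  clockwise s := by rw [deriv_bdry]; exact om_bdry_tang_neg s

/-! ### Chords of the curve and their heights -/

lemma contDiff_om {n : WithTop ℕ∞} : ContDiff ℝ n fun x : (ℝ × ℝ) × ℝ × ℝ => om x.1 x.2 := by
  unfold om; fun_prop

/-- Twice the area swept by the boundary curve, seen from the origin. -/
def sweep (s : ℝ) : ℝ := -∫ r in (0 : ℝ)..s, om (bdry r) (tang r)

lemma continuous_om_bdry_tang : Continuous fun r => om (bdry r) (tang r) :=
  continuous_om.comp (f := fun r => (bdry r, tang r)) (continuous_bdry.prodMk continuous_tang)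

lemma hasDerivAt_sweep (s : ℝ) : HasDerivAt sweep (-om (bdry s) (tang s)) s :=
  (intervalIntegral.integral_hasDerivAt_right (continuous_om_bdry_tang.intervalIntegrable _ _)
    (continuous_om_bdry_tang.stronglyMeasurableAtFilter _ _) continuous_om_bdry_tang.continuousAt).fun_neg

lemma contDiff_sweep : ContDiff ℝ 2 sweep := by
  rw [show (2 : WithTop ℕ∞) = 1 + 1 by norm_num, contDiff_succ_iff_deriv]
  refine ⟨fun s => (hasDerivAt_sweep s).differentiableAt, by simp, ?_⟩
  rw [show deriv sweep = fun s => -om (bdry s) (tang s) from funext fun s => (hasDerivAt_sweep s).deriv]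
  have h1 : ContDiff ℝ 1 bdry := contDiff_bdry.of_le (by norm_num)
  exact (contDiff_om.comp (f := fun r => (bdry r, tang r)) (h1.prodMk contDiff_tang)).neg

/-- The chord of the boundary curve from the parameter `a` to `b`. -/
def chord (a b : ℝ) : ℝ × ℝ := bdry b - bdry a

/-- The third coordinate of the horizontal lift of the arc of the boundary curve from `a` to `b`. -/
def height (a b : ℝ) : ℝ := sweep b - sweep a + om (bdry a) (bdry b)

/-- The derivative of the height with respect to an end of the arc is the area form of the chord and
the tangent there. Its sign is that of `om_chord_end`; the other end is governed by
`om_chord_start`. -/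
lemma hasDerivAt_height_right (a b : ℝ) : HasDerivAt (height a) (-om (chord a b) (tang b)) b := by
  have h1 : HasDerivAt (fun s => (bdry s).1) (tang b).1 b := (hasDerivAt_bdry b).fst
  have h2 : HasDerivAt (fun s => (bdry s).2) (tang b).2 b := (hasDerivAt_bdry b).snd
  refine (((hasDerivAt_sweep b).sub_const (sweep a)).fun_add
    ((h2.const_mul (bdry a).1).fun_sub (h1.const_mul (bdry a).2))).congr_deriv ?_
  simp only [chord, om, Prod.fst_sub, Prod.snd_sub]
  ring

lemma hasDerivAt_height_left (a b : ℝ) : HasDerivAt (fun a => height a b) (-om (chord a b) (tang a)) a := by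
  have h1 : HasDerivAt (fun s => (bdry s).1) (tang a).1 a := (hasDerivAt_bdry a).fst
  have h2 : HasDerivAt (fun s => (bdry s).2) (tang a).2 a := (hasDerivAt_bdry a).snd
  refine (((hasDerivAt_sweep a).const_sub (sweep b)).fun_add
    ((h1.mul_const (bdry b).2).fun_sub (h2.mul_const (bdry b).1))).congr_deriv ?_
  simp only [chord, om, Prod.fst_sub, Prod.snd_sub]
  ring

lemma height_self (a : ℝ) : height a a = 0 := by simp [height, om_self]

/-- The distance between the two poles. -/
def poleHeight : ℝ := height 0 (2 * Real.pi)

/-- A full turn sweeps the same area from every starting point. All lifted curves therefore end at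
the same pole. -/
lemma height_add_two_pi (a : ℝ) : height a (a + 2 * Real.pi) = poleHeight := by
  have hd : ∀ s, HasDerivAt (fun s => sweep (s + 2 * Real.pi) - sweep s) 0 s := fun s => by
    refine (((hasDerivAt_sweep _).comp_add_const s (2 * Real.pi)).fun_sub (hasDerivAt_sweep s)).congr_deriv ?_
    rw [bdry_add_two_pi, tang_add_two_pi, sub_self]
  have h := is_const_of_deriv_eq_zero (fun r => (hd r).differentiableAt) (fun r => (hd r).deriv) a 0
  have e0 := bdry_add_two_pi 0
  rw [zero_add] at e0 h
  simp only [height, poleHeight, bdry_add_two_pi, om_self, add_zero, e0]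
  exact h

lemma height_shift (a b : ℝ) : height (a + 2 * Real.pi) (b + 2 * Real.pi) = height a b := by
  have ha := height_add_two_pi a
  have hb := height_add_two_pi b
  simp only [height, bdry_add_two_pi, om_self, add_zero] at *
  linarith

lemma chord_shift (a b : ℝ) : chord (a + 2 * Real.pi) (b + 2 * Real.pi) = chord a b := by
  simp only [chord, bdry_add_two_pi]

lemma height_strictMonoOn (a : ℝ) : StrictMonoOn (height a) (Icc a (a + 2 * Real.pi)) := by
  refine strictMonoOn_of_deriv_pos (convex_Icc _ _)
    (fun s _ => (hasDerivAt_height_right a s).continuousAt.continuousWithinAt) fun s hs => ?_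
  rw [interior_Icc] at hs
  rw [(hasDerivAt_height_right a s).deriv, neg_pos]
  exact om_chord_end (by linarith [hs.1]) (by linarith [hs.2])

lemma height_strictAntiOn (b : ℝ) : StrictAntiOn (fun a => height a b) (Icc (b - 2 * Real.pi) b) := by
  refine strictAntiOn_of_deriv_neg (convex_Icc _ _)
    (fun s _ => (hasDerivAt_height_left s b).continuousAt.continuousWithinAt) fun s hs => ?_
  rw [interior_Icc] at hs
  rw [(hasDerivAt_height_left s b).deriv, neg_lt_zero]
  exact om_chord_start (by linarith [hs.2]) (by linarith [hs.1])

lemma height_mem {a b : ℝ} (h0 : 0 < b - a) (h1 : b - a < 2 * Real.pi) :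
    height a b ∈ Ioo 0 poleHeight := by
  have hb : b ∈ Icc a (a + 2 * Real.pi) := ⟨by linarith, by linarith⟩
  have h2 := height_strictMonoOn a (left_mem_Icc.2 (by linarith)) hb (by linarith)
  have h3 := height_strictMonoOn a hb (right_mem_Icc.2 (by linarith)) (by linarith)
  rw [height_self] at h2
  rw [height_add_two_pi] at h3
  exact ⟨h2, h3⟩

lemma chord_ne_zero {a b : ℝ} (h0 : 0 < b - a) (h1 : b - a < 2 * Real.pi) : chord a b ≠ 0 :=
  sub_ne_zero.2 (bdry_injOn h0 h1)

lemma contDiff_chord : ContDiff ℝ 2 fun x : ℝ × ℝ => chord x.1 x.2 := by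
  have := contDiff_bdry
  unfold chord
  fun_prop

lemma contDiff_height : ContDiff ℝ 2 fun x : ℝ × ℝ => height x.1 x.2 := by
  have h := contDiff_bdry
  exact ((contDiff_sweep.comp contDiff_snd).sub (contDiff_sweep.comp contDiff_fst)).add
    (contDiff_om.comp (f := fun x : ℝ × ℝ => (bdry x.1, bdry x.2)) (by fun_prop))

/-- Polar coordinates with the angle expressed through `turn`, which is onto because it differs from
the identity by a bounded amount. -/
lemma exists_tang (z : ℝ × ℝ) : ∃ r s : ℝ, 0 ≤ r ∧ z = r • tang s := by
  set c : ℂ := ⟨z.1, z.2⟩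
  set θ := -c.arg with hθ
  have hs : ∃ s, turn s = θ := by
    have hb : ∀ s, |turn s - s| ≤ 1 := fun s => by
      have h1 := Real.abs_sin_le_one s
      have h2 := Real.abs_cos_le_one s
      rw [turn, add_sub_cancel_left, abs_div, abs_mul, abs_mul, abs_abs]
      have h3 : |Real.sin s| * |Real.sin s| * |Real.cos s| ≤ 1 := by
        have := abs_nonneg (Real.sin s)
        have := abs_nonneg (Real.cos s)
        nlinarith [mul_le_mul h1 h1 (abs_nonneg _) zero_le_one]
      rw [abs_of_pos (by norm_num : (0 : ℝ) < 4)]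
      linarith
    have h1 := abs_le.1 (hb (θ - 1))
    have h2 := abs_le.1 (hb (θ + 1))
    obtain ⟨s, -, hs⟩ := intermediate_value_Icc (show θ - 1 ≤ θ + 1 by linarith)
      continuous_turn.continuousOn (show θ ∈ Icc (turn (θ - 1)) (turn (θ + 1)) from
        ⟨by linarith [h1.2], by linarith [h2.1]⟩)
    exact ⟨s, hs⟩
  obtain ⟨s, hs⟩ := hs
  refine ⟨‖c‖, s, norm_nonneg _, ?_⟩
  have h1 := Complex.norm_mul_cos_arg c
  have h2 := Complex.norm_mul_sin_arg c
  simp only [tang, hs, hθ, Real.cos_neg, Real.sin_neg, neg_neg]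
  ext
  · exact h1.symm
  · exact h2.symm

/-- A chord in the direction `tang s`, up to a common shift, surrounds `s`. -/
lemma chord_location {a b c s : ℝ} (h0 : 0 < b - a) (h1 : b - a < 2 * Real.pi) (hc : 0 < c)
    (h : chord a b = c • tang s) (ha : a ∈ Ico (s - Real.pi) (s + Real.pi)) :
    a ∈ Ioo (s - Real.pi) s ∧ b ∈ Ioo s (s + Real.pi) := by
  -- The chord inequalities at the two ends, evaluated for a chord parallel to `tang s`, say on
  -- which side of `s` each end lies.
  have hA : 0 < Real.sin (turn s - turn a) := by
    have := om_chord_start h0 h1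
    rw [← chord, h, om_smul_left, om_tang] at this
    exact pos_of_mul_pos_right this hc.le
  have hB : 0 < Real.sin (turn b - turn s) := by
    have := om_chord_end h0 h1
    rw [← chord, h, om_smul_left, om_tang, ← neg_sub, Real.sin_neg] at this
    by_contra hn
    nlinarith
  have hpi := Real.pi_pos
  have ha' : a ∈ Ioo (s - Real.pi) s := by
    constructor
    · rcases ha.1.eq_or_lt with h' | h'
      · rw [← h', turn_sub_pi] at hA; simp at hA
      · exact h'
    · by_contra hn
      rcases (not_lt.1 hn).eq_or_lt with h' | h'
      · rw [h'] at hA; simp at hA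
      · have := sin_turn_sub_pos (a := s) (b := a) (by linarith) (by linarith [ha.2])
        rw [← neg_sub, Real.sin_neg] at this
        linarith
  refine ⟨ha', ?_, ?_⟩
  · by_contra hn
    rcases (not_lt.1 hn).eq_or_lt with h' | h'
    · rw [h'] at hB; simp at hB
    · have := sin_turn_sub_pos (a := b) (b := s) (by linarith) (by linarith [ha'.1])
      rw [← neg_sub, Real.sin_neg] at this
      linarith
  · by_contra hn
    rcases (not_lt.1 hn).eq_or_lt with h' | h'
    · rw [← h', turn_add_pi] at hB; simp at hB
    · have := sin_turn_sub_neg (a := s) (b := b) (by linarith) (by linarith [ha'.2])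
      linarith

lemma om_bdry_strictAntiOn (s : ℝ) :
    StrictAntiOn (fun a => om (bdry a) (tang s)) (Icc (s - Real.pi) s) := fun a ha b hb hab =>
  om_bdry_gt hab fun r hr => by
    rw [← neg_sub, Real.sin_neg, neg_lt_zero]
    exact sin_turn_sub_pos (by linarith [hr.2, hb.2]) (by linarith [hr.1, ha.1])

lemma om_bdry_strictMonoOn (s : ℝ) :
    StrictMonoOn (fun a => om (bdry a) (tang s)) (Icc s (s + Real.pi)) := fun a ha b hb hab =>
  om_bdry_lt hab fun r hr => sin_turn_sub_pos (by linarith [hr.1, ha.1]) (by linarith [hr.2, hb.2])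

/-- Parallel chords of the same height coincide. -/
lemma chord_unique {a b a' b' s : ℝ} (ha : a ∈ Ioo (s - Real.pi) s) (hb : b ∈ Ioo s (s + Real.pi))
    (ha' : a' ∈ Ioo (s - Real.pi) s) (hb' : b' ∈ Ioo s (s + Real.pi))
    (h : om (bdry a) (tang s) = om (bdry b) (tang s))
    (h' : om (bdry a') (tang s) = om (bdry b') (tang s)) (ht : height a b = height a' b') :
    a = a' ∧ b = b' := by
  -- Parallel chords are nested: if the left end moves towards `s`, so does the right end, and the
  -- height strictly decreases.
  have key : ∀ a b a' b', a ∈ Ioo (s - Real.pi) s → b ∈ Ioo s (s + Real.pi) →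
      a' ∈ Ioo (s - Real.pi) s → b' ∈ Ioo s (s + Real.pi) →
      om (bdry a) (tang s) = om (bdry b) (tang s) → om (bdry a') (tang s) = om (bdry b') (tang s) →
      height a b = height a' b' → ¬ a < a' := by
    intro a b a' b' ha hb ha' hb' h h' ht hlt
    have h1 := om_bdry_strictAntiOn s (Ioo_subset_Icc_self ha) (Ioo_subset_Icc_self ha') hlt
    dsimp only at h1
    rw [h, h'] at h1
    have h2 := ((om_bdry_strictMonoOn s).lt_iff_lt (Ioo_subset_Icc_self hb')
      (Ioo_subset_Icc_self hb)).1 h1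
    have h3 := height_strictAntiOn b (show a ∈ Icc _ _ from ⟨by linarith [ha.1, hb.2], by linarith [ha.2, hb.1]⟩)
      (show a' ∈ Icc _ _ from ⟨by linarith [ha'.1, hb.2], by linarith [ha'.2, hb.1]⟩) hlt
    have h4 := height_strictMonoOn a' (show b' ∈ Icc _ _ from ⟨by linarith [ha'.2, hb'.1], by linarith [ha'.1, hb'.2]⟩)
      (show b ∈ Icc _ _ from ⟨by linarith [ha'.2, hb.1], by linarith [ha'.1, hb.2]⟩) h2
    dsimp only at h3
    linarith
  have haa : a = a' := le_antisymm (not_lt.1 (key _ _ _ _ ha' hb' ha hb h' h ht.symm))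
    (not_lt.1 (key _ _ _ _ ha hb ha' hb' h h' ht))
  refine ⟨haa, (om_bdry_strictMonoOn s).injOn (Ioo_subset_Icc_self hb) (Ioo_subset_Icc_self hb') ?_⟩
  rw [← h, ← h', haa]

/-- Every direction and every height between the poles is realized by a chord. -/
lemma exists_chord (s : ℝ) {t : ℝ} (ht : t ∈ Ioo 0 poleHeight) : ∃ a b c : ℝ, 0 < b - a ∧
    b - a < 2 * Real.pi ∧ 0 < c ∧ chord a b = c • tang s ∧ height a b = t := by
  have hpi := Real.pi_pos
  have hH : Continuous fun a => om (bdry a) (tang s) :=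
    continuous_om.comp (f := fun a => (bdry a, tang s)) (continuous_bdry.prodMk continuous_const)
  set H := fun a => om (bdry a) (tang s) with hHd
  -- This is the family of chords parallel to `tang s`, including the degenerate ones. The value of
  -- the linear form maps it homeomorphically to an interval, so it is connected. The height runs on
  -- it from `0` at `(s, s)` to the distance of the poles at `(s - π, s + π)`.
  set C : Set (ℝ × ℝ) := (Icc (s - Real.pi) s ×ˢ Icc s (s + Real.pi)) ∩ {x | H x.1 = H x.2} with hC
  have hCc : IsCompact C := (isCompact_Icc.prod isCompact_Icc).inter_right
    (isClosed_eq (hH.comp continuous_fst) (hH.comp continuous_snd))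
  have hends : H (s - Real.pi) = H (s + Real.pi) := by
    have := bdry_add_two_pi (s - Real.pi)
    rw [show s - Real.pi + 2 * Real.pi = s + Real.pi by ring] at this
    simp only [hHd, this]
  have himg : (fun x : ℝ × ℝ => H x.1) '' C = Icc (H s) (H (s + Real.pi)) := by
    ext y
    constructor
    · rintro ⟨x, hx, rfl⟩
      have hx2 : H x.1 = H x.2 := hx.2
      dsimp only
      rw [hx2]
      exact ⟨(om_bdry_strictMonoOn s).monotoneOn (left_mem_Icc.2 (by linarith)) hx.1.2 hx.1.2.1,
        (om_bdry_strictMonoOn s).monotoneOn hx.1.2 (right_mem_Icc.2 (by linarith)) hx.1.2.2⟩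
    · intro hy
      obtain ⟨b, hb, hby⟩ := intermediate_value_Icc (show s ≤ s + Real.pi by linarith) hH.continuousOn hy
      rw [← hends] at hy
      obtain ⟨a, ha, hay⟩ := intermediate_value_Icc' (show s - Real.pi ≤ s by linarith) hH.continuousOn hy
      exact ⟨(a, b), ⟨⟨ha, hb⟩, hay.trans hby.symm⟩, hay⟩
  have hpre : IsPreconnected C := by
    have hcs : CompactSpace C := isCompact_iff_compactSpace.1 hCc
    have hinj : Function.Injective fun x : C => H x.1.1 := by
      rintro ⟨x, hx⟩ ⟨y, hy⟩ hxy
      dsimp only at hxy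
      have h1 := (om_bdry_strictAntiOn s).injOn hx.1.1 hy.1.1 hxy
      have h2 : H x.2 = H y.2 := by rw [← hx.2, ← hy.2, hxy]
      have h3 := (om_bdry_strictMonoOn s).injOn hx.1.2 hy.1.2 h2
      exact Subtype.ext (Prod.ext h1 h3)
    have hcl : IsClosedEmbedding fun x : C => H x.1.1 :=
      Continuous.isClosedEmbedding (by fun_prop) hinj
    have h1 : (fun x : C => H x.1.1) '' univ = Icc (H s) (H (s + Real.pi)) := by
      rw [← himg]; ext y; simp
    have h2 : IsPreconnected (univ : Set C) := by
      rw [← hcl.isInducing.isPreconnected_image, h1]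
      exact isPreconnected_Icc
    have h3 := h2.image (Subtype.val) continuous_subtype_val.continuousOn
    simpa using h3
  have hht : ContinuousOn (fun x : ℝ × ℝ => height x.1 x.2) C := contDiff_height.continuous.continuousOn
  obtain ⟨⟨a, b⟩, hab, habt⟩ := hpre.intermediate_value (f := fun x : ℝ × ℝ => height x.1 x.2)
    (a := (s, s)) (b := (s - Real.pi, s + Real.pi))
    ⟨⟨right_mem_Icc.2 (by linarith), left_mem_Icc.2 (by linarith)⟩, rfl⟩
    ⟨⟨left_mem_Icc.2 (by linarith), right_mem_Icc.2 (by linarith)⟩, hends⟩ hht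
    (show t ∈ Icc _ _ by
      have h1 := height_add_two_pi (s - Real.pi)
      rw [show s - Real.pi + 2 * Real.pi = s + Real.pi by ring] at h1
      simp only [height_self, h1]
      exact Ioo_subset_Icc_self ht)
  dsimp only at habt
  have h0 : 0 < b - a := by
    rcases (show a ≤ b from hab.1.1.2.trans hab.1.2.1).eq_or_lt with h | h
    · rw [h, height_self] at habt; exact absurd habt ht.1.ne
    · linarith
  have h1 : b - a < 2 * Real.pi := by
    rcases (show b ≤ a + 2 * Real.pi by have := hab.1.1.1; have := hab.1.2.2; dsimp only at *; linarith).eq_or_lt with h | h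
    · rw [h, height_add_two_pi] at habt; exact absurd habt ht.2.ne'
    · linarith
  have hz : om (chord a b) (tang s) = 0 := by
    have h2 : H a = H b := hab.2
    rw [chord, om_sub_left]; simp only [hHd] at h2; linarith
  have hf := tang_frame s (chord a b)
  rw [om_comm (tang s), hz, neg_zero, zero_smul, add_zero] at hf
  refine ⟨a, b, om (chord a b) (J (tang s)), h0, h1, ?_, hf, habt⟩
  have h2 := om_chord_start h0 h1
  rw [← chord, hf, om_smul_left, om_tang] at h2
  have h3 : 0 ≤ Real.sin (turn s - turn a) := by
    have e1 := turn_strictMono.monotone (show a ≤ s from hab.1.1.2)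
    have e2 := turn_strictMono.monotone (show s - Real.pi ≤ a from hab.1.1.1)
    rw [turn_sub_pi] at e2
    exact Real.sin_nonneg_of_nonneg_of_le_pi (by linarith) (by linarith)
  exact pos_of_mul_pos_left h2 h3

/-! ### The dilation factor and its horizontal gradient -/

/-- Coordinates `(λ, a, b)` of a point: the chord from `a` to `b`, dilated by `λ`, at the height of the
chord. -/
def wulffMap (x : ℝ × ℝ × ℝ) : Heis :=
  ((x.1 • chord x.2.1 x.2.2).1, (x.1 • chord x.2.1 x.2.2).2, height x.2.1 x.2.2)

/-- The parameters `(λ, a, b)` that give the points off the axis and between the poles. -/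
def wulffStrip : Set (ℝ × ℝ × ℝ) := {x | 0 < x.1 ∧ 0 < x.2.2 - x.2.1 ∧ x.2.2 - x.2.1 < 2 * Real.pi}

/-- The points off the axis at a height between the poles. -/
def offAxis : Set Heis := {p | (p.1, p.2.1) ≠ 0 ∧ p.2.2 ∈ Ioo 0 poleHeight}

lemma isOpen_offAxis : IsOpen offAxis := by
  refine IsOpen.inter (isOpen_ne_fun (by fun_prop) continuous_const)
    (isOpen_Ioo.preimage (continuous_snd.comp continuous_snd))

lemma contDiff_wulffMap : ContDiff ℝ 2 wulffMap := by
  have h1 : ContDiff ℝ 2 fun x : ℝ × ℝ × ℝ => x.1 • chord x.2.1 x.2.2 :=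
    contDiff_fst.smul (contDiff_chord.comp contDiff_snd)
  exact h1.fst.prodMk (h1.snd.prodMk (contDiff_height.comp contDiff_snd))

lemma wulffMap_mem {x : ℝ × ℝ × ℝ} (hx : x ∈ wulffStrip) : wulffMap x ∈ offAxis :=
  ⟨smul_ne_zero hx.1.ne' (chord_ne_zero hx.2.1 hx.2.2), height_mem hx.2.1 hx.2.2⟩

lemma exists_hasFDerivAt_wulffMap (x : ℝ × ℝ × ℝ) : ∃ L : (ℝ × ℝ × ℝ) →L[ℝ] ℝ × ℝ × ℝ,
    HasFDerivAt wulffMap L x ∧ ∀ l u v : ℝ, L (l, u, v) =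
      ((l • chord x.2.1 x.2.2 + x.1 • (v • tang x.2.2 - u • tang x.2.1)).1,
        (l • chord x.2.1 x.2.2 + x.1 • (v • tang x.2.2 - u • tang x.2.1)).2,
        -(v * om (chord x.2.1 x.2.2) (tang x.2.2) + u * om (chord x.2.1 x.2.2) (tang x.2.1))) := by
  have pa : HasFDerivAt (fun x : ℝ × ℝ × ℝ => x.2.1) _ x := (hasFDerivAt_snd (𝕜 := ℝ) (p := x)).fst
  have pb : HasFDerivAt (fun x : ℝ × ℝ × ℝ => x.2.2) _ x := (hasFDerivAt_snd (𝕜 := ℝ) (p := x)).snd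
  have ba := HasFDerivAt.comp (g := bdry) x (hasDerivAt_bdry x.2.1).hasFDerivAt pa
  have bb := HasFDerivAt.comp (g := bdry) x (hasDerivAt_bdry x.2.2).hasFDerivAt pb
  have sa := HasFDerivAt.comp (g := sweep) x (hasDerivAt_sweep x.2.1).hasFDerivAt pa
  have sb := HasFDerivAt.comp (g := sweep) x (hasDerivAt_sweep x.2.2).hasFDerivAt pb
  have h1 : HasFDerivAt (fun x : ℝ × ℝ × ℝ => x.1 • chord x.2.1 x.2.2) _ x :=
    (hasFDerivAt_fst (p := x)).smul (bb.sub ba)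
  have h2 : HasFDerivAt (fun x : ℝ × ℝ × ℝ => height x.2.1 x.2.2) _ x :=
    (sb.sub sa).add ((ba.fst.mul bb.snd).sub (ba.snd.mul bb.fst))
  refine ⟨_, h1.fst.prodMk (h1.snd.prodMk h2), fun l u v => ?_⟩
  ext
  · simp [chord]; ring
  · simp [chord]; ring
  · simp [chord, om]; ring

/-- Pairing the planar equation with the chord removes `l` and leaves the difference of the two
terms whose sum is `h2`. Both vanish, and a chord is not parallel to the tangents at its ends. -/
lemma wulffMap_injective_deriv {x : ℝ × ℝ × ℝ} (hx : x ∈ wulffStrip) {l u v : ℝ}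
    (h1 : l • chord x.2.1 x.2.2 + x.1 • (v • tang x.2.2 - u • tang x.2.1) = 0)
    (h2 : v * om (chord x.2.1 x.2.2) (tang x.2.2) + u * om (chord x.2.1 x.2.2) (tang x.2.1) = 0) :
    l = 0 ∧ u = 0 ∧ v = 0 := by
  have hq := om_chord_end hx.2.1 hx.2.2
  have hp := om_chord_start hx.2.1 hx.2.2
  rw [← chord] at hp hq
  set z := chord x.2.1 x.2.2 with hz
  have h3 : om z (l • z + x.1 • (v • tang x.2.2 - u • tang x.2.1)) = 0 := by rw [h1]; simp [om]
  rw [om_add_right, om_smul_right, om_self, om_smul_right, om_sub_right, om_smul_right, om_smul_right,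
    mul_zero, zero_add] at h3
  have h4 := (mul_eq_zero.1 h3).resolve_left hx.1.ne'
  have hv : v = 0 := by
    have : v * om z (tang x.2.2) = 0 := by linarith
    exact (mul_eq_zero.1 this).resolve_right hq.ne
  have hu : u = 0 := by
    have : u * om z (tang x.2.1) = 0 := by linarith
    exact (mul_eq_zero.1 this).resolve_right hp.ne'
  rw [hu, hv] at h1
  simp only [zero_smul, sub_self, smul_zero, add_zero] at h1
  exact ⟨(smul_eq_zero.1 h1).resolve_right (chord_ne_zero hx.2.1 hx.2.2), hu, hv⟩

/-- The parameters `a` and `b` are determined only up to a common period, which can be spent on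
placing `a` in a given window. -/
lemma exists_shift (a d c : ℝ) : ∃ a' ∈ Ico c (c + 2 * Real.pi), chord a' (a' + d) = chord a (a + d) ∧
    height a' (a' + d) = height a (a + d) := by
  have hper : Function.Periodic (fun a => (chord a (a + d), height a (a + d))) (2 * Real.pi) := fun a => by
    simp only [add_right_comm a (2 * Real.pi) d, chord_shift, height_shift]
  obtain ⟨a', ha', h⟩ := hper.exists_mem_Ico Real.two_pi_pos a c
  exact ⟨a', ha', (congrArg Prod.fst h).symm, (congrArg Prod.snd h).symm⟩

/-- Both chords point in the direction of some `tang s`. After shifting them to the window around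
`s`, they are parallel chords of equal height and coincide, so the factors agree. -/
lemma wulffMap_injective_fst {x y : ℝ × ℝ × ℝ} (hx : x ∈ wulffStrip) (hy : y ∈ wulffStrip)
    (h : wulffMap x = wulffMap y) : x.1 = y.1 := by
  have hc : x.1 • chord x.2.1 x.2.2 = y.1 • chord y.2.1 y.2.2 :=
    Prod.ext (congrArg (fun p => p.1) h :) (congrArg (fun p => p.2.1) h :)
  have ht : height x.2.1 x.2.2 = height y.2.1 y.2.2 := congrArg (fun p => p.2.2) h
  obtain ⟨r, s, hr, hrs⟩ := exists_tang (chord x.2.1 x.2.2)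
  have hr0 : 0 < r := lt_of_le_of_ne hr fun h0 => chord_ne_zero hx.2.1 hx.2.2 (by rw [hrs, ← h0, zero_smul])
  have hys : chord y.2.1 y.2.2 = (y.1⁻¹ * x.1 * r) • tang s := by
    rw [mul_assoc, mul_smul, mul_smul, ← hrs, hc, smul_smul, inv_mul_cancel₀ hy.1.ne', one_smul]
  have hr1 : 0 < y.1⁻¹ * x.1 * r := mul_pos (mul_pos (inv_pos.2 hy.1) hx.1) hr0
  obtain ⟨a, ha, hac, hah⟩ := exists_shift x.2.1 (x.2.2 - x.2.1) (s - Real.pi)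
  obtain ⟨a', ha', hac', hah'⟩ := exists_shift y.2.1 (y.2.2 - y.2.1) (s - Real.pi)
  rw [add_sub_cancel] at hac hah hac' hah'
  rw [show s - Real.pi + 2 * Real.pi = s + Real.pi by ring] at ha ha'
  have hl := chord_location (by simpa using hx.2.1) (by simpa using hx.2.2) hr0 (hac.trans hrs) ha
  have hl' := chord_location (by simpa using hy.2.1) (by simpa using hy.2.2) hr1 (hac'.trans hys) ha'
  have hH : ∀ {a b c : ℝ}, chord a b = c • tang s → om (bdry a) (tang s) = om (bdry b) (tang s) := by
    intro a b c h
    have : om (chord a b) (tang s) = 0 := by rw [h, om_smul_left, om_self, mul_zero]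
    rw [chord, om_sub_left] at this
    linarith
  obtain ⟨e1, e2⟩ := chord_unique hl.1 hl.2 hl'.1 hl'.2 (hH (hac.trans hrs)) (hH (hac'.trans hys))
    (by rw [hah, hah', ht])
  have hce : chord x.2.1 x.2.2 = chord y.2.1 y.2.2 := by rw [← hac, ← hac', e2, e1]
  rw [← hce] at hc
  exact smul_left_injective ℝ (chord_ne_zero hx.2.1 hx.2.2) hc

lemma exists_wulffMap_eq {p : Heis} (hp : p ∈ offAxis) : ∃ x ∈ wulffStrip, wulffMap x = p := by
  obtain ⟨r, s, hr, hrs⟩ := exists_tang (p.1, p.2.1)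
  have hr0 : 0 < r := lt_of_le_of_ne hr fun h0 => hp.1 (by rw [hrs, ← h0, zero_smul])
  obtain ⟨a, b, c, h0, h1, hc, hab, ht⟩ := exists_chord s hp.2
  refine ⟨(r / c, a, b), ⟨div_pos hr0 hc, h0, h1⟩, ?_⟩
  have hz : (r / c) • chord a b = (p.1, p.2.1) := by
    rw [hab, smul_smul, div_mul_cancel₀ _ hc.ne', hrs]
  simp only [wulffMap, hz, ht]

open Classical in
/-- The dilation factor of a point with respect to the Pansu–Wulff shape. -/
def radius (p : Heis) : ℝ := if h : ∃ x ∈ wulffStrip, wulffMap x = p then h.choose.1 else 0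

lemma radius_wulffMap {x : ℝ × ℝ × ℝ} (hx : x ∈ wulffStrip) : radius (wulffMap x) = x.1 := by
  have h : ∃ y ∈ wulffStrip, wulffMap y = wulffMap x := ⟨x, hx, rfl⟩
  rw [radius, dif_pos h]
  exact wulffMap_injective_fst h.choose_spec.1 hx h.choose_spec.2

/-- The default value is the appropriate one on the axis, where the dilation factor tends to zero.
The ball thus contains the axis between the poles. -/
lemma radius_axis {p : Heis} (hp : (p.1, p.2.1) = 0) : radius p = 0 := by
  rw [radius, dif_neg]
  rintro ⟨x, hx, rfl⟩
  exact (wulffMap_mem hx).1 hp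

lemma radius_dilate {p : Heis} (hp : p ∈ offAxis) {μ : ℝ} (hμ : 0 < μ) :
    radius (μ * p.1, μ * p.2.1, p.2.2) = μ * radius p := by
  obtain ⟨x, hx, rfl⟩ := exists_wulffMap_eq hp
  have hx' : (μ * x.1, x.2) ∈ wulffStrip := ⟨mul_pos hμ hx.1, hx.2⟩
  rw [radius_wulffMap hx]
  convert radius_wulffMap hx' using 2
  simp [wulffMap, mul_assoc]

lemma isOpen_wulffStrip : IsOpen wulffStrip :=
  have h : Continuous fun x : ℝ × ℝ × ℝ => x.2.2 - x.2.1 := by fun_prop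
  (isOpen_lt continuous_const continuous_fst).inter
    ((isOpen_lt continuous_const h).inter (isOpen_lt h continuous_const))

/-- Near a point the factor is the first component of a `C²` local inverse of `wulffMap`, so its
differential is known on the image of the derivative of `wulffMap`. -/
lemma exists_radius_local {x : ℝ × ℝ × ℝ} (hx : x ∈ wulffStrip) : ContDiffAt ℝ 2 radius (wulffMap x) ∧
    ∀ L : (ℝ × ℝ × ℝ) →L[ℝ] ℝ × ℝ × ℝ, HasFDerivAt wulffMap L x → ∀ w,
      fderiv ℝ radius (wulffMap x) (L w) = w.1 := by
  obtain ⟨L, hL, hLv⟩ := exists_hasFDerivAt_wulffMap x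
  have hinj : ∀ w, L w = 0 → w = 0 := by
    rintro ⟨l, u, v⟩ h
    rw [hLv] at h
    obtain ⟨h1, h2, h3⟩ := wulffMap_injective_deriv hx (l := l) (u := u) (v := v)
      (Prod.ext (congrArg (fun p => p.1) h :) (congrArg (fun p => p.2.1) h :))
      (neg_eq_zero.1 (congrArg (fun p => p.2.2) h))
    rw [h1, h2, h3]; rfl
  obtain ⟨g, hg, hg0, hr, -, hd⟩ := exists_local_inverse contDiff_wulffMap.contDiffAt hL (by simp) hinj
  have heq : radius =ᶠ[𝓝 (wulffMap x)] fun q => (g q).1 := by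
    have h1 : ∀ᶠ q in 𝓝 (wulffMap x), g q ∈ wulffStrip :=
      hg.continuousAt.eventually (isOpen_wulffStrip.mem_nhds (by rwa [hg0]))
    filter_upwards [hr, h1] with q hq h1
    rw [← radius_wulffMap h1, hq]
  refine ⟨hg.fst.congr_of_eventuallyEq heq, fun L' hL' w => ?_⟩
  rw [hL'.unique hL, heq.fderiv_eq, (hg.differentiableAt (by simp)).hasFDerivAt.fst.fderiv]
  have h2 := hd (L w)
  have h3 : fderiv ℝ g (wulffMap x) (L w) = w := by
    have := hinj (fderiv ℝ g (wulffMap x) (L w) - w) (by rw [map_sub, h2, sub_self])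
    exact sub_eq_zero.1 this
  simp [h3]

lemma contDiffAt_radius {p : Heis} (hp : p ∈ offAxis) : ContDiffAt ℝ 2 radius p := by
  obtain ⟨x, hx, rfl⟩ := exists_wulffMap_eq hp
  exact (exists_radius_local hx).1

lemma fderiv_radius_radial {p : Heis} (hp : p ∈ offAxis) :
    fderiv ℝ radius p (p.1, p.2.1, 0) = radius p := by
  obtain ⟨x, hx, rfl⟩ := exists_wulffMap_eq hp
  obtain ⟨L, hL, hLv⟩ := exists_hasFDerivAt_wulffMap x
  have h := (exists_radius_local hx).2 L hL (x.1, 0, 0)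
  rw [hLv] at h
  rw [radius_wulffMap hx, ← h]
  simp [wulffMap]

/-- The horizontal gradient. -/
def hgrad (g : Heis → ℝ) (p : Heis) : ℝ × ℝ := (fderiv ℝ g p (X p), fderiv ℝ g p (Y p))

/-- At factor one, varying `λ` and `b` with `a` fixed moves the point horizontally, along the chord
and along `tang b`. The derivative of the factor is the coefficient of the chord when `ν` is
expanded in these two vectors. -/
lemma fderiv_radius_horiz {a b : ℝ} (h0 : 0 < b - a) (h1 : b - a < 2 * Real.pi) (ν : ℝ × ℝ) :
    fderiv ℝ radius (wulffMap (1, a, b)) (horiz (wulffMap (1, a, b)) ν)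
      = (om (tang b) (chord a b))⁻¹ * om (tang b) ν := by
  obtain ⟨L, hL, hLv⟩ := exists_hasFDerivAt_wulffMap (1, a, b)
  have hq : om (tang b) (chord a b) ≠ 0 := by
    rw [om_comm]; exact neg_ne_zero.2 (om_chord_end h0 h1).ne
  have h := (exists_radius_local (x := (1, a, b)) ⟨one_pos, h0, h1⟩).2 L hL
    ((om (tang b) (chord a b))⁻¹ * om (tang b) ν, 0, -((om (tang b) (chord a b))⁻¹ * om (chord a b) ν))
  rw [hLv] at h
  dsimp only at h
  rw [← h]
  congr 1
  ext
  · simp only [horiz, Prod.fst_add, Prod.smul_fst, Prod.fst_sub, smul_eq_mul]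
    field_simp
    simp only [om]; ring
  · simp only [horiz, Prod.snd_add, Prod.smul_snd, Prod.snd_sub, smul_eq_mul]
    field_simp
    simp only [om]; ring
  · simp only [horiz, wulffMap, one_smul]
    rw [om_comm (chord a b) (tang b)]
    field_simp
    simp only [om]; ring

lemma hgrad_radius {a b : ℝ} (h0 : 0 < b - a) (h1 : b - a < 2 * Real.pi) :
    hgrad radius (wulffMap (1, a, b)) = (om (tang b) (chord a b))⁻¹ • J (tang b) := by
  simp only [hgrad, X, Y, fderiv_radius_horiz h0 h1]
  ext <;> simp [om, J]

lemma om_tang_chord_pos {a b : ℝ} (h0 : 0 < b - a) (h1 : b - a < 2 * Real.pi) :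
    0 < om (tang b) (chord a b) := by
  rw [om_comm]; exact neg_pos.2 (om_chord_end h0 h1)

/-! ### The enclosed set and its boundary -/

/-- The set enclosed by the Pansu–Wulff shape. -/
def wulffBall : Set Heis := {p | p.2.2 ∈ Ioo 0 poleHeight ∧ radius p < 1}

/-- Away from the heights of the poles the chords cannot degenerate, and by periodicity they form a
compact family. Points close to the axis therefore have a small dilation factor, which makes the
ball open there. -/
lemma exists_chord_norm_ge {t : ℝ} (ht : t ∈ Ioo 0 poleHeight) : ∃ m > 0, ∃ ε > 0,
    ∀ a b, 0 < b - a → b - a < 2 * Real.pi → |height a b - t| ≤ ε → m ≤ ‖chord a b‖ := by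
  obtain ⟨ε, hε, hb⟩ := Metric.nhds_basis_closedBall.mem_iff.1 (isOpen_Ioo.mem_nhds ht)
  set Q : Set (ℝ × ℝ) := (Icc 0 (2 * Real.pi) ×ˢ Icc 0 (2 * Real.pi)) ∩
    {x | |height x.1 (x.1 + x.2) - t| ≤ ε} with hQ
  have hh : Continuous fun x : ℝ × ℝ => height x.1 (x.1 + x.2) :=
    contDiff_height.continuous.comp (f := fun x : ℝ × ℝ => (x.1, x.1 + x.2)) (by fun_prop)
  have hc : Continuous fun x : ℝ × ℝ => ‖chord x.1 (x.1 + x.2)‖ :=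
    (contDiff_chord.continuous.comp (f := fun x : ℝ × ℝ => (x.1, x.1 + x.2)) (by fun_prop)).norm
  have hQc : IsCompact Q := (isCompact_Icc.prod isCompact_Icc).inter_right
    (isClosed_le (hh.sub continuous_const).abs continuous_const)
  obtain ⟨m, hm, hmQ⟩ := hQc.exists_forall_le' (a := 0) hc.continuousOn fun x hx => by
    have h1 := hb (show height x.1 (x.1 + x.2) ∈ Metric.closedBall t ε by
      rw [Metric.mem_closedBall, Real.dist_eq]; exact hx.2)
    refine norm_pos_iff.2 (chord_ne_zero ?_ ?_)
    · rw [add_sub_cancel_left]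
      rcases hx.1.2.1.eq_or_lt with h | h
      · rw [← h, add_zero, height_self] at h1; exact absurd h1.1 (lt_irrefl _)
      · exact h
    · rw [add_sub_cancel_left]
      rcases hx.1.2.2.eq_or_lt with h | h
      · rw [h, height_add_two_pi] at h1; exact absurd h1.2 (lt_irrefl _)
      · exact h
  refine ⟨m, hm, ε, hε, fun a b h0 h1 hab => ?_⟩
  obtain ⟨a', ha', hc', hh'⟩ := exists_shift a (b - a) 0
  rw [add_sub_cancel] at hc' hh'
  have := hmQ (a', b - a) ⟨⟨⟨ha'.1, by linarith [ha'.2]⟩, h0.le, h1.le⟩, by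
    simp only [mem_ofPred_eq, hh']; exact hab⟩
  rwa [hc'] at this

lemma isOpen_wulffBall : IsOpen wulffBall := by
  rw [isOpen_iff_mem_nhds]
  rintro p ⟨hp, hp1⟩
  have h1 : ∀ᶠ q : Heis in 𝓝 p, q.2.2 ∈ Ioo 0 poleHeight :=
    (continuous_snd.comp continuous_snd).continuousAt.eventually (isOpen_Ioo.mem_nhds hp)
  by_cases hz : (p.1, p.2.1) = 0
  · obtain ⟨m, hm, ε, hε, h⟩ := exists_chord_norm_ge hp
    have h2 : ∀ᶠ q : Heis in 𝓝 p, |q.2.2 - p.2.2| < ε := by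
      have hc : Continuous fun q : Heis => |q.2.2 - p.2.2| := by fun_prop
      exact hc.continuousAt.eventually (isOpen_Iio.mem_nhds (by simpa using hε))
    have h3 : ∀ᶠ q : Heis in 𝓝 p, ‖(q.1, q.2.1)‖ < m := by
      have hc : Continuous fun q : Heis => ‖(q.1, q.2.1)‖ := by fun_prop
      exact hc.continuousAt.eventually (isOpen_Iio.mem_nhds (by simp only [hz, norm_zero]; exact hm))
    filter_upwards [h1, h2, h3] with q q1 q2 q3
    refine ⟨q1, ?_⟩
    by_cases hq : (q.1, q.2.1) = 0
    · rw [radius_axis hq]; exact one_pos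
    · obtain ⟨x, hx, rfl⟩ := exists_wulffMap_eq (p := q) ⟨hq, q1⟩
      rw [radius_wulffMap hx]
      have h4 := h x.2.1 x.2.2 hx.2.1 hx.2.2 q2.le
      have h5 : ‖x.1 • chord x.2.1 x.2.2‖ < m := q3
      rw [norm_smul, Real.norm_eq_abs, abs_of_pos hx.1] at h5
      by_contra hc
      nlinarith
  · filter_upwards [h1, (contDiffAt_radius ⟨hz, hp⟩).continuousAt.eventually (isOpen_Iio.mem_nhds hp1)]
      with q q1 q2 using ⟨q1, q2⟩

/-- Parameters of the closed set bounded by the Pansu–Wulff shape. -/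
def closedParams : Set (ℝ × ℝ × ℝ) :=
  {x | x.1 ∈ Icc 0 1 ∧ x.2.1 ∈ Icc 0 (2 * Real.pi) ∧ x.2.2 ∈ Icc x.2.1 (x.2.1 + 2 * Real.pi)}

lemma isCompact_closedParams : IsCompact closedParams := by
  have : closedParams ⊆ Icc ((0 : ℝ), (0 : ℝ), (0 : ℝ)) (1, 2 * Real.pi, 2 * Real.pi + 2 * Real.pi) :=
    fun x hx => ⟨⟨hx.1.1, hx.2.1.1, hx.2.1.1.trans hx.2.2.1⟩,
      hx.1.2, hx.2.1.2, hx.2.2.2.trans (add_le_add_left hx.2.1.2 _)⟩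
  refine isCompact_Icc.of_isClosed_subset ?_ this
  refine (isClosed_Icc.preimage continuous_fst).inter ((isClosed_Icc.preimage
    (continuous_fst.comp continuous_snd)).inter ?_)
  have h1 : Continuous fun x : ℝ × ℝ × ℝ => x.2.1 := by fun_prop
  have h2 : Continuous fun x : ℝ × ℝ × ℝ => x.2.2 := by fun_prop
  exact (isClosed_le h1 h2).inter (isClosed_le h2 (h1.add continuous_const))

/-- The right-hand side is compact. It gives boundedness, and it controls the closure in the
description of the boundary. -/
lemma wulffBall_subset : wulffBall ⊆ wulffMap '' closedParams := by
  rintro p ⟨hp, hp1⟩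
  by_cases hz : (p.1, p.2.1) = 0
  · obtain ⟨b, hb, hbt⟩ := intermediate_value_Icc (show (0 : ℝ) ≤ 2 * Real.pi from Real.two_pi_pos.le)
      (f := height 0) (fun s _ => (hasDerivAt_height_right 0 s).continuousAt.continuousWithinAt)
      (show p.2.2 ∈ Icc _ _ by rw [height_self]; exact Ioo_subset_Icc_self hp)
    refine ⟨(0, 0, b), ⟨⟨le_rfl, zero_le_one⟩, ⟨le_rfl, Real.two_pi_pos.le⟩, by simpa using hb⟩, ?_⟩
    have h1 := congrArg Prod.fst hz
    have h2 := congrArg Prod.snd hz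
    dsimp at h1 h2
    ext <;> simp [wulffMap, hbt, h1, h2]
  · obtain ⟨x, hx, rfl⟩ := exists_wulffMap_eq (p := p) ⟨hz, hp⟩
    rw [radius_wulffMap hx] at hp1
    obtain ⟨a, ha, hc, hh⟩ := exists_shift x.2.1 (x.2.2 - x.2.1) 0
    rw [add_sub_cancel] at hc hh
    refine ⟨(x.1, a, a + (x.2.2 - x.2.1)), ⟨⟨hx.1.le, hp1.le⟩, ⟨ha.1, by linarith [ha.2]⟩, ?_, ?_⟩, ?_⟩
    · dsimp only; linarith [hx.2.1]
    · dsimp only; linarith [hx.2.2]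
    · simp only [wulffMap, hc, hh]

lemma isBounded_wulffBall : Bornology.IsBounded wulffBall :=
  (isCompact_closedParams.image contDiff_wulffMap.continuous).isBounded.subset wulffBall_subset

/-- The integrand of the lift is the derivative of the height of the chord with respect to its end.
-/
lemma pansuWulffCurve_bdry (v s : ℝ) : pansuWulffCurve bdry v s = wulffMap (1, v, s + v) := by
  have hd : ∀ r, HasDerivAt (fun r => height v (r + v))
      ((bdry (r + v) - bdry v).2 * (deriv bdry (r + v)).1
        - (bdry (r + v) - bdry v).1 * (deriv bdry (r + v)).2) r := fun r => by
    refine ((hasDerivAt_height_right v (r + v)).comp_add_const r v).congr_deriv ?_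
    rw [deriv_bdry, chord, om]; ring
  have hc : Continuous fun r => (bdry (r + v) - bdry v).2 * (deriv bdry (r + v)).1
        - (bdry (r + v) - bdry v).1 * (deriv bdry (r + v)).2 := by
    rw [deriv_bdry]
    have h1 : Continuous fun r => bdry (r + v) := continuous_bdry.comp (continuous_add_const v)
    have h2 : Continuous fun r => tang (r + v) := continuous_tang.comp (continuous_add_const v)
    exact ((h1.sub continuous_const).snd.mul h2.fst).sub ((h1.sub continuous_const).fst.mul h2.snd)
  have h := intervalIntegral.integral_eq_sub_of_hasDerivAt (fun r _ => hd r) (hc.intervalIntegrable 0 s)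
  rw [zero_add, height_self, sub_zero] at h
  simp only [pansuWulffCurve, wulffMap, one_smul, chord, h]

lemma wulffMap_pole_left (l a : ℝ) : wulffMap (l, a, a) = 0 := by
  simp [wulffMap, chord, height_self]

lemma wulffMap_pole_right (l a : ℝ) : wulffMap (l, a, a + 2 * Real.pi) = (0, 0, poleHeight) := by
  simp [wulffMap, chord, height_add_two_pi, bdry_add_two_pi]

lemma mem_pansuWulffShape {p : Heis} : p ∈ pansuWulffShape bdry (2 * Real.pi) ↔
    ∃ a b, 0 ≤ b - a ∧ b - a ≤ 2 * Real.pi ∧ wulffMap (1, a, b) = p := by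
  simp only [pansuWulffShape, mem_iUnion, mem_image, pansuWulffCurve_bdry, exists_prop]
  constructor
  · rintro ⟨v, hv, s, hs, rfl⟩
    exact ⟨v, s + v, by linarith [hs.1], by linarith [hs.2], rfl⟩
  · rintro ⟨a, b, h0, h1, rfl⟩
    obtain ⟨a', ha', hc, hh⟩ := exists_shift a (b - a) 0
    rw [add_sub_cancel] at hc hh
    refine ⟨a', by simpa using ha', b - a, ⟨h0, h1⟩, ?_⟩
    rw [add_comm]
    simp only [wulffMap, hc, hh]

lemma poles_bdry : poles bdry (2 * Real.pi) = {0, (0, 0, poleHeight)} := by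
  rw [poles, pansuWulffCurve_bdry, pansuWulffCurve_bdry, zero_add, wulffMap_pole_left, add_comm,
    wulffMap_pole_right]

/-- Limit points have factor at most one, by compactness of the parameters. Those with factor below
one and a nondegenerate chord are interior, and the remaining ones lie on the shape. -/
lemma frontier_wulffBall : frontier wulffBall = pansuWulffShape bdry (2 * Real.pi) := by
  rw [isOpen_wulffBall.frontier_eq]
  ext p
  rw [mem_pansuWulffShape]
  constructor
  · rintro ⟨hp, hpE⟩
    have hQ : IsClosed (wulffMap '' closedParams) :=
      (isCompact_closedParams.image contDiff_wulffMap.continuous).isClosed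
    obtain ⟨⟨l, a, b⟩, ⟨hl, ha, hb⟩, rfl⟩ := closure_minimal wulffBall_subset hQ hp
    dsimp only at hl ha hb
    rcases hb.1.eq_or_lt with h | h
    · exact ⟨a, b, by rw [← h]; simp, by rw [← h]; simp [Real.pi_pos.le], by
        rw [← h, wulffMap_pole_left, wulffMap_pole_left]⟩
    rcases hb.2.eq_or_lt with h' | h'
    · exact ⟨a, b, by rw [h']; simp [Real.pi_pos.le], by rw [h']; simp, by
        rw [h', wulffMap_pole_right, wulffMap_pole_right]⟩
    have h0 : 0 < b - a := by linarith
    have h1 : b - a < 2 * Real.pi := by linarith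
    refine ⟨a, b, h0.le, h1.le, ?_⟩
    rcases hl.2.eq_or_lt with h2 | h2
    · rw [h2]
    · refine absurd ?_ hpE
      refine ⟨height_mem h0 h1, ?_⟩
      rcases hl.1.eq_or_lt with h3 | h3
      · rw [radius_axis (by simp [wulffMap, ← h3])]; exact one_pos
      · rw [radius_wulffMap ⟨h3, h0, h1⟩]; exact h2
  · rintro ⟨a, b, h0, h1, rfl⟩
    constructor
    -- The approximating points have factor `1 - ε` and an opening moved towards `π`. The second
    -- change is needed at the poles, where the opening is `0` or `2 π`.
    · have hc : Continuous fun ε : ℝ => wulffMap (1 - ε, a, a + ((1 - ε) * (b - a) + ε * Real.pi)) :=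
        contDiff_wulffMap.continuous.comp (by fun_prop)
      have ht : Filter.Tendsto (fun ε : ℝ => wulffMap (1 - ε, a, a + ((1 - ε) * (b - a) + ε * Real.pi)))
          (𝓝[>] 0) (𝓝 (wulffMap (1, a, b))) := by
        have := (hc.tendsto 0).mono_left (nhdsWithin_le_nhds (s := Ioi 0))
        simpa using this
      refine mem_closure_of_tendsto ht ?_
      filter_upwards [Ioo_mem_nhdsGT (show (0 : ℝ) < 1 from one_pos)] with ε hε
      have hpi := Real.pi_pos
      have hd0 : 0 < a + ((1 - ε) * (b - a) + ε * Real.pi) - a := by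
        have := mul_nonneg (sub_nonneg.2 hε.2.le) h0
        have := mul_pos hε.1 hpi
        linarith
      have hd1 : a + ((1 - ε) * (b - a) + ε * Real.pi) - a < 2 * Real.pi := by
        have := mul_le_mul_of_nonneg_left h1 (sub_nonneg.2 hε.2.le)
        have := mul_pos hε.1 hpi
        linarith
      refine ⟨height_mem hd0 hd1, ?_⟩
      rw [radius_wulffMap ⟨by linarith [hε.2], hd0, hd1⟩]
      linarith [hε.1]
    · rintro ⟨h2, h3⟩
      rcases h0.eq_or_lt with h | h
      · rw [show b = a by linarith, wulffMap_pole_left] at h2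
        exact lt_irrefl _ h2.1
      rcases h1.eq_or_lt with h' | h'
      · rw [show b = a + 2 * Real.pi by linarith, wulffMap_pole_right] at h2
        exact lt_irrefl _ h2.2
      rw [radius_wulffMap ⟨one_pos, h, h'⟩] at h3
      exact lt_irrefl _ h3

lemma mem_frontier_wulffBall {p : Heis} : p ∈ frontier wulffBall ∩ (poles bdry (2 * Real.pi))ᶜ ↔
    ∃ a b, 0 < b - a ∧ b - a < 2 * Real.pi ∧ wulffMap (1, a, b) = p := by
  rw [frontier_wulffBall, mem_inter_iff, mem_pansuWulffShape, poles_bdry]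
  constructor
  · rintro ⟨⟨a, b, h0, h1, rfl⟩, h2⟩
    refine ⟨a, b, lt_of_le_of_ne h0 fun h => h2 ?_, lt_of_le_of_ne h1 fun h => h2 ?_, rfl⟩
    · rw [show b = a by linarith, wulffMap_pole_left]; simp
    · rw [show b = a + 2 * Real.pi by linarith, wulffMap_pole_right]; simp
  · rintro ⟨a, b, h0, h1, rfl⟩
    refine ⟨⟨a, b, h0.le, h1.le, rfl⟩, fun h2 => ?_⟩
    have h3 := (wulffMap_mem (x := (1, a, b)) ⟨one_pos, h0, h1⟩).1
    rcases h2 with h2 | h2 <;> rw [h2] at h3 <;> exact h3 rfl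

lemma mem_frontier_wulffBall_iff {p : Heis} : p ∈ frontier wulffBall ∩ (poles bdry (2 * Real.pi))ᶜ ↔
    p ∈ offAxis ∧ radius p = 1 := by
  rw [mem_frontier_wulffBall]
  constructor
  · rintro ⟨a, b, h0, h1, rfl⟩
    exact ⟨wulffMap_mem ⟨one_pos, h0, h1⟩, radius_wulffMap ⟨one_pos, h0, h1⟩⟩
  · rintro ⟨hp, h1⟩
    obtain ⟨x, hx, rfl⟩ := exists_wulffMap_eq hp
    rw [radius_wulffMap hx] at h1
    exact ⟨x.2.1, x.2.2, hx.2.1, hx.2.2, by rw [← h1]⟩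

/-- A sublevel set of a `C¹` function is locally a Lipschitz epigraph in any direction of strict decrease. -/
lemma exists_epigraph_of_fderiv_neg {F : Heis → ℝ} {p d : Heis} (hF : ContDiffAt ℝ 1 F p) (h0 : F p = 0)
    (hd : fderiv ℝ F p d < 0) : ∃ (U : Set Heis) (A : Heis ≃L[ℝ] (ℝ × ℝ) × ℝ) (C : ℝ≥0) (ψ : ℝ × ℝ → ℝ),
      IsOpen U ∧ p ∈ U ∧ LipschitzWith C ψ ∧ ∀ q ∈ U, ψ (A q).1 < (A q).2 ↔ F q < 0 := by
  have hd0 : d ≠ 0 := by rintro rfl; simp at hd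
  set B : Heis ≃L[ℝ] (ℝ × ℝ) × ℝ := (ContinuousLinearEquiv.prodAssoc ℝ ℝ ℝ ℝ).symm with hB
  -- The linear coordinates are chosen with `d` as the last basis vector, so that the function is
  -- strictly monotone in the last coordinate.
  obtain ⟨A₀, hA₀⟩ := SeparatingDual.exists_continuousLinearEquiv_apply_eq (R := ℝ) (x := B d)
    (y := ((0 : ℝ × ℝ), (1 : ℝ))) (by simpa using hd0) (by simp)
  set A := B.trans A₀ with hA
  have hAd : A.symm ((0 : ℝ × ℝ), (1 : ℝ)) = d := by
    rw [ContinuousLinearEquiv.symm_apply_eq]; exact hA₀.symm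
  have hs := hF.hasStrictFDerivAt (by simp)
  set D := fderiv ℝ F p with hD
  set c := -D d / 2 with hc
  have hc0 : 0 < c := by rw [hc]; linarith
  have hdn : 0 < ‖d‖ := norm_pos_iff.2 hd0
  obtain ⟨L, s, hs', hL⟩ := hs.exists_lipschitzOnWith
  have hlo := hs.isLittleO.def (div_pos hc0 hdn)
  rw [nhds_prod_eq] at hlo
  obtain ⟨t, ht, hlo⟩ : ∃ t ∈ 𝓝 p, ∀ {x}, x ∈ t → ∀ {y}, y ∈ t →
      ‖F x - F y - D (x - y)‖ ≤ c / ‖d‖ * ‖x - y‖ := by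
    obtain ⟨t, ht, h⟩ := Filter.mem_prod_same_iff.1 hlo
    exact ⟨t, ht, fun hx _ hy => h (mk_mem_prod hx hy)⟩
  have hst : (A.symm : (ℝ × ℝ) × ℝ → Heis) ⁻¹' (s ∩ t) ∈ 𝓝 (A p) :=
    A.symm.continuous.continuousAt.preimage_mem_nhds (by
      rw [ContinuousLinearEquiv.symm_apply_apply]; exact Filter.inter_mem hs' ht)
  obtain ⟨r₀, hr₀, hball⟩ := Metric.nhds_basis_closedBall.mem_iff.1 hst
  have hmem : ∀ z ∈ Metric.closedBall (A p).1 r₀, ∀ w ∈ Icc ((A p).2 - r₀) ((A p).2 + r₀),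
      A.symm (z, w) ∈ s ∩ t := fun z hz w hw => hball (by
    rw [Metric.mem_closedBall, Prod.dist_eq, max_le_iff]
    exact ⟨hz, by rw [Real.dist_eq, abs_le]; constructor <;> linarith [hw.1, hw.2]⟩)
  have hmono : ∀ z ∈ Metric.closedBall (A p).1 r₀, ∀ w ∈ Icc ((A p).2 - r₀) ((A p).2 + r₀),
      ∀ w' ∈ Icc ((A p).2 - r₀) ((A p).2 + r₀), w ≤ w' →
        c * (w' - w) ≤ -F (A.symm (z, w')) - -F (A.symm (z, w)) := by
    intro z hz w hw w' hw' hww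
    have h1 := hlo (hmem z hz w' hw').2 (hmem z hz w hw).2
    have h2 : A.symm (z, w') - A.symm (z, w) = (w' - w) • d := by
      rw [← hAd, ← map_sub, ← map_smul]; congr 1; simp
    rw [h2, map_smul, norm_smul, Real.norm_eq_abs, Real.norm_eq_abs, abs_of_nonneg (sub_nonneg.2 hww),
      smul_eq_mul] at h1
    have h3 : c / ‖d‖ * ((w' - w) * ‖d‖) = c * (w' - w) := by field_simp
    rw [h3] at h1
    have h4 := (abs_le.1 h1).2
    have h5 : (w' - w) * D d = -2 * (c * (w' - w)) := by rw [hc]; ring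
    linarith
  obtain ⟨r, hr, hrr, C, ψ, hψ, -, hψr⟩ := exists_lipschitz_zero (h := fun z w => -F (A.symm (z, w)))
    (L := L * ‖(A.symm : (ℝ × ℝ) × ℝ →L[ℝ] Heis)‖) hr₀ hc0
    (by positivity) hr₀ le_rfl hmono
    (fun z hz z' hz' w hw => by
      have h1 := hL.dist_le_mul _ (hmem z hz w hw).1 _ (hmem z' hz' w hw).1
      rw [dist_eq_norm, dist_eq_norm, ← map_sub] at h1
      have h2 := (A.symm : (ℝ × ℝ) × ℝ →L[ℝ] Heis).le_opNorm ((z, w) - (z', w))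
      have h3 : ‖((z, w) : (ℝ × ℝ) × ℝ) - (z', w)‖ = ‖z - z'‖ := by simp [Prod.norm_def]
      rw [h3] at h2
      have h4 : |-F (A.symm (z, w)) - -F (A.symm (z', w))| = ‖F (A.symm (z, w)) - F (A.symm (z', w))‖ := by
        rw [Real.norm_eq_abs, ← abs_neg]; congr 1; ring
      rw [h4, mul_assoc]
      exact h1.trans (mul_le_mul_of_nonneg_left h2 L.2))
    (fun z hz w hw => by
      have h1 : ContinuousOn F s := hL.continuousOn
      refine ContinuousWithinAt.neg (ContinuousWithinAt.comp (t := s) (h1 _ (hmem z hz w hw).1)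
        (A.symm.continuous.comp (by fun_prop : Continuous fun w => (z, w))).continuousWithinAt
        fun w' hw' => (hmem z hz w' hw').1))
    (by simp [h0])
  refine ⟨A ⁻¹' (Metric.ball (A p).1 r ×ˢ Ioo ((A p).2 - r₀) ((A p).2 + r₀)), A, C, ψ,
    (Metric.isOpen_ball.prod isOpen_Ioo).preimage A.continuous,
    ⟨Metric.mem_ball_self hr, by constructor <;> linarith⟩, hψ, fun q hq => ?_⟩
  have hz : (A q).1 ∈ Metric.closedBall (A p).1 r := Metric.ball_subset_closedBall hq.1
  have hz' := Metric.closedBall_subset_closedBall hrr hz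
  obtain ⟨h1, h2⟩ := hψr _ hz
  have hw := Ioo_subset_Icc_self hq.2
  have hψI : ψ (A q).1 ∈ Icc ((A p).2 - r₀) ((A p).2 + r₀) := by
    have := abs_lt.1 h1; constructor <;> linarith
  have hq' : A.symm ((A q).1, (A q).2) = q := A.symm_apply_apply q
  constructor
  · intro hlt
    have h3 := hmono _ hz' _ hψI _ hw hlt.le
    rw [h2, hq'] at h3
    have := mul_pos hc0 (sub_pos.2 hlt)
    linarith
  · intro hlt
    by_contra hn
    have h3 := hmono _ hz' _ hw _ hψI (not_lt.1 hn)
    rw [h2, hq'] at h3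
    have := mul_nonneg hc0.le (sub_nonneg.2 (not_lt.1 hn))
    linarith

/-! ### Calculus of the horizontal divergence -/

/-- A cut-off of a function of class `C^n` near the support of the cut-off function. -/
lemma contDiff_smul_of_tsupport {E F : Type*} [NormedAddCommGroup E] [NormedSpace ℝ E]
    [NormedAddCommGroup F] [NormedSpace ℝ F] {n : WithTop ℕ∞} {η : E → ℝ} {f : E → F}
    (hη : ContDiff ℝ n η) (hf : ∀ x ∈ tsupport η, ContDiffAt ℝ n f x) :
    ContDiff ℝ n fun x => η x • f x := by
  rw [contDiff_iff_contDiffAt]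
  intro x
  by_cases hx : x ∈ tsupport η
  · exact hη.contDiffAt.smul (hf x hx)
  · refine (contDiffAt_const (c := (0 : F))).congr_of_eventuallyEq ?_
    filter_upwards [(isClosed_tsupport η).isOpen_compl.mem_nhds hx] with y hy
    rw [image_eq_zero_of_notMem_tsupport hy, zero_smul]

lemma hdiv_smul {f : Heis → ℝ} {V : Heis → ℝ × ℝ} {p : Heis} (hf : DifferentiableAt ℝ f p)
    (hV : DifferentiableAt ℝ V p) :
    hdiv (fun q => f q • V q) p = f p * hdiv V p + dot (hgrad f p) (V p) := by
  have h : HasFDerivAt (fun q => f q • V q) _ p := hf.hasFDerivAt.smul hV.hasFDerivAt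
  simp only [hdiv, h.fderiv, hgrad, dot]
  simp
  ring

lemma hdiv_sub {V W : Heis → ℝ × ℝ} {p : Heis} (hV : DifferentiableAt ℝ V p)
    (hW : DifferentiableAt ℝ W p) : hdiv (fun q => V q - W q) p = hdiv V p - hdiv W p := by
  simp only [hdiv, (hV.hasFDerivAt.fun_sub hW.hasFDerivAt).fderiv]
  simp
  ring

lemma hdiv_congr {V W : Heis → ℝ × ℝ} {p : Heis} (h : V =ᶠ[𝓝 p] W) : hdiv V p = hdiv W p := by
  simp only [hdiv, h.fderiv_eq]

lemma hdiv_eq_zero {V : Heis → ℝ × ℝ} {p : Heis} (h : p ∉ tsupport V) : hdiv V p = 0 := by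
  have h1 : V =ᶠ[𝓝 p] fun _ => 0 := by
    filter_upwards [(isClosed_tsupport V).isOpen_compl.mem_nhds h] with q hq
    exact image_eq_zero_of_notMem_tsupport hq
  rw [hdiv_congr h1]
  simp [hdiv]

lemma continuous_X : Continuous X := continuous_horiz (1, 0)

lemma continuous_Y : Continuous Y := continuous_horiz (0, 1)

lemma continuous_hdiv {V : Heis → ℝ × ℝ} (hV : ContDiff ℝ 1 V) : Continuous (hdiv V) := by
  have h := hV.continuous_fderiv (by simp)
  exact (h.clm_apply continuous_X).fst.add (h.clm_apply continuous_Y).snd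

lemma hasCompactSupport_hdiv {V : Heis → ℝ × ℝ} (hV : HasCompactSupport V) : HasCompactSupport (hdiv V) :=
  HasCompactSupport.intro hV.isCompact fun _ hp => hdiv_eq_zero hp

lemma integrable_hdiv {V : Heis → ℝ × ℝ} (hV : ContDiff ℝ 1 V) (hc : HasCompactSupport V) :
    Integrable (hdiv V) :=
  (continuous_hdiv hV).integrable_of_hasCompactSupport (hasCompactSupport_hdiv hc)

/-- The divergence theorem for horizontal fields with compact support. -/
lemma integral_hdiv {V : Heis → ℝ × ℝ} (hV : ContDiff ℝ 1 V) (hc : HasCompactSupport V) :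
    ∫ p, hdiv V p = 0 := by
  have h1 : (1 : ℝ) * 1 = 1 := one_mul 1
  set a : (ℝ × ℝ) × ℝ → ℝ × ℝ := fun q => V (zwInv 1 0 0 q) with ha
  have hV' : (fun p => a (zw 1 0 0 p)) = V := by ext1 p; simp only [ha, zwInv_zw h1]
  have hac : HasCompactSupport a := hc.comp_homeomorph (zwHomeo 0 0 h1).symm
  obtain ⟨R, hR⟩ := hac.isCompact.isBounded.exists_norm_le
  have hout : ∀ q : (ℝ × ℝ) × ℝ, q.2 ≤ -R - 1 → a q = 0 := fun q hq => by
    by_contra h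
    have h2 := hR q (subset_tsupport _ h)
    have h3 : |q.2| ≤ ‖q‖ := norm_snd_le q
    linarith [(abs_le.1 (h3.trans h2)).1]
  -- The epigraph of a constant below the support contains the support, and the boundary term
  -- vanishes.
  have h := setIntegral_hdiv_epi (e := 0) (k := 0) h1 (LipschitzWith.const (-R - 1) (α := ℝ × ℝ))
    (hV.comp contDiff_zwInv) hac
  have hz : ∀ z : ℝ × ℝ, a (z, -R - 1) = 0 := fun z => hout _ le_rfl
  change ∫ p in zw 1 0 0 ⁻¹' epi fun _ => -R - 1, hdiv (fun p => a (zw 1 0 0 p)) p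
    = ∫ z, dot (a (z, -R - 1)) _ at h
  simp only [hz, hV'] at h
  simp only [dot, Prod.fst_zero, Prod.snd_zero, zero_mul, add_zero, integral_zero] at h
  rw [← h]
  refine (setIntegral_eq_integral_of_forall_compl_eq_zero fun p hp => ?_).symm
  have h2 : IsOpen {p : Heis | (zw 1 0 0 p).2 < -R} :=
    isOpen_lt (continuous_snd.comp (contDiff_zw (n := 0)).continuous) continuous_const
  have h3 : V =ᶠ[𝓝 p] fun _ => 0 := by
    have h4 : (zw 1 0 0 p).2 < -R := by
      have : ¬ (-R - 1 < (zw 1 0 0 p).2) := hp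
      linarith
    filter_upwards [h2.mem_nhds h4] with q hq
    by_contra hn
    have h5 := hR (zw 1 0 0 q) (subset_tsupport _ (by rw [Function.mem_support]; rwa [← hV'] at hn))
    have h6 : |(zw 1 0 0 q).2| ≤ ‖zw 1 0 0 q‖ := norm_snd_le (zw 1 0 0 q)
    have h7 : (zw 1 0 0 q).2 < -R := hq
    linarith [(abs_le.1 (h6.trans h5)).1]
  rw [hdiv_congr h3]
  simp [hdiv]

lemma continuousOn_hgrad {g : Heis → ℝ} {U : Set Heis} (hU : IsOpen U) (hg : ContDiffOn ℝ 1 g U) :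
    ContinuousOn (hgrad g) U := by
  have h := hg.continuousOn_fderiv_of_isOpen hU (by simp)
  exact (h.clm_apply continuous_X.continuousOn).prodMk (h.clm_apply continuous_Y.continuousOn)

/-- A function of class `C¹` is of class `C¹_ℍ`. -/
lemma hasHorizontalGradient_of_contDiffOn {g : Heis → ℝ} {U : Set Heis} (hU : IsOpen U)
    (hg : ContDiffOn ℝ 1 g U) : HasHorizontalGradient U g (hgrad g) := by
  -- The weak identity is the divergence theorem for the field `η g v`, which is extended by zero.
  have key : ∀ (v : ℝ × ℝ) (η : Heis → ℝ), ContDiff ℝ ∞ η → HasCompactSupport η → tsupport η ⊆ U →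
      ∫ p, hdiv (fun q => η q • g q • v) p = 0 ∧ ∀ p, hdiv (fun q => η q • g q • v) p
        = g p * dot (hgrad η p) v + dot (hgrad g p) v * η p := by
    intro v η hη hc hs
    have hη1 : ContDiff ℝ 1 η := hη.of_le (by simp)
    have hgU : ∀ x ∈ U, ContDiffAt ℝ 1 g x := fun x hx => hg.contDiffAt (hU.mem_nhds hx)
    refine ⟨integral_hdiv (contDiff_smul_of_tsupport hη1 fun x hx => (hgU x (hs hx)).smul contDiffAt_const)
      hc.smul_right, fun p => ?_⟩
    by_cases hp : p ∈ tsupport η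
    · have h1 := (hgU p (hs hp)).differentiableAt (by simp)
      rw [hdiv_smul (V := fun q => g q • v) (hη1.differentiable (by simp) p) (h1.smul (differentiableAt_const v)),
        hdiv_smul (V := fun _ => v) h1 (differentiableAt_const v)]
      simp only [hdiv, fderiv_const_apply, zero_apply, dot, Prod.smul_fst, Prod.smul_snd, smul_eq_mul,
        Prod.fst_zero, Prod.snd_zero]
      ring
    · have h0 : η =ᶠ[𝓝 p] fun _ => 0 := by
        filter_upwards [(isClosed_tsupport η).isOpen_compl.mem_nhds hp] with q hq
        exact image_eq_zero_of_notMem_tsupport hq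
      have h1 : (fun q => η q • g q • v) =ᶠ[𝓝 p] fun _ => 0 := by
        filter_upwards [h0] with q hq
        rw [hq, zero_smul]
      rw [hdiv_congr h1, h0.self_of_nhds]
      simp [hdiv, hgrad, h0.fderiv_eq, dot]
  have hG := continuousOn_hgrad hU hg
  have hw : ∀ (v : ℝ × ℝ) (η : Heis → ℝ), ContDiff ℝ ∞ η → HasCompactSupport η → tsupport η ⊆ U →
      ∫ p, g p * dot (hgrad η p) v = -∫ p, dot (hgrad g p) v * η p := by
    intro v η hη hc hs
    obtain ⟨k1, k2⟩ := key v η hη hc hs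
    have hsub : tsupport (fun p => dot (hgrad η p) v) ⊆ tsupport η := by
      refine closure_minimal (fun p hp => ?_) (isClosed_tsupport η)
      by_contra hn
      have h0 := image_eq_zero_of_notMem_tsupport (fun h => hn (tsupport_fderiv_subset ℝ (f := η) h))
      exact hp (by simp [hgrad, h0, dot])
    have i1 : Integrable fun p => g p * dot (hgrad η p) v :=
      integrable_mul_of_continuousOn hU hg.continuousOn (continuous_dot.comp
        ((continuousOn_univ.1 (continuousOn_hgrad isOpen_univ (hη.of_le (by simp)).contDiffOn)).prodMk
          continuous_const)) (hc.of_isClosed_subset (isClosed_tsupport _) hsub) (hsub.trans hs)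
    have i2 : Integrable fun p => dot (hgrad g p) v * η p :=
      integrable_mul_of_continuousOn hU (continuous_dot.comp_continuousOn (hG.prodMk continuousOn_const))
        hη.continuous hc hs
    simp only [k2] at k1
    rw [integral_add i1 i2] at k1
    linarith
  refine ⟨hg.continuousOn, hG, fun η hη hc hs => ?_, fun η hη hc hs => ?_⟩
  · simpa [dot, hgrad] using hw (1, 0) η hη hc hs
  · simpa [dot, hgrad] using hw (0, 1) η hη hc hs

/-! ### Regularity, normals and characteristic curves of the shape -/

/-- The points off the axis at which the dilation factor has a horizontal gradient. -/
def regularSet : Set Heis := {p | p ∈ offAxis ∧ hgrad radius p ≠ 0}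

lemma contDiffOn_radius : ContDiffOn ℝ 2 radius offAxis := fun _ hp =>
  (contDiffAt_radius hp).contDiffWithinAt

lemma isOpen_regularSet : IsOpen regularSet :=
  (continuousOn_hgrad isOpen_offAxis (contDiffOn_radius.of_le (by norm_num))).isOpen_inter_preimage
    isOpen_offAxis isClosed_singleton.isOpen_compl

lemma wulffMap_mem_regularSet {a b : ℝ} (h0 : 0 < b - a) (h1 : b - a < 2 * Real.pi) :
    wulffMap (1, a, b) ∈ regularSet := by
  refine ⟨wulffMap_mem ⟨one_pos, h0, h1⟩, ?_⟩
  rw [hgrad_radius h0 h1]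
  exact smul_ne_zero (inv_pos.2 (om_tang_chord_pos h0 h1)).ne' (J_tang_ne_zero b)

lemma frontier_subset_regularSet : frontier wulffBall ∩ (poles bdry (2 * Real.pi))ᶜ ⊆ regularSet := by
  intro p hp
  obtain ⟨a, b, h0, h1, rfl⟩ := mem_frontier_wulffBall.1 hp
  exact wulffMap_mem_regularSet h0 h1

lemma offAxis_subset : offAxis ⊆ (poles bdry (2 * Real.pi))ᶜ := by
  intro p hp h
  rw [poles_bdry] at h
  rcases h with h | h <;> rw [h] at hp <;> exact hp.1 rfl

lemma frontier_inter_offAxis {p : Heis} (hp : p ∈ offAxis) : p ∈ frontier wulffBall ↔ radius p = 1 :=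
  ⟨fun h => (mem_frontier_wulffBall_iff.1 ⟨h, offAxis_subset hp⟩).2, fun h =>
    (mem_frontier_wulffBall_iff.2 ⟨hp, h⟩).1⟩

lemma mem_wulffBall_iff {p : Heis} (hp : p ∈ offAxis) : p ∈ wulffBall ↔ radius p < 1 :=
  ⟨fun h => h.2, fun h => ⟨hp.2, h⟩⟩

lemma isHDefiningFunction_radius {S : Set Heis} (hS : ∀ p ∈ offAxis, p ∈ S ↔ radius p = 1) :
    IsHDefiningFunction S regularSet (fun p => radius p - 1) (hgrad radius) := by
  have h : hgrad (fun p => radius p - 1) = hgrad radius := by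
    funext p; simp only [hgrad, fderiv_sub_const]
  refine ⟨isOpen_regularSet, ?_, fun q hq => hq.2, ?_⟩
  · rw [← h]
    exact hasHorizontalGradient_of_contDiffOn isOpen_regularSet
      (((contDiffOn_radius.mono fun p hp => hp.1).of_le (by norm_num)).sub contDiffOn_const)
  · ext p
    simp only [mem_inter_iff, mem_ofPred_eq]
    refine ⟨fun ⟨h1, h2⟩ => ⟨h2, sub_eq_zero.2 ((hS p h2.1).1 h1)⟩, fun ⟨h1, h2⟩ =>
      ⟨(hS p h1.1).2 (sub_eq_zero.1 h2), h1⟩⟩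

lemma isHRegular_wulffBall : IsHRegular (frontier wulffBall ∩ (poles bdry (2 * Real.pi))ᶜ) := fun _ hp =>
  ⟨regularSet, _, _, frontier_subset_regularSet hp, isHDefiningFunction_radius fun _ hq =>
    ⟨fun h => (frontier_inter_offAxis hq).1 h.1, fun h =>
      ⟨(frontier_inter_offAxis hq).2 h, offAxis_subset hq⟩⟩⟩

/-- By homogeneity the factor increases in the radial direction of the horizontal plane coordinates,
so the inward radial direction is one of strict decrease. -/
lemma hasLipschitzBoundary_wulffBall : HasLipschitzBoundary (poles bdry (2 * Real.pi))ᶜ wulffBall := by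
  intro p hp
  obtain ⟨hpo, hp1⟩ := mem_frontier_wulffBall_iff.1 hp
  have hF : ContDiffAt ℝ 1 (fun p => radius p - 1) p :=
    ((contDiffAt_radius hpo).of_le (by norm_num)).sub contDiffAt_const
  have hd : fderiv ℝ (fun p => radius p - 1) p (-(p.1, p.2.1, 0)) < 0 := by
    rw [fderiv_sub_const, map_neg, fderiv_radius_radial hpo, hp1]
    norm_num
  obtain ⟨U, A, C, ψ, hU, hpU, hψ, h⟩ := exists_epigraph_of_fderiv_neg hF (sub_eq_zero.2 hp1) hd
  refine ⟨U ∩ offAxis, A, C, ψ, hU.inter isOpen_offAxis, ⟨hpU, hpo⟩, hψ, fun q hq => ⟨fun hlt => ?_, fun hE => ?_⟩⟩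
  · exact (mem_wulffBall_iff hq.2).2 (sub_neg.1 ((h q hq.1).1 hlt))
  · exact ((h q hq.1).2 (sub_neg.2 hE.2)).le

lemma horizLength_J_tang (s : ℝ) : horizLength (J (tang s)) = 1 := by
  have := tang_sq s
  rw [horizLength, J, Real.sqrt_eq_one]
  dsimp only
  linarith

lemma isOuterNormal_wulffBall {a b : ℝ} (h0 : 0 < b - a) (h1 : b - a < 2 * Real.pi) :
    IsOuterNormal wulffBall (wulffMap (1, a, b)) (J (tang b)) := by
  refine ⟨regularSet, _, _, wulffMap_mem_regularSet h0 h1, isHDefiningFunction_radius fun q hq =>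
    frontier_inter_offAxis hq, fun q _ hE => (sub_neg.2 hE.2).le, ?_⟩
  have := unitVec_smul (inv_pos.2 (om_tang_chord_pos h0 h1)) (J (tang b))
  rw [unitVec, unitVec, horizLength_J_tang, inv_one, one_smul] at this
  rw [hgrad_radius h0 h1, this]

lemma hasDerivAt_wulffMap_right (a b : ℝ) :
    HasDerivAt (fun b => wulffMap (1, a, b)) (horiz (wulffMap (1, a, b)) (tang b)) b := by
  have h1 : HasDerivAt (fun b => (1 : ℝ) • chord a b) ((1 : ℝ) • tang b) b :=
    ((hasDerivAt_bdry b).sub_const _).fun_const_smul _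
  have h2 : HasDerivAt (fun b => wulffMap (1, a, b)) (((1 : ℝ) • tang b).1, ((1 : ℝ) • tang b).2,
      -om (chord a b) (tang b)) b := h1.fst.prodMk (h1.snd.prodMk (hasDerivAt_height_right a b))
  refine h2.congr_deriv ?_
  simp only [horiz, wulffMap, one_smul, om]
  ext <;> simp
  ring

/-- The outer normal is `J (tang b)` and `J² = -1`, so the characteristic field points against the
lifted curve. This explains the reversed parameter. -/
lemma isCharacteristicCurve_wulffBall (v : ℝ) :
    IsCharacteristicCurve (poles bdry (2 * Real.pi))ᶜ wulffBall (Ioo (-(2 * Real.pi)) 0)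
      (fun s => pansuWulffCurve bdry v (-s)) := by
  intro s hs
  have h0 : 0 < -s + v - v := by linarith [hs.2]
  have h1 : -s + v - v < 2 * Real.pi := by linarith [hs.1]
  simp only [pansuWulffCurve_bdry]
  refine ⟨mem_frontier_wulffBall.2 ⟨v, -s + v, h0, h1, rfl⟩, J (tang (-s + v)),
    isOuterNormal_wulffBall h0 h1, ?_⟩
  have h2 : HasDerivAt (fun s : ℝ => -s + v) (-1) s := (hasDerivAt_neg s).add_const v
  refine ((hasDerivAt_wulffMap_right v (-s + v)).scomp s h2).congr_deriv ?_
  simp only [horiz, J]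
  ext <;> simp
  ring

/-- The curvature `turnRate` is the area form of the second derivative of the curve with the first.
A `C³` curve would make it differentiable. -/
lemma not_contDiffAt_bdry {b : ℝ} (hb : Real.sin b = 0) : ¬ContDiffAt ℝ 3 bdry b := by
  intro h
  have hder : ∀ (f : ℝ → ℝ × ℝ) (m n : WithTop ℕ∞), ContDiffAt ℝ n f b → m + 1 ≤ n → ContDiffAt ℝ m (deriv f) b :=
    fun f m n hf hmn => (hf.fderiv_right hmn).clm_apply contDiffAt_const
  have h1 := hder _ 2 _ h (by norm_num)
  rw [deriv_bdry] at h1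
  have h2 := hder _ 1 _ h1 (by norm_num)
  rw [show deriv tang = fun s => -turnRate s • J (tang s) from funext fun s => (hasDerivAt_tang s).deriv] at h2
  have h3 : ContDiffAt ℝ 1 (fun s => om (-turnRate s • J (tang s)) (tang s)) b :=
    contDiff_om.contDiffAt.comp (f := fun s => (-turnRate s • J (tang s), tang s)) b
      (h2.prodMk contDiff_tang.contDiffAt)
  have h4 : (fun s => om (-turnRate s • J (tang s)) (tang s)) = turnRate := by
    funext s
    rw [om_smul_left, om_comm, om_tang_J]; ring
  rw [h4] at h3
  exact not_differentiableAt_turnRate hb (h3.differentiableAt (by simp))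

/-- Every lifted curve runs once around the body, so it passes over a point whose parameter is a
multiple of `π`. The first two coordinates lose regularity there. -/
lemma not_contDiffOn_pansuWulffCurve (v : ℝ) : ¬ContDiffOn ℝ 3
    (fun s => pansuWulffCurve bdry v (-s)) (Ioo (-(2 * Real.pi)) 0) := by
  intro h
  have hpi := Real.pi_pos
  set n : ℤ := ⌊v / Real.pi⌋ + 1 with hn
  have hn1 : v < n * Real.pi := by
    rw [← div_lt_iff₀ hpi, hn]; push_cast; exact Int.lt_floor_add_one _
  have hn2 : n * Real.pi ≤ v + Real.pi := by
    have := (le_div_iff₀ hpi).1 (Int.floor_le (v / Real.pi))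
    rw [hn]; push_cast; linarith
  have hs : v - n * Real.pi ∈ Ioo (-(2 * Real.pi)) 0 := ⟨by linarith, by linarith⟩
  have h1 := h.contDiffAt (isOpen_Ioo.mem_nhds hs)
  have h2 : ContDiffAt ℝ 3 (fun s => bdry (-s + v) - bdry v) (v - n * Real.pi) := h1.fst.prodMk h1.snd.fst
  have h3 : ContDiffAt ℝ 3 (fun r : ℝ => (bdry (-(v - r) + v) - bdry v) + bdry v) (n * Real.pi) :=
    (ContDiffAt.comp (g := fun s => bdry (-s + v) - bdry v) (f := fun r => v - r) _ h2 (by fun_prop)).add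
      contDiffAt_const
  refine not_contDiffAt_bdry (b := n * Real.pi) (Real.sin_int_mul_pi n) ?_
  convert h3 using 2 with r
  rw [sub_add_cancel]; congr 1; ring

lemma wulffBall_subset_poles : wulffBall ⊆ (poles bdry (2 * Real.pi))ᶜ := by
  intro p hp h
  rw [poles_bdry] at h
  rcases h with h | h <;> rw [h] at hp
  · exact lt_irrefl _ hp.1.1
  · exact lt_irrefl _ hp.1.2

lemma isOpen_poles_compl : IsOpen (poles bdry (2 * Real.pi))ᶜ :=
  (Set.Finite.isClosed (by rw [poles_bdry]; exact Set.toFinite _)).isOpen_compl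

/-! ### Flux inequalities and calibrations -/

lemma exists_cutoff {C O : Set Heis} (hC : IsCompact C) (hO : IsOpen O) (h : C ⊆ O) :
    ∃ χ : Heis → ℝ, ContDiff ℝ ∞ χ ∧ HasCompactSupport χ ∧ tsupport χ ⊆ O ∧ (∀ x, χ x ∈ Icc (0 : ℝ) 1) ∧
      ∃ N, IsOpen N ∧ C ⊆ N ∧ ∀ x ∈ N, χ x = 1 := by
  obtain ⟨L, hL, hCL, hLO⟩ := exists_compact_between hC hO h
  obtain ⟨f, h1, h0, hf⟩ := exists_contMDiffMap_one_nhds_of_subset_interior (n := (⊤ : ℕ∞))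
    (modelWithCornersSelf ℝ Heis) hC.isClosed hCL
  have hs : Function.support f ⊆ L := fun x hx => by
    by_contra hn
    exact hx (h0 x hn)
  obtain ⟨N, hN, hCN, h1N⟩ := mem_nhdsSet_iff_exists.1 h1
  exact ⟨f, f.contMDiff.contDiff, HasCompactSupport.of_support_subset_isCompact hL hs,
    (closure_minimal hs hL.isClosed).trans hLO, hf, N, hN, hCN, fun x hx => h1N hx⟩

/-- The divergence theorem for fields that vanish near the boundary. -/
lemma setIntegral_hdiv_eq_zero {E : Set Heis} (hE : MeasurableSet E) {V : Heis → ℝ × ℝ} (hV : ContDiff ℝ 1 V)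
    (hc : HasCompactSupport V) (h : Disjoint (frontier E) (tsupport V)) : ∫ p in E, hdiv V p = 0 := by
  have hz : hdiv (fun _ : Heis => (0 : ℝ × ℝ)) = 0 := by funext p; simp [hdiv]
  have hloc : ∀ p, (p ∈ E ∧ E.indicator V =ᶠ[𝓝 p] V) ∨
      ((p ∉ E ∨ hdiv V p = 0) ∧ E.indicator V =ᶠ[𝓝 p] fun _ => 0) := by
    intro p
    by_cases hp : p ∈ tsupport V
    · have hpf : p ∉ frontier E := fun hf => disjoint_left.1 h hf hp
      by_cases hpE : p ∈ closure E
      · have : p ∈ interior E := by by_contra hi; exact hpf ⟨hpE, hi⟩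
        refine Or.inl ⟨interior_subset this, ?_⟩
        filter_upwards [mem_interior_iff_mem_nhds.1 this] with q hq using indicator_of_mem hq V
      · refine Or.inr ⟨Or.inl fun hpE' => hpE (subset_closure hpE'), ?_⟩
        filter_upwards [isClosed_closure.isOpen_compl.mem_nhds hpE] with q hq using
          indicator_of_notMem (fun hq' => hq (subset_closure hq')) V
    · refine Or.inr ⟨Or.inr (hdiv_eq_zero hp), ?_⟩
      filter_upwards [(isClosed_tsupport V).isOpen_compl.mem_nhds hp] with q hq
      rw [indicator_apply_eq_zero]
      exact fun _ => image_eq_zero_of_notMem_tsupport hq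
  have hI : ContDiff ℝ 1 (E.indicator V) := by
    rw [contDiff_iff_contDiffAt]
    intro p
    rcases hloc p with ⟨-, h1⟩ | ⟨-, h1⟩
    · exact hV.contDiffAt.congr_of_eventuallyEq h1
    · exact contDiffAt_const.congr_of_eventuallyEq h1
  have hIc : HasCompactSupport (E.indicator V) := hc.mono (by simp)
  rw [← integral_hdiv hI hIc, ← integral_indicator hE]
  congr 1
  funext p
  rcases hloc p with ⟨h0, h1⟩ | ⟨h0, h1⟩
  · rw [hdiv_congr h1, indicator_of_mem h0]
  · rw [hdiv_congr h1, hz, Pi.zero_apply, indicator_apply_eq_zero]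
    exact fun hp => h0.resolve_left (not_not_intro hp)

lemma hgrad_comp {θ : ℝ → ℝ} {w : Heis → ℝ} {p : Heis} (hθ : DifferentiableAt ℝ θ (w p))
    (hw : DifferentiableAt ℝ w p) : hgrad (fun q => θ (w q)) p = deriv θ (w p) • hgrad w p := by
  have h := hθ.hasDerivAt.comp_hasFDerivAt p hw.hasFDerivAt
  have h' : HasFDerivAt (fun q => θ (w q)) (deriv θ (w p) • fderiv ℝ w p) p := h
  simp only [hgrad, h'.fderiv]
  ext <;> simp

/-- Monotone smooth approximations of the indicator function of the negative half-line. -/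
def negStep (n : ℕ) (r : ℝ) : ℝ := Real.smoothTransition (-(n + 1) * r)

lemma contDiff_negStep (n : ℕ) : ContDiff ℝ 1 (negStep n) :=
  Real.smoothTransition.contDiff.comp (by fun_prop)

lemma negStep_of_nonneg (n : ℕ) {r : ℝ} (h : 0 ≤ r) : negStep n r = 0 :=
  Real.smoothTransition.zero_of_nonpos (by have := mul_nonneg (by positivity : (0 : ℝ) ≤ n + 1) h; linarith)

lemma negStep_of_le (n : ℕ) {r : ℝ} (h : r ≤ -(1 / (n + 1))) : negStep n r = 1 :=
  Real.smoothTransition.one_of_one_le (by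
    have h1 : (0 : ℝ) < n + 1 := by positivity
    have h2 := mul_le_mul_of_nonneg_left h h1.le
    rw [mul_neg, mul_one_div_cancel h1.ne'] at h2
    linarith)

lemma deriv_negStep_nonpos (n : ℕ) (r : ℝ) : deriv (negStep n) r ≤ 0 := by
  have h : Antitone (negStep n) := fun a b hab => Real.smoothTransition.monotone (by
    have := mul_le_mul_of_nonneg_left hab (by positivity : (0 : ℝ) ≤ n + 1)
    linarith)
  exact h.deriv_nonpos

lemma deriv_negStep_eq_zero (n : ℕ) {r : ℝ} (h : 1 / (n + 1) < |r|) : deriv (negStep n) r = 0 := by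
  rcases lt_abs.1 h with h | h
  · have h1 : negStep n =ᶠ[𝓝 r] fun _ => 0 := by
      filter_upwards [isOpen_Ioi.mem_nhds (lt_trans (by positivity) h)] with x hx
      exact negStep_of_nonneg n (le_of_lt hx)
    rw [h1.deriv_eq, deriv_const]
  · have h1 : negStep n =ᶠ[𝓝 r] fun _ => 1 := by
      filter_upwards [isOpen_Iio.mem_nhds (show r < -(1 / ((n : ℝ) + 1)) by linarith)] with x hx
      exact negStep_of_le n (le_of_lt hx)
    rw [h1.deriv_eq, deriv_const]

lemma negStep_mem (n : ℕ) (r : ℝ) : negStep n r ∈ Icc (0 : ℝ) 1 :=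
  ⟨Real.smoothTransition.nonneg _, Real.smoothTransition.le_one _⟩

lemma tendsto_negStep {r : ℝ} (h : r < 0) : Filter.Tendsto (fun n => negStep n r) Filter.atTop (𝓝 1) := by
  refine tendsto_const_nhds.congr' ?_
  filter_upwards [(tendsto_one_div_add_atTop_nhds_zero_nat (𝕜 := ℝ)).eventually
    (isOpen_Iio.mem_nhds (show (0 : ℝ) < -r by linarith))] with n hn
  have hn' : 1 / ((n : ℝ) + 1) < -r := hn
  exact (negStep_of_le n (by linarith)).symm

lemma contDiffAt_hgrad {w : Heis → ℝ} {p : Heis} (hw : ContDiffAt ℝ 2 w p) : ContDiffAt ℝ 1 (hgrad w) p := by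
  have h : ContDiffAt ℝ 1 (fderiv ℝ w) p := hw.fderiv_right (by norm_num)
  have hX : ContDiff ℝ 1 X := by unfold X horiz; fun_prop
  have hY : ContDiff ℝ 1 Y := by unfold Y horiz; fun_prop
  exact (h.clm_apply hX.contDiffAt).prodMk (h.clm_apply hY.contDiffAt)

/-- A field that strictly enters a sublevel set has nonpositive flux through its boundary. -/
lemma setIntegral_hdiv_nonpos_of_neg {w : Heis → ℝ} {O : Set Heis} (hO : IsOpen O)
    (hw : ContDiffOn ℝ 1 w O) {χ : Heis → ℝ} (hχ : ContDiff ℝ 1 χ) (hχc : HasCompactSupport χ)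
    (hχO : tsupport χ ⊆ O) (hχ0 : ∀ x, 0 ≤ χ x) {V : Heis → ℝ × ℝ} (hV : ContDiffOn ℝ 1 V O)
    (h : ∀ x ∈ tsupport χ, w x = 0 → dot (hgrad w x) (V x) < 0) {E : Set Heis} (hE : MeasurableSet E)
    (hEO : ∀ x ∈ O, x ∈ E ↔ w x < 0) : ∫ p in E, hdiv (fun q => χ q • V q) p ≤ 0 := by
  have hwA : ∀ x ∈ O, ContDiffAt ℝ 1 w x := fun x hx => hw.contDiffAt (hO.mem_nhds hx)
  have hVA : ∀ x ∈ O, ContDiffAt ℝ 1 V x := fun x hx => hV.contDiffAt (hO.mem_nhds hx)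
  have hχV : ContDiff ℝ 1 fun q => χ q • V q := contDiff_smul_of_tsupport hχ fun x hx => hVA x (hχO hx)
  have hχVc : HasCompactSupport fun q => χ q • V q := hχc.smul_right
  have hflux : ContinuousOn (fun x => dot (hgrad w x) (V x)) O :=
    continuous_dot.comp_continuousOn ((continuousOn_hgrad hO hw).prodMk hV.continuousOn)
  -- By compactness the flux density is negative in a whole layer `|w| < δ` over the support of `χ`.
  obtain ⟨δ, hδ, hδ'⟩ : ∃ δ > 0, ∀ x ∈ tsupport χ, 0 ≤ dot (hgrad w x) (V x) → δ ≤ |w x| := by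
    have hQ : IsCompact (tsupport χ ∩ (fun x => dot (hgrad w x) (V x)) ⁻¹' Ici 0) :=
      hχc.isCompact.of_isClosed_subset ((hflux.mono hχO).preimage_isClosed_of_isClosed
        (isClosed_tsupport χ) isClosed_Ici) inter_subset_left
    obtain ⟨δ, hδ, h'⟩ := hQ.exists_forall_le' (a := 0) (f := fun x => |w x|)
      ((hw.continuousOn.mono (inter_subset_left.trans hχO)).abs) fun x hx => abs_pos.2 fun h0 =>
        absurd (h x hx.1 h0) (not_lt.2 hx.2)
    exact ⟨δ, hδ, fun x hx hx' => h' x ⟨hx, hx'⟩⟩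
  set F : ℕ → Heis → ℝ := fun n x => negStep n (w x) * hdiv (fun q => χ q • V q) x with hF
  have hFi : ∀ n, Integrable (F n) := fun n => by
    have h1 : tsupport (hdiv fun q => χ q • V q) ⊆ tsupport fun q => χ q • V q := by
      refine closure_minimal (fun x hx => ?_) (isClosed_tsupport _)
      by_contra hn
      exact hx (hdiv_eq_zero hn)
    exact integrable_mul_of_continuousOn hO ((contDiff_negStep n).continuous.comp_continuousOn hw.continuousOn)
      (continuous_hdiv hχV) (hasCompactSupport_hdiv hχVc)
      (h1.trans ((tsupport_smul_subset_left χ V).trans hχO))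
  have hle : ∀ᶠ n : ℕ in Filter.atTop, ∫ x, F n x ≤ 0 := by
    filter_upwards [(tendsto_one_div_add_atTop_nhds_zero_nat (𝕜 := ℝ)).eventually
      (isOpen_Iio.mem_nhds hδ)] with n hn
    have hn' : 1 / ((n : ℝ) + 1) < δ := hn
    have hθw : ∀ x ∈ O, ContDiffAt ℝ 1 (fun q => negStep n (w q)) x := fun x hx =>
      (contDiff_negStep n).contDiffAt.comp x (hwA x hx)
    have hC : ContDiff ℝ 1 fun q => χ q • negStep n (w q) • V q :=
      contDiff_smul_of_tsupport hχ fun x hx => (hθw x (hχO hx)).smul (hVA x (hχO hx))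
    have hCc : HasCompactSupport fun q => χ q • negStep n (w q) • V q := hχc.smul_right
    rw [← integral_hdiv hC hCc]
    -- The step function varies only in the layer, where its derivative and the flux density are
    -- both nonpositive. The missing term of the product rule has the right sign, and the full
    -- divergence integrates to zero.
    have hpt : ∀ x, F n x ≤ hdiv (fun q => χ q • negStep n (w q) • V q) x := by
      intro x
      by_cases hx : x ∈ tsupport χ
      · have hxO := hχO hx
        have h1 : (fun q => χ q • negStep n (w q) • V q) = fun q => negStep n (w q) • χ q • V q := by
          funext q; rw [smul_comm]
        rw [h1, hdiv_smul (V := fun q => χ q • V q) ((hθw x hxO).differentiableAt (by simp))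
          (hχV.differentiable (by simp) x), hgrad_comp ((contDiff_negStep n).differentiable (by simp) _)
          ((hwA x hxO).differentiableAt (by simp))]
        have h2 : dot (deriv (negStep n) (w x) • hgrad w x) (χ x • V x)
            = deriv (negStep n) (w x) * (χ x * dot (hgrad w x) (V x)) := by
          simp only [dot, Prod.smul_fst, Prod.smul_snd, smul_eq_mul]; ring
        rw [h2]
        refine le_add_of_nonneg_right ?_
        rcases lt_or_ge |w x| δ with h3 | h3
        · refine mul_nonneg_of_nonpos_of_nonpos (deriv_negStep_nonpos n _)
            (mul_nonpos_of_nonneg_of_nonpos (hχ0 x) ?_)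
          by_contra h4
          exact absurd (hδ' x hx (not_le.1 h4).le) (not_le.2 h3)
        · rw [deriv_negStep_eq_zero n (hn'.trans_le h3), zero_mul]
      · have hz : ∀ G : Heis → ℝ × ℝ, hdiv (fun q => χ q • G q) x = 0 := fun G => by
          have : (fun q => χ q • G q) =ᶠ[𝓝 x] fun _ => 0 := by
            filter_upwards [(isClosed_tsupport χ).isOpen_compl.mem_nhds hx] with q hq
            rw [image_eq_zero_of_notMem_tsupport hq, zero_smul]
          rw [hdiv_congr this]; simp [hdiv]
        simp only [hF, hz, mul_zero, le_refl]
    exact integral_mono (hFi n) (integrable_hdiv hC hCc) hpt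
  have hlim : Filter.Tendsto (fun n => ∫ x, F n x) Filter.atTop
      (𝓝 (∫ x, E.indicator (hdiv fun q => χ q • V q) x)) := by
    refine tendsto_integral_of_dominated_convergence (fun x => ‖hdiv (fun q => χ q • V q) x‖)
      (fun n => (hFi n).aestronglyMeasurable) (integrable_hdiv hχV hχVc).norm
      (fun n => .of_forall fun x => ?_) (.of_forall fun x => ?_)
    · rw [norm_mul, Real.norm_eq_abs, abs_of_nonneg (negStep_mem n _).1]
      exact mul_le_of_le_one_left (norm_nonneg _) (negStep_mem n _).2
    · by_cases hx : x ∈ tsupport fun q => χ q • V q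
      · have hxO := hχO (tsupport_smul_subset_left χ V hx)
        by_cases hxE : x ∈ E
        · rw [indicator_of_mem hxE]
          simpa using (tendsto_negStep ((hEO x hxO).1 hxE)).mul_const (hdiv (fun q => χ q • V q) x)
        · rw [indicator_of_notMem hxE]
          have h1 : ∀ n, F n x = 0 := fun n => by
            simp only [hF, negStep_of_nonneg n (not_lt.1 fun h => hxE ((hEO x hxO).2 h)), zero_mul]
          simp only [h1, tendsto_const_nhds]
      · have h0 := hdiv_eq_zero hx
        have h1 : ∀ n, F n x = 0 := fun n => by simp only [hF, h0, mul_zero]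
        rw [indicator_apply_eq_zero.2 fun _ => h0]
        simp only [h1, tendsto_const_nhds]
  rw [← integral_indicator hE]
  exact le_of_tendsto hlim hle

/-- A field that enters a set has nonpositive flux through its boundary. -/
lemma setIntegral_hdiv_nonpos {w : Heis → ℝ} {O : Set Heis} (hO : IsOpen O)
    (hw : ContDiffOn ℝ 2 w O) (hw0 : ∀ x ∈ O, hgrad w x ≠ 0) {V : Heis → ℝ × ℝ} (hV : ContDiff ℝ 1 V)
    (hVc : HasCompactSupport V) {E : Set Heis} (hE : MeasurableSet E)
    (hEO : ∀ x ∈ O, x ∈ E ↔ w x < 0) (hfr : frontier E ∩ tsupport V ⊆ O)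
    (h : ∀ x ∈ O, w x = 0 → dot (hgrad w x) (V x) ≤ 0) : ∫ p in E, hdiv V p ≤ 0 := by
  obtain ⟨χ, hχ, hχc, hχO, hχ1, N, hN, hCN, hN1⟩ :=
    exists_cutoff (hVc.isCompact.inter_left (isClosed_frontier (s := E))) hO hfr
  have hχ' : ContDiff ℝ 1 χ := hχ.of_le (by simp)
  have hg : ∀ x ∈ tsupport χ, ContDiffAt ℝ 1 (hgrad w) x := fun x hx =>
    contDiffAt_hgrad (hw.contDiffAt (hO.mem_nhds (hχO hx)))
  have hχG := contDiff_smul_of_tsupport hχ' hg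
  have hχGc : HasCompactSupport fun x => χ x • hgrad w x := hχc.smul_right
  have hχV : ContDiff ℝ 1 fun x => χ x • V x := hχ'.smul hV
  have hχVc : HasCompactSupport fun x => χ x • V x := hχc.smul_right
  have hfar : ∫ p in E, hdiv (fun x => V x - χ x • V x) p = 0 := by
    refine setIntegral_hdiv_eq_zero hE (hV.sub hχV) (hVc.sub hχVc) (disjoint_left.2 fun x hx hx' => ?_)
    have hxV : x ∈ tsupport V := by
      refine closure_mono (fun y hy => ?_) hx'
      rw [Function.mem_support] at hy ⊢
      intro hy0
      exact hy (by rw [hy0, smul_zero, sub_zero])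
    have h1 : (fun x => V x - χ x • V x) =ᶠ[𝓝 x] fun _ => 0 := by
      filter_upwards [hN.mem_nhds (hCN ⟨hx, hxV⟩)] with y hy
      rw [hN1 y hy, one_smul, sub_self]
    exact (notMem_tsupport_iff_eventuallyEq.2 h1) hx'
  -- Subtracting `ε` times the horizontal gradient makes the field enter strictly. The error
  -- disappears with `ε`.
  have hnear : ∀ ε > 0, ∫ p in E, hdiv (fun x => χ x • V x) p
      ≤ ε * ∫ p in E, hdiv (fun x => χ x • hgrad w x) p := by
    intro ε hε
    have hVO : ContDiffOn ℝ 1 (fun x => V x - ε • hgrad w x) O := fun x hx =>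
      (hV.contDiffAt.sub ((contDiffAt_hgrad (hw.contDiffAt (hO.mem_nhds hx))).const_smul
        ε)).contDiffWithinAt
    have h1 := setIntegral_hdiv_nonpos_of_neg hO (hw.of_le (by norm_num)) hχ' hχc hχO (fun x => (hχ1 x).1) hVO
      (fun x hx hx0 => by
        have h1 := h x (hχO hx) hx0
        have h2 := dot_self_pos (hw0 x (hχO hx))
        have h3 : dot (hgrad w x) (V x - ε • hgrad w x)
            = dot (hgrad w x) (V x) - ε * dot (hgrad w x) (hgrad w x) := by
          simp only [dot, Prod.fst_sub, Prod.snd_sub, Prod.smul_fst, Prod.smul_snd, smul_eq_mul]; ring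
        rw [h3]
        nlinarith) hE hEO
    have h2 : ∀ p, hdiv (fun x => χ x • (V x - ε • hgrad w x)) p
        = hdiv (fun x => χ x • V x) p - ε * hdiv (fun x => χ x • hgrad w x) p := fun p => by
      have h3 : (fun x => χ x • (V x - ε • hgrad w x)) = fun x => χ x • V x - ε • χ x • hgrad w x := by
        funext x; rw [smul_sub, smul_comm]
      have h4 := hχG.differentiable (by simp) p
      have h5 := hdiv_smul (f := fun _ => ε) (differentiableAt_const ε) h4
      rw [h3, hdiv_sub (W := fun x => ε • χ x • hgrad w x) (hχV.differentiable (by simp) p)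
        (h4.const_smul ε), h5]
      simp [hgrad, dot]
    simp only [h2] at h1
    rw [integral_sub (integrable_hdiv hχV hχVc).integrableOn
      ((integrable_hdiv hχG hχGc).integrableOn.const_mul ε), integral_const_mul] at h1
    linarith
  have hlim : ∫ p in E, hdiv (fun x => χ x • V x) p ≤ 0 := by
    have h1 : Filter.Tendsto (fun ε : ℝ => ε * ∫ p in E, hdiv (fun x => χ x • hgrad w x) p) (𝓝[>] 0)
        (𝓝 (0 * ∫ p in E, hdiv (fun x => χ x • hgrad w x) p)) :=
      ((continuous_id.mul continuous_const).tendsto 0).mono_left nhdsWithin_le_nhds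
    rw [zero_mul] at h1
    exact ge_of_tendsto h1 (eventually_nhdsWithin_of_forall fun ε hε => hnear ε hε)
  have hsum : ∀ p, hdiv (fun x => V x - χ x • V x) p = hdiv V p - hdiv (fun x => χ x • V x) p := fun p =>
    hdiv_sub (hV.differentiable (by simp) p) (hχV.differentiable (by simp) p)
  simp only [hsum] at hfar
  rw [integral_sub (integrable_hdiv hV hVc).integrableOn (integrable_hdiv hχV hχVc).integrableOn] at hfar
  linarith

lemma abs_setIntegral_sub_le {F : Heis → ℝ} (hF : Integrable F) {E₁ E₂ : Set Heis} (h1 : MeasurableSet E₁)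
    (h2 : MeasurableSet E₂) {κ : ℝ} (hκ : ∀ x ∈ symmDiff E₁ E₂, |F x| ≤ κ)
    (hv : volume (symmDiff E₁ E₂) ≠ ⊤) :
    |(∫ x in E₁, F x) - ∫ x in E₂, F x| ≤ κ * volume.real (symmDiff E₁ E₂) := by
  have e1 := integral_inter_add_sdiff (s := E₁) h2 hF.integrableOn
  have e2 := integral_inter_add_sdiff (s := E₂) h1 hF.integrableOn
  rw [inter_comm] at e2
  have hv1 : volume (E₁ \ E₂) < ⊤ := (measure_mono subset_union_left).trans_lt hv.lt_top
  have hv2 : volume (E₂ \ E₁) < ⊤ := (measure_mono subset_union_right).trans_lt hv.lt_top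
  have b1 := norm_setIntegral_le_of_norm_le_const hv1 (f := F) fun x hx => hκ x (Or.inl hx)
  have b2 := norm_setIntegral_le_of_norm_le_const hv2 (f := F) fun x hx => hκ x (Or.inr hx)
  rw [Real.norm_eq_abs] at b1 b2
  have hu : volume.real (symmDiff E₁ E₂) = volume.real (E₁ \ E₂) + volume.real (E₂ \ E₁) :=
    measureReal_union disjoint_sdiff_sdiff (h2.diff h1) hv1.ne hv2.ne
  rw [hu]
  have : (∫ x in E₁, F x) - ∫ x in E₂, F x = (∫ x in E₁ \ E₂, F x) - ∫ x in E₂ \ E₁, F x := by linarith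
  rw [this]
  refine (abs_sub _ _).trans ?_
  linarith

/-- Comparison of the perimeters of two close sets, the first of which has a calibrating field near the
difference. -/
lemma perimeter_le_of_calibration {K : Set (ℝ × ℝ)} (hK : IsC2PlusBody K) {B O : Set Heis} (hB : IsOpen B)
    (hBv : volume B ≠ ⊤) (hO : IsOpen O) {w : Heis → ℝ} (hw : ContDiffOn ℝ 2 w O)
    (hw0 : ∀ x ∈ O, hgrad w x ≠ 0) {U : Heis → ℝ × ℝ} (hU : ContDiffOn ℝ 1 U O) (hUK : ∀ x, U x ∈ K)
    (hsup : ∀ x ∈ O, w x = 0 → ∀ k ∈ K, dot (hgrad w x) k ≤ dot (hgrad w x) (U x))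
    {E₁ E₂ : Set Heis} (h1 : MeasurableSet E₁) (h2 : MeasurableSet E₂) (hE₁ : ∀ x ∈ O, x ∈ E₁ ↔ w x < 0)
    {χ : Heis → ℝ} (hχ : ContDiff ℝ ∞ χ) (hχc : HasCompactSupport χ) (hχO : tsupport χ ⊆ O)
    (hχB : tsupport χ ⊆ B) (hχ1 : ∀ x, χ x ∈ Icc (0 : ℝ) 1) {N : Set Heis} (hN : IsOpen N)
    (hN1 : ∀ x ∈ N, χ x = 1) (hD : symmDiff E₁ E₂ ⊆ N) {κ : ℝ}
    (hκ : ∀ x ∈ symmDiff E₁ E₂, |hdiv U x - 1| ≤ κ) (hP : perimeter K E₂ B ≠ ⊤) :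
    perimeter K E₁ B ≠ ⊤ ∧ (perimeter K E₁ B).toReal - ∫ _ in E₁ ∩ B, (1 : ℝ)
      ≤ (perimeter K E₂ B).toReal - (∫ _ in E₂ ∩ B, (1 : ℝ)) + κ * volume.real (symmDiff E₁ E₂) := by
  have hχ' : ContDiff ℝ 1 χ := hχ.of_le (by simp)
  have hUA : ∀ x ∈ tsupport χ, ContDiffAt ℝ 1 U x := fun x hx => hU.contDiffAt (hO.mem_nhds (hχO hx))
  have hχU := contDiff_smul_of_tsupport hχ' hUA
  have hχUc : HasCompactSupport fun x => χ x • U x := hχc.smul_right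
  have hNB : N ⊆ B := fun x hx => hχB (subset_tsupport _ (by rw [Function.mem_support, hN1 x hx]; exact one_ne_zero))
  have hv : volume (symmDiff E₁ E₂) ≠ ⊤ := ((measure_mono (hD.trans hNB)).trans_lt hBv.lt_top).ne
  have hBi : Integrable (B.indicator fun _ => (1 : ℝ)) :=
    (integrable_indicator_iff hB.measurableSet).2 (integrableOn_const hBv)
  have key : ∀ V, IsTestField K B V → ∫ p in E₁, hdiv V p ≤ (perimeter K E₂ B).toReal
      - (∫ _ in E₂ ∩ B, (1 : ℝ)) + κ * volume.real (symmDiff E₁ E₂) + ∫ _ in E₁ ∩ B, (1 : ℝ) := by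
    intro V hV
    have hχV : ContDiff ℝ 1 fun x => χ x • V x := hχ'.smul hV.contDiff
    have hχVc : HasCompactSupport fun x => χ x • V x := hχc.smul_right
    have hWd : ContDiff ℝ 1 fun x => V x - χ x • V x + χ x • U x := (hV.contDiff.sub hχV).add hχU
    have hVK : ∀ x, V x ∈ K := fun x => (hK.gauge_le_one_iff _).1 (hV.norm_le x)
    have hW : IsTestField K B fun x => V x - χ x • V x + χ x • U x := by
      refine ⟨hWd, (hV.compactSupport.sub hχVc).add hχUc, ?_, fun x => (hK.gauge_le_one_iff _).2 ?_⟩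
      · refine (closure_minimal (fun x hx => ?_) ((isClosed_tsupport V).union (isClosed_tsupport χ))).trans
          (union_subset hV.support_subset hχB)
        by_contra hn
        rw [mem_union, not_or] at hn
        apply hx
        simp only [image_eq_zero_of_notMem_tsupport hn.1, image_eq_zero_of_notMem_tsupport hn.2]
        simp
      · have := hK.convex (hVK x) (hUK x) (sub_nonneg.2 (hχ1 x).2) (hχ1 x).1 (by ring)
        rwa [sub_smul, one_smul] at this
    -- Near the difference of the sets the competitor is replaced by the calibrating field, and
    -- convexity keeps it admissible. The replacement can only increase the flux through the
    -- boundary of `E₁`, for whose normal `U` is optimal.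
    set W : Heis → ℝ × ℝ := fun x => V x - χ x • V x + χ x • U x with hWdef
    have hflux : ∫ p in E₁, hdiv (fun x => χ x • V x - χ x • U x) p ≤ 0 := by
      refine setIntegral_hdiv_nonpos hO hw hw0 (hχV.sub hχU) (hχVc.sub hχUc) h1 hE₁ ?_ fun x hx hx0 => ?_
      · refine inter_subset_right.trans ((closure_minimal (fun x hx => ?_) (isClosed_tsupport χ)).trans hχO)
        by_contra hn
        apply hx
        simp only [image_eq_zero_of_notMem_tsupport hn]
        simp
      · have e1 := hsup x hx hx0 _ (hVK x)
        have e2 : dot (hgrad w x) (χ x • V x - χ x • U x)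
            = χ x * (dot (hgrad w x) (V x) - dot (hgrad w x) (U x)) := by
          simp only [dot, Prod.fst_sub, Prod.snd_sub, Prod.smul_fst, Prod.smul_snd, smul_eq_mul]; ring
        rw [e2]
        exact mul_nonpos_of_nonneg_of_nonpos (hχ1 x).1 (by linarith)
    have hVW : ∀ p, hdiv (fun x => χ x • V x - χ x • U x) p = hdiv V p - hdiv W p := fun p => by
      rw [← hdiv_sub (hV.contDiff.differentiable (by simp) p) (hWd.differentiable (by simp) p)]
      congr 1
      funext x
      simp only [hWdef]
      abel
    simp only [hVW] at hflux
    rw [integral_sub (integrable_hdiv hV.contDiff hV.compactSupport).integrableOn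
      (integrable_hdiv hW.contDiff hW.compactSupport).integrableOn] at hflux
    have hWi := integrable_hdiv hW.contDiff hW.compactSupport
    -- On the difference of the sets `W` agrees with `U`, and its divergence is within `κ` of the
    -- prescribed curvature one. Passing from `E₁` to `E₂` therefore costs only `κ` times the volume
    -- between them.
    have hdiff := abs_setIntegral_sub_le (F := fun x => hdiv W x - B.indicator (fun _ => (1 : ℝ)) x)
      (hWi.sub hBi) h1 h2 (κ := κ) (fun x hx => by
        have e1 : W =ᶠ[𝓝 x] U := by
          filter_upwards [hN.mem_nhds (hD hx)] with y hy
          simp [hWdef, hN1 y hy]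
        rw [hdiv_congr e1, indicator_of_mem (hNB (hD hx))]
        exact hκ x hx) hv
    rw [integral_sub hWi.integrableOn hBi.integrableOn, integral_sub hWi.integrableOn hBi.integrableOn,
      setIntegral_indicator hB.measurableSet, setIntegral_indicator hB.measurableSet] at hdiff
    have h3 := le_perimeter_toReal hP hW
    have h4 := (abs_le.1 hdiff).2
    linarith
  have h0 : IsTestField K B fun _ => 0 := by
    refine ⟨contDiff_const, HasCompactSupport.zero, ?_, fun _ => by simp⟩
    have : tsupport (fun _ : Heis => (0 : ℝ × ℝ)) = ∅ := tsupport_eq_empty_iff.2 rfl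
    rw [this]; exact empty_subset B
  set c := (perimeter K E₂ B).toReal - (∫ _ in E₂ ∩ B, (1 : ℝ)) + κ * volume.real (symmDiff E₁ E₂)
    + ∫ _ in E₁ ∩ B, (1 : ℝ) with hc
  have hc0 : 0 ≤ c := by
    have := key _ h0
    simpa [hdiv] using this
  have hle := perimeter_toReal_le hc0 key
  refine ⟨(lt_of_le_of_lt (iSup₂_le fun V hV => ENNReal.ofReal_le_ofReal (key V hV))
    ENNReal.ofReal_lt_top).ne, ?_⟩
  linarith

/-- Sets with a calibrating field near their boundary have locally finite perimeter. -/
lemma perimeter_ne_top_of_calibration {K : Set (ℝ × ℝ)} (hK : IsC2PlusBody K) {B O : Set Heis}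
    (hBc : IsCompact (closure B)) (hO : IsOpen O) {w : Heis → ℝ} (hw : ContDiffOn ℝ 2 w O)
    (hw0 : ∀ x ∈ O, hgrad w x ≠ 0) {U : Heis → ℝ × ℝ} (hU : ContDiffOn ℝ 1 U O)
    (hsup : ∀ x ∈ O, w x = 0 → ∀ k ∈ K, dot (hgrad w x) k ≤ dot (hgrad w x) (U x))
    {E : Set Heis} (hE : MeasurableSet E) (hEO : ∀ x ∈ O, x ∈ E ↔ w x < 0)
    (hfr : frontier E ∩ closure B ⊆ O) (hfrO : ∀ x ∈ O, w x = 0 → x ∈ frontier E) :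
    perimeter K E B ≠ ⊤ := by
  obtain ⟨χ, hχ, hχc, hχO, hχ1, N, hN, hCN, hN1⟩ :=
    exists_cutoff (hBc.inter_left (isClosed_frontier (s := E))) hO hfr
  have hχ' : ContDiff ℝ 1 χ := hχ.of_le (by simp)
  have hUA : ∀ x ∈ tsupport χ, ContDiffAt ℝ 1 U x := fun x hx => hU.contDiffAt (hO.mem_nhds (hχO hx))
  have hχU := contDiff_smul_of_tsupport hχ' hUA
  have hχUc : HasCompactSupport fun x => χ x • U x := hχc.smul_right
  refine (lt_of_le_of_lt (iSup₂_le fun V hV => ENNReal.ofReal_le_ofReal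
    (q := ∫ p in E, hdiv (fun x => χ x • U x) p) ?_) ENNReal.ofReal_lt_top).ne
  have hVK : ∀ x, V x ∈ K := fun x => (hK.gauge_le_one_iff _).1 (hV.norm_le x)
  have hflux : ∫ p in E, hdiv (fun x => V x - χ x • U x) p ≤ 0 := by
    refine setIntegral_hdiv_nonpos hO hw hw0 (hV.contDiff.sub hχU) (hV.compactSupport.sub hχUc) hE hEO ?_
      fun x hx hx0 => ?_
    · rintro x ⟨hx, hx'⟩
      have h1 : x ∈ tsupport V ∪ tsupport χ := by
        refine closure_minimal (fun y hy => ?_) ((isClosed_tsupport V).union (isClosed_tsupport χ)) hx'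
        by_contra hn
        rw [mem_union, not_or] at hn
        apply hy
        simp only [image_eq_zero_of_notMem_tsupport hn.1, image_eq_zero_of_notMem_tsupport hn.2]
        simp
      rcases h1 with h1 | h1
      · exact hfr ⟨hx, subset_closure (hV.support_subset h1)⟩
      · exact hχO h1
    · have e1 := hsup x hx hx0 _ (hVK x)
      have e0 := hsup x hx hx0 0 (interior_subset hK.zero_mem)
      have e2 : dot (hgrad w x) (V x - χ x • U x)
          = dot (hgrad w x) (V x) - χ x * dot (hgrad w x) (U x) := by
        simp only [dot, Prod.fst_sub, Prod.snd_sub, Prod.smul_fst, Prod.smul_snd, smul_eq_mul]; ring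
      have e3 : dot (hgrad w x) 0 = 0 := by simp [dot]
      rw [e3] at e0
      rw [e2]
      -- The cut-off equals one at boundary points in the closure of `B`. Elsewhere the competitor
      -- vanishes, and the calibrating field has nonnegative flux density because `0 ∈ K`.
      by_cases hxB : x ∈ closure B
      · rw [hN1 x (hCN ⟨hfrO x hx hx0, hxB⟩)]; linarith
      · have e4 : V x = 0 := image_eq_zero_of_notMem_tsupport fun h =>
          hxB (subset_closure (hV.support_subset h))
        rw [e4, e3]
        have := mul_nonneg (hχ1 x).1 e0
        linarith
  simp only [hdiv_sub (hV.contDiff.differentiable (by simp) _) (hχU.differentiable (by simp) _)] at hflux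
  rw [integral_sub (integrable_hdiv hV.contDiff hV.compactSupport).integrableOn
    (integrable_hdiv hχU hχUc).integrableOn] at hflux
  linarith

/-! ### The calibrating field of the shape -/

/-- The support point of `wulffBody` in a given direction. -/
def supportPoint : ℝ × ℝ → ℝ × ℝ := isC2PlusBody_wulffBody.exists_supportMap.choose

lemma isSupportPoint_supportPoint (n : ℝ × ℝ) : IsSupportPoint wulffBody n (supportPoint n) :=
  isC2PlusBody_wulffBody.exists_supportMap.choose_spec.1 n

lemma supportPoint_J_tang {ρ : ℝ} (hρ : 0 < ρ) (s : ℝ) : supportPoint (ρ • J (tang s)) = bdry s := by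
  have hu := isC2PlusBody_wulffBody.exists_supportMap.choose_spec.2.1
  have h1 : supportPoint (J (tang s)) = bdry s := (hu _ _ (J_tang_ne_zero s) (isSupportPoint_bdry s)).symm
  rw [← h1]
  exact supportMap_smul isSupportPoint_supportPoint hu hρ (J_tang_ne_zero s)

/-- In the polar coordinates `n = ρ • J (tang s)` the support map is `bdry s`. These coordinates
form a `C¹` local diffeomorphism because `turnRate` does not vanish. -/
lemma contDiffAt_supportPoint {n : ℝ × ℝ} (hn : n ≠ 0) : ContDiffAt ℝ 1 supportPoint n := by
  obtain ⟨ρ, s, hρ, hs⟩ := exists_tang (n.2, -n.1)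
  have hn' : n = ρ • J (tang s) := by
    have h1 := congrArg Prod.fst hs
    have h2 := congrArg Prod.snd hs
    simp only [Prod.smul_fst, Prod.smul_snd, smul_eq_mul] at h1 h2
    ext
    · simp only [J, Prod.smul_fst, smul_eq_mul]; linarith
    · simp only [J, Prod.smul_snd, smul_eq_mul]; linarith
  have hρ0 : 0 < ρ := lt_of_le_of_ne hρ fun h => hn (by rw [hn', ← h, zero_smul])
  have hJ : ContDiff ℝ 1 J := by unfold J; fun_prop
  have hJl : HasDerivAt (fun s => J (tang s)) (-turnRate s • J (J (tang s))) s := by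
    have h1 : HasDerivAt (fun s => (tang s).1) (-turnRate s • J (tang s)).1 s := (hasDerivAt_tang s).fst
    have h2 : HasDerivAt (fun s => (tang s).2) (-turnRate s • J (tang s)).2 s := (hasDerivAt_tang s).snd
    refine (h2.fun_neg.prodMk h1).congr_deriv ?_
    ext <;> simp [J]
  have hF : ContDiff ℝ 1 fun x : ℝ × ℝ => x.1 • J (tang x.2) :=
    contDiff_fst.smul (hJ.comp (contDiff_tang.comp contDiff_snd))
  have hd : HasFDerivAt (fun x : ℝ × ℝ => x.1 • J (tang x.2)) _ (ρ, s) :=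
    (hasFDerivAt_fst (𝕜 := ℝ) (p := (ρ, s))).smul
      (HasFDerivAt.comp (g := fun s => J (tang s)) (f := Prod.snd) (ρ, s) hJl.hasFDerivAt hasFDerivAt_snd)
  obtain ⟨g, hg, hg0, hr, -, -⟩ := exists_local_inverse hF.contDiffAt hd (by simp) fun v hv => by
    have hJJ : J (J (tang s)) = -tang s := by ext <;> simp [J]
    simp [hJJ] at hv
    have h1 : om (tang s) (ρ • (v.2 * turnRate s) • tang s + v.1 • J (tang s)) = 0 := by
      rw [← smul_smul, hv]; simp [om]
    rw [om_add_right, om_smul_right, om_smul_right, om_smul_right, om_self, om_tang_J] at h1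
    have hv1 : v.1 = 0 := by linarith
    rw [hv1, zero_smul, add_zero, smul_smul, smul_smul] at hv
    have h2 := (smul_eq_zero.1 hv).resolve_right (tang_ne_zero s)
    have h3 : v.2 = 0 := by
      rcases mul_eq_zero.1 h2 with h | h
      · rcases mul_eq_zero.1 h with h | h
        · exact absurd h hρ0.ne'
        · exact h
      · exact absurd h (turnRate_pos s).ne'
    exact Prod.ext hv1 h3
  dsimp only at hg hg0 hr
  rw [← hn'] at hg hg0 hr
  have hpos : ∀ᶠ m in 𝓝 n, 0 < (g m).1 :=
    hg.continuousAt.fst.eventually (isOpen_Ioi.mem_nhds (by simp only [hg0]; exact hρ0))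
  have hb : ContDiff ℝ 1 bdry := contDiff_bdry.of_le (by norm_num)
  refine (hb.contDiffAt.comp n hg.snd).congr_of_eventuallyEq ?_
  filter_upwards [hr, hpos] with m hm hm0
  rw [Function.comp, ← supportPoint_J_tang hm0, hm]

lemma supportPoint_hgrad_radius {a b : ℝ} (h0 : 0 < b - a) (h1 : b - a < 2 * Real.pi) :
    supportPoint (hgrad radius (wulffMap (1, a, b))) = bdry b := by
  rw [hgrad_radius h0 h1]
  exact supportPoint_J_tang (inv_pos.2 (om_tang_chord_pos h0 h1)) b

lemma contDiffAt_supportPoint_hgrad {w : Heis → ℝ} {p : Heis} (hw : ContDiffAt ℝ 2 w p)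
    (h0 : hgrad w p ≠ 0) : ContDiffAt ℝ 1 (fun x => supportPoint (hgrad w x)) p :=
  (contDiffAt_supportPoint h0).comp p (contDiffAt_hgrad hw)

/-- The Pansu–Wulff shape has mean curvature one: the calibrating field has divergence one on it. -/
lemma hdiv_supportPoint_hgrad_radius {p : Heis}
    (hp : p ∈ frontier wulffBall ∩ (poles bdry (2 * Real.pi))ᶜ) :
    hdiv (fun x => supportPoint (hgrad radius x)) p = 1 := by
  obtain ⟨a, b, h0, h1, rfl⟩ := mem_frontier_wulffBall.1 hp
  set p := wulffMap (1, a, b) with hpd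
  have hreg := wulffMap_mem_regularSet h0 h1
  set V : Heis → ℝ × ℝ := fun x => supportPoint (hgrad radius x) with hV
  have hVd : HasFDerivAt V (fderiv ℝ V p) p :=
    ((contDiffAt_supportPoint_hgrad (contDiffAt_radius hreg.1) hreg.2).differentiableAt (by simp)).hasFDerivAt
  set D := fderiv ℝ V p with hD
  have hVp : V p = bdry b := supportPoint_hgrad_radius h0 h1
  -- The field has values in the body, and its value at `p` maximizes `om (tang b)` there, so the
  -- derivative has no normal component.
  have hom : ∀ v, om (tang b) (D v) = 0 := by
    intro v
    have hline : HasDerivAt (fun r : ℝ => p + r • v) v 0 := by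
      simpa using ((hasDerivAt_id (0 : ℝ)).smul_const v).const_add p
    have h2 : HasDerivAt (fun r : ℝ => V (p + r • v)) (D v) 0 :=
      HasFDerivAt.comp_hasDerivAt (l := V) (f := fun r : ℝ => p + r • v) 0 (by simpa using hVd) hline
    have h3 : HasDerivAt (fun r : ℝ => (V (p + r • v)).1) (D v).1 0 := h2.fst
    have h4 : HasDerivAt (fun r : ℝ => (V (p + r • v)).2) (D v).2 0 := h2.snd
    have h5 : HasDerivAt (fun r : ℝ => om (tang b) (V (p + r • v))) (om (tang b) (D v)) 0 :=
      (h4.const_mul _).fun_sub (h3.const_mul _)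
    refine IsLocalMax.hasDerivAt_eq_zero (Filter.Eventually.of_forall fun r => ?_) h5
    simp only [zero_smul, add_zero, hVp, om_J]
    exact (isSupportPoint_bdry b).2 _ (isSupportPoint_supportPoint _).1
  -- Along the lifted curve the field is the boundary curve itself.
  have hτ : D (horiz p (tang b)) = tang b := by
    have h2 : HasDerivAt (fun r => V (wulffMap (1, a, r))) (D (horiz p (tang b))) b :=
      HasFDerivAt.comp_hasDerivAt (l := V) (f := fun r => wulffMap (1, a, r)) b hVd
        (hasDerivAt_wulffMap_right a b)
    have h3 : (fun r => V (wulffMap (1, a, r))) =ᶠ[𝓝 b] bdry := by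
      filter_upwards [Ioo_mem_nhds (show a < b by linarith) (show b < a + 2 * Real.pi by linarith)] with r hr
      exact supportPoint_hgrad_radius (by linarith [hr.1]) (by linarith [hr.2])
    exact (h2.congr_of_eventuallyEq h3.symm).unique (hasDerivAt_bdry b)
  have hframe : ∀ v, D v = om (D v) (J (tang b)) • tang b := fun v => by
    have := tang_frame b (D v)
    rwa [hom, zero_smul, add_zero] at this
  have hh : horiz p (tang b) = (tang b).1 • X p + (tang b).2 • Y p := by
    ext <;> simp [horiz, X, Y]; ring
  -- The derivative has range in the line of `tang b`, so its trace on the horizontal plane is its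
  -- coefficient in the direction `tang b`, which is one.
  have h2 : om (D (horiz p (tang b))) (J (tang b)) = 1 := by rw [hτ, om_tang_J]
  rw [hh, map_add, map_smul, map_smul, om_add_left, om_smul_left, om_smul_left] at h2
  have h3 : hdiv V p = (D (X p)).1 + (D (Y p)).2 := rfl
  rw [h3, hframe (X p), hframe (Y p), ← h2]
  simp only [Prod.smul_fst, Prod.smul_snd, smul_eq_mul]
  ring

/-! ### Flows and the volume they sweep -/

lemma fderiv_slice {F : Type*} [NormedAddCommGroup F] [NormedSpace ℝ F] {f : ℝ × Heis → F} {q : ℝ × Heis}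
    (hf : DifferentiableAt ℝ f q) (v : Heis) :
    fderiv ℝ (fun x => f (q.1, x)) q.2 v = fderiv ℝ f q (0, v) := by
  have h1 : HasFDerivAt (fun x : Heis => (q.1, x)) (ContinuousLinearMap.inr ℝ ℝ Heis) q.2 :=
    hasFDerivAt_prodMk_right q.1 q.2
  have h2 : HasFDerivAt (fun x => f (q.1, x)) ((fderiv ℝ f q).comp (ContinuousLinearMap.inr ℝ ℝ Heis)) q.2 :=
    HasFDerivAt.comp (g := f) q.2 hf.hasFDerivAt h1
  rw [h2.fderiv]
  rfl

/-- Gradients in space at fixed time are read off the joint derivative. Joint regularity is needed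
for estimates uniform in small times. -/
lemma contDiffOn_hgrad_slice {f : ℝ × Heis → ℝ} {D : Set (ℝ × Heis)} (hD : IsOpen D)
    (hf : ContDiffOn ℝ 2 f D) : ContDiffOn ℝ 1 (fun q => hgrad (fun x => f (q.1, x)) q.2) D := by
  have h1 : ContDiffOn ℝ 1 (fderiv ℝ f) D := hf.fderiv_of_isOpen hD (by norm_num)
  have hX : ContDiff ℝ 1 fun q : ℝ × Heis => ((0 : ℝ), X q.2) := by unfold X horiz; fun_prop
  have hY : ContDiff ℝ 1 fun q : ℝ × Heis => ((0 : ℝ), Y q.2) := by unfold Y horiz; fun_prop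
  refine ((h1.clm_apply hX.contDiffOn).prodMk (h1.clm_apply hY.contDiffOn)).congr fun q hq => ?_
  have h2 := (hf.contDiffAt (hD.mem_nhds hq)).differentiableAt (by simp)
  simp only [hgrad, fderiv_slice h2]

lemma continuousOn_hdiv_slice {V : ℝ × Heis → ℝ × ℝ} {D : Set (ℝ × Heis)} (hD : IsOpen D)
    (hV : ContDiffOn ℝ 1 V D) : ContinuousOn (fun q => hdiv (fun x => V (q.1, x)) q.2) D := by
  have h1 := hV.continuousOn_fderiv_of_isOpen hD (by simp)
  have hX : Continuous fun q : ℝ × Heis => ((0 : ℝ), X q.2) := by unfold X horiz; fun_prop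
  have hY : Continuous fun q : ℝ × Heis => ((0 : ℝ), Y q.2) := by unfold Y horiz; fun_prop
  refine ((h1.clm_apply hX.continuousOn).fst.add (h1.clm_apply hY.continuousOn).snd).congr fun q hq => ?_
  have h2 := (hV.contDiffAt (hD.mem_nhds hq)).differentiableAt (by simp)
  simp only [hdiv, fderiv_slice h2]
  rfl

section Flow

variable {W : Heis → Heis} {φ : ℝ → Heis → Heis}

/-- A compactly supported smooth field is Lipschitz, so its integral curves are unique. The group
law and the fixed points outside the support follow. -/
lemma IsFlow.eq_of_hasDerivAt (hφ : IsFlow W φ) (hW : ContDiff ℝ ∞ W) (hc : HasCompactSupport W) {c : ℝ → Heis}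
    (hd : ∀ s, HasDerivAt c (W (c s)) s) (s : ℝ) : c s = φ s (c 0) := by
  obtain ⟨L, hL⟩ := ContDiff.lipschitzWith_of_hasCompactSupport hc hW (by simp)
  have h := ODE_solution_unique_univ (v := fun _ => W) (s := fun _ => univ) (K := L) (t₀ := 0)
    (f := c) (g := fun s => φ s (c 0)) (fun _ => hL.lipschitzOnWith) (fun t => ⟨hd t, mem_univ _⟩)
    (fun t => ⟨hφ.deriv t _, mem_univ _⟩) (hφ.zero _).symm
  exact congrFun h s

lemma IsFlow.add (hφ : IsFlow W φ) (hW : ContDiff ℝ ∞ W) (hc : HasCompactSupport W) (s r : ℝ) (p : Heis) :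
    φ (s + r) p = φ s (φ r p) := by
  have h := hφ.eq_of_hasDerivAt hW hc (c := fun s => φ (s + r) p)
    (fun s => (hφ.deriv (s + r) p).comp_add_const s r) s
  simpa using h

lemma IsFlow.fix (hφ : IsFlow W φ) (hW : ContDiff ℝ ∞ W) (hc : HasCompactSupport W) {p : Heis}
    (hp : p ∉ tsupport W) (s : ℝ) : φ s p = p := by
  refine (hφ.eq_of_hasDerivAt hW hc (c := fun _ => p) (fun s => ?_) s).symm
  rw [image_eq_zero_of_notMem_tsupport hp]
  exact hasDerivAt_const _ _

lemma IsFlow.mem_image (hφ : IsFlow W φ) (hW : ContDiff ℝ ∞ W) (hc : HasCompactSupport W) (s : ℝ)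
    (E : Set Heis) (p : Heis) : p ∈ φ s '' E ↔ φ (-s) p ∈ E :=
  mem_image_group_iff hφ.zero (hφ.add hW hc) s E p

lemma IsFlow.measurableSet_image (hφ : IsFlow W φ) (hW : ContDiff ℝ ∞ W) (hc : HasCompactSupport W) (s : ℝ)
    {E : Set Heis} (hE : MeasurableSet E) : MeasurableSet (φ s '' E) := by
  have h : φ s '' E = φ (-s) ⁻¹' E := by ext p; exact hφ.mem_image hW hc s E p
  have hcont : Continuous (φ (-s)) := hφ.smooth.continuous.comp (by fun_prop : Continuous fun p => (-s, p))
  rw [h]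
  exact hcont.measurable hE

/-- A moved set differs from the original one only at points swept by the moving boundary. -/
lemma IsFlow.exists_of_mem_symmDiff (hφ : IsFlow W φ) (hW : ContDiff ℝ ∞ W) (hc : HasCompactSupport W) {s : ℝ}
    {E : Set Heis} {x : Heis} (hx : x ∈ symmDiff (φ s '' E) E) :
    ∃ y ∈ frontier E ∩ tsupport W, ∃ r, |r| ≤ |s| ∧ x = φ r y := by
  have hxx : ¬(φ (-s) x ∈ E ↔ x ∈ E) := by
    rw [← hφ.mem_image hW hc]
    rcases hx with h | h
    · exact fun hn => h.2 (hn.1 h.1)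
    · exact fun hn => h.2 (hn.2 h.1)
  have hcont : Continuous fun r => φ r x := hφ.smooth.continuous.comp (by fun_prop : Continuous fun r => (r, x))
  have hpre : IsPreconnected ((fun r => φ r x) '' uIcc 0 (-s)) :=
    isPreconnected_uIcc.image _ hcont.continuousOn
  -- The orbit of `x` joins a point of `E` to a point outside, so it meets the boundary. If the
  -- meeting point were outside the support of the field it would be fixed, and the orbit constant.
  have hcross : ∃ r ∈ uIcc 0 (-s), φ r x ∈ frontier E := by
    by_contra hn
    push Not at hn
    have hsub : (fun r => φ r x) '' uIcc 0 (-s) ⊆ interior E ∪ (closure E)ᶜ := by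
      rintro _ ⟨r, hr, rfl⟩
      by_contra h
      rw [mem_union, not_or, notMem_compl_iff] at h
      exact hn r hr ⟨h.2, h.1⟩
    have m0 : x ∈ (fun r => φ r x) '' uIcc 0 (-s) := ⟨0, left_mem_uIcc, hφ.zero x⟩
    have m1 : φ (-s) x ∈ (fun r => φ r x) '' uIcc 0 (-s) := ⟨-s, right_mem_uIcc, rfl⟩
    rcases hpre.subset_or_subset isOpen_interior isClosed_closure.isOpen_compl
      (disjoint_compl_right.mono_left interior_subset_closure) hsub with h | h
    · exact hxx (iff_of_true (interior_subset (h m1)) (interior_subset (h m0)))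
    · exact hxx (iff_of_false (fun h' => h m1 (subset_closure h')) (fun h' => h m0 (subset_closure h')))
  obtain ⟨r, hr, hrf⟩ := hcross
  have hback : φ (-r) (φ r x) = x := by rw [← hφ.add hW hc, neg_add_cancel, hφ.zero]
  refine ⟨φ r x, ⟨hrf, ?_⟩, -r, ?_, hback.symm⟩
  · by_contra hn
    have h1 := hφ.fix hW hc hn
    have h2 : φ r x = x := by rw [← h1 (-r), hback]
    rw [h2] at h1
    exact hxx (by rw [h1])
  · rw [abs_neg]
    have := abs_sub_left_of_mem_uIcc hr
    simpa using this

lemma exists_tube_nhds {A : Set (ℝ × Heis)} (hA : IsOpen A) {C : Set Heis} (hC : IsCompact C)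
    (h : ∀ y ∈ C, ((0 : ℝ), y) ∈ A) :
    ∃ σ > 0, ∃ v, IsOpen v ∧ C ⊆ v ∧ ∀ r, |r| ≤ σ → ∀ y ∈ v, (r, y) ∈ A := by
  obtain ⟨u, v, hu, hv, h0u, hCv, huv⟩ := generalized_tube_lemma isCompact_singleton hC hA
    (show ({(0 : ℝ)} : Set ℝ) ×ˢ C ⊆ A by
      rintro ⟨_, y⟩ ⟨rfl, hy⟩
      exact h y hy)
  obtain ⟨σ, hσ, hb⟩ := Metric.nhds_basis_closedBall.mem_iff.1 (hu.mem_nhds (h0u rfl))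
  refine ⟨σ, hσ, v, hv, hCv, fun r hr y hy => huv ⟨hb ?_, hy⟩⟩
  rwa [Metric.mem_closedBall, Real.dist_eq, sub_zero]

lemma exists_tube {A : Set (ℝ × Heis)} (hA : IsOpen A) {C : Set Heis} (hC : IsCompact C)
    (h : ∀ y ∈ C, ((0 : ℝ), y) ∈ A) : ∃ σ > 0, ∀ r, |r| ≤ σ → ∀ y ∈ C, (r, y) ∈ A := by
  obtain ⟨σ, hσ, v, -, hCv, hv⟩ := exists_tube_nhds hA hC h
  exact ⟨σ, hσ, fun r hr y hy => hv r hr y (hCv hy)⟩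

/-- The part of the ball of dilation factor `μ` off the axis. -/
def punctured (μ : ℝ) : Set Heis := {p | p ∈ offAxis ∧ radius p < μ}

lemma isOpen_punctured (μ : ℝ) : IsOpen (punctured μ) :=
  contDiffOn_radius.continuousOn.isOpen_inter_preimage isOpen_offAxis isOpen_Iio

/-- Dilation of the first two coordinates multiplies the factor by `μ` and the volume by `μ²`. -/
lemma volume_punctured {μ : ℝ} (hμ : 0 < μ) :
    volume (punctured μ) = ENNReal.ofReal (μ ^ 2) * volume (punctured 1) := by
  set L : Heis →ₗ[ℝ] Heis := LinearMap.prodMap (μ⁻¹ • LinearMap.id)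
    (LinearMap.prodMap (μ⁻¹ • LinearMap.id) LinearMap.id) with hL
  have hdet : LinearMap.det L = μ⁻¹ * μ⁻¹ := by
    simp [hL, LinearMap.det_prodMap]
  have hpre : punctured μ = L ⁻¹' punctured 1 := by
    ext p
    have hLp : L p = (μ⁻¹ * p.1, μ⁻¹ * p.2.1, p.2.2) := by simp [hL]
    have hoff : L p ∈ offAxis ↔ p ∈ offAxis := by
      rw [hLp]
      have : (μ⁻¹ * p.1, μ⁻¹ * p.2.1) = μ⁻¹ • (p.1, p.2.1) := by simp
      simp only [offAxis, mem_ofPred_eq, this, ne_eq, smul_eq_zero, inv_eq_zero, hμ.ne', false_or]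
    rw [mem_preimage]
    constructor
    · rintro ⟨h1, h2⟩
      refine ⟨hoff.2 h1, ?_⟩
      rw [hLp, radius_dilate h1 (inv_pos.2 hμ), inv_mul_lt_iff₀ hμ, mul_one]
      exact h2
    · rintro ⟨h1, h2⟩
      have h1' := hoff.1 h1
      refine ⟨h1', ?_⟩
      rwa [hLp, radius_dilate h1' (inv_pos.2 hμ), inv_mul_lt_iff₀ hμ, mul_one] at h2
  have hd0 : LinearMap.det L ≠ 0 := by rw [hdet]; positivity
  have : (volume : Measure Heis).IsAddHaarMeasure := Measure.prod.instIsAddHaarMeasure volume volume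
  rw [hpre, Measure.addHaar_preimage_linearMap volume hd0, hdet]
  congr 2
  rw [mul_inv, inv_inv, abs_of_pos (mul_pos hμ hμ), sq]

lemma volume_punctured_ne_top {μ : ℝ} (hμ : 0 < μ) : volume (punctured μ) ≠ ⊤ := by
  rw [volume_punctured hμ]
  refine ENNReal.mul_ne_top ENNReal.ofReal_ne_top ?_
  have hsub : punctured 1 ⊆ wulffBall := fun p hp => ⟨hp.1.2, hp.2⟩
  exact ((measure_mono hsub).trans_lt isBounded_wulffBall.measure_lt_top).ne

/-- The closed layer fits between the open sublevel sets of `1 - δ` and `1 + 2 δ`, and `(1 + 2 δ)² -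
(1 - δ)² = 6 δ + 3 δ² ≤ 9 δ`. -/
lemma volume_real_band_le {δ : ℝ} (h0 : 0 < δ) (h1 : δ < 1) {D : Set Heis}
    (hD : ∀ x ∈ D, x ∈ offAxis ∧ |radius x - 1| ≤ δ) :
    volume.real D ≤ 9 * volume.real (punctured 1) * δ := by
  have hsub : D ⊆ punctured (1 + 2 * δ) \ punctured (1 - δ) := fun x hx => by
    obtain ⟨e1, e2⟩ := hD x hx
    rw [abs_le] at e2
    exact ⟨⟨e1, by linarith⟩, fun h => by linarith [h.2]⟩
  have hv := volume_punctured_ne_top (μ := 1 + 2 * δ) (by linarith)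
  have hreal : ∀ μ : ℝ, 0 < μ → volume.real (punctured μ) = μ ^ 2 * volume.real (punctured 1) := fun μ hμ => by
    rw [Measure.real, volume_punctured hμ, ENNReal.toReal_mul, ENNReal.toReal_ofReal (sq_nonneg μ), Measure.real]
  refine (measureReal_mono hsub ((measure_mono sdiff_subset).trans_lt hv.lt_top).ne).trans ?_
  have hmono : punctured (1 - δ) ⊆ punctured (1 + 2 * δ) := fun x hx => ⟨hx.1, by linarith [hx.2]⟩
  rw [measureReal_sdiff hmono (isOpen_punctured _).measurableSet
    (volume_punctured_ne_top (by linarith)),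
    hreal (1 + 2 * δ) (by linarith), hreal (1 - δ) (by linarith)]
  have := measureReal_nonneg (μ := volume) (s := punctured 1)
  have h3 : (1 + 2 * δ) ^ 2 - (1 - δ) ^ 2 ≤ 9 * δ := by nlinarith
  nlinarith

/-- The volume swept by the moving boundary is at most linear in time. -/
lemma IsFlow.exists_volume_symmDiff_le (hφ : IsFlow W φ) (hW : ContDiff ℝ ∞ W) (hc : HasCompactSupport W)
    (hs : frontier wulffBall ∩ tsupport W ⊆ (poles bdry (2 * Real.pi))ᶜ) :
    ∃ C, 0 ≤ C ∧ ∃ σ > 0, ∀ s, |s| ≤ σ →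
      volume.real (symmDiff (φ s '' wulffBall) wulffBall) ≤ C * |s| := by
  set C₀ := frontier wulffBall ∩ tsupport W with hC₀
  have hC₀c : IsCompact C₀ := hc.isCompact.inter_left isClosed_frontier
  have hC₀S : ∀ y ∈ C₀, y ∈ offAxis ∧ radius y = 1 := fun y hy =>
    mem_frontier_wulffBall_iff.1 ⟨hy.1, hs hy⟩
  have hcont := hφ.smooth.continuous
  obtain ⟨σ, hσ, hσA⟩ := exists_tube (isOpen_offAxis.preimage hcont) hC₀c fun y hy => by
    rw [mem_preimage, hφ.zero]; exact (hC₀S y hy).1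
  have hoff : MapsTo (fun q : ℝ × Heis => φ q.1 q.2) (Icc (-σ) σ ×ˢ C₀) offAxis := fun q hq =>
    hσA q.1 (abs_le.2 hq.1) q.2 hq.2
  have hder : ContinuousOn (fun q : ℝ × Heis => fderiv ℝ radius (φ q.1 q.2) (W (φ q.1 q.2)))
      (Icc (-σ) σ ×ˢ C₀) :=
    ((contDiffOn_radius.continuousOn_fderiv_of_isOpen isOpen_offAxis (by norm_num)).comp
      hcont.continuousOn hoff).clm_apply (hW.continuous.comp hcont).continuousOn
  obtain ⟨L, hL⟩ := (isCompact_Icc.prod hC₀c).exists_bound_of_continuousOn hder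
  -- The factor changes at a bounded rate along orbits starting on the compact part of the boundary
  -- met by the field, so every swept point has factor within `L |r|` of one.
  have hlip : ∀ r, |r| ≤ σ → ∀ y ∈ C₀, |radius (φ r y) - 1| ≤ L * |r| := by
    intro r hr y hy
    have hd : ∀ t ∈ Icc (-σ) σ, HasDerivAt (fun r => radius (φ r y))
        (fderiv ℝ radius (φ t y) (W (φ t y))) t := fun t ht =>
      HasFDerivAt.comp_hasDerivAt (l := radius) (f := fun r => φ r y) t
        ((contDiffAt_radius (hσA t (abs_le.2 ht) y hy)).differentiableAt (by norm_num)).hasFDerivAt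
        (hφ.deriv t y)
    have h := (convex_Icc (-σ) σ).norm_image_sub_le_of_norm_hasDerivWithin_le
      (f := fun r => radius (φ r y)) (fun t ht => (hd t ht).hasDerivWithinAt)
      (fun t ht => hL (t, y) ⟨ht, hy⟩) (show (0 : ℝ) ∈ Icc (-σ) σ from ⟨by linarith, hσ.le⟩) (abs_le.1 hr)
    rw [hφ.zero, (hC₀S y hy).2, sub_zero] at h
    exact h
  set M := max L 1 with hM
  have hM0 : 0 < M := lt_of_lt_of_le one_pos (le_max_right _ _)
  refine ⟨9 * volume.real (punctured 1) * M, by positivity, min σ (1 / (2 * M)), by positivity, fun s hsσ => ?_⟩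
  by_cases hs0 : s = 0
  · have h0 : φ 0 '' wulffBall = wulffBall := by
      ext p; rw [hφ.mem_image hW hc, neg_zero, hφ.zero]
    rw [hs0, h0]
    simp
  have hsp := abs_pos.2 hs0
  have hMs : M * |s| < 1 := by
    have h1 := hsσ.trans (min_le_right _ _)
    have h2 := mul_le_mul_of_nonneg_left h1 hM0.le
    have h3 : M * (1 / (2 * M)) = 1 / 2 := by field_simp
    linarith
  rw [mul_assoc]
  refine volume_real_band_le (mul_pos hM0 hsp) hMs fun x hx => ?_
  obtain ⟨y, hy, r, hr, rfl⟩ := hφ.exists_of_mem_symmDiff hW hc hx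
  have hrσ := hr.trans (hsσ.trans (min_le_left _ _))
  refine ⟨hσA r hrσ y hy, (hlip r hrσ y hy).trans ?_⟩
  exact (mul_le_mul_of_nonneg_right (le_max_left _ _) (abs_nonneg r)).trans
    (mul_le_mul_of_nonneg_left hr hM0.le)

end Flow

lemma perimeter_wulffBall_ne_top {B : Set Heis} (hB : IsRelCompactOpen B (poles bdry (2 * Real.pi))ᶜ) :
    perimeter wulffBody wulffBall B ≠ ⊤ := by
  have hg : hgrad (fun p => radius p - 1) = hgrad radius := by
    funext p; simp only [hgrad, fderiv_sub_const]
  have hr : ∀ x ∈ regularSet, ContDiffAt ℝ 2 radius x := fun x hx => contDiffAt_radius hx.1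
  refine perimeter_ne_top_of_calibration isC2PlusBody_wulffBody (O := regularSet) (w := fun p => radius p - 1)
    (U := fun x => supportPoint (hgrad radius x)) hB.2.1 isOpen_regularSet
    (fun x hx => ((hr x hx).sub contDiffAt_const).contDiffWithinAt) (fun x hx => by rw [hg]; exact hx.2)
    (fun x hx => (contDiffAt_supportPoint_hgrad (hr x hx) hx.2).contDiffWithinAt)
    (fun x _ _ k hk => by rw [hg]; exact (isSupportPoint_supportPoint _).2 k hk)
    isOpen_wulffBall.measurableSet (fun x hx => by rw [mem_wulffBall_iff hx.1, sub_neg])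
    (fun x hx => frontier_subset_regularSet ⟨hx.1, hB.2.2 hx.2⟩)
    (fun x hx h0 => (frontier_inter_offAxis hx.1).2 (sub_eq_zero.1 h0))

/-! ### The first variation of the ball -/

section Flow

variable {W : Heis → Heis} {φ : ℝ → Heis → Heis}

/-- The defining function of the moved ball, as a function of time and place. -/
def movedRadius (φ : ℝ → Heis → Heis) (q : ℝ × Heis) : ℝ := radius (φ (-q.1) q.2) - 1

/-- The points at which the defining function of the moved ball is regular. -/
def movedRegular (φ : ℝ → Heis → Heis) : Set (ℝ × Heis) :=
  {q | φ (-q.1) q.2 ∈ offAxis ∧ hgrad (fun x => movedRadius φ (q.1, x)) q.2 ≠ 0}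

/-- The calibrating field of the moved ball. -/
def movedField (φ : ℝ → Heis → Heis) (q : ℝ × Heis) : ℝ × ℝ :=
  supportPoint (hgrad (fun x => movedRadius φ (q.1, x)) q.2)

lemma IsFlow.continuous_back (hφ : IsFlow W φ) : Continuous fun q : ℝ × Heis => φ (-q.1) q.2 :=
  hφ.smooth.continuous.comp (by fun_prop : Continuous fun q : ℝ × Heis => (-q.1, q.2))

lemma IsFlow.contDiffOn_movedRadius (hφ : IsFlow W φ) :
    ContDiffOn ℝ 2 (movedRadius φ) ((fun q : ℝ × Heis => φ (-q.1) q.2) ⁻¹' offAxis) := fun q hq => by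
  have h1 : ContDiff ℝ 2 fun q : ℝ × Heis => φ (-q.1) q.2 :=
    (hφ.smooth.comp (by fun_prop : ContDiff ℝ ∞ fun q : ℝ × Heis => (-q.1, q.2))).of_le
      (WithTop.coe_le_coe.2 le_top)
  exact (((contDiffAt_radius hq).comp q h1.contDiffAt).sub contDiffAt_const).contDiffWithinAt

lemma IsFlow.isOpen_movedRegular (hφ : IsFlow W φ) : IsOpen (movedRegular φ) :=
  (contDiffOn_hgrad_slice (isOpen_offAxis.preimage hφ.continuous_back)
    hφ.contDiffOn_movedRadius).continuousOn.isOpen_inter_preimage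
      (isOpen_offAxis.preimage hφ.continuous_back) isClosed_singleton.isOpen_compl

lemma IsFlow.contDiffOn_movedField (hφ : IsFlow W φ) : ContDiffOn ℝ 1 (movedField φ) (movedRegular φ) :=
  fun q hq => by
    have hD := isOpen_offAxis.preimage hφ.continuous_back
    have h1 := (contDiffOn_hgrad_slice hD hφ.contDiffOn_movedRadius).contDiffAt (hD.mem_nhds hq.1)
    exact ((contDiffAt_supportPoint hq.2).comp q h1).contDiffWithinAt

lemma IsFlow.movedRadius_zero (hφ : IsFlow W φ) : (fun x => movedRadius φ (0, x)) = fun x => radius x - 1 := by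
  funext x; simp only [movedRadius, neg_zero, hφ.zero]

lemma IsFlow.hgrad_movedRadius_zero (hφ : IsFlow W φ) :
    hgrad (fun x => movedRadius φ (0, x)) = hgrad radius := by
  rw [hφ.movedRadius_zero]
  funext p; simp only [hgrad, fderiv_sub_const]

lemma IsFlow.mem_movedRegular_zero (hφ : IsFlow W φ) {x : Heis} (hx : x ∈ regularSet) :
    ((0 : ℝ), x) ∈ movedRegular φ := by
  refine ⟨?_, ?_⟩
  · simp only [neg_zero, hφ.zero]; exact hx.1
  · simp only [hφ.hgrad_movedRadius_zero]; exact hx.2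

lemma contDiff_slice {s : ℝ} {n : WithTop ℕ∞} : ContDiff ℝ n fun x : Heis => (s, x) := by fun_prop

/-- Comparison of the ball at two instants. -/
lemma IsFlow.perimeter_le (hφ : IsFlow W φ) (hW : ContDiff ℝ ∞ W) (hc : HasCompactSupport W) {B : Set Heis}
    (hB : IsOpen B) (hBv : volume B ≠ ⊤) {χ : Heis → ℝ} (hχ : ContDiff ℝ ∞ χ) (hχc : HasCompactSupport χ)
    (hχB : tsupport χ ⊆ B) (hχ1 : ∀ x, χ x ∈ Icc (0 : ℝ) 1) {N : Set Heis} (hN : IsOpen N)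
    (hN1 : ∀ x ∈ N, χ x = 1) {s r : ℝ} (hs : ∀ x ∈ tsupport χ, (s, x) ∈ movedRegular φ)
    (hD : symmDiff (φ s '' wulffBall) (φ r '' wulffBall) ⊆ N) {κ : ℝ}
    (hκ : ∀ x ∈ symmDiff (φ s '' wulffBall) (φ r '' wulffBall),
      |hdiv (fun x => movedField φ (s, x)) x - 1| ≤ κ)
    (hP : perimeter wulffBody (φ r '' wulffBall) B ≠ ⊤) :
    perimeter wulffBody (φ s '' wulffBall) B ≠ ⊤ ∧
      (perimeter wulffBody (φ s '' wulffBall) B).toReal - ∫ _ in φ s '' wulffBall ∩ B, (1 : ℝ)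
      ≤ (perimeter wulffBody (φ r '' wulffBall) B).toReal - (∫ _ in φ r '' wulffBall ∩ B, (1 : ℝ))
        + κ * volume.real (symmDiff (φ s '' wulffBall) (φ r '' wulffBall)) := by
  have hO : IsOpen {x | (s, x) ∈ movedRegular φ} :=
    hφ.isOpen_movedRegular.preimage (contDiff_slice (n := 0)).continuous
  have hm := isOpen_wulffBall.measurableSet
  refine perimeter_le_of_calibration isC2PlusBody_wulffBody hB hBv hO (w := fun x => movedRadius φ (s, x))
    ?_ (fun x hx => hx.2) (hφ.contDiffOn_movedField.comp contDiff_slice.contDiffOn fun x hx => hx)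
    (fun x => (isSupportPoint_supportPoint _).1) (fun x _ _ k hk => (isSupportPoint_supportPoint _).2 k hk)
    (hφ.measurableSet_image hW hc s hm) (hφ.measurableSet_image hW hc r hm) (fun x hx => ?_)
    hχ hχc hs hχB hχ1 hN hN1 hD hκ hP
  · exact hφ.contDiffOn_movedRadius.comp contDiff_slice.contDiffOn fun x hx => hx.1
  · rw [hφ.mem_image hW hc, mem_wulffBall_iff hx.1]
    simp only [movedRadius, sub_neg]

/-- The sets at times `s` and `0` are compared in both directions, each with its own calibrating
field. For small `s` both divergences are within `κ` of one on the swept region, so the functional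
changes by at most `κ C |s|` for every positive `κ`. -/
lemma hasPrescribedCurvature_wulffBall :
    HasPrescribedCurvature wulffBody (poles bdry (2 * Real.pi))ᶜ wulffBall fun _ => 1 := by
  refine ⟨fun B hB => perimeter_wulffBall_ne_top hB, fun B hB W hW hc hWB φ hφ => ?_⟩
  have hBv : volume B ≠ ⊤ := ((measure_mono subset_closure).trans_lt hB.2.1.measure_lt_top).ne
  have hWΩ : frontier wulffBall ∩ tsupport W ⊆ (poles bdry (2 * Real.pi))ᶜ := fun x hx =>
    hB.2.2 (subset_closure (hWB hx.2))
  obtain ⟨C, hC0, σ₀, hσ₀, hvol⟩ := hφ.exists_volume_symmDiff_le hW hc hWΩ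
  set C₀ := frontier wulffBall ∩ tsupport W with hC₀
  have hC₀c : IsCompact C₀ := hc.isCompact.inter_left isClosed_frontier
  obtain ⟨χ, hχ, hχc, hχO, hχ1, N, hN, hCN, hN1⟩ := exists_cutoff hC₀c (isOpen_regularSet.inter hB.1)
    fun x hx => ⟨frontier_subset_regularSet ⟨hx.1, hWΩ hx⟩, hWB hx.2⟩
  obtain ⟨σ₁, hσ₁, hχD⟩ := exists_tube hφ.isOpen_movedRegular hχc.isCompact
    fun x hx => hφ.mem_movedRegular_zero (hχO hx).1
  have hT0 : φ 0 '' wulffBall = wulffBall := by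
    ext p; rw [hφ.mem_image hW hc, neg_zero, hφ.zero]
  have hP0 : perimeter wulffBody (φ 0 '' wulffBall) B ≠ ⊤ := by
    rw [hT0]; exact perimeter_wulffBall_ne_top hB
  set Φ : ℝ → ℝ := fun s => (perimeter wulffBody (φ s '' wulffBall) B).toReal
    - ∫ p in (φ s '' wulffBall) ∩ B, (1 : ℝ) with hΦ
  have key : ∀ κ > 0, ∀ᶠ s in 𝓝 (0 : ℝ), perimeter wulffBody (φ s '' wulffBall) B ≠ ⊤ ∧
      |Φ s - Φ 0| ≤ κ * (C * |s|) := by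
    intro κ hκ
    have hcont : ContinuousOn (fun q : ℝ × Heis => hdiv (fun x => movedField φ (q.1, x)) q.2)
        (movedRegular φ) := continuousOn_hdiv_slice hφ.isOpen_movedRegular hφ.contDiffOn_movedField
    have hA : IsOpen (movedRegular φ ∩ (fun q : ℝ × Heis => hdiv (fun x => movedField φ (q.1, x)) q.2) ⁻¹'
        Metric.ball 1 κ) := hcont.isOpen_inter_preimage hφ.isOpen_movedRegular Metric.isOpen_ball
    -- On the original boundary at time zero the divergence is exactly one. By joint continuity it
    -- stays within `κ` of one for small times in a neighbourhood of the boundary points met by the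
    -- field.
    obtain ⟨σ₂, hσ₂, v, hv, hCv, hvA⟩ := exists_tube_nhds hA hC₀c fun y hy => by
      have hyS : y ∈ frontier wulffBall ∩ (poles bdry (2 * Real.pi))ᶜ := ⟨hy.1, hWΩ hy⟩
      refine ⟨hφ.mem_movedRegular_zero (frontier_subset_regularSet hyS), ?_⟩
      have h1 : (fun x => movedField φ (0, x)) = fun x => supportPoint (hgrad radius x) := by
        funext x; simp only [movedField, hφ.hgrad_movedRadius_zero]
      rw [mem_preimage]
      simp only [h1, hdiv_supportPoint_hgrad_radius hyS]
      exact Metric.mem_ball_self hκ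
    obtain ⟨σ₃, hσ₃, hflow⟩ := exists_tube ((hv.inter hN).preimage hφ.smooth.continuous) hC₀c
      fun y hy => by
        rw [mem_preimage, hφ.zero]
        exact ⟨hCv hy, hCN hy⟩
    filter_upwards [Metric.closedBall_mem_nhds (0 : ℝ) hσ₀, Metric.closedBall_mem_nhds (0 : ℝ) hσ₁,
      Metric.closedBall_mem_nhds (0 : ℝ) hσ₂, Metric.closedBall_mem_nhds (0 : ℝ) hσ₃] with s h0 h1 h2 h3
    rw [Metric.mem_closedBall, Real.dist_eq, sub_zero] at h0 h1 h2 h3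
    have hmem : ∀ x ∈ symmDiff (φ s '' wulffBall) (φ 0 '' wulffBall), x ∈ v ∩ N := fun x hx => by
      rw [hT0] at hx
      obtain ⟨y, hy, r, hr, rfl⟩ := hφ.exists_of_mem_symmDiff hW hc hx
      exact hflow r (hr.trans h3) y hy
    have hest : ∀ r, |r| ≤ σ₂ → ∀ x ∈ symmDiff (φ s '' wulffBall) (φ 0 '' wulffBall),
        |hdiv (fun x => movedField φ (r, x)) x - 1| ≤ κ := fun r hr x hx => by
      have := (hvA r hr x (hmem x hx).1).2
      rw [mem_preimage, Metric.mem_ball, Real.dist_eq] at this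
      exact this.le
    obtain ⟨k1, k2⟩ := hφ.perimeter_le hW hc hB.1 hBv hχ hχc (fun x hx => (hχO hx).2) hχ1 hN hN1
      (hχD s h1) (fun x hx => (hmem x hx).2) (hest s h2) hP0
    have hest0 := hest 0 (by rw [abs_zero]; exact hσ₂.le)
    have hmem0 : symmDiff (φ s '' wulffBall) (φ 0 '' wulffBall) ⊆ N := fun x hx => (hmem x hx).2
    have hvol' : volume.real (symmDiff (φ s '' wulffBall) (φ 0 '' wulffBall)) ≤ C * |s| := by
      rw [hT0]; exact hvol s h0
    rw [symmDiff_comm] at hest0 hmem0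
    -- The second comparison exchanges the roles of the two sets. It needs the finiteness of the
    -- perimeter at time `s`, which the first one has supplied.
    obtain ⟨-, k3⟩ := hφ.perimeter_le hW hc hB.1 hBv hχ hχc (fun x hx => (hχO hx).2) hχ1 hN hN1
      (hχD 0 (by rw [abs_zero]; exact hσ₁.le)) hmem0 hest0 k1
    rw [symmDiff_comm] at k3
    have h4 := mul_le_mul_of_nonneg_left hvol' hκ.le
    refine ⟨k1, abs_le.2 ⟨?_, ?_⟩⟩
    · simp only [hΦ]; linarith
    · simp only [hΦ]; linarith
  refine ⟨(key 1 one_pos).mono fun s hs => hs.1, ?_⟩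
  rw [hasDerivAt_iff_isLittleO, Asymptotics.isLittleO_iff]
  intro c hc'
  filter_upwards [key (c / (C + 1)) (by positivity)] with s hs
  have h1 := hs.2
  have h2 : c / (C + 1) * (C * |s|) ≤ c * |s| := by
    have h3 : c / (C + 1) * C ≤ c := by
      rw [div_mul_eq_mul_div, div_le_iff₀ (by positivity)]
      nlinarith
    calc c / (C + 1) * (C * |s|) = c / (C + 1) * C * |s| := by ring
      _ ≤ c * |s| := mul_le_mul_of_nonneg_right h3 (abs_nonneg s)
  simp only [sub_zero, smul_zero, Real.norm_eq_abs]
  exact h1.trans h2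

end Flow

/-! ### Conclusion -/

lemma isRegularPrescribed_wulffBall :
    IsRegularPrescribed wulffBody (poles bdry (2 * Real.pi))ᶜ wulffBall fun _ => 1 where
  isOpen := isOpen_poles_compl
  measurable := isOpen_wulffBall.measurableSet
  subset := wulffBall_subset_poles
  continuousOn := continuousOn_const
  lipschitz := hasLipschitzBoundary_wulffBall
  hregular := isHRegular_wulffBall
  prescribed := hasPrescribedCurvature_wulffBall

end SubFinsler

end

theorem theorem3p1 :
    -- characteristic curves are of class `C²`
    (∀ (K : Set (ℝ × ℝ)) (Ω E : Set Heis) (f : Heis → ℝ),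
      IsC2PlusBody K → IsRegularPrescribed K Ω E f →
        ∀ (I : Set ℝ) (Γ : ℝ → Heis), IsOpen I → IsCharacteristicCurve Ω E I Γ →
          ContDiffOn ℝ 2 Γ I) ∧
    -- optimality, shown by a Pansu–Wulff shape, away from its poles
    (∃ (K : Set (ℝ × ℝ)) (P : ℝ) (γ : ℝ → ℝ × ℝ) (E : Set Heis),
      IsC2PlusBody K ∧ IsClockwiseParam K P γ ∧
      IsOpen E ∧ Bornology.IsBounded E ∧ frontier E = pansuWulffShape γ P ∧
      IsRegularPrescribed K (poles γ P)ᶜ E (fun _ => 1) ∧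
      ∀ v : ℝ,
        IsCharacteristicCurve (poles γ P)ᶜ E (Ioo (-P) 0) (fun s => pansuWulffCurve γ v (-s)) ∧
        ¬ ContDiffOn ℝ 3 (fun s => pansuWulffCurve γ v (-s)) (Ioo (-P) 0)) := by
  exact ⟨fun K Ω E f hK hE I Γ hI hΓ => hE.contDiffOn_characteristic hK hI hΓ,
    wulffBody, 2 * Real.pi, bdry, wulffBall, isC2PlusBody_wulffBody, isClockwiseParam_bdry,
    isOpen_wulffBall, isBounded_wulffBall, frontier_wulffBall, isRegularPrescribed_wulffBall,
    fun v => ⟨isCharacteristicCurve_wulffBall v, not_contDiffOn_pansuWulffCurve v⟩⟩
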